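/- All manifolds are smooth, finite-dimensional, Hausdorff, second countable and without boundary. For a Lie groupoid $\Gamma\rightrightarrows M$ with source $s$ and target $t$, the product $gh$ is defined when $t(g)=s(h)$, and a left $\Gamma$-space is a manifold $X$ with a smooth map $J:X\to M$ and a smooth action $(r,x)\mapsto rx$, defined for $t(r)=J(x)$, with $J(rx)=s(r)$. Let $\Gamma_p$ be the manifold of composable $p$-tuples of arrows ($\Gamma_0=M$). Let $\partial=\sum_i(-1)^i d_i$ be the alternating sum of the maps induced by the faces $d_i:\Gamma_{p+1}\to\Gamma_p$, ordered so that $d_0=s$ and $d_1=t$ for $p=0$ (so $\partial=s^*-t^*$ on forms on $M$), and let $\delta=(-1)^pd+\partial$ be the total differential, both on the double complex of differential forms $\Omega^k(\Gamma_p)$ and on the double complex $C_k(\Gamma_p,\mathbb Z)$ of piecewise smooth singular chains. Write $C_n(\Gamma_\bullet,\mathbb Z)=\bigoplus_{k+p=n}C_k(\Gamma_p,\mathbb Z)$, and $Z_n(\Gamma_\bullet,\mathbb Z)$ for its $\delta$-cycles. A form in $\Omega^k(\Gamma_p)$ is integrated over the component in $C_k(\Gamma_p,\mathbb Z)$ of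 a chain. A pre-quasi-symplectic groupoid is a Lie groupoid $\Gamma\rightrightarrows M$ with $\omega\in\Omega^2(\Gamma)$ and $\Omega\in\Omega^3(M)$ such that $d\Omega=0$, $d\omega=\partial\Omega$ and $\partial\omega=0$. A pre-Hamiltonian $\Gamma$-space is a left $\Gamma$-space $J:X\to M$ with $\omega_X\in\Omega^2(X)$ such that $d\omega_X=J^*\Omega$ and the graph $\{(r,x,rx)\}\subset\Gamma\times X\times X$ is isotropic for $(\omega,\omega_X,-\omega_X)$. Let $\Gamma\times_MX\rightrightarrows X$ be the transformation groupoid, with source $(r,x)\mapsto rx$ and target $(r,x)\mapsto x$, and $J_*$ the chain map induced by the projection homomorphism $J:\Gamma\times_MX\to\Gamma$. The pair $(\omega_X,\omega+\Omega)$ satisfies the integrality condition if for all $C\in Z_2((\Gamma\times_MX)_\bullet,\mathbb Z)$ and $D\in C_3(\Gamma_\bullet,\mathbb Z)$, $$\delta D=J_*(C)\quad\Longrightarrow\quad\int_C\omega_X-\int_D(\omega+\Omega)\in\mathbb Z.$$ Let $(G\rightrightarrows G_0,\omega_G+\Omega_G)$ and $(H\rightrightarrows H_0,\omega_H+\Omega_H)$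 be pre-quasi-symplectic groupoids which are Morita equivalent by $(G_0\stackrel{\rho}{\leftarrow}X\stackrel{\sigma}{\to}H_0,\omega_X)$: $X$ carries commuting left $G$- and right $H$-actions with moment maps $\rho$ and $\sigma$, $\sigma$ is a principal $G$-bundle, $\rho$ is a principal $H$-bundle, and $X\to G_0\times H_0$ with $\omega_X\in\Omega^2(X)$ and the action $(g,h)\cdot x=gxh^{-1}$ is a pre-Hamiltonian $G\times\overline H$-space, where $G\times\overline H$ is the product groupoid with the forms $\omega_G-\omega_H$ and $\Omega_G-\Omega_H$. Let $(J_F:F\to G_0,\omega_F)$ be a pre-Hamiltonian $G$-space and $(J_E:E\to H_0,\omega_E)$ a pre-Hamiltonian $H$-space which correspond to each other, that is, $E$ is isomorphic to the pre-Hamiltonian $H$-space $\overline X\times_GF$: the quotient manifold of $X\times_{G_0}F$ by the diagonal $G$-action, with moment map $[x,f]\mapsto\sigma(x)$, action $h\cdot[x,f]=[xh^{-1},f]$, and the $2$-form whose pull-back to $X\times_{G_0}F$ is the restriction of $(-\omega_X,\omega_F)$. Then $(\omega_F,\omega_G+\Omega_G)$ satisfies the integrality condition if and only if $(\omega_E,\omega_H+\Omega_H)$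 does. -/

import Mathlib

open scoped Manifold ContDiff

noncomputable section

namespace PreQuasi

universe u

/-! ### Manifolds and differential forms -/

/-- A finite-dimensional, Hausdorff, second countable smooth manifold without boundary. -/
structure SmoothMfd : Type (u + 1) where
  carrier : Type u
  E : Type
  H : Type
  [normed : NormedAddCommGroup E]
  [space : NormedSpace ℝ E]
  [finDim : FiniteDimensional ℝ E]
  [topH : TopologicalSpace H]
  I : ModelWithCorners ℝ E H
  [boundaryless : I.Boundaryless]
  [top : TopologicalSpace carrier]
  [charted : ChartedSpace H carrier]
  [isManifold : IsManifold I ∞ carrier]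
  [t2 : T2Space carrier]
  [secondCountable : SecondCountableTopology carrier]

instance : CoeSort SmoothMfd.{u} (Type u) := ⟨SmoothMfd.carrier⟩

attribute [instance] SmoothMfd.normed SmoothMfd.space SmoothMfd.finDim SmoothMfd.topH
  SmoothMfd.boundaryless SmoothMfd.top SmoothMfd.charted SmoothMfd.isManifold SmoothMfd.t2
  SmoothMfd.secondCountable

/-- The product manifold. -/
def SmoothMfd.prod (M : SmoothMfd.{u}) (N : SmoothMfd.{u}) : SmoothMfd.{u} where
  carrier := M × N
  E := M.E × N.E
  H := ModelProd M.H N.H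
  I := M.I.prod N.I
  boundaryless := ⟨by
    have h : Set.range (M.I.prod N.I) = Set.range M.I ×ˢ Set.range N.I :=
      ModelWithCorners.range_prod
    rw [h, M.I.range_eq_univ, N.I.range_eq_univ, Set.univ_prod_univ]⟩

/-- A (not necessarily smooth) field of alternating `k`-forms on the tangent spaces of `M`. -/
abbrev Form (k : ℕ) (M : SmoothMfd.{u}) : Type u :=
  ∀ x : M, TangentSpace M.I x [⋀^Fin k]→L[ℝ] ℝ

namespace Form

variable {k : ℕ} {M : SmoothMfd.{u}} {N : SmoothMfd.{u}}

/-- The pull-back `f^* α`. -/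
def pullback (f : N → M) (α : Form k M) : Form k N := fun x =>
  (α (f x)).compContinuousLinearMap (mfderiv N.I M.I f x)

/-- The expression of `α` in the preferred chart around `x₀`, a form on the model space. -/
def inChart (α : Form k M) (x₀ : M) : M.E → M.E [⋀^Fin k]→L[ℝ] ℝ := fun y =>
  (α ((extChartAt M.I x₀).symm y)).compContinuousLinearMap
    (mfderiv 𝓘(ℝ, M.E) M.I (extChartAt M.I x₀).symm y)

/-- `α ∈ Ω^k(M)`: `α` is smooth. -/
def IsSmooth (α : Form k M) : Prop :=
  ∀ x₀ : M, ContDiffOn ℝ ∞ (α.inChart x₀) (extChartAt M.I x₀).target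

/-- The exterior derivative, computed in charts. -/
def d (α : Form k M) : Form (k + 1) M := fun x =>
  (extDeriv (α.inChart x) (extChartAt M.I x x)).compContinuousLinearMap
    (mfderiv M.I 𝓘(ℝ, M.E) (extChartAt M.I x) x)

/-- `pr₁^* α - pr₂^* η` on a product `M × N̄`. -/
def prodBar (α : Form k M) (η : Form k N) : Form k (M.prod N) := fun p =>
  pullback (N := M.prod N) (M := M) Prod.fst α p - pullback (N := M.prod N) (M := N) Prod.snd η p

end Form

/-! ### Piecewise smooth singular chains -/

/-- The standard `k`-simplex with vertices `0, e₁, …, e_k` in `ℝ^k`. -/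
def simplexSet (k : ℕ) : Set (Fin k → ℝ) := {x | (∀ i, 0 ≤ x i) ∧ ∑ i, x i ≤ 1}

/-- The standard `k`-simplex as a type. -/
abbrev Δ (k : ℕ) : Type := simplexSet k

/-- The barycentric coordinates `(1 - ∑ xᵢ, x₁, …, x_k)`. -/
def barycentric {k : ℕ} (x : Fin k → ℝ) : Fin (k + 1) → ℝ := Fin.cons (1 - ∑ i, x i) x

theorem barycentric_nonneg {k : ℕ} (x : Δ k) (i : Fin (k + 1)) : 0 ≤ barycentric x.1 i := by
  refine Fin.cases ?_ (fun i => ?_) i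
  · simpa [barycentric] using x.2.2
  · simpa [barycentric] using x.2.1 i

theorem sum_barycentric {k : ℕ} (x : Fin k → ℝ) : ∑ i, barycentric x i = 1 := by
  simp [barycentric, Fin.sum_univ_succ]

/-- The inclusion `Δ_k → Δ_{k+1}` of the face opposite to the `j`-th vertex: a zero is inserted as
`j`-th barycentric coordinate. -/
def simplexFace {k : ℕ} (j : Fin (k + 2)) (x : Δ k) : Δ (k + 1) :=
  ⟨fun i => (j.insertNth (0 : ℝ) (barycentric x.1) : Fin (k + 2) → ℝ) i.succ, by
    have hb : ∀ i, 0 ≤ (j.insertNth (0 : ℝ) (barycentric x.1) : Fin (k + 2) → ℝ) i := by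
      intro i
      refine Fin.succAboveCases j ?_ (fun i => ?_) i
      · simp
      · simpa using barycentric_nonneg x i
    have hs : ∑ i, (j.insertNth (0 : ℝ) (barycentric x.1) : Fin (k + 2) → ℝ) i = 1 := by
      rw [Fin.sum_univ_succAbove _ j]
      simpa using sum_barycentric x.1
    refine ⟨fun i => hb _, ?_⟩
    rw [Fin.sum_univ_succ] at hs
    linarith [hb 0]⟩

/-- An arbitrary extension to `ℝ^k` of a map defined on the simplex. -/
def extendSimplex {k : ℕ} {A : Type u} (σ : Δ k → A) (x : Fin k → ℝ) : A :=
  open Classical in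
  if h : x ∈ simplexSet k then σ ⟨x, h⟩ else σ ⟨0, by simp [simplexSet]⟩

/-- A closed convex polyhedron: a finite intersection of closed half-spaces. -/
def IsPolyhedron {k : ℕ} (P : Set (Fin k → ℝ)) : Prop :=
  ∃ L : Finset ((Fin k → ℝ) →ᵃ[ℝ] ℝ), P = {x | ∀ ℓ ∈ L, 0 ≤ ℓ x}

/-- `σ : Δ_k → M` is piecewise smooth: the simplex is covered by finitely many closed convex
polyhedra, and `σ` is smooth on (the part in `Δ_k` of) each of them. In particular it is
continuous. -/
def PiecewiseSmooth (M : SmoothMfd.{u}) {k : ℕ} (σ : Δ k → M) : Prop :=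
  ∃ Ps : Set (Set (Fin k → ℝ)), Ps.Finite ∧ simplexSet k ⊆ ⋃₀ Ps ∧
    ∀ P ∈ Ps, IsPolyhedron P ∧
      ContMDiffOn 𝓘(ℝ, Fin k → ℝ) M.I ∞ (extendSimplex σ) (simplexSet k ∩ P)

/-- Spaces in which piecewise smooth simplices make sense. They are used for manifolds, for products
(a simplex is piecewise smooth if its components are) and for subspaces (a simplex is piecewise
smooth if it is so in the ambient space; for an embedded submanifold this is piecewise smoothness
with respect to its own manifold structure). -/
class HasSimplices (A : Type u) where
  IsSimplex : ∀ {k : ℕ}, (Δ k → A) → Prop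

instance (M : SmoothMfd.{u}) : HasSimplices M := ⟨fun σ => PiecewiseSmooth M σ⟩

instance {A : Type u} {B : Type u} [HasSimplices A] [HasSimplices B] : HasSimplices (A × B) :=
  ⟨fun σ => HasSimplices.IsSimplex (fun x => (σ x).1) ∧ HasSimplices.IsSimplex (fun x => (σ x).2)⟩

instance {ι : Type} {A : Type u} [HasSimplices A] : HasSimplices (ι → A) :=
  ⟨fun σ => ∀ i, HasSimplices.IsSimplex (fun x => σ x i)⟩

instance {A : Type u} [HasSimplices A] (P : A → Prop) : HasSimplices {a // P a} :=
  ⟨fun σ => HasSimplices.IsSimplex (fun x => (σ x).1)⟩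

/-- Finite integral combinations of maps `Δ_k → A`. The piecewise smooth chains are those which
involve only piecewise smooth maps, see `IsSmoothChain`. -/
abbrev Chain (A : Type u) (k : ℕ) : Type u := (Δ k → A) →₀ ℤ

namespace Chain

variable {A : Type u} {B : Type u} {k : ℕ}

/-- The chain map `f_*`. -/
def push (f : A → B) : Chain A k →+ Chain B k :=
  Finsupp.mapDomain.addMonoidHom fun σ => f ∘ σ

/-- The singular boundary `d`. -/
def d : Chain A (k + 1) →+ Chain A k :=
  ∑ j : Fin (k + 2), (-1 : ℤ) ^ (j : ℕ) •
    Finsupp.mapDomain.addMonoidHom fun σ : Δ (k + 1) → A => σ ∘ simplexFace j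

/-- The chain belongs to `C_k(A, ℤ)`: all simplices which occur are piecewise smooth. -/
def IsSmoothChain [HasSimplices A] (c : Chain A k) : Prop :=
  ∀ σ ∈ c.support, HasSimplices.IsSimplex σ

/-- `∫_{Δ_k} σ^* α`. -/
def integralSimplex {M : SmoothMfd.{u}} (α : Form k M) (σ : Δ k → M) : ℝ :=
  ∫ x in simplexSet k, α (extendSimplex σ x) fun i =>
    mfderivWithin 𝓘(ℝ, Fin k → ℝ) M.I (extendSimplex σ) (simplexSet k) x (Pi.single i (1 : ℝ))

/-- `∫_c α`. -/
def integral {M : SmoothMfd.{u}} (α : Form k M) (c : Chain M k) : ℝ :=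
  c.sum fun σ n => (n : ℝ) * integralSimplex α σ

end Chain

/-! ### Groupoids, nerves and the double complex of chains -/

/-- A groupoid with arrows `A` and objects `O`. The product `g h` is meaningful if `t g = s h`; the
values of `mul` on other pairs are irrelevant. -/
structure SetGroupoid (A : Type u) (O : Type u) where
  s : A → O
  t : A → O
  one : O → A
  inv : A → A
  mul : A → A → A
  s_one : ∀ x, s (one x) = x
  t_one : ∀ x, t (one x) = x
  s_inv : ∀ g, s (inv g) = t g
  t_inv : ∀ g, t (inv g) = s g
  s_mul : ∀ g h, t g = s h → s (mul g h) = s g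
  t_mul : ∀ g h, t g = s h → t (mul g h) = t h
  mul_assoc : ∀ g h l, t g = s h → t h = s l → mul (mul g h) l = mul g (mul h l)
  one_mul : ∀ g, mul (one (s g)) g = g
  mul_one : ∀ g, mul g (one (t g)) = g
  mul_inv : ∀ g, mul g (inv g) = one (s g)
  inv_mul : ∀ g, mul (inv g) g = one (t g)

namespace SetGroupoid

variable {A : Type u} {O : Type u} {A' : Type u} {O' : Type u}

/-- `Γ_{p+1}`: strings of `p + 1` composable arrows, listed from right to left, so that the product
of the string is `a_p ⋯ a_1 a_0`. -/
abbrev Strings (𝒢 : SetGroupoid A O) (p : ℕ) : Type u :=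
  {a : Fin (p + 1) → A // ∀ i : Fin p, 𝒢.t (a i.succ) = 𝒢.s (a i.castSucc)}

/-- `Γ_p`, with `Γ_0` the space of objects. -/
def Nerve (𝒢 : SetGroupoid A O) : ℕ → Type u
  | 0 => O
  | p + 1 => 𝒢.Strings p

/-- A string of arrows `a_0, …, a_p` involves the objects `x_0 = t a_0` and `x_{i+1} = s a_i`. The
`i`-th face leaves out the object `x_i`: this drops the first or last arrow of the string, or
replaces two consecutive arrows by their product. -/
def stringFace (𝒢 : SetGroupoid A O) (p : ℕ) (i : Fin (p + 3)) (a : 𝒢.Strings (p + 1)) :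
    𝒢.Strings p :=
  Fin.cases (motive := fun _ => 𝒢.Strings p)
    ⟨Fin.tail a.1, fun l => a.2 l.succ⟩
    (fun j => ⟨Fin.contractNth j (fun x y => 𝒢.mul y x) a.1, by
      intro l
      have h1 : 𝒢.t (a.1 l.succ.castSucc) = 𝒢.s (a.1 l.castSucc.castSucc) := a.2 l.castSucc
      have h2 : 𝒢.t (a.1 l.succ.succ) = 𝒢.s (a.1 l.succ.castSucc) := a.2 l.succ
      have e : l.castSucc.succ = l.succ.castSucc := rfl
      rw [← e] at h1 h2
      simp only [Fin.contractNth, Fin.val_succ, Fin.val_castSucc, ← e]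
      by_cases c1 : (l : ℕ) + 1 < j
      · have c2 : (l : ℕ) < j := by omega
        simp [c1, c2, h1]
      · by_cases c3 : (l : ℕ) + 1 = j
        · have c2 : (l : ℕ) < j := by omega
          simp [c3, c2, 𝒢.t_mul _ _ h2, h1]
        · by_cases c4 : (l : ℕ) = j
          · have c2 : ¬ (l : ℕ) < j := by omega
            simp [c4, 𝒢.s_mul _ _ h1, h2]
          · have c2 : ¬ (l : ℕ) < j := by omega
            simp [c1, c3, c2, c4, h2]⟩) i

/-- The face maps `Γ_{p+1} → Γ_p`. For `p = 0` they are `s` (the object `t g` is left out) and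
`t`. -/
def face (𝒢 : SetGroupoid A O) : (p : ℕ) → Fin (p + 2) → 𝒢.Nerve (p + 1) → 𝒢.Nerve p
  | 0, i, a => if i = 0 then 𝒢.s (a.1 0) else 𝒢.t (a.1 0)
  | p + 1, i, a => 𝒢.stringFace p i a


/-- Piecewise smooth simplices of `Γ_p`, as a subspace of a product of copies of the space of
arrows. -/
instance [HasSimplices A] [HasSimplices O] (𝒢 : SetGroupoid A O) (p : ℕ) :
    HasSimplices (𝒢.Nerve p) :=
  match p with
  | 0 => ⟨fun σ => HasSimplices.IsSimplex (A := O) σ⟩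
  | p + 1 => ⟨fun σ => HasSimplices.IsSimplex (A := 𝒢.Strings p) σ⟩

/-- A homomorphism of groupoids. -/
structure Hom (𝒢 : SetGroupoid A O) (𝒢' : SetGroupoid A' O') where
  onArr : A → A'
  onObj : O → O'
  map_s : ∀ g, 𝒢'.s (onArr g) = onObj (𝒢.s g)
  map_t : ∀ g, 𝒢'.t (onArr g) = onObj (𝒢.t g)
  map_mul : ∀ g h, 𝒢.t g = 𝒢.s h → onArr (𝒢.mul g h) = 𝒢'.mul (onArr g) (onArr h)

/-- The map `Γ_p → Γ'_p` induced by a homomorphism. -/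
def Hom.nerve {𝒢 : SetGroupoid A O} {𝒢' : SetGroupoid A' O'} (φ : Hom 𝒢 𝒢') :
    (p : ℕ) → 𝒢.Nerve p → 𝒢'.Nerve p
  | 0, x => φ.onObj x
  | _ + 1, a => ⟨fun i => φ.onArr (a.1 i), fun i => by rw [φ.map_t, φ.map_s, a.2 i]⟩

/-- A family of chains `D k p ∈ C_k(Γ_p)`, an element of the double complex. -/
abbrev DoubleChain (𝒢 : SetGroupoid A O) : Type u := ∀ k p : ℕ, Chain (𝒢.Nerve p) k

/-- The boundary `∂ : C_k(Γ_{p+1}) → C_k(Γ_p)`, the alternating sum of the maps induced by the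
faces. -/
def bd (𝒢 : SetGroupoid A O) (k p : ℕ) : Chain (𝒢.Nerve (p + 1)) k →+ Chain (𝒢.Nerve p) k :=
  ∑ i : Fin (p + 2), (-1 : ℤ) ^ (i : ℕ) • Chain.push (𝒢.face p i)

/-- The total differential `δ = (-1)^p d + ∂`. -/
def totalBd (𝒢 : SetGroupoid A O) (D : 𝒢.DoubleChain) : 𝒢.DoubleChain := fun k p =>
  (-1 : ℤ) ^ p • Chain.d (D (k + 1) p) + 𝒢.bd k p (D k (p + 1))

/-- `D ∈ C_n(Γ_•, ℤ)`, the group of piecewise smooth chains of total degree `n`. -/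
def IsChain [HasSimplices A] [HasSimplices O] (𝒢 : SetGroupoid A O) (n : ℕ)
    (D : 𝒢.DoubleChain) : Prop :=
  ∀ k p, (k + p ≠ n → D k p = 0) ∧ (D k p).IsSmoothChain

/-- `C ∈ Z_n(Γ_•, ℤ)`. -/
def IsCycle [HasSimplices A] [HasSimplices O] (𝒢 : SetGroupoid A O) (n : ℕ)
    (C : 𝒢.DoubleChain) : Prop :=
  𝒢.IsChain n C ∧ 𝒢.totalBd C = 0

/-- `φ_*` on the double complex. -/
def Hom.push {𝒢 : SetGroupoid A O} {𝒢' : SetGroupoid A' O'} (φ : Hom 𝒢 𝒢')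
    (D : 𝒢.DoubleChain) : 𝒢'.DoubleChain := fun k p => Chain.push (φ.nerve p) (D k p)

end SetGroupoid

/-! ### Lie groupoids and pre-quasi-symplectic groupoids -/

open Manifold in
/-- A Lie groupoid `Γ ⇉ M`. The multiplication is smooth on the manifold of composable pairs. -/
structure LieGroupoid (Γ M : SmoothMfd.{u}) extends SetGroupoid Γ M where
  submersion_s : IsSubmersion Γ.I M.I ∞ s
  submersion_t : IsSubmersion Γ.I M.I ∞ t
  smooth_one : ContMDiff M.I Γ.I ∞ one
  smooth_inv : ContMDiff Γ.I Γ.I ∞ inv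
  smooth_mul : ContMDiffOn (Γ.I.prod Γ.I) Γ.I ∞ (fun p : Γ × Γ => mul p.1 p.2)
    {p | t p.1 = s p.2}

namespace LieGroupoid

variable {Γ M Γ' M' : SmoothMfd.{u}}

/-- The product Lie groupoid `Γ × Γ' ⇉ M × M'`. -/
def prod (𝒢 : LieGroupoid Γ M) (ℋ : LieGroupoid Γ' M') :
    LieGroupoid (Γ.prod Γ') (M.prod M') where
  s := Prod.map 𝒢.s ℋ.s
  t := Prod.map 𝒢.t ℋ.t
  one := Prod.map 𝒢.one ℋ.one
  inv := Prod.map 𝒢.inv ℋ.inv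
  mul g h := (𝒢.mul g.1 h.1, ℋ.mul g.2 h.2)
  s_one x := Prod.ext (𝒢.s_one _) (ℋ.s_one _)
  t_one x := Prod.ext (𝒢.t_one _) (ℋ.t_one _)
  s_inv g := Prod.ext (𝒢.s_inv _) (ℋ.s_inv _)
  t_inv g := Prod.ext (𝒢.t_inv _) (ℋ.t_inv _)
  s_mul g h e := Prod.ext (𝒢.s_mul _ _ (congrArg Prod.fst e)) (ℋ.s_mul _ _ (congrArg Prod.snd e))
  t_mul g h e := Prod.ext (𝒢.t_mul _ _ (congrArg Prod.fst e)) (ℋ.t_mul _ _ (congrArg Prod.snd e))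
  mul_assoc g h l e e' := Prod.ext
    (𝒢.mul_assoc _ _ _ (congrArg Prod.fst e) (congrArg Prod.fst e'))
    (ℋ.mul_assoc _ _ _ (congrArg Prod.snd e) (congrArg Prod.snd e'))
  one_mul g := Prod.ext (𝒢.one_mul _) (ℋ.one_mul _)
  mul_one g := Prod.ext (𝒢.mul_one _) (ℋ.mul_one _)
  mul_inv g := Prod.ext (𝒢.mul_inv _) (ℋ.mul_inv _)
  inv_mul g := Prod.ext (𝒢.inv_mul _) (ℋ.inv_mul _)
  submersion_s := 𝒢.submersion_s.prodMap ℋ.submersion_s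
  submersion_t := 𝒢.submersion_t.prodMap ℋ.submersion_t
  smooth_one := 𝒢.smooth_one.prodMap ℋ.smooth_one
  smooth_inv := 𝒢.smooth_inv.prodMap ℋ.smooth_inv
  smooth_mul := by
    have h1 : ContMDiff ((Γ.I.prod Γ'.I).prod (Γ.I.prod Γ'.I)) (Γ.I.prod Γ.I) ∞
        (fun p : (Γ × Γ') × (Γ × Γ') => (p.1.1, p.2.1)) :=
      (contMDiff_fst.comp contMDiff_fst).prodMk (contMDiff_fst.comp contMDiff_snd)
    have h2 : ContMDiff ((Γ.I.prod Γ'.I).prod (Γ.I.prod Γ'.I)) (Γ'.I.prod Γ'.I) ∞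
        (fun p : (Γ × Γ') × (Γ × Γ') => (p.1.2, p.2.2)) :=
      (contMDiff_snd.comp contMDiff_fst).prodMk (contMDiff_snd.comp contMDiff_snd)
    exact ContMDiffOn.prodMk
      (𝒢.smooth_mul.comp h1.contMDiffOn fun p (hp : Prod.map 𝒢.t ℋ.t p.1 = Prod.map 𝒢.s ℋ.s p.2) =>
        congrArg Prod.fst hp)
      (ℋ.smooth_mul.comp h2.contMDiffOn fun p (hp : Prod.map 𝒢.t ℋ.t p.1 = Prod.map 𝒢.s ℋ.s p.2) =>
        congrArg Prod.snd hp)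

end LieGroupoid

/-- A pre-quasi-symplectic groupoid `(Γ ⇉ M, ω + Ω)`: `dΩ = 0`, `dω = ∂Ω` and `∂ω = 0`. The last
condition is `m^* ω = pr₁^* ω + pr₂^* ω` on the manifold of composable pairs, whose tangent vectors
at `(g, h)` are the pairs `(u, v)` with `dt(u) = ds(v)`. -/
structure PreQuasiSymplecticGroupoid (Γ M : SmoothMfd.{u}) extends LieGroupoid Γ M where
  form₂ : Form 2 Γ
  form₃ : Form 3 M
  smooth_form₂ : form₂.IsSmooth
  smooth_form₃ : form₃.IsSmooth
  d_form₃ : ∀ x, form₃.d x = 0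
  d_form₂ : ∀ g, form₂.d g = Form.pullback s form₃ g - Form.pullback t form₃ g
  multiplicative : ∀ g h, t g = s h →
    ∀ (a : Fin 2 → TangentSpace Γ.I g) (b : Fin 2 → TangentSpace Γ.I h),
      (∀ i, (mfderiv Γ.I M.I t g (a i) : M.E) = (mfderiv Γ.I M.I s h (b i) : M.E)) →
      form₂ (mul g h) (fun i => mfderivWithin (Γ.I.prod Γ.I) Γ.I (fun p : Γ × Γ => mul p.1 p.2)
        {p | t p.1 = s p.2} (g, h) (a i, b i)) = form₂ g a + form₂ h b

/-! ### Actions and pre-Hamiltonian spaces -/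

/-- A left `Γ`-space `J : X → M`. The arrow `r` acts on `x` if `t r = J x`. -/
structure LeftAction {Γ M : SmoothMfd.{u}} (𝒢 : LieGroupoid Γ M) (X : SmoothMfd.{u}) where
  J : X → M
  act : Γ → X → X
  smooth_J : ContMDiff X.I M.I ∞ J
  smooth_act : ContMDiffOn (Γ.I.prod X.I) X.I ∞ (fun p : Γ × X => act p.1 p.2)
    {p | 𝒢.t p.1 = J p.2}
  J_act : ∀ r x, 𝒢.t r = J x → J (act r x) = 𝒢.s r
  one_act : ∀ x, act (𝒢.one (J x)) x = x
  mul_act : ∀ g h x, 𝒢.t g = 𝒢.s h → 𝒢.t h = J x → act (𝒢.mul g h) x = act g (act h x)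

/-- A right `Γ`-space `J : X → M`. The product `x r` is defined if `J x = s r`. -/
structure RightAction {Γ M : SmoothMfd.{u}} (𝒢 : LieGroupoid Γ M) (X : SmoothMfd.{u}) where
  J : X → M
  act : X → Γ → X
  smooth_J : ContMDiff X.I M.I ∞ J
  smooth_act : ContMDiffOn (X.I.prod Γ.I) X.I ∞ (fun p : X × Γ => act p.1 p.2)
    {p | J p.1 = 𝒢.s p.2}
  J_act : ∀ x r, J x = 𝒢.s r → J (act x r) = 𝒢.t r
  act_one : ∀ x, act x (𝒢.one (J x)) = x
  act_mul : ∀ x g h, J x = 𝒢.s g → 𝒢.t g = 𝒢.s h → act x (𝒢.mul g h) = act (act x g) h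

namespace LeftAction

variable {Γ M X : SmoothMfd.{u}} {𝒢 : LieGroupoid Γ M}

/-- The space of arrows `Γ ×_M X` of the transformation groupoid. -/
abbrev Arrows (𝒜 : LeftAction 𝒢 X) : Type u := {p : Γ × X // 𝒢.t p.1 = 𝒜.J p.2}

open Classical in
/-- The product `(r, r' x) (r', x) = (r r', x)`; other pairs are irrelevant. -/
def mulArrow (𝒜 : LeftAction 𝒢 X) (p q : 𝒜.Arrows) : 𝒜.Arrows :=
  if h : p.1.2 = 𝒜.act q.1.1 q.1.2 then ⟨(𝒢.mul p.1.1 q.1.1, q.1.2), by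
    show 𝒢.t (𝒢.mul p.1.1 q.1.1) = 𝒜.J q.1.2
    rw [𝒢.t_mul _ _ (by rw [p.2, h, 𝒜.J_act _ _ q.2]), q.2]⟩
  else p

theorem mulArrow_val (𝒜 : LeftAction 𝒢 X) {p q : 𝒜.Arrows} (h : p.1.2 = 𝒜.act q.1.1 q.1.2) :
    (𝒜.mulArrow p q).1 = (𝒢.mul p.1.1 q.1.1, q.1.2) := by
  simp [mulArrow, h]

/-- The transformation groupoid `Γ ×_M X ⇉ X`, with `s (r, x) = r x` and `t (r, x) = x`. -/
def transformation (𝒜 : LeftAction 𝒢 X) : SetGroupoid 𝒜.Arrows X where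
  s p := 𝒜.act p.1.1 p.1.2
  t p := p.1.2
  one x := ⟨(𝒢.one (𝒜.J x), x), 𝒢.t_one _⟩
  inv p := ⟨(𝒢.inv p.1.1, 𝒜.act p.1.1 p.1.2), by
    show 𝒢.t (𝒢.inv p.1.1) = 𝒜.J (𝒜.act p.1.1 p.1.2)
    rw [𝒢.t_inv, 𝒜.J_act _ _ p.2]⟩
  mul := 𝒜.mulArrow
  s_one x := 𝒜.one_act x
  t_one x := rfl
  s_inv p := by
    show 𝒜.act (𝒢.inv p.1.1) (𝒜.act p.1.1 p.1.2) = p.1.2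
    rw [← 𝒜.mul_act _ _ _ (𝒢.t_inv _) p.2, 𝒢.inv_mul, p.2, 𝒜.one_act]
  t_inv p := rfl
  s_mul p q h := by
    have h' : p.1.2 = 𝒜.act q.1.1 q.1.2 := h
    simp only [𝒜.mulArrow_val h']
    rw [𝒜.mul_act _ _ _ (by rw [p.2, h', 𝒜.J_act _ _ q.2]) q.2, ← h']
  t_mul p q h := by
    have h' : p.1.2 = 𝒜.act q.1.1 q.1.2 := h
    simp only [𝒜.mulArrow_val h']
  mul_assoc p q r h h' := by
    have e : p.1.2 = 𝒜.act q.1.1 q.1.2 := h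
    have e' : q.1.2 = 𝒜.act r.1.1 r.1.2 := h'
    have f' : 𝒢.t q.1.1 = 𝒢.s r.1.1 := by rw [q.2, e', 𝒜.J_act _ _ r.2]
    have f : 𝒢.t p.1.1 = 𝒢.s q.1.1 := by rw [p.2, e, 𝒜.J_act _ _ q.2]
    have k : (𝒜.mulArrow p q).1.2 = 𝒜.act r.1.1 r.1.2 := by rw [𝒜.mulArrow_val e]; exact e'
    have k' : p.1.2 = 𝒜.act (𝒜.mulArrow q r).1.1 (𝒜.mulArrow q r).1.2 := by
      rw [𝒜.mulArrow_val e']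
      show p.1.2 = 𝒜.act (𝒢.mul q.1.1 r.1.1) r.1.2
      rw [𝒜.mul_act _ _ _ f' r.2, ← e', e]
    refine Subtype.ext ?_
    rw [𝒜.mulArrow_val k, 𝒜.mulArrow_val k', 𝒜.mulArrow_val e, 𝒜.mulArrow_val e']
    exact Prod.ext (𝒢.mul_assoc _ _ _ f f') rfl
  one_mul p := by
    refine Subtype.ext ((𝒜.mulArrow_val rfl).trans (Prod.ext ?_ rfl))
    show 𝒢.mul (𝒢.one (𝒜.J (𝒜.act p.1.1 p.1.2))) p.1.1 = p.1.1
    rw [𝒜.J_act _ _ p.2, 𝒢.one_mul]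
  mul_one p := by
    refine Subtype.ext ((𝒜.mulArrow_val (𝒜.one_act p.1.2).symm).trans (Prod.ext ?_ rfl))
    show 𝒢.mul p.1.1 (𝒢.one (𝒜.J p.1.2)) = p.1.1
    rw [← p.2, 𝒢.mul_one]
  mul_inv p := by
    have e : p.1.2 = 𝒜.act (𝒢.inv p.1.1) (𝒜.act p.1.1 p.1.2) := by
      rw [← 𝒜.mul_act _ _ _ (𝒢.t_inv _) p.2, 𝒢.inv_mul, p.2, 𝒜.one_act]
    refine Subtype.ext ((𝒜.mulArrow_val e).trans (Prod.ext ?_ rfl))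
    show 𝒢.mul p.1.1 (𝒢.inv p.1.1) = 𝒢.one (𝒜.J (𝒜.act p.1.1 p.1.2))
    rw [𝒢.mul_inv, 𝒜.J_act _ _ p.2]
  inv_mul p := by
    refine Subtype.ext ((𝒜.mulArrow_val rfl).trans (Prod.ext ?_ rfl))
    show 𝒢.mul (𝒢.inv p.1.1) p.1.1 = 𝒢.one (𝒜.J p.1.2)
    rw [𝒢.inv_mul, p.2]

/-- The homomorphism `J` from the transformation groupoid to `Γ ⇉ M`. -/
def momentHom (𝒜 : LeftAction 𝒢 X) : SetGroupoid.Hom 𝒜.transformation 𝒢.toSetGroupoid where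
  onArr p := p.1.1
  onObj := 𝒜.J
  map_s p := (𝒜.J_act _ _ p.2).symm
  map_t p := p.2
  map_mul p q h := by
    have h' : p.1.2 = 𝒜.act q.1.1 q.1.2 := h
    show (𝒜.mulArrow p q).1.1 = 𝒢.mul p.1.1 q.1.1
    rw [𝒜.mulArrow_val h']

/-- `β` is a compatible form for the left `Γ`-space `X`: it is a smooth `2`-form, `dβ = J^* Ω`, and
the graph `{(r, x, r x)}` of the action is isotropic with respect to `(ω, β, -β)`. The tangent
vectors of the graph are `(a, b, act_*(a, b))` with `dt(a) = dJ(b)`. -/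
def IsPreHamiltonian (𝒜 : LeftAction 𝒢 X) (form₂ : Form 2 Γ) (form₃ : Form 3 M)
    (β : Form 2 X) : Prop :=
  β.IsSmooth ∧ (∀ x, β.d x = Form.pullback 𝒜.J form₃ x) ∧
  ∀ r x, 𝒢.t r = 𝒜.J x → ∀ (a : Fin 2 → TangentSpace Γ.I r) (b : Fin 2 → TangentSpace X.I x),
    (∀ i, (mfderiv Γ.I M.I 𝒢.t r (a i) : M.E) = (mfderiv X.I M.I 𝒜.J x (b i) : M.E)) →
    form₂ r a + β x b - β (𝒜.act r x) (fun i =>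
      mfderivWithin (Γ.I.prod X.I) X.I (fun p : Γ × X => 𝒜.act p.1 p.2)
        {p | 𝒢.t p.1 = 𝒜.J p.2} (r, x) (a i, b i)) = 0

end LeftAction

/-- A pre-Hamiltonian `Γ`-space `(J : X → M, ω_X)`. -/
structure PreHamiltonianSpace {Γ M : SmoothMfd.{u}} (𝒢 : PreQuasiSymplecticGroupoid Γ M)
    (X : SmoothMfd.{u}) extends LeftAction 𝒢.toLieGroupoid X where
  form : Form 2 X
  isPreHamiltonian : toLeftAction.IsPreHamiltonian 𝒢.form₂ 𝒢.form₃ form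

/-- The integrality condition for `(ω_X, ω + Ω)`: for all `C ∈ Z_2((Γ ×_M X)_•, ℤ)` and
`D ∈ C_3(Γ_•, ℤ)` with `δ D = J_* C`, the number `∫_C ω_X - ∫_D (ω + Ω)` is an integer. Here `ω_X`
pairs with the component of `C` in `C_2(X)`, and `ω` and `Ω` with those of `D` in `C_2(Γ)` and
`C_3(M)`. -/
def PreHamiltonianSpace.IntegralityCondition {Γ M X : SmoothMfd.{u}}
    {𝒢 : PreQuasiSymplecticGroupoid Γ M} (F : PreHamiltonianSpace 𝒢 X) : Prop :=
  ∀ (C : F.transformation.DoubleChain) (D : 𝒢.DoubleChain),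
    F.transformation.IsCycle 2 C → 𝒢.IsChain 3 D → 𝒢.totalBd D = F.momentHom.push C →
    ∃ n : ℤ, Chain.integral F.form (C 2 0) -
      (Chain.integral 𝒢.form₂ (Chain.push (fun a : 𝒢.Nerve 1 => a.1 0) (D 2 1)) +
        Chain.integral 𝒢.form₃ (D 3 0)) = n

/-! ### Morita equivalence -/

open Manifold in
/-- A Morita equivalence bimodule `G₀ ←ρ X →σ H₀` between the Lie groupoids `G` and `H`: commuting
left `G`- and right `H`-actions, such that `X → H₀` is a principal `G`-bundle and `X → G₀` is a
principal `H`-bundle. Principality says that the moment map of the other action is a surjective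
submersion, and that the action is free and transitive on its fibres, with smooth division map. -/
structure MoritaBimodule {G G₀ H H₀ : SmoothMfd.{u}} (𝒢 : LieGroupoid G G₀) (ℋ : LieGroupoid H H₀)
    (X : SmoothMfd.{u}) where
  left : LeftAction 𝒢 X
  right : RightAction ℋ X
  left_right : ∀ x h, right.J x = ℋ.s h → left.J (right.act x h) = left.J x
  right_left : ∀ g x, 𝒢.t g = left.J x → right.J (left.act g x) = right.J x
  comm : ∀ g x h, 𝒢.t g = left.J x → right.J x = ℋ.s h →
    left.act g (right.act x h) = right.act (left.act g x) h
  left_submersion : IsSubmersion X.I G₀.I ∞ left.J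
  left_surjective : Function.Surjective left.J
  right_submersion : IsSubmersion X.I H₀.I ∞ right.J
  right_surjective : Function.Surjective right.J
  left_free : ∀ g x, 𝒢.t g = left.J x → left.act g x = x → g = 𝒢.one (left.J x)
  left_principal : ∃ div : X → X → G,
    ContMDiffOn (X.I.prod X.I) G.I ∞ (fun p : X × X => div p.1 p.2) {p | right.J p.1 = right.J p.2} ∧
    ∀ x y, right.J x = right.J y → 𝒢.t (div x y) = left.J y ∧ left.act (div x y) y = x
  right_free : ∀ x h, right.J x = ℋ.s h → right.act x h = x → h = ℋ.one (right.J x)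
  right_principal : ∃ div : X → X → H,
    ContMDiffOn (X.I.prod X.I) H.I ∞ (fun p : X × X => div p.1 p.2) {p | left.J p.1 = left.J p.2} ∧
    ∀ x y, left.J x = left.J y → right.J x = ℋ.s (div x y) ∧ right.act x (div x y) = y

namespace MoritaBimodule

variable {G G₀ H H₀ X : SmoothMfd.{u}} {𝒢 : LieGroupoid G G₀} {ℋ : LieGroupoid H H₀}

/-- The left action `(g, h) · x = g x h⁻¹` of `G × H` on `X`, with moment map `ρ × σ`. -/
def prodAction (B : MoritaBimodule 𝒢 ℋ X) : LeftAction (𝒢.prod ℋ) X where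
  J x := (B.left.J x, B.right.J x)
  act r x := B.right.act (B.left.act r.1 x) (ℋ.inv r.2)
  smooth_J := B.left.smooth_J.prodMk B.right.smooth_J
  smooth_act := by
    have h1 : ContMDiff ((G.I.prod H.I).prod X.I) (G.I.prod X.I) ∞
        (fun p : (G × H) × X => (p.1.1, p.2)) :=
      (contMDiff_fst.comp contMDiff_fst).prodMk contMDiff_snd
    have h2 : ContMDiff ((G.I.prod H.I).prod X.I) H.I ∞
        (fun p : (G × H) × X => ℋ.inv p.1.2) :=
      ℋ.smooth_inv.comp (contMDiff_snd.comp contMDiff_fst)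
    have h3 : ContMDiffOn ((G.I.prod H.I).prod X.I) X.I ∞
        (fun p : (G × H) × X => B.left.act p.1.1 p.2)
        {p | Prod.map 𝒢.t ℋ.t p.1 = (B.left.J p.2, B.right.J p.2)} :=
      B.left.smooth_act.comp h1.contMDiffOn fun p hp => congrArg Prod.fst hp
    refine B.right.smooth_act.comp (h3.prodMk h2.contMDiffOn) fun p hp => ?_
    have e1 : 𝒢.t p.1.1 = B.left.J p.2 := congrArg Prod.fst hp
    have e2 : ℋ.t p.1.2 = B.right.J p.2 := congrArg Prod.snd hp
    show B.right.J (B.left.act p.1.1 p.2) = ℋ.s (ℋ.inv p.1.2)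
    rw [B.right_left _ _ e1, ℋ.s_inv, e2]
  J_act r x h := by
    have e1 : 𝒢.t r.1 = B.left.J x := congrArg Prod.fst h
    have e2 : ℋ.t r.2 = B.right.J x := congrArg Prod.snd h
    have e3 : B.right.J (B.left.act r.1 x) = ℋ.s (ℋ.inv r.2) := by
      rw [B.right_left _ _ e1, ℋ.s_inv, e2]
    refine Prod.ext ?_ ?_
    · show B.left.J _ = 𝒢.s r.1
      rw [B.left_right _ _ e3, B.left.J_act _ _ e1]
    · show B.right.J _ = ℋ.s r.2
      rw [B.right.J_act _ _ e3, ℋ.t_inv]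
  one_act x := by
    show B.right.act (B.left.act (𝒢.one (B.left.J x)) x) (ℋ.inv (ℋ.one (B.right.J x))) = x
    have e : ℋ.inv (ℋ.one (B.right.J x)) = ℋ.one (B.right.J x) := by
      have h := ℋ.mul_inv (ℋ.one (B.right.J x))
      have h' := ℋ.one_mul (ℋ.inv (ℋ.one (B.right.J x)))
      rw [ℋ.s_inv, ℋ.t_one] at h'
      rw [h', ℋ.s_one] at h
      exact h
    rw [e, B.left.one_act, B.right.act_one]
  mul_act g h x e e' := by
    have e1 : 𝒢.t g.1 = 𝒢.s h.1 := congrArg Prod.fst e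
    have e2 : ℋ.t g.2 = ℋ.s h.2 := congrArg Prod.snd e
    have f1 : 𝒢.t h.1 = B.left.J x := congrArg Prod.fst e'
    have f2 : ℋ.t h.2 = B.right.J x := congrArg Prod.snd e'
    have inv_mul : ℋ.inv (ℋ.mul g.2 h.2) = ℋ.mul (ℋ.inv h.2) (ℋ.inv g.2) := by
      have c0 : ℋ.t (ℋ.mul g.2 h.2) = ℋ.t h.2 := ℋ.t_mul _ _ e2
      have c0' : ℋ.s (ℋ.mul g.2 h.2) = ℋ.s g.2 := ℋ.s_mul _ _ e2
      have c1 : ℋ.t (ℋ.inv h.2) = ℋ.s (ℋ.inv g.2) := by rw [ℋ.t_inv, ℋ.s_inv, e2]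
      have c2 : ℋ.s (ℋ.mul (ℋ.inv h.2) (ℋ.inv g.2)) = ℋ.t h.2 := by rw [ℋ.s_mul _ _ c1, ℋ.s_inv]
      have c3 : ℋ.mul (ℋ.mul g.2 h.2) (ℋ.mul (ℋ.inv h.2) (ℋ.inv g.2)) = ℋ.one (ℋ.s g.2) := by
        rw [ℋ.mul_assoc _ _ _ e2 c2.symm, ← ℋ.mul_assoc h.2 _ _ (ℋ.s_inv _).symm c1, ℋ.mul_inv,
          ← e2, ← ℋ.s_inv, ℋ.one_mul, ℋ.mul_inv]
      have c4 := ℋ.one_mul (ℋ.mul (ℋ.inv h.2) (ℋ.inv g.2))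
      have c5 := ℋ.mul_one (ℋ.inv (ℋ.mul g.2 h.2))
      rw [c2, ← c0, ← ℋ.inv_mul, ℋ.mul_assoc _ _ _ (ℋ.t_inv _) (by rw [c0, c2]), c3] at c4
      rw [ℋ.t_inv, c0'] at c5
      rw [← c5, c4]
    have k1 : B.right.J (B.left.act h.1 x) = ℋ.s (ℋ.inv h.2) := by
      rw [B.right_left _ _ f1, ℋ.s_inv, f2]
    have k2 : 𝒢.t g.1 = B.left.J (B.left.act h.1 x) := by rw [B.left.J_act _ _ f1, e1]
    have k3 : ℋ.t (ℋ.inv h.2) = ℋ.s (ℋ.inv g.2) := by rw [ℋ.t_inv, ℋ.s_inv, e2]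
    show B.right.act (B.left.act (𝒢.mul g.1 h.1) x) (ℋ.inv (ℋ.mul g.2 h.2)) =
      B.right.act (B.left.act g.1 (B.right.act (B.left.act h.1 x) (ℋ.inv h.2))) (ℋ.inv g.2)
    rw [B.left.mul_act _ _ _ e1 f1, inv_mul, B.comm _ _ _ k2 k1,
      B.right.act_mul _ _ _ (by rw [B.right_left _ _ k2, k1]) k3]

end MoritaBimodule

/-- A Morita equivalence of pre-quasi-symplectic groupoids: a Morita equivalence bimodule `X` and a
`2`-form `ω_X` which make `X → G₀ × H̄₀` a pre-Hamiltonian `G × H̄`-space, where `H̄` is `H` with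
the opposite forms. -/
structure MoritaEquivalence {G G₀ H H₀ : SmoothMfd.{u}} (𝒢 : PreQuasiSymplecticGroupoid G G₀)
    (ℋ : PreQuasiSymplecticGroupoid H H₀) (X : SmoothMfd.{u}) extends
    MoritaBimodule 𝒢.toLieGroupoid ℋ.toLieGroupoid X where
  form : Form 2 X
  isPreHamiltonian : toMoritaBimodule.prodAction.IsPreHamiltonian
    (Form.prodBar 𝒢.form₂ ℋ.form₂) (Form.prodBar 𝒢.form₃ ℋ.form₃) form

/-- The pre-Hamiltonian `H`-space `E` corresponds to the pre-Hamiltonian `G`-space `F` under the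
Morita equivalence `X`, that is, `E` is isomorphic to the pre-Hamiltonian `H`-space
`X̄ ×_G F = G \ (X ×_{G₀} F)`. Explicitly, there is a surjective submersion
`q : X ×_{G₀} F → E`, `q(x, f) = [x, f]`, whose fibres are the orbits of the diagonal `G`-action,
such that `J_E [x, f] = σ(x)`, `h · [x, f] = [x h⁻¹, f]`, and `q^* ω_E` is the restriction of
`(-ω_X, ω_F)`. Tangent vectors of `X ×_{G₀} F` are the pairs `(a, b)` with `dρ(a) = dJ_F(b)`. -/
def MoritaEquivalence.Corresponding {G G₀ H H₀ X F₀ E₀ : SmoothMfd.{u}}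
    {𝒢 : PreQuasiSymplecticGroupoid G G₀} {ℋ : PreQuasiSymplecticGroupoid H H₀}
    (B : MoritaEquivalence 𝒢 ℋ X) (F : PreHamiltonianSpace 𝒢 F₀) (E : PreHamiltonianSpace ℋ E₀) :
    Prop :=
  ∃ q : X × F₀ → E₀,
    ContMDiffOn (X.I.prod F₀.I) E₀.I ∞ q {p | B.left.J p.1 = F.J p.2} ∧
    (∀ e, ∃ p, B.left.J p.1 = F.J p.2 ∧ q p = e) ∧
    (∀ x f, B.left.J x = F.J f → ∀ c : TangentSpace E₀.I (q (x, f)),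
      ∃ (a : TangentSpace X.I x) (b : TangentSpace F₀.I f),
        (mfderiv X.I G₀.I B.left.J x a : G₀.E) = (mfderiv F₀.I G₀.I F.J f b : G₀.E) ∧
        mfderivWithin (X.I.prod F₀.I) E₀.I q {p | B.left.J p.1 = F.J p.2} (x, f) (a, b) = c) ∧
    (∀ x f x' f', B.left.J x = F.J f → B.left.J x' = F.J f' →
      (q (x, f) = q (x', f') ↔
        ∃ g, 𝒢.t g = B.left.J x ∧ x' = B.left.act g x ∧ f' = F.act g f)) ∧
    (∀ x f, B.left.J x = F.J f → E.J (q (x, f)) = B.right.J x) ∧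
    (∀ h x f, B.left.J x = F.J f → ℋ.t h = B.right.J x →
      E.act h (q (x, f)) = q (B.right.act x (ℋ.inv h), f)) ∧
    ∀ x f, B.left.J x = F.J f →
      ∀ (a : Fin 2 → TangentSpace X.I x) (b : Fin 2 → TangentSpace F₀.I f),
        (∀ i, (mfderiv X.I G₀.I B.left.J x (a i) : G₀.E) =
          (mfderiv F₀.I G₀.I F.J f (b i) : G₀.E)) →
        E.form (q (x, f)) (fun i =>
          mfderivWithin (X.I.prod F₀.I) E₀.I q {p | B.left.J p.1 = F.J p.2} (x, f) (a i, b i)) =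
          F.form f b - B.form x a

end PreQuasi

/-! Let `K` be the pull-back of `G` along `ρ : X → G₀`, with arrows `(x', g, x)`. Since `X` is
principal on both sides, the equation `x' h = g x` lets `g` and `h` determine each other, so `K` is
the pull-back of `H` along `σ` as well. In the same way the pull-back `L` of the transformation
groupoid of `F` along `X ×_{G₀} F → F` is also the pull-back of the transformation groupoid of `E`
along the quotient map `q`, and the moment maps induce a homomorphism `κ : L → K`. All four
projections are Cartesian (`Hom.Cartesian`), and their maps of objects have local sections.

On `K` and `L` the forms coming from the two sides are related by `ω_X`: `ω_G - ω_H = ∂ω_X` on the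
arrows of `K`, `Ω_G - Ω_H = dω_X` on `X`, and `ω_F - ω_E` is the pull-back of `ω_X` to `X ×_{G₀} F`.
Hence, if `C'` is a 2-cycle of `L` and `D'` a 3-chain of `K` with `δD' = κ_* C'`, the numbers
attached to the images of `(C', D')` on the two sides differ by `∫_{κ_* C'} ω_X - ∫_{δD'} ω_X = 0`
(`pairing_eq`). It remains to lift a pair `(C, D)` given on one side to such a pair `(C', D')`
(`IntegralityCondition.transfer`).

The lifting rests on two facts. First, for a Cartesian `φ` the kernel of `φ_*` on the total complex
is acyclic (`exists_totalBd_eq`). Replacing every simplex of objects by a chosen one with the same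
image gives a normalization which depends only on the image under `φ`, hence vanishes on the kernel;
prisms join it to the identity and give a contracting homotopy in the nerve direction. Therefore an
arbitrary lift of a chain can be corrected so as to have a prescribed boundary
(`exists_lift_totalBd`). Second, a simplex of the nerve lifts as soon as its objects stay in domains
of local sections, and iterated barycentric subdivision achieves this (`eventually_isLiftable`).
Subdivision commutes with `δ` and with push-forwards and preserves integrals (`integral_sd`), so
`(C, D)` may simply be replaced by its subdivision; no homotopy between a chain and its subdivision
is needed.

The analytic input is Stokes' theorem for piecewise smooth 3-simplices (`integral_d`). After
subdivision a simplex lies in a chart, where it is Lipschitz. A Lipschitz retraction of the cube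
onto the simplex reduces the statement to Lipschitz maps of a cube, where one sums a discretized
2-form over the boundaries of small cubes and passes to the limit by Rademacher's theorem and
dominated convergence (`integral_cube_eq`). -/

namespace PreQuasi

/-! ### Alternating sums of face operators -/

section Alternating

variable {A B C : Type*} [AddCommGroup A] [AddCommGroup B] [AddCommGroup C]

theorem alternatingSum_comp_eq_zero {n : ℕ} (f : Fin (n + 3) → A →+ B) (g : Fin (n + 2) → B →+ C)
    (h : ∀ i j : Fin (n + 2), i ≤ j → (g i).comp (f j.succ) = (g j).comp (f i.castSucc)) (a : A) :
    (∑ i : Fin (n + 2), (-1 : ℤ) ^ (i : ℕ) • g i)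
      ((∑ j : Fin (n + 3), (-1 : ℤ) ^ (j : ℕ) • f j) a) = 0 := by
  have key : (∑ i : Fin (n + 2), (-1 : ℤ) ^ (i : ℕ) • g i)
      ((∑ j : Fin (n + 3), (-1 : ℤ) ^ (j : ℕ) • f j) a) =
      ∑ x : Fin (n + 2) × Fin (n + 3), (-1 : ℤ) ^ ((x.1 : ℕ) + x.2) • g x.1 (f x.2 a) := by
    rw [Fintype.sum_prod_type, AddMonoidHom.finsetSum_apply]
    refine Finset.sum_congr rfl fun i _ => ?_
    rw [AddMonoidHom.smul_apply, AddMonoidHom.finsetSum_apply, map_sum, Finset.smul_sum]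
    refine Finset.sum_congr rfl fun j _ => ?_
    rw [AddMonoidHom.smul_apply, map_zsmul, smul_smul, pow_add]
  have pair : ∀ i j : Fin (n + 2), i ≤ j →
      (-1 : ℤ) ^ ((i : ℕ) + (j.succ : Fin (n + 3))) • g i (f j.succ a) +
        (-1 : ℤ) ^ ((j : ℕ) + (i.castSucc : Fin (n + 3))) • g j (f i.castSucc a) = 0 := by
    intro i j hij
    have := DFunLike.congr_fun (h i j hij) a
    simp only [AddMonoidHom.comp_apply] at this
    rw [this, Fin.val_succ, Fin.val_castSucc, ← add_smul,
      show (i : ℕ) + (j + 1) = (j + i) + 1 by omega, pow_succ]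
    simp
  -- The involution exchanges `(i, j + 1)` and `(j, i)` for `i ≤ j`. The simplicial identity equates
  -- the two composites, and their signs are opposite.
  let e : Fin (n + 2) × Fin (n + 3) → Fin (n + 2) × Fin (n + 3) := fun x =>
    if hx : (x.1 : ℕ) < x.2 then (⟨x.2 - 1, by omega⟩, x.1.castSucc)
    else (⟨x.2, by omega⟩, x.1.succ)
  have e1 : ∀ i j : Fin (n + 2), i ≤ j → e (i, j.succ) = (j, i.castSucc) := by
    intro i j hij
    simp [e, hij]
  have e2 : ∀ i j : Fin (n + 2), i ≤ j → e (j, i.castSucc) = (i, j.succ) := by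
    intro i j hij
    simp [e, hij]
  have cases : ∀ x : Fin (n + 2) × Fin (n + 3), ∃ i j : Fin (n + 2), i ≤ j ∧
      (x = (i, j.succ) ∨ x = (j, i.castSucc)) := by
    rintro ⟨i, j⟩
    by_cases hx : (i : ℕ) < j
    · exact ⟨i, ⟨j - 1, by omega⟩, Fin.le_def.2 (by simp; omega),
        Or.inl (by simp [Fin.ext_iff]; omega)⟩
    · exact ⟨⟨j, by omega⟩, i, Fin.le_def.2 (by simp; omega), Or.inr (by simp)⟩
  rw [key]
  refine Finset.sum_ninvolution e ?_ ?_ ?_ ?_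
  · intro x
    obtain ⟨i, j, hij, rfl | rfl⟩ := cases x
    · rw [e1 i j hij]; exact pair i j hij
    · rw [e2 i j hij, add_comm]; exact pair i j hij
  · intro x _
    obtain ⟨i, j, hij, rfl | rfl⟩ := cases x
    · rw [e1 i j hij, ne_eq, Prod.mk.injEq, Fin.ext_iff, Fin.ext_iff, Fin.val_succ,
        Fin.val_castSucc]
      omega
    · rw [e2 i j hij, ne_eq, Prod.mk.injEq, Fin.ext_iff, Fin.ext_iff, Fin.val_succ,
        Fin.val_castSucc]
      omega
  · simp
  · intro x
    obtain ⟨i, j, hij, rfl | rfl⟩ := cases x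
    · rw [e1 i j hij, e2 i j hij]
    · rw [e2 i j hij, e1 i j hij]

/-- The sum of the faces of a prism: the alternating sum of the maps `h i` of a simplicial homotopy
is a chain homotopy. -/
theorem prism_alternatingSum {X₀ X Y : Type*} [AddCommGroup X₀] [AddCommGroup X]
    [AddCommGroup Y] {n : ℕ} (δ' : Fin (n + 2) → X →+ X₀) (h' : Fin (n + 1) → X₀ →+ X)
    (h : Fin (n + 2) → X →+ Y) (δ : Fin (n + 3) → Y →+ X)
    (below : ∀ (i : Fin (n + 1)) (j : Fin (n + 2)), j ≤ i.castSucc →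
      (δ j.castSucc).comp (h i.succ) = (h' i).comp (δ' j))
    (middle : ∀ i : Fin (n + 1), (δ i.castSucc.succ).comp (h i.succ) =
      (δ i.castSucc.succ).comp (h i.castSucc))
    (above : ∀ (i : Fin (n + 1)) (j : Fin (n + 2)), i.castSucc < j →
      (δ j.succ).comp (h i.castSucc) = (h' i).comp (δ' j)) (a : X) :
    (∑ j : Fin (n + 3), (-1 : ℤ) ^ (j : ℕ) • δ j)
        ((∑ i : Fin (n + 2), (-1 : ℤ) ^ (i : ℕ) • h i) a) +
      (∑ i : Fin (n + 1), (-1 : ℤ) ^ (i : ℕ) • h' i)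
        ((∑ j : Fin (n + 2), (-1 : ℤ) ^ (j : ℕ) • δ' j) a) =
      δ 0 (h 0 a) - δ (Fin.last _) (h (Fin.last _) a) := by
  let β : Fin (n + 2) × Fin (n + 3) → X := fun x =>
    (-1 : ℤ) ^ ((x.1 : ℕ) + x.2) • δ x.2 (h x.1 a)
  let α : Fin (n + 1) × Fin (n + 2) → X := fun x =>
    (-1 : ℤ) ^ ((x.1 : ℕ) + x.2) • h' x.1 (δ' x.2 a)
  have e1 : (∑ j : Fin (n + 3), (-1 : ℤ) ^ (j : ℕ) • δ j)
        ((∑ i : Fin (n + 2), (-1 : ℤ) ^ (i : ℕ) • h i) a) = ∑ x, β x := by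
    rw [Fintype.sum_prod_type_right, AddMonoidHom.finsetSum_apply]
    refine Finset.sum_congr rfl fun j _ => ?_
    rw [AddMonoidHom.smul_apply, AddMonoidHom.finsetSum_apply, map_sum, Finset.smul_sum]
    refine Finset.sum_congr rfl fun i _ => ?_
    rw [AddMonoidHom.smul_apply, map_zsmul, smul_smul, ← pow_add, add_comm]
  have e2 : (∑ i : Fin (n + 1), (-1 : ℤ) ^ (i : ℕ) • h' i)
        ((∑ j : Fin (n + 2), (-1 : ℤ) ^ (j : ℕ) • δ' j) a) = ∑ x, α x := by
    rw [Fintype.sum_prod_type, AddMonoidHom.finsetSum_apply]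
    refine Finset.sum_congr rfl fun i _ => ?_
    rw [AddMonoidHom.smul_apply, AddMonoidHom.finsetSum_apply, map_sum, Finset.smul_sum]
    refine Finset.sum_congr rfl fun j _ => ?_
    rw [AddMonoidHom.smul_apply, map_zsmul, smul_smul, ← pow_add]
  -- the faces of the prism are indexed by `i` with `j < i`, `j = i`, `j = i + 1`, `j > i + 1`
  have split : ∑ x, β x = (∑ x ∈ Finset.univ.filter fun x : Fin (n + 1) × Fin (n + 2) =>
        ¬ x.1.castSucc < x.2, β (x.1.succ, x.2.castSucc)) +
      (∑ x ∈ Finset.univ.filter fun x : Fin (n + 1) × Fin (n + 2) =>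
        x.1.castSucc < x.2, β (x.1.castSucc, x.2.succ)) +
      ((∑ i : Fin (n + 2), β (i, i.castSucc)) + ∑ i : Fin (n + 2), β (i, i.succ)) := by
    classical
    have s1 := Finset.sum_filter_add_sum_filter_not Finset.univ
      (fun x : Fin (n + 2) × Fin (n + 3) => (x.2 : ℕ) < x.1) β
    have s2 := Finset.sum_filter_add_sum_filter_not
      (Finset.univ.filter fun x : Fin (n + 2) × Fin (n + 3) => ¬ (x.2 : ℕ) < x.1)
      (fun x : Fin (n + 2) × Fin (n + 3) => (x.1 : ℕ) + 1 < x.2) β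
    have s3 := Finset.sum_filter_add_sum_filter_not
      ((Finset.univ.filter fun x : Fin (n + 2) × Fin (n + 3) => ¬ (x.2 : ℕ) < x.1).filter
        fun x : Fin (n + 2) × Fin (n + 3) => ¬ (x.1 : ℕ) + 1 < x.2)
      (fun x : Fin (n + 2) × Fin (n + 3) => (x.2 : ℕ) = x.1) β
    rw [← s1, ← s2, ← s3, add_assoc]
    congr 1
    · symm
      refine Finset.sum_bij (fun x _ => (x.1.succ, x.2.castSucc)) ?_ ?_ ?_ (fun _ _ => rfl)
      · rintro ⟨i, j⟩ hx
        simp [Fin.lt_def] at hx ⊢; omega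
      · rintro ⟨i, j⟩ _ ⟨i', j'⟩ _ h
        simpa using h
      · rintro ⟨i, j⟩ hx
        simp at hx
        refine ⟨(⟨i - 1, by omega⟩, ⟨j, by omega⟩), by simp [Fin.lt_def]; omega, ?_⟩
        simp [Fin.ext_iff]; omega
    congr 1
    · symm
      refine Finset.sum_bij (fun x _ => (x.1.castSucc, x.2.succ)) ?_ ?_ ?_ (fun _ _ => rfl)
      · rintro ⟨i, j⟩ hx
        simp [Fin.lt_def] at hx ⊢; omega
      · rintro ⟨i, j⟩ _ ⟨i', j'⟩ _ h
        simpa using h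
      · rintro ⟨i, j⟩ hx
        simp at hx
        refine ⟨(⟨i, by omega⟩, ⟨j - 1, by omega⟩), by simp [Fin.lt_def]; omega, ?_⟩
        simp [Fin.ext_iff]; omega
    congr 1
    · symm
      refine Finset.sum_bij (fun i _ => (i, i.castSucc)) ?_ ?_ ?_ (fun _ _ => rfl)
      · intro i _
        simp
      · intro i _ i' _ h
        simpa using h
      · rintro ⟨i, j⟩ hx
        simp at hx
        exact ⟨i, by simp, by simp [Fin.ext_iff]; omega⟩
    · symm
      refine Finset.sum_bij (fun i _ => (i, i.succ)) ?_ ?_ ?_ (fun _ _ => rfl)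
      · intro i _
        simp
      · intro i _ i' _ h
        simpa using h
      · rintro ⟨i, j⟩ hx
        simp at hx
        exact ⟨i, by simp, by simp [Fin.ext_iff]; omega⟩
  -- On the diagonal, `middle` identifies the wall between consecutive pieces of the prism. It
  -- occurs with both signs, so that the sum telescopes to the two ends.
  have diag : (∑ i : Fin (n + 2), β (i, i.castSucc)) + ∑ i : Fin (n + 2), β (i, i.succ) =
      δ 0 (h 0 a) - δ (Fin.last _) (h (Fin.last _) a) := by
    rw [Fin.sum_univ_succ, Fin.sum_univ_castSucc (fun i => β (i, i.succ))]
    have : ∑ i : Fin (n + 1), β (i.castSucc, i.castSucc.succ) =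
        - ∑ i : Fin (n + 1), β (i.succ, i.succ.castSucc) := by
      rw [← Finset.sum_neg_distrib]
      refine Finset.sum_congr rfl fun i _ => ?_
      have := DFunLike.congr_fun (middle i) a
      simp only [AddMonoidHom.comp_apply] at this
      simp only [β]
      rw [← this, Fin.succ_castSucc, ← neg_smul]
      congr 1
      simp only [Fin.val_succ, Fin.val_castSucc]
      ring
    rw [this]
    have l1 : β (0, Fin.castSucc 0) = δ 0 (h 0 a) := by simp [β]
    have l2 : β (Fin.last _, (Fin.last (n + 1)).succ) = - δ (Fin.last _) (h (Fin.last _) a) := by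
      simp only [β, Fin.succ_last, Fin.val_last]
      rw [show n + 1 + (n + 1).succ = 2 * (n + 1) + 1 by omega, pow_succ, pow_mul]
      simp
    rw [l1, l2]
    abel
  -- Off the diagonal, a face of a prism is a prism over a face with one of the two indices shifted
  -- by one. The shift flips the sign, so these terms cancel against `α`.
  have low : ∑ x ∈ Finset.univ.filter (fun x : Fin (n + 1) × Fin (n + 2) =>
      ¬ x.1.castSucc < x.2), β (x.1.succ, x.2.castSucc) = - ∑ x ∈ Finset.univ.filter
      (fun x : Fin (n + 1) × Fin (n + 2) => ¬ x.1.castSucc < x.2), α x := by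
    rw [← Finset.sum_neg_distrib]
    refine Finset.sum_congr rfl fun x hx => ?_
    have := DFunLike.congr_fun (below x.1 x.2 (by simpa using hx)) a
    simp only [AddMonoidHom.comp_apply] at this
    simp only [β, α]
    rw [this, ← neg_smul]
    congr 1
    simp only [Fin.val_succ, Fin.val_castSucc]
    ring
  have high : ∑ x ∈ Finset.univ.filter (fun x : Fin (n + 1) × Fin (n + 2) =>
      x.1.castSucc < x.2), β (x.1.castSucc, x.2.succ) = - ∑ x ∈ Finset.univ.filter
      (fun x : Fin (n + 1) × Fin (n + 2) => x.1.castSucc < x.2), α x := by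
    rw [← Finset.sum_neg_distrib]
    refine Finset.sum_congr rfl fun x hx => ?_
    have := DFunLike.congr_fun (above x.1 x.2 (by simpa using hx)) a
    simp only [AddMonoidHom.comp_apply] at this
    simp only [β, α]
    rw [this, ← neg_smul]
    congr 1
    simp only [Fin.val_succ, Fin.val_castSucc]
    ring
  rw [e1, e2, split, diag, low, high, ← Finset.sum_filter_add_sum_filter_not Finset.univ
    (fun x : Fin (n + 1) × Fin (n + 2) => x.1.castSucc < x.2) α]
  abel

end Alternating

/-! ### Affine maps of simplices -/

theorem convex_simplexSet (k : ℕ) : Convex ℝ (simplexSet k) := by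
  intro x hx y hy a b ha hb hab
  refine ⟨fun i => ?_, ?_⟩
  · have := mul_nonneg ha (hx.1 i)
    have := mul_nonneg hb (hy.1 i)
    simp only [Pi.add_apply, Pi.smul_apply, smul_eq_mul]
    linarith
  · simp only [Pi.add_apply, Pi.smul_apply, smul_eq_mul, Finset.sum_add_distrib, ← Finset.mul_sum]
    nlinarith [hx.2, hy.2]

namespace Simplex

variable {k m n : ℕ}

theorem ext_barycentric {x y : Δ k} (h : ∀ i, barycentric x.1 i = barycentric y.1 i) : x = y :=
  Subtype.ext (funext fun i => by simpa [barycentric] using h i.succ)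

/-- The point with given barycentric coordinates. -/
def ofBarycentric (b : Fin (k + 1) → ℝ) (h0 : ∀ i, 0 ≤ b i) (h1 : ∑ i, b i = 1) : Δ k :=
  ⟨fun i => b i.succ, fun i => h0 _, by rw [Fin.sum_univ_succ] at h1; linarith [h0 0]⟩

@[simp]
theorem barycentric_ofBarycentric (b : Fin (k + 1) → ℝ) (h0 : ∀ i, 0 ≤ b i) (h1 : ∑ i, b i = 1)
    (i : Fin (k + 1)) : barycentric (ofBarycentric b h0 h1).1 i = b i := by
  refine Fin.cases ?_ (fun i => ?_) i
  · rw [Fin.sum_univ_succ] at h1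
    simp only [barycentric, ofBarycentric, Fin.cons_zero]
    linarith
  · simp [barycentric, ofBarycentric]

/-- The `i`-th vertex of the standard simplex. -/
def vertex (i : Fin (k + 1)) : Δ k :=
  ofBarycentric (Pi.single i 1) (fun j => by
    by_cases h : j = i
    · subst h; simp
    · simp [h]) (by simp)

@[simp]
theorem barycentric_vertex (i j : Fin (k + 1)) :
    barycentric (vertex i).1 j = (Pi.single i 1 : Fin (k + 1) → ℝ) j :=
  barycentric_ofBarycentric _ _ _ _

/-- The affine map of simplices with prescribed vertices. -/
def affine (w : Fin (k + 1) → Δ m) (x : Δ k) : Δ m :=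
  ⟨∑ i, barycentric x.1 i • (w i).1, (convex_simplexSet m).sum_mem
    (fun i _ => barycentric_nonneg x i) (sum_barycentric x.1) fun i _ => (w i).2⟩

theorem barycentric_affine (w : Fin (k + 1) → Δ m) (x : Δ k) (j : Fin (m + 1)) :
    barycentric (affine w x).1 j = ∑ i, barycentric x.1 i * barycentric (w i).1 j := by
  refine Fin.cases ?_ (fun j => ?_) j
  · simp only [barycentric, affine, Fin.cons_zero, mul_sub, mul_one, Finset.sum_sub_distrib]
    have := sum_barycentric x.1
    simp only [barycentric] at this
    rw [this]
    congr 1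
    simp only [Finset.sum_apply, Pi.smul_apply, smul_eq_mul, Finset.mul_sum]
    exact Finset.sum_comm
  · simp [barycentric, affine]

@[simp]
theorem affine_vertex (w : Fin (k + 1) → Δ m) (i : Fin (k + 1)) : affine w (vertex i) = w i := by
  refine ext_barycentric fun j => ?_
  simp [barycentric_affine, Pi.single_apply]

theorem affine_comp (w : Fin (m + 1) → Δ n) (v : Fin (k + 1) → Δ m) :
    affine w ∘ affine v = affine (affine w ∘ v) := by
  funext x
  refine ext_barycentric fun j => ?_
  simp only [Function.comp_apply, barycentric_affine, Finset.sum_mul, Finset.mul_sum, mul_assoc]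
  exact Finset.sum_comm

theorem barycentric_simplexFace (j : Fin (k + 2)) (x : Δ k) (i : Fin (k + 2)) :
    barycentric (simplexFace j x).1 i =
      (j.insertNth (0 : ℝ) (barycentric x.1) : Fin (k + 2) → ℝ) i := by
  have hs : ∑ i, (j.insertNth (0 : ℝ) (barycentric x.1) : Fin (k + 2) → ℝ) i = 1 := by
    rw [Fin.sum_univ_succAbove _ j]
    simpa using sum_barycentric x.1
  refine Fin.cases ?_ (fun i => ?_) i
  · rw [Fin.sum_univ_succ] at hs
    simp only [barycentric, simplexFace, Fin.cons_zero] at hs ⊢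
    linarith
  · simp [barycentric, simplexFace]

/-- With faces written as affine maps with prescribed vertices, identities between faces and
subdivision maps become identities between lists of vertices. -/
theorem simplexFace_eq_affine (j : Fin (k + 2)) :
    simplexFace j = affine (fun i : Fin (k + 1) => vertex (j.succAbove i)) := by
  funext x
  refine ext_barycentric fun i => ?_
  rw [barycentric_simplexFace, barycentric_affine]
  refine Fin.succAboveCases j ?_ (fun i => ?_) i
  · simp
  · simp [Pi.single_apply]

theorem affine_comp_simplexFace (w : Fin (k + 2) → Δ m) (j : Fin (k + 2)) :
    affine w ∘ simplexFace j = affine (fun i => w (j.succAbove i)) := by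
  rw [simplexFace_eq_affine, affine_comp]
  congr 1
  funext i
  simp

/-- The cosimplicial identity at the level of indices. It serves both the faces of the standard
simplices and the faces of the nerve. -/
theorem succ_succAbove_succAbove {i j : Fin (n + 2)} (h : i ≤ j) (l : Fin (n + 1)) :
    j.succ.succAbove (i.succAbove l) = i.castSucc.succAbove (j.succAbove l) := by
  simp only [Fin.succAbove, Fin.lt_def, Fin.le_def, Fin.ext_iff] at *
  split_ifs <;> simp at * <;> omega

theorem simplexFace_comp {i j : Fin (k + 2)} (h : i ≤ j) :
    (simplexFace j.succ ∘ simplexFace i : Δ k → Δ (k + 2)) =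
      simplexFace i.castSucc ∘ simplexFace j := by
  rw [simplexFace_eq_affine, simplexFace_eq_affine i.castSucc, affine_comp_simplexFace,
    affine_comp_simplexFace]
  congr 1
  funext l
  rw [succ_succAbove_succAbove h]

end Simplex

/-! ### Push-forward, precomposition and boundary of singular chains. -/

namespace Chain

variable {A B C : Type u} {k m : ℕ}

@[simp]
theorem push_single (f : A → B) (σ : Δ k → A) (n : ℤ) :
    push f (Finsupp.single σ n) = Finsupp.single (f ∘ σ) n :=
  Finsupp.mapDomain_single

theorem push_push (f : A → B) (g : B → C) (c : Chain A k) : push g (push f c) = push (g ∘ f) c :=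
  (Finsupp.mapDomain_comp (f := fun σ : Δ k → A => f ∘ σ) (g := fun σ => g ∘ σ) (v := c)).symm

/-- Precomposition of a chain with a map of simplices. -/
def precomp (τ : Δ m → Δ k) : Chain A k →+ Chain A m :=
  Finsupp.mapDomain.addMonoidHom fun σ => σ ∘ τ

@[simp]
theorem precomp_single (τ : Δ m → Δ k) (σ : Δ k → A) (n : ℤ) :
    precomp τ (Finsupp.single σ n) = Finsupp.single (σ ∘ τ) n :=
  Finsupp.mapDomain_single

theorem d_eq : (d : Chain A (k + 1) →+ Chain A k) =
    ∑ j : Fin (k + 2), (-1 : ℤ) ^ (j : ℕ) • precomp (simplexFace j) := rfl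

theorem d_single (σ : Δ (k + 1) → A) (n : ℤ) : d (Finsupp.single σ n) =
    ∑ j : Fin (k + 2), (-1 : ℤ) ^ (j : ℕ) • Finsupp.single (σ ∘ simplexFace j) n := by
  simp [d_eq, AddMonoidHom.finsetSum_apply]

theorem precomp_push (τ : Δ m → Δ k) (f : A → B) (c : Chain A k) :
    precomp τ (push f c) = push f (precomp τ c) := by
  refine DFunLike.congr_fun (f := (precomp τ).comp (push f)) (g := (push f).comp (precomp τ)) ?_ c
  exact Finsupp.addHom_ext fun σ n => by simp; rfl

theorem d_push (f : A → B) (c : Chain A (k + 1)) : d (push f c) = push f (d c) := by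
  simp only [d_eq, AddMonoidHom.finsetSum_apply, AddMonoidHom.smul_apply, map_sum, map_zsmul,
    precomp_push]

theorem d_d (c : Chain A (k + 2)) : d (d c) = 0 := by
  refine alternatingSum_comp_eq_zero _ _ (fun i j h => ?_) c
  refine Finsupp.addHom_ext fun σ n => ?_
  have := Simplex.simplexFace_comp h
  simp [Function.comp_assoc, this]

end Chain

/-! ### Barycentric subdivision -/

namespace Simplex

variable {k m n : ℕ}

/-- The barycentre of the vertices `π j, …, π k`. -/
def sdVertex (π : Equiv.Perm (Fin (k + 1))) (j : Fin (k + 1)) : Δ k :=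
  ofBarycentric (fun i => if j ≤ π.symm i then ((k + 1 - j : ℕ) : ℝ)⁻¹ else 0)
    (fun i => by split_ifs <;> positivity) (by
      rw [← Equiv.sum_comp π]
      simp only [Equiv.symm_apply_apply]
      rw [← Finset.sum_filter, Finset.sum_const, nsmul_eq_mul,
        show Finset.univ.filter (fun i => j ≤ i) = Finset.Ici j by ext; simp, Fin.card_Ici]
      rw [mul_inv_cancel₀]
      have := j.2
      exact_mod_cast (by omega : k + 1 - (j : ℕ) ≠ 0))

theorem barycentric_sdVertex (π : Equiv.Perm (Fin (k + 1))) (j i : Fin (k + 1)) :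
    barycentric (sdVertex π j).1 i = if j ≤ π.symm i then ((k + 1 - j : ℕ) : ℝ)⁻¹ else 0 :=
  barycentric_ofBarycentric _ _ _ _

/-- The simplex of the barycentric subdivision which belongs to the ordering `π` of the vertices. -/
def sdMap (π : Equiv.Perm (Fin (k + 1))) : Δ k → Δ k := affine (sdVertex π)

/-- The permutation of `Fin (k + 2)` with `0 ↦ i` and `j + 1 ↦ i.succAbove (π j)`. -/
def consPerm (i : Fin (k + 1)) (π : Equiv.Perm (Fin k)) : Equiv.Perm (Fin (k + 1)) :=
  (Equiv.Perm.decomposeFin.symm (0, π)).trans i.cycleRange.symm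

@[simp]
theorem consPerm_zero (i : Fin (k + 1)) (π : Equiv.Perm (Fin k)) : consPerm i π 0 = i := by
  simp [consPerm, Equiv.Perm.decomposeFin_symm_apply_zero]

@[simp]
theorem consPerm_succ (i : Fin (k + 1)) (π : Equiv.Perm (Fin k)) (j : Fin k) :
    consPerm i π j.succ = i.succAbove (π j) := by
  simp [consPerm, Equiv.Perm.decomposeFin_symm_apply_succ]

theorem sign_consPerm (i : Fin (k + 1)) (π : Equiv.Perm (Fin k)) :
    ((consPerm i π).sign : ℤ) = (-1) ^ (i : ℕ) * (π.sign : ℤ) := by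
  simp [consPerm, Equiv.Perm.sign_trans, Equiv.Perm.decomposeFin.symm_sign, Fin.sign_cycleRange]

theorem consPerm_bijective :
    Function.Bijective fun p : Fin (k + 1) × Equiv.Perm (Fin k) => consPerm p.1 p.2 := by
  rw [Fintype.bijective_iff_injective_and_card]
  refine ⟨?_, by simp [Fintype.card_perm, Nat.factorial_succ]⟩
  rintro ⟨i, π⟩ ⟨i', π'⟩ h
  have h0 : i = i' := by simpa using DFunLike.congr_fun h 0
  subst h0
  refine Prod.ext rfl (Equiv.ext fun j => ?_)
  simpa using DFunLike.congr_fun h j.succ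

theorem simplexFace_sdVertex (i : Fin (k + 2)) (π : Equiv.Perm (Fin (k + 1))) (j : Fin (k + 1)) :
    simplexFace i (sdVertex π j) = sdVertex (consPerm i π) j.succ := by
  refine ext_barycentric fun l => ?_
  rw [barycentric_simplexFace, barycentric_sdVertex]
  refine Fin.succAboveCases i ?_ (fun l => ?_) l
  · have : (consPerm i π).symm i = 0 := by rw [Equiv.symm_apply_eq]; simp
    simp [this]
  · have : (consPerm i π).symm (i.succAbove l) = (π.symm l).succ := by
      rw [Equiv.symm_apply_eq]; simp
    simp [this, barycentric_sdVertex]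

/-- The `i`-th vertex depends only on the set `{π i, …, π k}`, which a swap of the values at `j` and
`j + 1` can alter only for `i = j + 1`. -/
theorem sdVertex_mul_swap (π : Equiv.Perm (Fin (k + 2))) (j : Fin (k + 1)) (i : Fin (k + 2))
    (hi : i ≠ j.succ) : sdVertex (π * Equiv.swap j.castSucc j.succ) i = sdVertex π i := by
  refine ext_barycentric fun l => ?_
  rw [barycentric_sdVertex, barycentric_sdVertex]
  have : (π * Equiv.swap j.castSucc j.succ).symm l = Equiv.swap j.castSucc j.succ (π.symm l) := by
    rw [Equiv.symm_apply_eq]; simp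
  rw [this]
  congr 1
  rw [eq_iff_iff]
  rcases eq_or_ne (π.symm l) j.castSucc with h | h
  · rw [h, Equiv.swap_apply_left]
    simp [Fin.le_def, Fin.ext_iff] at hi ⊢; omega
  rcases eq_or_ne (π.symm l) j.succ with h' | h'
  · rw [h', Equiv.swap_apply_right]
    simp [Fin.le_def, Fin.ext_iff] at hi ⊢; omega
  rw [Equiv.swap_apply_of_ne_of_ne h h']

end Simplex

namespace Chain

variable {A B : Type u} {k m : ℕ}

/-- Barycentric subdivision of chains. -/
def sd : Chain A k →+ Chain A k :=
  ∑ π : Equiv.Perm (Fin (k + 1)), (π.sign : ℤ) • precomp (Simplex.sdMap π)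

theorem sd_single (σ : Δ k → A) (n : ℤ) : sd (Finsupp.single σ n) =
    ∑ π : Equiv.Perm (Fin (k + 1)), (π.sign : ℤ) • Finsupp.single (σ ∘ Simplex.sdMap π) n := by
  simp [sd, AddMonoidHom.finsetSum_apply]

theorem sd_push (f : A → B) (c : Chain A k) : sd (push f c) = push f (sd c) := by
  simp only [sd, AddMonoidHom.finsetSum_apply, AddMonoidHom.smul_apply, map_sum, map_zsmul,
    precomp_push]

/-- A face opposite to a vertex `j + 1` is interior: it is shared by the pieces of `π` and of `π`
precomposed with the swap of `j` and `j + 1`, which have opposite signs. The faces opposite to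
vertex `0`, the barycentre, make up the subdivided boundary: the orderings starting with `i`
subdivide the `i`-th face, and moving `i` to the front produces the sign `(-1)^i` of that face. -/
theorem d_sd (c : Chain A (k + 1)) : d (sd c) = sd (d c) := by
  refine DFunLike.congr_fun (f := d.comp sd) (g := sd.comp d) (Finsupp.addHom_ext fun σ n => ?_) c
  simp only [AddMonoidHom.comp_apply, sd_single, d_single, map_sum, map_zsmul]
  simp only [Finset.smul_sum]
  rw [Finset.sum_comm, Fin.sum_univ_succ]
  have h0 : ∑ j : Fin (k + 1), ∑ π : Equiv.Perm (Fin (k + 2)), (π.sign : ℤ) • (-1 : ℤ) ^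
      (j.succ : ℕ) • Finsupp.single ((σ ∘ Simplex.sdMap π) ∘ simplexFace j.succ) n = 0 := by
    refine Finset.sum_eq_zero fun j _ => ?_
    refine Finset.sum_ninvolution (fun π => π * Equiv.swap j.castSucc j.succ) ?_ ?_ ?_ ?_
    · intro π
      have : Simplex.sdMap (π * Equiv.swap j.castSucc j.succ) ∘ simplexFace j.succ =
          Simplex.sdMap π ∘ simplexFace j.succ := by
        rw [Simplex.sdMap, Simplex.sdMap, Simplex.affine_comp_simplexFace,
          Simplex.affine_comp_simplexFace]
        congr 1
        funext i
        exact Simplex.sdVertex_mul_swap _ _ _ (Fin.succAbove_ne _ _)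
      rw [Function.comp_assoc, Function.comp_assoc, this, ← add_smul]
      simp [Equiv.Perm.sign_swap (Fin.castSucc_lt_succ (i := j)).ne]
    · intro π _ h
      have := DFunLike.congr_fun h j.castSucc
      simp only [Equiv.Perm.mul_apply, Equiv.swap_apply_left, EmbeddingLike.apply_eq_iff_eq] at this
      exact (Fin.castSucc_lt_succ (i := j)).ne' this
    · simp
    · intro π
      rw [mul_assoc, Equiv.swap_mul_self, mul_one]
  rw [h0, add_zero, ← Simplex.consPerm_bijective.sum_comp, Fintype.sum_prod_type]
  refine Finset.sum_congr rfl fun i _ => Finset.sum_congr rfl fun π _ => ?_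
  have : Simplex.sdMap (Simplex.consPerm i π) ∘ simplexFace 0 =
      simplexFace i ∘ Simplex.sdMap π := by
    rw [Simplex.sdMap, Simplex.sdMap, Simplex.affine_comp_simplexFace,
      Simplex.simplexFace_eq_affine i, Simplex.affine_comp, ← Simplex.simplexFace_eq_affine]
    congr 1
    funext j
    simp [Simplex.simplexFace_sdVertex]
  simp only [Function.comp_assoc, this, Simplex.sign_consPerm]
  simp [mul_smul]

end Chain

/-! ### Piecewise smooth chains -/

/-- Composites of simplices with affine maps are simplices. -/
class LawfulSimplices (A : Type u) [HasSimplices A] : Prop where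
  comp_affine : ∀ {k m : ℕ} {σ : Δ m → A} (w : Fin (k + 1) → Δ m), HasSimplices.IsSimplex σ →
    HasSimplices.IsSimplex (σ ∘ Simplex.affine w)

instance {A B : Type u} [HasSimplices A] [HasSimplices B] [LawfulSimplices A] [LawfulSimplices B] :
    LawfulSimplices (A × B) :=
  ⟨fun w h => ⟨LawfulSimplices.comp_affine w h.1, LawfulSimplices.comp_affine w h.2⟩⟩

instance {A : Type u} [HasSimplices A] [LawfulSimplices A] (P : A → Prop) :
    LawfulSimplices {a // P a} :=
  ⟨fun w h => LawfulSimplices.comp_affine (A := A) w h⟩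

/-- `f` maps simplices to simplices. -/
def MapsSimplices {A B : Type u} [HasSimplices A] [HasSimplices B] (f : A → B) : Prop :=
  ∀ {k : ℕ} {σ : Δ k → A}, HasSimplices.IsSimplex σ → HasSimplices.IsSimplex fun x => f (σ x)

namespace Chain

variable {A B : Type u} [HasSimplices A] [HasSimplices B] {k m : ℕ}

namespace IsSmoothChain

theorem zero : (0 : Chain A k).IsSmoothChain := fun σ h => by simp at h

theorem add {c c' : Chain A k} (h : c.IsSmoothChain) (h' : c'.IsSmoothChain) :
    (c + c').IsSmoothChain := fun σ hσ => by
  classical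
  rcases Finset.mem_union.1 (Finsupp.support_add hσ) with h1 | h1
  exacts [h σ h1, h' σ h1]

theorem neg {c : Chain A k} (h : c.IsSmoothChain) : (-c).IsSmoothChain := fun σ hσ =>
  h σ (by simpa using hσ)

theorem sub {c c' : Chain A k} (h : c.IsSmoothChain) (h' : c'.IsSmoothChain) :
    (c - c').IsSmoothChain := by
  rw [sub_eq_add_neg]; exact h.add h'.neg

theorem zsmul {c : Chain A k} (h : c.IsSmoothChain) (n : ℤ) : (n • c).IsSmoothChain :=
  fun σ hσ => h σ (Finsupp.support_smul hσ)

theorem sum {ι : Type*} (s : Finset ι) {c : ι → Chain A k} (h : ∀ i ∈ s, (c i).IsSmoothChain) :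
    (∑ i ∈ s, c i).IsSmoothChain := by
  classical
  induction s using Finset.induction_on with
  | empty => exact zero
  | insert a s ha ih =>
    rw [Finset.sum_insert ha]
    exact (h a (by simp)).add (ih fun i hi => h i (by simp [hi]))

theorem single {σ : Δ k → A} (h : HasSimplices.IsSimplex σ) (n : ℤ) :
    IsSmoothChain (Finsupp.single σ n : Chain A k) := fun τ hτ => by
  have := Finsupp.support_single_subset hτ
  simp at this
  rwa [this]

theorem map {c : Chain A k} (h : c.IsSmoothChain) (f : Chain A k →+ Chain B m)
    (hf : ∀ σ : Δ k → A, HasSimplices.IsSimplex σ →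
      ∀ n : ℤ, (f (Finsupp.single σ n)).IsSmoothChain) :
    (f c).IsSmoothChain := by
  rw [← Finsupp.sum_single c, Finsupp.sum, map_sum]
  exact sum _ fun σ hσ => hf σ (h σ hσ) _

theorem push {c : Chain A k} (h : c.IsSmoothChain) {f : A → B} (hf : MapsSimplices f) :
    (Chain.push f c).IsSmoothChain :=
  h.map _ fun σ hσ n => by rw [push_single]; exact single (hf hσ) n

theorem precomp_affine [LawfulSimplices A] {c : Chain A k} (h : c.IsSmoothChain)
    (w : Fin (m + 1) → Δ k) : (Chain.precomp (Simplex.affine w) c).IsSmoothChain :=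
  h.map _ fun σ hσ n => by rw [precomp_single]; exact single (LawfulSimplices.comp_affine w hσ) n

theorem d [LawfulSimplices A] {c : Chain A (k + 1)} (h : c.IsSmoothChain) :
    (Chain.d c).IsSmoothChain := by
  rw [d_eq, AddMonoidHom.finsetSum_apply]
  refine sum _ fun j _ => ?_
  rw [AddMonoidHom.smul_apply, Simplex.simplexFace_eq_affine]
  exact (h.precomp_affine _).zsmul _

theorem sd [LawfulSimplices A] {c : Chain A k} (h : c.IsSmoothChain) :
    (Chain.sd c).IsSmoothChain := by
  rw [Chain.sd, AddMonoidHom.finsetSum_apply]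
  refine sum _ fun j _ => ?_
  rw [AddMonoidHom.smul_apply]
  exact (h.precomp_affine _).zsmul _

end IsSmoothChain

end Chain

/-! ### The nerve in terms of coherent families of arrows -/

namespace SetGroupoid

variable {A O A' O' : Type u} (𝒢 : SetGroupoid A O) {p : ℕ}

theorem eq_one_of_mul_self {g : A} (h : 𝒢.t g = 𝒢.s g) (h' : 𝒢.mul g g = g) :
    g = 𝒢.one (𝒢.s g) := by
  have h1 := 𝒢.mul_assoc g g (𝒢.inv g) h (𝒢.s_inv g).symm
  rw [h', 𝒢.mul_inv] at h1
  rw [h1]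
  conv_lhs => rw [← 𝒢.mul_one g]
  rw [h]

theorem eq_inv_of_mul {g g' : A} (h : 𝒢.t g = 𝒢.s g') (h' : 𝒢.mul g g' = 𝒢.one (𝒢.s g)) :
    g' = 𝒢.inv g := by
  have h1 := 𝒢.mul_assoc (𝒢.inv g) g g' (𝒢.t_inv g) h
  rw [h', 𝒢.inv_mul, h, 𝒢.one_mul, ← 𝒢.t_inv, 𝒢.mul_one] at h1
  exact h1

/-- A family of arrows `c i j` from `j` to `i` which is compatible with composition. -/
def IsCoherent {ι : Type*} (c : ι → ι → A) : Prop :=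
  ∀ i j l, 𝒢.t (c i j) = 𝒢.s (c j l) ∧ 𝒢.mul (c i j) (c j l) = c i l

variable {𝒢}

namespace IsCoherent

variable {ι κ : Type*} {c c' : ι → ι → A}

theorem comp (h : 𝒢.IsCoherent c) (f : κ → ι) : 𝒢.IsCoherent fun i j => c (f i) (f j) :=
  fun _ _ _ => h _ _ _

theorem s_eq (h : 𝒢.IsCoherent c) (i j l : ι) : 𝒢.s (c i j) = 𝒢.s (c i l) := by
  rw [← (h i j l).2, 𝒢.s_mul _ _ (h i j l).1]

theorem t_eq (h : 𝒢.IsCoherent c) (i j : ι) : 𝒢.t (c i j) = 𝒢.s (c j j) := (h i j j).1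

theorem self_eq (h : 𝒢.IsCoherent c) (i : ι) : c i i = 𝒢.one (𝒢.s (c i i)) :=
  𝒢.eq_one_of_mul_self (h i i i).1 (h i i i).2

theorem inv_eq (h : 𝒢.IsCoherent c) (i j : ι) : 𝒢.inv (c i j) = c j i :=
  (𝒢.eq_inv_of_mul (h i j i).1 (by rw [(h i j i).2, h.self_eq, h.s_eq i i j])).symm

theorem ext_of_base (h : 𝒢.IsCoherent c) (h' : 𝒢.IsCoherent c') (i₀ : ι)
    (e : ∀ i, c i i₀ = c' i i₀) : c = c' := by
  funext i j
  rw [← (h i i₀ j).2, ← (h' i i₀ j).2, ← h.inv_eq j, ← h'.inv_eq j, e i, e j]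

/-- All arrows of a coherent family are composites of consecutive ones and their inverses. The
object at `0` has to be given as well, since for `p = 0` there are no consecutive arrows. -/
theorem ext_fin {c c' : Fin (p + 1) → Fin (p + 1) → A} (h : 𝒢.IsCoherent c)
    (h' : 𝒢.IsCoherent c') (e0 : 𝒢.s (c 0 0) = 𝒢.s (c' 0 0))
    (e : ∀ i : Fin p, c i.succ i.castSucc = c' i.succ i.castSucc) : c = c' := by
  refine h.ext_of_base h' 0 fun i => ?_
  induction i using Fin.induction with
  | zero => rw [h.self_eq, h'.self_eq, e0]
  | succ i ih => rw [← (h i.succ i.castSucc 0).2, ← (h' i.succ i.castSucc 0).2, e, ih]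

end IsCoherent

variable (𝒢)

/-- The element of the nerve determined by a coherent family. -/
def ofCoherent : {p : ℕ} → (c : Fin (p + 1) → Fin (p + 1) → A) → 𝒢.IsCoherent c → 𝒢.Nerve p
  | 0, c, _ => 𝒢.s (c 0 0)
  | _ + 1, c, h => ⟨fun i => c i.succ i.castSucc, fun i => (h i.succ.succ i.succ.castSucc _).1⟩

/-- The composites `a_i ⋯ a_0` of the arrows of a string. -/
def stringArr {p : ℕ} (a : 𝒢.Strings p) : Fin (p + 2) → A :=
  Fin.induction (𝒢.one (𝒢.t (a.1 0))) fun i g => 𝒢.mul (a.1 i) g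

/-- The composite from the `j`-th to the `i`-th object of an element of the nerve. -/
def arr : {p : ℕ} → 𝒢.Nerve p → Fin (p + 1) → Fin (p + 1) → A
  | 0, x, _, _ => 𝒢.one x
  | _ + 1, a, i, j => 𝒢.mul (𝒢.stringArr a i) (𝒢.inv (𝒢.stringArr a j))

variable {𝒢}

theorem stringArr_succ (a : 𝒢.Strings p) (i : Fin (p + 1)) :
    𝒢.stringArr a i.succ = 𝒢.mul (a.1 i) (𝒢.stringArr a i.castSucc) := rfl

theorem s_t_stringArr (a : 𝒢.Strings p) (i : Fin (p + 1)) :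
    𝒢.s (𝒢.stringArr a i.castSucc) = 𝒢.t (a.1 i) ∧
      𝒢.t (𝒢.stringArr a i.castSucc) = 𝒢.t (a.1 0) := by
  induction i using Fin.induction with
  | zero => exact ⟨𝒢.s_one _, 𝒢.t_one _⟩
  | succ i ih =>
    rw [← Fin.succ_castSucc, stringArr_succ, 𝒢.s_mul _ _ ih.1.symm, 𝒢.t_mul _ _ ih.1.symm]
    exact ⟨(a.2 i).symm, ih.2⟩

theorem t_stringArr (a : 𝒢.Strings p) (i : Fin (p + 2)) :
    𝒢.t (𝒢.stringArr a i) = 𝒢.t (a.1 0) := by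
  refine Fin.cases (𝒢.t_one _) (fun i => ?_) i
  rw [stringArr_succ, 𝒢.t_mul _ _ (s_t_stringArr a i).1.symm, (s_t_stringArr a i).2]

theorem isCoherent_mul_inv {ι : Type*} {u : ι → A} {x : O} (h : ∀ i, 𝒢.t (u i) = x) :
    𝒢.IsCoherent fun i j => 𝒢.mul (u i) (𝒢.inv (u j)) := by
  intro i j l
  have h1 : ∀ i j, 𝒢.t (u i) = 𝒢.s (𝒢.inv (u j)) := fun i j => by rw [𝒢.s_inv, h, h]
  have h2 : 𝒢.t (𝒢.inv (u j)) = 𝒢.s (𝒢.mul (u j) (𝒢.inv (u l))) := by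
    rw [𝒢.t_inv, 𝒢.s_mul _ _ (h1 _ _)]
  refine ⟨by rw [𝒢.t_mul _ _ (h1 _ _), h2], ?_⟩
  rw [𝒢.mul_assoc _ _ _ (h1 _ _) h2, ← 𝒢.mul_assoc _ _ _ (𝒢.t_inv _) (h1 _ _), 𝒢.inv_mul, h1 j l,
    𝒢.one_mul]

theorem isCoherent_arr : {p : ℕ} → (a : 𝒢.Nerve p) → 𝒢.IsCoherent (𝒢.arr a)
  | 0, x => fun i j l => by
    have h1 : 𝒢.mul (𝒢.one x) (𝒢.one x) = 𝒢.one x := by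
      simpa only [𝒢.t_one x] using 𝒢.mul_one (𝒢.one x)
    exact ⟨(𝒢.t_one x).trans (𝒢.s_one x).symm, h1⟩
  | _ + 1, a => isCoherent_mul_inv (t_stringArr a)

theorem mul_stringArr_inv (a : 𝒢.Strings p) (i : Fin (p + 1)) :
    𝒢.mul (𝒢.stringArr a i.succ) (𝒢.inv (𝒢.stringArr a i.castSucc)) = a.1 i := by
  rw [stringArr_succ, 𝒢.mul_assoc _ _ _ (s_t_stringArr a i).1.symm (𝒢.s_inv _).symm, 𝒢.mul_inv,
    (s_t_stringArr a i).1, 𝒢.mul_one]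

theorem ofCoherent_arr : {p : ℕ} → (a : 𝒢.Nerve p) → 𝒢.ofCoherent (𝒢.arr a) (isCoherent_arr a) = a
  | 0, x => 𝒢.s_one x
  | _ + 1, a => Subtype.ext (funext fun i => mul_stringArr_inv a i)

theorem arr_ofCoherent : {p : ℕ} → (c : Fin (p + 1) → Fin (p + 1) → A) → (h : 𝒢.IsCoherent c) →
    𝒢.arr (𝒢.ofCoherent c h) = c
  | 0, c, h => by
    refine (isCoherent_arr _).ext_fin h ?_ fun i => i.elim0
    exact 𝒢.s_one _
  | p + 1, c, h => by
    refine (isCoherent_arr _).ext_fin h ?_ fun i => mul_stringArr_inv _ i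
    have h1 : 𝒢.s (𝒢.arr (𝒢.ofCoherent c h) 0 0) = 𝒢.t (c (Fin.succ 0) (Fin.castSucc 0)) := by
      rw [← (isCoherent_arr (𝒢.ofCoherent c h)).t_eq (Fin.succ 0) 0]
      exact congrArg 𝒢.t (mul_stringArr_inv _ 0)
    rw [h1]
    exact h.t_eq _ _

theorem nerve_ext {a b : 𝒢.Nerve p} (h : 𝒢.arr a = 𝒢.arr b) : a = b := by
  rw [← ofCoherent_arr a, ← ofCoherent_arr b]
  congr 1

/-- The purpose of coherent families: composing two arrows and dropping an end arrow both become the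
omission of an index. The simplicial identities and the compatibility with homomorphisms then follow
without case distinctions. -/
theorem face_ofCoherent : (p : ℕ) → (i : Fin (p + 2)) → (c : Fin (p + 2) → Fin (p + 2) → A) →
    (h : 𝒢.IsCoherent c) → 𝒢.face p i (𝒢.ofCoherent c h) =
      𝒢.ofCoherent (fun j l => c (i.succAbove j) (i.succAbove l)) (h.comp _)
  | 0, i, c, h => by
    have hi : i = 0 ∨ i = 1 := by fin_cases i <;> simp
    rcases hi with rfl | rfl
    · exact h.s_eq _ _ _
    · exact h.t_eq _ _
  | p + 1, i, c, h => by
    refine Subtype.ext (funext fun l => ?_)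
    refine Fin.cases ?_ (fun j => ?_) i
    · rfl
    · change Fin.contractNth j (fun x y => 𝒢.mul y x)
        (fun i : Fin (p + 2) => c i.succ i.castSucc) l = c (j.succ.succAbove l.succ)
          (j.succ.succAbove l.castSucc)
      simp only [Fin.contractNth]
      split_ifs with h1 h2
      · congr 1 <;> simp [Fin.succAbove, Fin.ext_iff, Fin.lt_def] <;> grind
      · rw [show l.succ.castSucc = l.castSucc.succ from rfl, (h _ _ _).2]
        congr 1 <;> simp [Fin.succAbove, Fin.ext_iff, Fin.lt_def] <;> grind
      · congr 1 <;> simp [Fin.succAbove, Fin.ext_iff, Fin.lt_def] <;> grind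

theorem arr_face (i : Fin (p + 2)) (a : 𝒢.Nerve (p + 1)) (j l : Fin (p + 1)) :
    𝒢.arr (𝒢.face p i a) j l = 𝒢.arr a (i.succAbove j) (i.succAbove l) := by
  conv_lhs => rw [← ofCoherent_arr a]
  rw [face_ofCoherent, arr_ofCoherent]

/-- The `i`-th object of an element of the nerve. -/
def obj (a : 𝒢.Nerve p) (i : Fin (p + 1)) : O := 𝒢.s (𝒢.arr a i i)

theorem s_arr (a : 𝒢.Nerve p) (i j : Fin (p + 1)) : 𝒢.s (𝒢.arr a i j) = obj a i :=
  (isCoherent_arr a).s_eq _ _ _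

theorem t_arr (a : 𝒢.Nerve p) (i j : Fin (p + 1)) : 𝒢.t (𝒢.arr a i j) = obj a j :=
  (isCoherent_arr a).t_eq _ _

theorem obj_face (i : Fin (p + 2)) (a : 𝒢.Nerve (p + 1)) (j : Fin (p + 1)) :
    obj (𝒢.face p i a) j = obj a (i.succAbove j) := by
  rw [obj, obj, arr_face]

theorem face_face {i j : Fin (p + 2)} (h : i ≤ j) (a : 𝒢.Nerve (p + 2)) :
    𝒢.face p i (𝒢.face (p + 1) j.succ a) = 𝒢.face p j (𝒢.face (p + 1) i.castSucc a) := by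
  refine nerve_ext (funext fun l => funext fun m => ?_)
  simp only [arr_face, Simplex.succ_succAbove_succAbove h]

namespace Hom

variable {𝒢' : SetGroupoid A' O'} (φ : Hom 𝒢 𝒢')

theorem isCoherent {ι : Type*} {c : ι → ι → A} (h : 𝒢.IsCoherent c) :
    𝒢'.IsCoherent fun i j => φ.onArr (c i j) := fun i j l => by
  rw [φ.map_t, φ.map_s, (h i j l).1, ← φ.map_mul _ _ (h i j l).1, (h i j l).2]
  exact ⟨rfl, rfl⟩

theorem nerve_ofCoherent : {p : ℕ} → (c : Fin (p + 1) → Fin (p + 1) → A) → (h : 𝒢.IsCoherent c) →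
    φ.nerve p (𝒢.ofCoherent c h) = 𝒢'.ofCoherent _ (φ.isCoherent h)
  | 0, c, _ => (φ.map_s (c 0 0)).symm
  | _ + 1, _, _ => rfl

theorem arr_nerve (a : 𝒢.Nerve p) (i j : Fin (p + 1)) :
    𝒢'.arr (φ.nerve p a) i j = φ.onArr (𝒢.arr a i j) := by
  conv_lhs => rw [← ofCoherent_arr a]
  rw [nerve_ofCoherent, arr_ofCoherent]

theorem obj_nerve (a : 𝒢.Nerve p) (i : Fin (p + 1)) :
    SetGroupoid.obj (φ.nerve p a) i = φ.onObj (SetGroupoid.obj a i) := by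
  rw [SetGroupoid.obj, arr_nerve, φ.map_s, SetGroupoid.obj]

theorem face_nerve (i : Fin (p + 2)) (a : 𝒢.Nerve (p + 1)) :
    𝒢'.face p i (φ.nerve (p + 1) a) = φ.nerve p (𝒢.face p i a) := by
  refine nerve_ext (funext fun l => funext fun m => ?_)
  simp only [arr_face, arr_nerve]

end Hom

/-! ### Piecewise smooth simplices of the nerve -/

/-- The structure maps of the groupoid map simplices to simplices. -/
class SmoothOps [HasSimplices A] [HasSimplices O] (𝒢 : SetGroupoid A O) : Prop where
  s : MapsSimplices 𝒢.s
  t : MapsSimplices 𝒢.t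
  one : MapsSimplices 𝒢.one
  inv : MapsSimplices 𝒢.inv
  mul : ∀ {k : ℕ} {σ τ : Δ k → A}, HasSimplices.IsSimplex σ → HasSimplices.IsSimplex τ →
    (∀ x, 𝒢.t (σ x) = 𝒢.s (τ x)) → HasSimplices.IsSimplex fun x => 𝒢.mul (σ x) (τ x)

section Simplices

variable [HasSimplices A] [HasSimplices O] [𝒢.SmoothOps]

theorem isSimplex_stringArr {k : ℕ} {σ : Δ k → 𝒢.Strings p} (h : HasSimplices.IsSimplex σ)
    (i : Fin (p + 2)) : HasSimplices.IsSimplex fun x => 𝒢.stringArr (σ x) i := by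
  have h' : ∀ i, HasSimplices.IsSimplex fun x => (σ x).1 i := h
  induction i using Fin.induction with
  | zero => exact SmoothOps.one (SmoothOps.t (h' 0))
  | succ i ih => exact SmoothOps.mul (h' i) ih fun x => (s_t_stringArr (σ x) i).1.symm

/-- Composites of a string arise from its arrows by the smooth structure maps. Conversely, the
arrows of the string are particular composites, or, for `p = 0`, the object is the source of its
unit. -/
theorem isSimplex_nerve_iff : {p : ℕ} → {k : ℕ} → {σ : Δ k → 𝒢.Nerve p} →
    (HasSimplices.IsSimplex σ ↔ ∀ i j, HasSimplices.IsSimplex fun x => 𝒢.arr (σ x) i j)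
  | 0, k, σ => by
    refine ⟨fun h _ _ => SmoothOps.one (A := A) (O := O) (𝒢 := 𝒢) (σ := σ) h, fun h => ?_⟩
    have h1 := SmoothOps.s (𝒢 := 𝒢) (h 0 0)
    have h2 : (fun x => 𝒢.s (𝒢.arr (σ x) 0 0)) = σ := funext fun x => 𝒢.s_one _
    rw [h2] at h1
    exact h1
  | p + 1, k, σ => by
    constructor
    · intro h i j
      refine SmoothOps.mul (isSimplex_stringArr h i) (SmoothOps.inv (isSimplex_stringArr h j)) ?_
      intro x
      exact (t_stringArr (𝒢 := 𝒢) _ i).trans ((t_stringArr _ j).symm.trans (𝒢.s_inv _).symm)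
    · intro h i
      refine Eq.mp ?_ (h i.succ i.castSucc)
      congr 1
      funext x
      exact mul_stringArr_inv _ i

theorem mapsSimplices_face (i : Fin (p + 2)) : MapsSimplices (𝒢.face p i) := by
  intro k σ h
  rw [isSimplex_nerve_iff] at h ⊢
  intro j l
  simp only [arr_face]
  exact h _ _

theorem mapsSimplices_obj (i : Fin (p + 1)) :
    MapsSimplices (fun a : 𝒢.Nerve p => SetGroupoid.obj a i) := by
  intro k σ h
  rw [isSimplex_nerve_iff] at h
  exact SmoothOps.s (h i i)

instance [LawfulSimplices A] (p : ℕ) : LawfulSimplices (𝒢.Nerve p) := ⟨fun w h => by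
  rw [isSimplex_nerve_iff] at h ⊢
  exact fun i j => LawfulSimplices.comp_affine w (h i j)⟩

theorem Hom.mapsSimplices_nerve [HasSimplices A'] [HasSimplices O'] {𝒢' : SetGroupoid A' O'}
    [𝒢'.SmoothOps] (φ : Hom 𝒢 𝒢') (h : MapsSimplices φ.onArr) (p : ℕ) :
    MapsSimplices (φ.nerve p) := by
  intro k σ hσ
  rw [isSimplex_nerve_iff] at hσ ⊢
  intro i j
  simp only [φ.arr_nerve]
  exact h (hσ i j)

end Simplices

/-! ### The double complex -/

theorem bd_bd (k p : ℕ) (c : Chain (𝒢.Nerve (p + 2)) k) : 𝒢.bd k p (𝒢.bd k (p + 1) c) = 0 := by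
  refine alternatingSum_comp_eq_zero (fun i => Chain.push (𝒢.face (p + 1) i))
    (fun i => Chain.push (𝒢.face p i)) (fun i j h => ?_) c
  refine Finsupp.addHom_ext fun σ n => ?_
  simp only [AddMonoidHom.comp_apply, Chain.push_single]
  congr 1
  funext x
  exact face_face h (σ x)

theorem d_bd (k p : ℕ) (c : Chain (𝒢.Nerve (p + 1)) (k + 1)) :
    Chain.d (𝒢.bd (k + 1) p c) = 𝒢.bd k p (Chain.d c) := by
  simp only [bd, AddMonoidHom.finsetSum_apply, AddMonoidHom.smul_apply, map_sum, map_zsmul,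
    Chain.d_push]

theorem totalBd_add (D D' : 𝒢.DoubleChain) :
    𝒢.totalBd (D + D') = 𝒢.totalBd D + 𝒢.totalBd D' := by
  funext k p
  simp only [totalBd, Pi.add_apply, map_add, smul_add]
  abel

theorem totalBd_neg (D : 𝒢.DoubleChain) : 𝒢.totalBd (-D) = -𝒢.totalBd D := by
  funext k p
  simp only [totalBd, Pi.neg_apply, map_neg, smul_neg]
  abel

theorem totalBd_sub (D D' : 𝒢.DoubleChain) :
    𝒢.totalBd (D - D') = 𝒢.totalBd D - 𝒢.totalBd D' := by
  rw [sub_eq_add_neg, totalBd_add, totalBd_neg, sub_eq_add_neg]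

theorem totalBd_totalBd (D : 𝒢.DoubleChain) : 𝒢.totalBd (𝒢.totalBd D) = 0 := by
  funext k p
  simp only [totalBd, map_add, map_zsmul, Chain.d_d, bd_bd, d_bd, smul_zero, zero_add, add_zero,
    Pi.zero_apply, pow_succ]
  simp

/-- Barycentric subdivision of the components of a double chain. -/
def sd (D : 𝒢.DoubleChain) : 𝒢.DoubleChain := fun k p => Chain.sd (D k p)

theorem sd_totalBd (D : 𝒢.DoubleChain) : sd (𝒢.totalBd D) = 𝒢.totalBd (sd D) := by
  funext k p
  simp only [sd, totalBd, bd, map_add, map_zsmul, Chain.d_sd, AddMonoidHom.finsetSum_apply, map_sum,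
    AddMonoidHom.smul_apply, Chain.sd_push]

namespace Hom

variable {𝒢' : SetGroupoid A' O'} (φ : Hom 𝒢 𝒢')

theorem push_sub (D D' : 𝒢.DoubleChain) : φ.push (D - D') = φ.push D - φ.push D' := by
  funext k p
  exact map_sub (Chain.push (φ.nerve p)) _ _

theorem push_sd (D : 𝒢.DoubleChain) : φ.push (SetGroupoid.sd D) = SetGroupoid.sd (φ.push D) := by
  funext k p
  exact (Chain.sd_push _ _).symm

theorem push_bd (k p : ℕ) (c : Chain (𝒢.Nerve (p + 1)) k) :
    Chain.push (φ.nerve p) (𝒢.bd k p c) = 𝒢'.bd k p (Chain.push (φ.nerve (p + 1)) c) := by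
  simp only [bd, AddMonoidHom.finsetSum_apply, AddMonoidHom.smul_apply, map_sum, map_zsmul,
    Chain.push_push]
  refine Finset.sum_congr rfl fun i _ => ?_
  congr 2
  have : φ.nerve p ∘ 𝒢.face p i = 𝒢'.face p i ∘ φ.nerve (p + 1) :=
    funext fun a => (φ.face_nerve i a).symm
  rw [this]

theorem push_totalBd (D : 𝒢.DoubleChain) : φ.push (𝒢.totalBd D) = 𝒢'.totalBd (φ.push D) := by
  funext k p
  simp only [push, totalBd, map_add, map_zsmul, push_bd, Chain.d_push]

end Hom

theorem IsChain.sub [HasSimplices A] [HasSimplices O] {n : ℕ} {D D' : 𝒢.DoubleChain}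
    (h : 𝒢.IsChain n D) (h' : 𝒢.IsChain n D') :
    𝒢.IsChain n (D - D') := fun k p =>
  ⟨fun hn => by simp [(h k p).1 hn, (h' k p).1 hn], (h k p).2.sub (h' k p).2⟩

section Smooth

variable [HasSimplices A] [HasSimplices O] [𝒢.SmoothOps] {n : ℕ}

theorem isSmoothChain_bd {k p : ℕ} {c : Chain (𝒢.Nerve (p + 1)) k} (h : c.IsSmoothChain) :
    (𝒢.bd k p c).IsSmoothChain := by
  rw [bd, AddMonoidHom.finsetSum_apply]
  refine Chain.IsSmoothChain.sum _ fun i _ => ?_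
  rw [AddMonoidHom.smul_apply]
  exact (h.push (mapsSimplices_face i)).zsmul _

variable [HasSimplices A'] [HasSimplices O'] {𝒢' : SetGroupoid A' O'} [𝒢'.SmoothOps]

theorem IsChain.push (φ : Hom 𝒢 𝒢') (hφ : MapsSimplices φ.onArr) {D : 𝒢.DoubleChain}
    (h : 𝒢.IsChain n D) : 𝒢'.IsChain n (φ.push D) := fun k p =>
  ⟨fun hn => by simp [Hom.push, (h k p).1 hn], (h k p).2.push (φ.mapsSimplices_nerve hφ p)⟩

theorem IsCycle.push (φ : Hom 𝒢 𝒢') (hφ : MapsSimplices φ.onArr) {C : 𝒢.DoubleChain}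
    (h : 𝒢.IsCycle n C) : 𝒢'.IsCycle n (φ.push C) :=
  ⟨h.1.push φ hφ, by
    rw [← φ.push_totalBd, h.2]
    funext k p
    exact map_zero _⟩

variable [LawfulSimplices A]

theorem IsChain.totalBd {D : 𝒢.DoubleChain} (h : 𝒢.IsChain (n + 1) D) :
    𝒢.IsChain n (𝒢.totalBd D) := fun k p => by
  refine ⟨fun hn => ?_, ((h _ _).2.d.zsmul _).add (isSmoothChain_bd (h _ _).2)⟩
  rw [SetGroupoid.totalBd, (h (k + 1) p).1 (by omega), (h k (p + 1)).1 (by omega)]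
  simp

theorem IsChain.sd {D : 𝒢.DoubleChain} (h : 𝒢.IsChain n D) : 𝒢.IsChain n (SetGroupoid.sd D) :=
  fun k p => ⟨fun hn => by simp [SetGroupoid.sd, (h k p).1 hn], (h k p).2.sd⟩

theorem IsCycle.sd {C : 𝒢.DoubleChain} (h : 𝒢.IsCycle n C) : 𝒢.IsCycle n (SetGroupoid.sd C) :=
  ⟨h.1.sd, by
    rw [← sd_totalBd, h.2]
    funext k p
    exact map_zero _⟩

end Smooth

end SetGroupoid

theorem val_predAbove {n : ℕ} (i : Fin n) (l : Fin (n + 1)) :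
    (i.predAbove l : ℕ) = if (i : ℕ) < l then (l : ℕ) - 1 else l := by
  simp only [Fin.predAbove, Fin.lt_def, Fin.val_castSucc]
  split_ifs <;> simp

theorem val_succAbove {n : ℕ} (j : Fin (n + 1)) (l : Fin n) :
    (j.succAbove l : ℕ) = if (l : ℕ) < j then (l : ℕ) else l + 1 := by
  simp only [Fin.succAbove, Fin.lt_def, Fin.val_castSucc]
  split_ifs <;> simp

/-- Applied with `f` the projection of simplices of the nerve along a homomorphism: an operation
which sees only the projected simplex vanishes on the kernel of the projection. -/
theorem mapDomain_eq_zero_of_factorsThrough {α β γ : Type*} {f : α → β} {g : α → γ}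
    (h : g.FactorsThrough f) {z : α →₀ ℤ} (hz : z.mapDomain f = 0) : z.mapDomain g = 0 := by
  rcases isEmpty_or_nonempty γ with hγ | ⟨⟨c⟩⟩
  · exact Subsingleton.elim _ _
  · have : g = Function.extend f g (fun _ => c) ∘ f := funext fun x => (h.extend_apply _ x).symm
    rw [this, Finsupp.mapDomain_comp, hz, Finsupp.mapDomain_zero]

/-! ### Cartesian homomorphisms and the normalization of simplices of objects. -/

namespace SetGroupoid

variable {A O A' O' : Type u} {𝒢 : SetGroupoid A O} {𝒦 : SetGroupoid A' O'}

/-- The homomorphism `φ` identifies `𝒦` with the pull-back of `𝒢` along the map of objects: an arrow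
`lift γ y' y` over `γ` is determined by its source `y'` and its target `y`. -/
structure Hom.Cartesian [HasSimplices A] [HasSimplices A'] [HasSimplices O'] (φ : Hom 𝒦 𝒢) where
  lift : A → O' → O' → A'
  s_lift : ∀ γ y' y, 𝒢.s γ = φ.onObj y' → 𝒢.t γ = φ.onObj y → 𝒦.s (lift γ y' y) = y'
  t_lift : ∀ γ y' y, 𝒢.s γ = φ.onObj y' → 𝒢.t γ = φ.onObj y → 𝒦.t (lift γ y' y) = y
  map_lift : ∀ γ y' y, 𝒢.s γ = φ.onObj y' → 𝒢.t γ = φ.onObj y → φ.onArr (lift γ y' y) = γ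
  unique : ∀ a b, 𝒦.s a = 𝒦.s b → 𝒦.t a = 𝒦.t b → φ.onArr a = φ.onArr b → a = b
  mapsSimplices : MapsSimplices φ.onArr
  isSimplex_lift : ∀ {k : ℕ} {σ : Δ k → A} {τ' τ : Δ k → O'}, HasSimplices.IsSimplex σ →
    HasSimplices.IsSimplex τ' → HasSimplices.IsSimplex τ → (∀ x, 𝒢.s (σ x) = φ.onObj (τ' x)) →
    (∀ x, 𝒢.t (σ x) = φ.onObj (τ x)) → HasSimplices.IsSimplex fun x => lift (σ x) (τ' x) (τ x)

namespace Hom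

/-- The simplex `m` of objects is the image of a simplex of objects. -/
def Liftable [HasSimplices O'] (φ : Hom 𝒦 𝒢) {k : ℕ} (m : Δ k → O) : Prop :=
  ∃ y : Δ k → O', HasSimplices.IsSimplex y ∧ ∀ x, φ.onObj (y x) = m x

open Classical in
/-- A lift of a map of a simplex to the space of objects, which is a simplex if possible. -/
def chosenLift [HasSimplices O'] (φ : Hom 𝒦 𝒢) {k : ℕ} (m : Δ k → O)
    (h : ∃ y : Δ k → O', ∀ x, φ.onObj (y x) = m x) : Δ k → O' :=
  if h' : φ.Liftable m then h'.choose else h.choose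

theorem chosenLift_spec [HasSimplices O'] (φ : Hom 𝒦 𝒢) {k : ℕ} (m : Δ k → O)
    (h : ∃ y : Δ k → O', ∀ x, φ.onObj (y x) = m x) (x : Δ k) :
    φ.onObj (φ.chosenLift m h x) = m x := by
  rw [chosenLift]
  split_ifs with h'
  exacts [h'.choose_spec.2 x, h.choose_spec x]

theorem isSimplex_chosenLift [HasSimplices O'] (φ : Hom 𝒦 𝒢) {k : ℕ} (m : Δ k → O)
    (h : ∃ y : Δ k → O', ∀ x, φ.onObj (y x) = m x) (h' : φ.Liftable m) :
    HasSimplices.IsSimplex (φ.chosenLift m h) := by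
  rw [chosenLift, dif_pos h']
  exact h'.choose_spec.1

/-- The chosen map with the same image in the objects of `𝒢`. -/
def normalize [HasSimplices O'] (φ : Hom 𝒦 𝒢) {k : ℕ} (y : Δ k → O') : Δ k → O' :=
  φ.chosenLift (fun x => φ.onObj (y x)) ⟨y, fun _ => rfl⟩

theorem onObj_normalize [HasSimplices O'] (φ : Hom 𝒦 𝒢) {k : ℕ} (y : Δ k → O') (x : Δ k) :
    φ.onObj (φ.normalize y x) = φ.onObj (y x) := φ.chosenLift_spec _ _ x

theorem isSimplex_normalize [HasSimplices O'] (φ : Hom 𝒦 𝒢) {k : ℕ} {y : Δ k → O'}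
    (h : HasSimplices.IsSimplex y) : HasSimplices.IsSimplex (φ.normalize y) :=
  φ.isSimplex_chosenLift _ _ ⟨y, h, fun _ => rfl⟩

/-- The choice is made from the projected map alone; `y` enters only as a proof that some lift
exists. -/
theorem normalize_congr [HasSimplices O'] (φ : Hom 𝒦 𝒢) {k : ℕ} {y y' : Δ k → O'}
    (h : ∀ x, φ.onObj (y x) = φ.onObj (y' x)) : φ.normalize y = φ.normalize y' := by
  have key : ∀ (m m' : Δ k → O) (_ : m = m') (p : ∃ y : Δ k → O', ∀ x, φ.onObj (y x) = m x)
      (p' : ∃ y : Δ k → O', ∀ x, φ.onObj (y x) = m' x), φ.chosenLift m p = φ.chosenLift m' p' := by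
    rintro m _ rfl _ _
    rfl
  exact key _ _ (funext h) _ _

end Hom

namespace Hom.Cartesian

variable [HasSimplices A] [HasSimplices A'] [HasSimplices O'] {φ : Hom 𝒦 𝒢} (L : φ.Cartesian)

theorem nerve_ext (L : φ.Cartesian) {p : ℕ} {a b : 𝒦.Nerve p} (h : φ.nerve p a = φ.nerve p b)
    (h' : ∀ i, SetGroupoid.obj a i = SetGroupoid.obj b i) : a = b := by
  refine SetGroupoid.nerve_ext (funext fun i => funext fun j => L.unique _ _ ?_ ?_ ?_)
  · rw [s_arr, s_arr, h']
  · rw [t_arr, t_arr, h']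
  · rw [← φ.arr_nerve, ← φ.arr_nerve, h]

theorem isCoherent_lift {ι : Type*} {c : ι → ι → A} (h : 𝒢.IsCoherent c) {y : ι → O'}
    (hy : ∀ i, φ.onObj (y i) = 𝒢.s (c i i)) :
    𝒦.IsCoherent fun i j => L.lift (c i j) (y i) (y j) := by
  have hs : ∀ i j, 𝒢.s (c i j) = φ.onObj (y i) := fun i j => by rw [hy, h.s_eq]
  have ht : ∀ i j, 𝒢.t (c i j) = φ.onObj (y j) := fun i j => by rw [hy, h.t_eq]
  intro i j l
  have e : 𝒦.t (L.lift (c i j) (y i) (y j)) = 𝒦.s (L.lift (c j l) (y j) (y l)) := by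
    rw [L.t_lift _ _ _ (hs _ _) (ht _ _), L.s_lift _ _ _ (hs _ _) (ht _ _)]
  refine ⟨e, L.unique _ _ ?_ ?_ ?_⟩
  · rw [𝒦.s_mul _ _ e, L.s_lift _ _ _ (hs _ _) (ht _ _), L.s_lift _ _ _ (hs _ _) (ht _ _)]
  · rw [𝒦.t_mul _ _ e, L.t_lift _ _ _ (hs _ _) (ht _ _), L.t_lift _ _ _ (hs _ _) (ht _ _)]
  · rw [φ.map_mul _ _ e, L.map_lift _ _ _ (hs _ _) (ht _ _), L.map_lift _ _ _ (hs _ _) (ht _ _),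
      L.map_lift _ _ _ (hs _ _) (ht _ _), (h i j l).2]

/-- The element of the nerve over `γ`, reindexed along `e`, with given objects. -/
def liftNerve {p q : ℕ} (γ : 𝒢.Nerve p) (e : Fin (q + 1) → Fin (p + 1)) (y : Fin (q + 1) → O')
    (hy : ∀ i, φ.onObj (y i) = SetGroupoid.obj γ (e i)) : 𝒦.Nerve q :=
  𝒦.ofCoherent _ (L.isCoherent_lift ((isCoherent_arr γ).comp e) hy)

variable {p q : ℕ} (γ : 𝒢.Nerve p) (e : Fin (q + 1) → Fin (p + 1)) (y : Fin (q + 1) → O')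
    (hy : ∀ i, φ.onObj (y i) = SetGroupoid.obj γ (e i))

theorem arr_liftNerve (i j : Fin (q + 1)) :
    𝒦.arr (L.liftNerve γ e y hy) i j = L.lift (𝒢.arr γ (e i) (e j)) (y i) (y j) := by
  rw [liftNerve, arr_ofCoherent]

theorem obj_liftNerve (i : Fin (q + 1)) : SetGroupoid.obj (L.liftNerve γ e y hy) i = y i := by
  rw [SetGroupoid.obj, arr_liftNerve, L.s_lift _ _ _ (by rw [s_arr, hy]) (by rw [t_arr, hy])]

theorem arr_map_liftNerve (i j : Fin (q + 1)) :
    𝒢.arr (φ.nerve q (L.liftNerve γ e y hy)) i j = 𝒢.arr γ (e i) (e j) := by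
  rw [φ.arr_nerve, arr_liftNerve, L.map_lift _ _ _ (by rw [s_arr, hy]) (by rw [t_arr, hy])]

theorem exists_lift_simplex (L : φ.Cartesian) [HasSimplices O] [𝒢.SmoothOps] [𝒦.SmoothOps] {k : ℕ}
    {σ : Δ k → 𝒢.Nerve p} (hσ : HasSimplices.IsSimplex σ)
    (h : ∀ i, φ.Liftable fun x => SetGroupoid.obj (σ x) i) :
    ∃ τ : Δ k → 𝒦.Nerve p, HasSimplices.IsSimplex τ ∧ φ.nerve p ∘ τ = σ := by
  choose y hy h' using h
  refine ⟨fun x => L.liftNerve (σ x) id (fun i => y i x) fun i => h' i x, ?_, ?_⟩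
  · rw [isSimplex_nerve_iff] at hσ ⊢
    intro i j
    simp only [arr_liftNerve]
    refine L.isSimplex_lift (hσ i j) (hy i) (hy j) (fun x => ?_) fun x => ?_
    · rw [h', s_arr]; rfl
    · rw [h', t_arr]; rfl
  · funext x
    refine SetGroupoid.nerve_ext (funext fun i => funext fun j => ?_)
    exact L.arr_map_liftNerve _ _ _ _ i j

/-! #### The homotopy -/

/-- The prism over a simplex of the nerve, between the simplex and its normalization: the objects
after the `i`-th one are normalized. -/
def prism {k p : ℕ} (i : Fin (p + 1)) (σ : Δ k → 𝒦.Nerve p) : Δ k → 𝒦.Nerve (p + 1) := fun x =>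
  L.liftNerve (φ.nerve p (σ x)) i.predAbove
    (fun l => if l ≤ i.castSucc then SetGroupoid.obj (σ x) (i.predAbove l)
      else φ.normalize (fun x => SetGroupoid.obj (σ x) (i.predAbove l)) x) (fun l => by
        split_ifs
        · rw [φ.obj_nerve]
        · rw [φ.obj_nerve, φ.onObj_normalize])

theorem arr_map_prism {k p : ℕ} (i : Fin (p + 1)) (σ : Δ k → 𝒦.Nerve p) (x : Δ k)
    (l m : Fin (p + 2)) : 𝒢.arr (φ.nerve (p + 1) (L.prism i σ x)) l m =
      𝒢.arr (φ.nerve p (σ x)) (i.predAbove l) (i.predAbove m) :=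
  L.arr_map_liftNerve _ _ _ _ l m

theorem obj_prism {k p : ℕ} (i : Fin (p + 1)) (σ : Δ k → 𝒦.Nerve p) (x : Δ k) (l : Fin (p + 2)) :
    SetGroupoid.obj (L.prism i σ x) l =
      if l ≤ i.castSucc then SetGroupoid.obj (σ x) (i.predAbove l)
        else φ.normalize (fun x => SetGroupoid.obj (σ x) (i.predAbove l)) x :=
  L.obj_liftNerve _ _ _ _ l

/-- A common form of the prism identities, stated for the two data which by `nerve_ext` determine an
element of the nerve: its image and its objects. For the outer faces, `τ` is a face of `σ` and `f`
is the identity; for the middle faces, `τ = σ`, `g` is the identity and `f` omits an index. -/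
theorem face_prism_eq {k p q : ℕ} {i : Fin (p + 1)} {j : Fin (p + 2)} {σ : Δ k → 𝒦.Nerve p}
    {i' : Fin (q + 1)} {τ : Δ k → 𝒦.Nerve q} (g : Fin (q + 1) → Fin (p + 1))
    (f : Fin (p + 1) → Fin (q + 2))
    (hτ : ∀ x l m, 𝒦.arr (τ x) l m = 𝒦.arr (σ x) (g l) (g m))
    (h : ∀ l, i.predAbove (j.succAbove l) = g (i'.predAbove (f l)))
    (h' : ∀ l, j.succAbove l ≤ i.castSucc ↔ f l ≤ i'.castSucc) (x : Δ k) (l m : Fin (p + 1)) :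
    𝒢.arr (φ.nerve p (𝒦.face p j (L.prism i σ x))) l m =
      𝒢.arr (φ.nerve (q + 1) (L.prism i' τ x)) (f l) (f m) ∧
    SetGroupoid.obj (𝒦.face p j (L.prism i σ x)) l =
      SetGroupoid.obj (L.prism i' τ x) (f l) := by
  constructor
  · rw [← φ.face_nerve, arr_face, arr_map_prism, arr_map_prism, φ.arr_nerve, φ.arr_nerve, hτ, h, h]
  · rw [obj_face, obj_prism, obj_prism, h]
    simp only [h', SetGroupoid.obj, hτ]

theorem face_prism_below {k p : ℕ} (i : Fin (p + 1)) (j : Fin (p + 2)) (hij : j ≤ i.castSucc)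
    (σ : Δ k → 𝒦.Nerve (p + 1)) :
    𝒦.face (p + 1) j.castSucc ∘ L.prism i.succ σ = L.prism i (𝒦.face p j ∘ σ) := by
  funext x
  have hij' : (j : ℕ) ≤ i := hij
  clear hij
  have := L.face_prism_eq (i := i.succ) (j := j.castSucc) (σ := σ) (i' := i)
    (τ := 𝒦.face p j ∘ σ) j.succAbove id (fun x l m => arr_face _ _ _ _)
    (fun l => Fin.ext (by
      simp only [val_predAbove, val_succAbove, Fin.val_succ, Fin.val_castSucc, id]
      split_ifs <;> omega))
    (fun l => by
      simp only [Fin.le_def, val_succAbove, Fin.val_succ, Fin.val_castSucc, id]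
      split_ifs <;> omega)
    x
  exact L.nerve_ext (SetGroupoid.nerve_ext (funext fun l => funext fun m => (this l m).1))
    fun l => (this l l).2

theorem face_prism_above {k p : ℕ} (i : Fin (p + 1)) (j : Fin (p + 2)) (hij : i.castSucc < j)
    (σ : Δ k → 𝒦.Nerve (p + 1)) :
    𝒦.face (p + 1) j.succ ∘ L.prism i.castSucc σ = L.prism i (𝒦.face p j ∘ σ) := by
  funext x
  have hij' : (i : ℕ) < j := hij
  clear hij
  have := L.face_prism_eq (i := i.castSucc) (j := j.succ) (σ := σ) (i' := i)
    (τ := 𝒦.face p j ∘ σ) j.succAbove id (fun x l m => arr_face _ _ _ _)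
    (fun l => Fin.ext (by
      simp only [val_predAbove, val_succAbove, Fin.val_succ, Fin.val_castSucc, id]
      split_ifs <;> omega))
    (fun l => by
      simp only [Fin.le_def, val_succAbove, Fin.val_succ, Fin.val_castSucc, id]
      split_ifs <;> omega)
    x
  exact L.nerve_ext (SetGroupoid.nerve_ext (funext fun l => funext fun m => (this l m).1))
    fun l => (this l l).2

theorem face_prism_middle {k p : ℕ} (i : Fin (p + 1)) (σ : Δ k → 𝒦.Nerve (p + 1)) :
    𝒦.face (p + 1) i.castSucc.succ ∘ L.prism i.succ σ =
      𝒦.face (p + 1) i.castSucc.succ ∘ L.prism i.castSucc σ := by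
  funext x
  have := L.face_prism_eq (i := i.succ) (j := i.castSucc.succ) (σ := σ) (i' := i.castSucc) (τ := σ)
    id (i.castSucc.succ).succAbove (fun x l m => rfl)
    (fun l => Fin.ext (by
      simp only [val_predAbove, val_succAbove, Fin.val_succ, Fin.val_castSucc, id]
      split_ifs <;> omega))
    (fun l => by
      simp only [Fin.le_def, val_succAbove, Fin.val_succ, Fin.val_castSucc]
      split_ifs <;> omega)
    x
  refine L.nerve_ext (SetGroupoid.nerve_ext (funext fun l => funext fun m => ?_)) fun l => ?_
  · refine (this l m).1.trans ?_
    rw [Function.comp_apply, ← φ.face_nerve, arr_face]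
  · refine (this l l).2.trans ?_
    rw [Function.comp_apply, obj_face]

theorem face_last_prism {k p : ℕ} (σ : Δ k → 𝒦.Nerve p) :
    𝒦.face p (Fin.last _) ∘ L.prism (Fin.last _) σ = σ := by
  funext x
  refine L.nerve_ext (SetGroupoid.nerve_ext (funext fun l => funext fun m => ?_)) fun l => ?_
  · rw [Function.comp_apply, ← φ.face_nerve, arr_face, arr_map_prism]
    simp
  · rw [Function.comp_apply, obj_face, obj_prism]
    simp [Fin.le_def]
    omega

/-- The normalization of a simplex depends only on its image. -/
theorem face_zero_prism_factorsThrough (k p : ℕ) :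
    (fun σ : Δ k → 𝒦.Nerve p => 𝒦.face p 0 ∘ L.prism 0 σ).FactorsThrough
      fun σ => φ.nerve p ∘ σ := by
  intro σ τ h
  funext x
  have hx : ∀ x, φ.nerve p (σ x) = φ.nerve p (τ x) := fun x => congrFun h x
  refine L.nerve_ext (SetGroupoid.nerve_ext (funext fun l => funext fun m => ?_)) fun l => ?_
  · simp only [Function.comp_apply, ← φ.face_nerve, arr_face, arr_map_prism, hx]
  · simp only [Function.comp_apply, obj_face, obj_prism]
    rw [if_neg (by simp), if_neg (by simp)]
    refine congrFun (φ.normalize_congr fun x => ?_) x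
    rw [← φ.obj_nerve, ← φ.obj_nerve, hx]

theorem prism_factorsThrough {k p : ℕ} (i : Fin (p + 1)) :
    (fun σ : Δ k → 𝒦.Nerve p => φ.nerve (p + 1) ∘ L.prism i σ).FactorsThrough
      fun σ => φ.nerve p ∘ σ := by
  intro σ τ h
  funext x
  have hx : φ.nerve p (σ x) = φ.nerve p (τ x) := congrFun h x
  refine SetGroupoid.nerve_ext (funext fun l => funext fun m => ?_)
  simp only [Function.comp_apply, arr_map_prism, hx]

theorem isSimplex_prism [HasSimplices O] [𝒢.SmoothOps] [𝒦.SmoothOps] {k p : ℕ} (i : Fin (p + 1))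
    {σ : Δ k → 𝒦.Nerve p} (h : HasSimplices.IsSimplex σ) :
    HasSimplices.IsSimplex (L.prism i σ) := by
  have hobj : ∀ l : Fin (p + 2), HasSimplices.IsSimplex fun x =>
      if l ≤ i.castSucc then SetGroupoid.obj (σ x) (i.predAbove l)
        else φ.normalize (fun x => SetGroupoid.obj (σ x) (i.predAbove l)) x := by
    intro l
    have := mapsSimplices_obj (𝒢 := 𝒦) (i.predAbove l) h
    split_ifs
    · exact this
    · exact φ.isSimplex_normalize this
  have hσ := h
  rw [isSimplex_nerve_iff] at hσ ⊢
  intro l m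
  simp only [prism, arr_liftNerve, φ.arr_nerve]
  refine L.isSimplex_lift (L.mapsSimplices (hσ _ _)) (hobj l) (hobj m) (fun x => ?_) fun x => ?_
  · rw [φ.map_s, s_arr]
    split_ifs
    · rfl
    · rw [φ.onObj_normalize]
  · rw [φ.map_t, t_arr]
    split_ifs
    · rfl
    · rw [φ.onObj_normalize]

/-- The chain homotopy between the identity and the normalization. -/
def homotopy (k p : ℕ) : Chain (𝒦.Nerve p) k →+ Chain (𝒦.Nerve (p + 1)) k :=
  ∑ i : Fin (p + 1), (-1 : ℤ) ^ (i : ℕ) • Finsupp.mapDomain.addMonoidHom (L.prism i)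

/-- The image of a prism is a degeneracy of the image of the simplex, so it depends on nothing else.
The homotopy therefore stays inside the kernel of `φ_*`. -/
theorem push_homotopy {k p : ℕ} {z : Chain (𝒦.Nerve p) k} (hz : Chain.push (φ.nerve p) z = 0) :
    Chain.push (φ.nerve (p + 1)) (L.homotopy k p z) = 0 := by
  rw [homotopy, AddMonoidHom.finsetSum_apply, map_sum]
  refine Finset.sum_eq_zero fun i _ => ?_
  rw [AddMonoidHom.smul_apply, map_zsmul]
  have := mapDomain_eq_zero_of_factorsThrough (L.prism_factorsThrough i) hz
  have h2 : Chain.push (φ.nerve (p + 1)) (Finsupp.mapDomain.addMonoidHom (L.prism i) z) = 0 := by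
    rw [← this]
    exact (Finsupp.mapDomain_comp (f := L.prism i) (g := fun σ => φ.nerve (p + 1) ∘ σ)).symm
  rw [h2, smul_zero]

theorem isSmoothChain_homotopy [HasSimplices O] [𝒢.SmoothOps] [𝒦.SmoothOps] {k p : ℕ}
    {z : Chain (𝒦.Nerve p) k} (hz : z.IsSmoothChain) : (L.homotopy k p z).IsSmoothChain := by
  rw [homotopy, AddMonoidHom.finsetSum_apply]
  refine Chain.IsSmoothChain.sum _ fun i _ => ?_
  rw [AddMonoidHom.smul_apply]
  refine Chain.IsSmoothChain.zsmul (hz.map _ fun σ hσ n => ?_) _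
  have : Finsupp.mapDomain.addMonoidHom (L.prism i) (Finsupp.single σ n) =
      Finsupp.single (L.prism i σ) n := Finsupp.mapDomain_single
  rw [this]
  exact Chain.IsSmoothChain.single (L.isSimplex_prism i hσ) n

theorem push_face_prism {k p : ℕ} (j : Fin (p + 2)) (i : Fin (p + 1)) (z : Chain (𝒦.Nerve p) k) :
    Chain.push (𝒦.face p j) (Finsupp.mapDomain.addMonoidHom (L.prism i) z) =
      Finsupp.mapDomain (fun σ => 𝒦.face p j ∘ L.prism i σ) z :=
  (Finsupp.mapDomain_comp (f := L.prism i) (g := fun σ => 𝒦.face p j ∘ σ)).symm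

/-- One end of the prism is the fully normalized simplex, which sees only the image and so
contributes nothing on the kernel. The other end is the simplex itself. -/
theorem prism_boundary {k p : ℕ} {z : Chain (𝒦.Nerve p) k} (hz : Chain.push (φ.nerve p) z = 0) :
    Chain.push (𝒦.face p 0) (Finsupp.mapDomain.addMonoidHom (L.prism 0) z) -
      Chain.push (𝒦.face p (Fin.last _)) (Finsupp.mapDomain.addMonoidHom (L.prism (Fin.last _)) z) =
      -z := by
  rw [push_face_prism, push_face_prism,
    mapDomain_eq_zero_of_factorsThrough (L.face_zero_prism_factorsThrough k p) hz, zero_sub]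
  congr 1
  simp only [face_last_prism]
  exact Finsupp.mapDomain_id

theorem bd_homotopy_zero {k : ℕ} {z : Chain (𝒦.Nerve 0) k} (hz : Chain.push (φ.nerve 0) z = 0) :
    𝒦.bd k 0 (L.homotopy k 0 z) = -z := by
  rw [← L.prism_boundary hz]
  simp [bd, homotopy, Fin.sum_univ_succ, sub_eq_add_neg]

theorem bd_homotopy_succ {k p : ℕ} {z : Chain (𝒦.Nerve (p + 1)) k}
    (hz : Chain.push (φ.nerve (p + 1)) z = 0) :
    𝒦.bd k (p + 1) (L.homotopy k (p + 1) z) + L.homotopy k p (𝒦.bd k p z) = -z := by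
  rw [← L.prism_boundary hz]
  refine prism_alternatingSum (fun j => Chain.push (𝒦.face p j))
    (fun i => Finsupp.mapDomain.addMonoidHom (L.prism i))
    (fun i => Finsupp.mapDomain.addMonoidHom (L.prism i))
    (fun j => Chain.push (𝒦.face (p + 1) j)) ?_ ?_ ?_ z
  · intro i j hij
    refine Finsupp.addHom_ext fun σ n => ?_
    have := L.face_prism_below i j hij σ
    simp [this]
  · intro i
    refine Finsupp.addHom_ext fun σ n => ?_
    have := L.face_prism_middle i σ
    simp [this]
  · intro i j hij
    refine Finsupp.addHom_ext fun σ n => ?_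
    have := L.face_prism_above i j hij σ
    simp [this]

/-- The homotopy on the double complex. -/
def totalHomotopy (z : 𝒦.DoubleChain) : 𝒦.DoubleChain
  | _, 0 => 0
  | k, p + 1 => L.homotopy k p (z k p)

/-! ### Lifting chains along Cartesian homomorphisms; acyclicity of the kernel. -/

section Smooth

variable [HasSimplices O] [𝒢.SmoothOps] [𝒦.SmoothOps]

/-- All objects which occur in the components of the double chain are liftable. -/
def _root_.PreQuasi.SetGroupoid.Hom.IsLiftable (φ : Hom 𝒦 𝒢) (D : 𝒢.DoubleChain) : Prop :=
  ∀ k p, ∀ σ ∈ (D k p).support, ∀ i, φ.Liftable fun x => SetGroupoid.obj (σ x) i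

theorem exists_lift_chain (L : φ.Cartesian) {k p : ℕ} {c : Chain (𝒢.Nerve p) k}
    (hc : c.IsSmoothChain) (h : ∀ σ ∈ c.support, ∀ i, φ.Liftable fun x => SetGroupoid.obj (σ x) i) :
    ∃ c' : Chain (𝒦.Nerve p) k, c'.IsSmoothChain ∧ Chain.push (φ.nerve p) c' = c := by
  choose τ hτ hτ' using fun σ : c.support =>
    L.exists_lift_simplex (hc σ.1 σ.2) (h σ.1 σ.2)
  refine ⟨∑ σ : c.support, Finsupp.single (τ σ) (c σ.1),
    Chain.IsSmoothChain.sum _ fun σ _ => Chain.IsSmoothChain.single (hτ σ) _, ?_⟩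
  rw [map_sum]
  simp only [Chain.push_single, hτ']
  rw [Finset.sum_coe_sort c.support fun σ => Finsupp.single σ (c σ)]
  exact c.sum_single

theorem exists_lift_doubleChain (L : φ.Cartesian) {n : ℕ} {D : 𝒢.DoubleChain}
    (hD : 𝒢.IsChain n D) (h : φ.IsLiftable D) : ∃ D', 𝒦.IsChain n D' ∧ φ.push D' = D := by
  have : ∀ k p, ∃ c' : Chain (𝒦.Nerve p) k, (k + p ≠ n → c' = 0) ∧ c'.IsSmoothChain ∧
      Chain.push (φ.nerve p) c' = D k p := by
    intro k p
    by_cases hn : k + p = n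
    · obtain ⟨c', h1, h2⟩ := L.exists_lift_chain (hD k p).2 (h k p)
      exact ⟨c', fun h => absurd hn h, h1, h2⟩
    · exact ⟨0, fun _ => rfl, Chain.IsSmoothChain.zero, by rw [(hD k p).1 hn, map_zero]⟩
  choose D' h1 h2 h3 using this
  exact ⟨D', fun k p => ⟨h1 k p, h2 k p⟩, funext fun k => funext fun p => h3 k p⟩

variable [LawfulSimplices A']

/-- The kernel of `φ_*` on the total complex is acyclic. -/
theorem exists_totalBd_eq (L : φ.Cartesian) {n : ℕ} (m : ℕ) :
    ∀ {z : 𝒦.DoubleChain}, 𝒦.IsChain n z → φ.push z = 0 →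
    𝒦.totalBd z = 0 → (∀ k p, m ≤ k → z k p = 0) →
    ∃ w, 𝒦.IsChain (n + 1) w ∧ φ.push w = 0 ∧ 𝒦.totalBd w = z := by
  induction m with
  | zero =>
    intro z _ _ _ h
    have hz : z = 0 := funext fun k => funext fun p => h k p (Nat.zero_le _)
    refine ⟨0, fun k p => ⟨fun _ => rfl, Chain.IsSmoothChain.zero⟩, ?_, ?_⟩
    · funext k p; exact map_zero _
    · rw [hz]; funext k p; simp [totalBd]
  | succ m ih =>
    intro z hz h0 h1 h2
    have g0 : ∀ k p, Chain.push (φ.nerve p) (z k p) = 0 := fun k p =>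
      congrFun (congrFun h0 k) p
    have hw : 𝒦.IsChain (n + 1) (L.totalHomotopy z) := by
      rintro k (_ | p)
      · exact ⟨fun _ => rfl, Chain.IsSmoothChain.zero⟩
      · refine ⟨fun hn => ?_, L.isSmoothChain_homotopy (hz k p).2⟩
        rw [totalHomotopy, (hz k p).1 (by omega), map_zero]
    have hw0 : φ.push (L.totalHomotopy z) = 0 := by
      funext k p
      cases p with
      | zero => exact map_zero _
      | succ p => exact L.push_homotopy (g0 k p)
    -- The homotopy satisfies `∂h + h∂ = -1`, so that adding `δ(h z)` to `z` removes the components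
    -- of the highest simplicial degree `k = m`. The result has one fewer possible value of `k`, and
    -- the induction hypothesis applies.
    have hz' : 𝒦.IsChain n (z - -𝒦.totalBd (L.totalHomotopy z)) := by
      refine hz.sub fun k p => ⟨fun hn => ?_, (hw.totalBd k p).2.neg⟩
      simp [(hw.totalBd k p).1 hn]
    obtain ⟨w, hw1, hw2, hw3⟩ := ih hz' (by
        have : φ.push (-𝒦.totalBd (L.totalHomotopy z)) = -φ.push (𝒦.totalBd (L.totalHomotopy z)) :=
          funext fun k => funext fun p => map_neg (Chain.push (φ.nerve p)) _
        rw [φ.push_sub, h0, this, φ.push_totalBd, hw0]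
        funext k p
        simp [totalBd]) (by
        rw [totalBd_sub, h1, totalBd_neg, totalBd_totalBd]; simp) (by
        intro k p hk
        -- For `k ≥ m` the components of degree `k + 1` vanish. Hence the singular boundary does not
        -- contribute to degree `k`, neither in `δ(h z)` nor in `δ z = 0`; the latter gives `∂ z =
        -- 0` in this degree.
        have e1 : L.totalHomotopy z (k + 1) p = 0 := by
          cases p with
          | zero => rfl
          | succ p => rw [totalHomotopy, h2 (k + 1) p (by omega), map_zero]
        have e2 : (z - -𝒦.totalBd (L.totalHomotopy z)) k p =
            z k p + 𝒦.bd k p (L.homotopy k p (z k p)) := by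
          simp only [Pi.sub_apply, Pi.neg_apply, totalBd, e1, map_zero, smul_zero, zero_add,
            sub_neg_eq_add]
          rfl
        rw [e2]
        cases p with
        | zero => rw [L.bd_homotopy_zero (g0 k 0), add_neg_cancel]
        | succ p =>
          have e3 : 𝒦.bd k p (z k (p + 1)) = 0 := by
            have := congrFun (congrFun h1 k) p
            simpa only [totalBd, h2 (k + 1) p (by omega), map_zero, smul_zero, zero_add, Pi.zero_apply]
              using this
          have := L.bd_homotopy_succ (g0 k (p + 1))
          rw [e3, map_zero, add_zero] at this
          rw [this, add_neg_cancel])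
    -- Here `δ w = z + δ(h z)`, so the term added before the induction is subtracted again.
    refine ⟨w - L.totalHomotopy z, hw1.sub hw, ?_, ?_⟩
    · rw [φ.push_sub, hw2, hw0, sub_zero]
    · rw [totalBd_sub, hw3]; abel

/-- A chain with prescribed boundary lifts to a chain with prescribed boundary. -/
theorem exists_lift_totalBd (L : φ.Cartesian) {n : ℕ} {D : 𝒢.DoubleChain} (hD : 𝒢.IsChain (n + 1) D)
    (h : φ.IsLiftable D) {C : 𝒦.DoubleChain} (hC : 𝒦.IsCycle n C) (hCD : 𝒢.totalBd D = φ.push C) :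
    ∃ D', 𝒦.IsChain (n + 1) D' ∧ φ.push D' = D ∧ 𝒦.totalBd D' = C := by
  obtain ⟨D', h1, h2⟩ := L.exists_lift_doubleChain hD h
  -- The error of an arbitrary lift `D'` is a cycle in the kernel of `φ_*`, hence the boundary of a
  -- chain `w` in the kernel. Subtracting `w` corrects the boundary without changing the image.
  have hz : 𝒦.IsChain n (𝒦.totalBd D' - C) := h1.totalBd.sub hC.1
  obtain ⟨w, hw1, hw2, hw3⟩ := L.exists_totalBd_eq (n + 1) hz
    (by rw [φ.push_sub, φ.push_totalBd, h2, hCD, sub_self])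
    (by rw [totalBd_sub, totalBd_totalBd, hC.2, sub_self])
    (fun k p hk => (hz k p).1 (by omega))
  refine ⟨D' - w, h1.sub hw1, by rw [φ.push_sub, h2, hw2, sub_zero], ?_⟩
  rw [totalBd_sub, hw3]
  abel

/-- A cycle lifts to a cycle. -/
theorem exists_lift_cycle (L : φ.Cartesian) {n : ℕ} {D : 𝒢.DoubleChain}
    (hD : 𝒢.IsCycle (n + 1) D) (h : φ.IsLiftable D) :
    ∃ D', 𝒦.IsCycle (n + 1) D' ∧ φ.push D' = D := by
  have h0 : 𝒦.IsCycle n 0 :=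
    ⟨fun k p => ⟨fun _ => rfl, Chain.IsSmoothChain.zero⟩, funext fun k => funext fun p => by
      simp [totalBd]⟩
  obtain ⟨D', h1, h2, h3⟩ := L.exists_lift_totalBd hD.1 h h0 (by
    rw [hD.2]; exact (funext fun k => funext fun p => (map_zero _).symm))
  exact ⟨D', ⟨h1, h3⟩, h2⟩

end Smooth

end Hom.Cartesian

end SetGroupoid

/-! ### Piecewise smooth maps -/

section Polyhedra

variable {k m : ℕ}

theorem IsPolyhedron.inter {P Q : Set (Fin k → ℝ)} (hP : IsPolyhedron P) (hQ : IsPolyhedron Q) :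
    IsPolyhedron (P ∩ Q) := by
  classical
  obtain ⟨L, rfl⟩ := hP
  obtain ⟨L', rfl⟩ := hQ
  refine ⟨L ∪ L', ?_⟩
  ext x
  simp only [Set.mem_inter_iff, Set.mem_ofPred_eq, Finset.mem_union]
  exact ⟨fun h l hl => hl.elim (h.1 l) (h.2 l), fun h => ⟨fun l hl => h l (Or.inl hl),
    fun l hl => h l (Or.inr hl)⟩⟩

theorem IsPolyhedron.preimage {P : Set (Fin m → ℝ)} (hP : IsPolyhedron P)
    (f : (Fin k → ℝ) →ᵃ[ℝ] (Fin m → ℝ)) : IsPolyhedron (f ⁻¹' P) := by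
  classical
  obtain ⟨L, rfl⟩ := hP
  refine ⟨L.image fun l => l.comp f, ?_⟩
  ext x
  simp

theorem IsPolyhedron.isClosed {P : Set (Fin k → ℝ)} (hP : IsPolyhedron P) : IsClosed P := by
  obtain ⟨L, rfl⟩ := hP
  have : {x | ∀ l ∈ L, 0 ≤ l x} = ⋂ l ∈ L, {x : Fin k → ℝ | 0 ≤ l x} := by ext; simp
  rw [this]
  exact isClosed_biInter fun l _ => isClosed_le continuous_const l.continuous_of_finiteDimensional

theorem IsPolyhedron.convex {P : Set (Fin k → ℝ)} (hP : IsPolyhedron P) : Convex ℝ P := by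
  obtain ⟨L, rfl⟩ := hP
  have : {x | ∀ l ∈ L, 0 ≤ l x} = ⋂ l ∈ L, l ⁻¹' Set.Ici (0 : ℝ) := by ext; simp
  rw [this]
  exact convex_iInter₂ fun l _ => (convex_Ici (0 : ℝ)).affine_preimage l

theorem isClosed_simplexSet (k : ℕ) : IsClosed (simplexSet k) := by
  have : simplexSet k = (⋂ i, {x : Fin k → ℝ | 0 ≤ x i}) ∩ {x | ∑ i, x i ≤ 1} := by
    ext; simp [simplexSet]
  rw [this]
  exact (isClosed_iInter fun i => isClosed_le continuous_const (continuous_apply i)).inter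
    (isClosed_le (by fun_prop) continuous_const)

theorem simplexSet_subset_Icc (k : ℕ) : simplexSet k ⊆ Set.Icc 0 1 := fun x hx =>
  ⟨fun i => hx.1 i, fun i =>
    (Finset.single_le_sum (f := x) (fun j _ => hx.1 j) (Finset.mem_univ i)).trans hx.2⟩

theorem isCompact_simplexSet (k : ℕ) : IsCompact (simplexSet k) :=
  isCompact_Icc.of_isClosed_subset (isClosed_simplexSet k) (simplexSet_subset_Icc k)

theorem interior_simplexSet_nonempty (k : ℕ) : (interior (simplexSet k)).Nonempty := by
  refine ⟨fun _ => ((k : ℝ) + 1)⁻¹, mem_interior.2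
    ⟨(⋂ i, {x : Fin k → ℝ | 0 < x i}) ∩ {x | ∑ i, x i < 1}, ?_, ?_, ?_⟩⟩
  · rintro x ⟨h1, h2⟩
    simp only [Set.mem_iInter, Set.mem_ofPred_eq] at h1 h2
    exact ⟨fun i => (h1 i).le, h2.le⟩
  · exact (isOpen_iInter_of_finite fun i => isOpen_lt continuous_const (continuous_apply i)).inter
      (isOpen_lt (by fun_prop) continuous_const)
  · simp only [Set.mem_inter_iff, Set.mem_iInter, Set.mem_ofPred_eq, Finset.sum_const,
      Finset.card_univ, Fintype.card_fin, nsmul_eq_mul]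
    refine ⟨fun i => by positivity, ?_⟩
    rw [← div_eq_mul_inv, div_lt_one (by positivity)]
    linarith

theorem uniqueDiffOn_simplexSet (k : ℕ) : UniqueDiffOn ℝ (simplexSet k) :=
  uniqueDiffOn_convex (convex_simplexSet k) (interior_simplexSet_nonempty k)

end Polyhedra

section Extend

variable {A B : Type u} {k m : ℕ}

theorem extendSimplex_of_mem (σ : Δ k → A) {x : Fin k → ℝ} (hx : x ∈ simplexSet k) :
    extendSimplex σ x = σ ⟨x, hx⟩ := by
  rw [extendSimplex, dif_pos hx]

theorem extendSimplex_coe (σ : Δ k → A) (x : Δ k) : extendSimplex σ x.1 = σ x :=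
  extendSimplex_of_mem σ x.2

theorem extendSimplex_comp (f : A → B) (σ : Δ k → A) :
    extendSimplex (fun x => f (σ x)) = f ∘ extendSimplex σ := by
  funext x
  simp only [extendSimplex, Function.comp_apply]
  split_ifs <;> rfl

theorem exists_extendSimplex_eq (σ : Δ k → A) (x : Fin k → ℝ) : ∃ y, extendSimplex σ x = σ y := by
  rw [extendSimplex]
  split_ifs
  exacts [⟨_, rfl⟩, ⟨_, rfl⟩]

namespace Simplex

/-- The linear part of an affine map of simplices. -/
def affineLinear (w : Fin (k + 1) → Δ m) : (Fin k → ℝ) →ₗ[ℝ] (Fin m → ℝ) :=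
  ∑ i : Fin k, (LinearMap.proj i).smulRight ((w i.succ).1 - (w 0).1)

theorem affineLinear_apply (w : Fin (k + 1) → Δ m) (x : Fin k → ℝ) :
    affineLinear w x = ∑ i : Fin k, x i • ((w i.succ).1 - (w 0).1) := by
  simp [affineLinear]

/-- The extension of an affine map of simplices to the ambient space. -/
def affineExt (w : Fin (k + 1) → Δ m) : (Fin k → ℝ) →ᵃ[ℝ] (Fin m → ℝ) :=
  (affineLinear w).toAffineMap + AffineMap.const ℝ _ (w 0).1

theorem affineExt_apply (w : Fin (k + 1) → Δ m) (x : Fin k → ℝ) :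
    affineExt w x = affineLinear w x + (w 0).1 := rfl

theorem affineExt_coe (w : Fin (k + 1) → Δ m) (x : Δ k) : affineExt w x.1 = (affine w x).1 := by
  rw [affineExt_apply, affineLinear_apply]
  simp only [affine, Fin.sum_univ_succ, barycentric, Fin.cons_zero, Fin.cons_succ, smul_sub,
    sub_smul, one_smul, Finset.sum_sub_distrib, Finset.sum_smul]
  abel

theorem mapsTo_affineExt (w : Fin (k + 1) → Δ m) :
    Set.MapsTo (affineExt w) (simplexSet k) (simplexSet m) := fun x hx => by
  rw [affineExt_coe w ⟨x, hx⟩]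
  exact (affine w _).2

theorem extendSimplex_comp_affine (w : Fin (k + 1) → Δ m) (σ : Δ m → A) {x : Fin k → ℝ}
    (hx : x ∈ simplexSet k) :
    extendSimplex (σ ∘ affine w) x = extendSimplex σ (affineExt w x) := by
  rw [extendSimplex_of_mem _ hx, affineExt_coe w ⟨x, hx⟩, extendSimplex_coe]
  rfl

theorem hasFDerivAt_affineExt (w : Fin (k + 1) → Δ m) (x : Fin k → ℝ) :
    HasFDerivAt (affineExt w) (LinearMap.toContinuousLinearMap (affineLinear w)) x :=
  ((LinearMap.toContinuousLinearMap (affineLinear w)).hasFDerivAt (x := x)).add_const _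

theorem contDiff_affineExt (w : Fin (k + 1) → Δ m) : ContDiff ℝ ∞ (affineExt w) :=
  (LinearMap.toContinuousLinearMap (affineLinear w)).contDiff.add contDiff_const

end Simplex

end Extend

namespace PiecewiseSmooth

variable {M N : SmoothMfd.{u}} {k m : ℕ} {σ : Δ k → M}

theorem comp_affine {σ : Δ m → M} (h : PiecewiseSmooth M σ) (w : Fin (k + 1) → Δ m) :
    PiecewiseSmooth M (σ ∘ Simplex.affine w) := by
  obtain ⟨Ps, hfin, hcov, hP⟩ := h
  refine ⟨(fun P => Simplex.affineExt w ⁻¹' P) '' Ps, hfin.image _, ?_, ?_⟩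
  · intro x hx
    obtain ⟨P, hP, hxP⟩ := hcov (Simplex.mapsTo_affineExt w hx)
    exact ⟨_, ⟨P, hP, rfl⟩, hxP⟩
  · rintro _ ⟨P, hPs, rfl⟩
    refine ⟨(hP P hPs).1.preimage _, ?_⟩
    have h1 : ContMDiffOn 𝓘(ℝ, Fin k → ℝ) 𝓘(ℝ, Fin m → ℝ) ∞ (Simplex.affineExt w)
        (simplexSet k ∩ Simplex.affineExt w ⁻¹' P) :=
      (Simplex.contDiff_affineExt w).contMDiff.contMDiffOn
    refine ((hP P hPs).2.comp h1 fun x hx => ⟨Simplex.mapsTo_affineExt w hx.1, hx.2⟩).congr ?_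
    intro x hx
    exact Simplex.extendSimplex_comp_affine w σ hx.1

theorem comp_contMDiffOn (h : PiecewiseSmooth M σ) {f : M → N} {S : Set M}
    (hf : ContMDiffOn M.I N.I ∞ f S) (hS : ∀ x, σ x ∈ S) : PiecewiseSmooth N fun x => f (σ x) := by
  obtain ⟨Ps, hfin, hcov, hP⟩ := h
  refine ⟨Ps, hfin, hcov, fun P hPs => ⟨(hP P hPs).1, ?_⟩⟩
  rw [extendSimplex_comp]
  refine hf.comp (hP P hPs).2 fun x _ => ?_
  obtain ⟨y, hy⟩ := exists_extendSimplex_eq σ x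
  rw [Set.mem_preimage, hy]
  exact hS y

theorem comp_contMDiff (h : PiecewiseSmooth M σ) {f : M → N} (hf : ContMDiff M.I N.I ∞ f) :
    PiecewiseSmooth N fun x => f (σ x) :=
  h.comp_contMDiffOn (S := Set.univ) hf.contMDiffOn fun _ => Set.mem_univ _

theorem prodMk {τ : Δ k → N} (hσ : PiecewiseSmooth M σ) (hτ : PiecewiseSmooth N τ) :
    PiecewiseSmooth (M.prod N) fun x => (σ x, τ x) := by
  obtain ⟨Ps, hfin, hcov, hP⟩ := hσ
  obtain ⟨Qs, hfin', hcov', hQ⟩ := hτ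
  refine ⟨Set.image2 (fun P Q => P ∩ Q) Ps Qs, hfin.image2 _ hfin', ?_, ?_⟩
  · intro x hx
    obtain ⟨P, hP, hxP⟩ := hcov hx
    obtain ⟨Q, hQ, hxQ⟩ := hcov' hx
    exact ⟨_, ⟨P, hP, Q, hQ, rfl⟩, hxP, hxQ⟩
  · rintro _ ⟨P, hPs, Q, hQs, rfl⟩
    refine ⟨(hP P hPs).1.inter (hQ Q hQs).1, ?_⟩
    have h1 := (hP P hPs).2.mono (Set.inter_subset_inter_right (simplexSet k)
      (Set.inter_subset_left (s := P) (t := Q)))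
    have h2 := (hQ Q hQs).2.mono (Set.inter_subset_inter_right (simplexSet k)
      (Set.inter_subset_right (s := P) (t := Q)))
    refine (ContMDiffOn.prodMk h1 h2).congr fun x hx => ?_
    refine (extendSimplex_of_mem (A := M × N) _ hx.1).trans (Prod.ext ?_ ?_)
    · exact (extendSimplex_of_mem σ hx.1).symm
    · exact (extendSimplex_of_mem τ hx.1).symm

theorem continuousOn (h : PiecewiseSmooth M σ) : ContinuousOn (extendSimplex σ) (simplexSet k) := by
  obtain ⟨Ps, hfin, hcov, hP⟩ := h
  have : simplexSet k = ⋃ P : Ps, simplexSet k ∩ P.1 := by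
    rw [← Set.inter_iUnion, ← Set.sUnion_eq_iUnion, Set.inter_eq_left.2 hcov]
  rw [this]
  have := hfin.to_subtype
  exact (locallyFinite_of_finite _).continuousOn_iUnion
    (fun P => (isClosed_simplexSet k).inter (hP P.1 P.2).1.isClosed)
    fun P => (hP P.1 P.2).2.continuousOn

theorem continuous (h : PiecewiseSmooth M σ) : Continuous σ := by
  have := continuousOn_iff_continuous_domRestrict.1 h.continuousOn
  exact this.congr fun x => extendSimplex_coe σ x

/-- Outside of a null set, a piecewise smooth map is smooth at interior points. -/
theorem ae_contMDiffAt (h : PiecewiseSmooth M σ) :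
    ∀ᵐ x ∂(MeasureTheory.volume.restrict (simplexSet k)), x ∈ interior (simplexSet k) ∧
      ContMDiffAt 𝓘(ℝ, Fin k → ℝ) M.I ∞ (extendSimplex σ) x := by
  obtain ⟨Ps, hfin, hcov, hP⟩ := h
  rw [MeasureTheory.ae_restrict_iff' (isClosed_simplexSet k).measurableSet]
  -- The pieces are convex, so their frontiers are null sets.
  have h1 : ∀ᵐ x : Fin k → ℝ, ∀ P ∈ Ps, x ∉ frontier (simplexSet k ∩ P) := by
    rw [MeasureTheory.ae_ball_iff hfin.countable]
    intro P hPs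
    exact MeasureTheory.compl_mem_ae_iff.2
      (((convex_simplexSet k).inter (hP P hPs).1.convex).addHaar_frontier _)
  filter_upwards [h1] with x hx hxk
  obtain ⟨P, hPs, hxP⟩ := hcov hxk
  have hint : x ∈ interior (simplexSet k ∩ P) := by
    by_contra hn
    exact hx P hPs ⟨subset_closure ⟨hxk, hxP⟩, hn⟩
  exact ⟨interior_mono Set.inter_subset_left hint,
    ((hP P hPs).2 x ⟨hxk, hxP⟩).contMDiffAt (mem_interior_iff_mem_nhds.1 hint)⟩

end PiecewiseSmooth

instance (M : SmoothMfd.{u}) : LawfulSimplices M := ⟨fun w h => h.comp_affine w⟩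

/-! ### Forms in charts and integrability -/

namespace Form

variable {M N : SmoothMfd.{u}} {k : ℕ}

/-- Every tangent space is by definition the model space `M.E`, so tangent vectors at points that
are only provably equal can be compared without transport. -/
theorem apply_congr (α : Form k M) {x x' : M} (h : x = x') {v v' : Fin k → M.E} (hv : v = v') :
    (α x v : ℝ) = α x' v' := by
  subst h hv; rfl

theorem mfderiv_extChartAt_symm_apply {z x : M} (hx : x ∈ (extChartAt M.I z).source) (v : M.E) :
    (mfderiv 𝓘(ℝ, M.E) M.I (extChartAt M.I z).symm (extChartAt M.I z x)
      (mfderiv M.I 𝓘(ℝ, M.E) (extChartAt M.I z) x v : M.E) : M.E) = v := by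
  have h := mfderivWithin_extChartAt_symm_comp_mfderiv_extChartAt' (I := M.I) (x := z) hx
  rw [M.I.range_eq_univ, mfderivWithin_univ] at h
  exact DFunLike.congr_fun h v

theorem apply_eq_inChart (α : Form k M) {z x : M} (hx : x ∈ (extChartAt M.I z).source)
    (v : Fin k → M.E) : (α x v : ℝ) = α.inChart z (extChartAt M.I z x)
      fun i => (mfderiv M.I 𝓘(ℝ, M.E) (extChartAt M.I z) x (v i) : M.E) :=
  apply_congr α ((extChartAt M.I z).left_inv hx).symm
    (funext fun i => (mfderiv_extChartAt_symm_apply hx (v i)).symm)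

/-- The pull-back of a form along a map from a vector space, computed in a chart. -/
theorem apply_mfderivWithin_eq_inChart {V : Type*} [NormedAddCommGroup V] [NormedSpace ℝ V]
    (α : Form k M) {z : M} {f : V → M} {Q : Set V} {x : V}
    (hz : f x ∈ (extChartAt M.I z).source) (hf : MDifferentiableWithinAt 𝓘(ℝ, V) M.I f Q x)
    (hQ : UniqueDiffWithinAt ℝ Q x) (v : Fin k → V) :
    (α (f x) fun i => mfderivWithin 𝓘(ℝ, V) M.I f Q x (v i)) =
      α.inChart z (extChartAt M.I z (f x)) fun i =>
        fderivWithin ℝ (fun y => extChartAt M.I z (f y)) Q x (v i) := by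
  refine (α.apply_eq_inChart hz _).trans ?_
  congr 1
  funext i
  have h1 := mfderiv_comp_mfderivWithin (I := 𝓘(ℝ, V)) (I' := M.I) (I'' := 𝓘(ℝ, M.E)) x
    (mdifferentiableAt_extChartAt (I := M.I) (x := z) (by rwa [extChartAt_source] at hz)) hf
    hQ.uniqueMDiffWithinAt
  rw [mfderivWithin_eq_fderivWithin] at h1
  exact (DFunLike.congr_fun h1 (v i)).symm

end Form

namespace PiecewiseSmooth

variable {M N : SmoothMfd.{u}} {k : ℕ} {σ : Δ k → M}

/-- Continuity is local, so it is checked in a chart around `f x₀`, where both the coefficients of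
the form and the derivative of `f` are continuous. -/
theorem continuousOn_density {V : Type*} [NormedAddCommGroup V] [NormedSpace ℝ V] {α : Form k M}
    (hα : α.IsSmooth) {f : V → M} {Q : Set V} (hf : ContMDiffOn 𝓘(ℝ, V) M.I ∞ f Q)
    (hQ : UniqueDiffOn ℝ Q) (v : Fin k → V) :
    ContinuousOn (fun x => (α (f x) fun i => mfderivWithin 𝓘(ℝ, V) M.I f Q x (v i) : ℝ)) Q := by
  intro x₀ hx₀
  set z := f x₀
  have hU : f ⁻¹' (extChartAt M.I z).source ∈ nhdsWithin x₀ Q :=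
    (hf.continuousOn x₀ hx₀).preimage_mem_nhdsWithin (extChartAt_source_mem_nhds z)
  obtain ⟨U, hUo, hxU, hUQ⟩ := mem_nhdsWithin.1 hU
  have hs : ContDiffOn ℝ ∞ (fun y => extChartAt M.I z (f y)) (U ∩ Q) := by
    rw [← contMDiffOn_iff_contDiffOn]
    refine (contMDiffOn_extChartAt (x := z)).comp (hf.mono Set.inter_subset_right) fun y hy => ?_
    rw [← extChartAt_source M.I]
    exact hUQ hy
  have hQ' : UniqueDiffOn ℝ (U ∩ Q) := by rw [Set.inter_comm]; exact hQ.inter hUo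
  have hc : ContinuousOn (fun x => α.inChart z (extChartAt M.I z (f x)) fun i =>
      fderivWithin ℝ (fun y => extChartAt M.I z (f y)) (U ∩ Q) x (v i)) (U ∩ Q) := by
    have h1 : ContinuousOn (fun x => α.inChart z (extChartAt M.I z (f x))) (U ∩ Q) :=
      (hα z).continuousOn.comp hs.continuousOn fun y hy => (extChartAt M.I z).map_source (hUQ hy)
    have h2 : ContinuousOn (fun x => fun i =>
        fderivWithin ℝ (fun y => extChartAt M.I z (f y)) (U ∩ Q) x (v i)) (U ∩ Q) :=
      continuousOn_pi.2 fun i =>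
        (hs.continuousOn_fderivWithin hQ' (by simp)).clm_apply continuousOn_const
    intro x hx
    exact ContinuousWithinAt.eval (h1 x hx) (h2 x hx)
  have hc' : ContinuousOn (fun x => (α (f x) fun i => mfderivWithin 𝓘(ℝ, V) M.I f Q x (v i) : ℝ))
      (U ∩ Q) := by
    refine hc.congr fun x hx => ?_
    refine (α.apply_mfderivWithin_eq_inChart (hUQ hx)
      ((hf x hx.2).mdifferentiableWithinAt (by simp)) (hQ x hx.2) v).trans ?_
    rw [Set.inter_comm]
    congr 1
    funext i
    rw [fderivWithin_inter (hUo.mem_nhds hx.1)]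
  exact (hc' x₀ ⟨hxU, hx₀⟩).mono_of_mem_nhdsWithin
    (Filter.inter_mem (mem_nhdsWithin_of_mem_nhds (hUo.mem_nhds hxU)) self_mem_nhdsWithin)

end PiecewiseSmooth

namespace Chain

variable {M N : SmoothMfd.{u}} {k : ℕ}

/-- The density of the pull-back of a form to the simplex. -/
def density (α : Form k M) (σ : Δ k → M) (x : Fin k → ℝ) : ℝ :=
  α (extendSimplex σ x) fun i =>
    mfderivWithin 𝓘(ℝ, Fin k → ℝ) M.I (extendSimplex σ) (simplexSet k) x (Pi.single i (1 : ℝ))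

theorem integralSimplex_eq (α : Form k M) (σ : Δ k → M) :
    integralSimplex α σ = ∫ x in simplexSet k, density α σ x := rfl

theorem integrableOn_density {α : Form k M} (hα : α.IsSmooth) {σ : Δ k → M}
    (h : PiecewiseSmooth M σ) : MeasureTheory.IntegrableOn (density α σ) (simplexSet k) := by
  obtain ⟨Ps, hfin, hcov, hP⟩ := h
  have : simplexSet k = ⋃ P ∈ Ps, simplexSet k ∩ P := by
    rw [← Set.inter_iUnion₂, ← Set.sUnion_eq_biUnion, Set.inter_eq_left.2 hcov]
  rw [this, MeasureTheory.integrableOn_finite_biUnion hfin]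
  intro P hPs
  have hconv : Convex ℝ (simplexSet k ∩ P) := (convex_simplexSet k).inter (hP P hPs).1.convex
  have hcomp : IsCompact (simplexSet k ∩ P) :=
    (isCompact_simplexSet k).inter_right (hP P hPs).1.isClosed
  -- The density uses derivatives within the whole simplex. They agree with derivatives within the
  -- piece at interior points of the piece, and the frontier is null. If the interior is empty there
  -- is nothing to prove; otherwise the piece has unique derivatives and the density within it is
  -- continuous on a compact set.
  rw [← MeasureTheory.integrableOn_congr_set_ae
    (interior_ae_eq_of_null_frontier (hconv.addHaar_frontier MeasureTheory.volume))]
  rcases Set.eq_empty_or_nonempty (interior (simplexSet k ∩ P)) with he | hne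
  · rw [he]; exact MeasureTheory.integrableOn_empty
  have hQ : UniqueDiffOn ℝ (simplexSet k ∩ P) := uniqueDiffOn_convex hconv hne
  have := ((PiecewiseSmooth.continuousOn_density hα (hP P hPs).2 hQ
    fun i => Pi.single i (1 : ℝ)).integrableOn_compact (μ := MeasureTheory.volume) hcomp).mono_set
    interior_subset
  refine this.congr_fun (fun x hx => ?_) isOpen_interior.measurableSet
  have h1 : simplexSet k ∩ P ∈ nhds x := mem_interior_iff_mem_nhds.1 hx
  have h2 : simplexSet k ∈ nhds x := Filter.mem_of_superset h1 Set.inter_subset_left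
  simp only [density]
  rw [mfderivWithin_of_mem_nhds h1, mfderivWithin_of_mem_nhds h2]

/-- Integration of a form as a homomorphism. -/
def integralHom (α : Form k M) : Chain M k →+ ℝ :=
  Finsupp.liftAddHom fun σ => (AddMonoidHom.mulRight (integralSimplex α σ)).comp (Int.castAddHom ℝ)

theorem integralHom_apply (α : Form k M) (c : Chain M k) : integralHom α c = integral α c := rfl

theorem integralHom_single (α : Form k M) (σ : Δ k → M) (n : ℤ) :
    integralHom α (Finsupp.single σ n) = n * integralSimplex α σ := by
  simp [integralHom]

/-- Two homomorphisms on chains agree on a piecewise smooth chain if they agree on simplices. -/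
theorem eq_of_isSmoothChain {A : Type u} [HasSimplices A] {B : Type*} [AddCommGroup B]
    {f g : Chain A k →+ B} (h : ∀ σ : Δ k → A, HasSimplices.IsSimplex σ →
      f (Finsupp.single σ 1) = g (Finsupp.single σ 1)) {c : Chain A k} (hc : c.IsSmoothChain) :
    f c = g c := by
  rw [← Finsupp.sum_single c, Finsupp.sum, map_sum, map_sum]
  refine Finset.sum_congr rfl fun σ hσ => ?_
  have : (Finsupp.single σ (c σ) : Chain A k) = c σ • Finsupp.single σ 1 := by simp
  rw [this, map_zsmul, map_zsmul, h σ (hc σ hσ)]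

end Chain

/-! ### The integral is invariant under subdivision -/

namespace Simplex

variable {k : ℕ}

/-- The matrix of barycentric coordinates of the vertices computes the determinant. -/
theorem det_barycentric (w : Fin (k + 1) → Δ k) :
    Matrix.det (Matrix.of fun j l => barycentric (w j).1 l) = LinearMap.det (affineLinear w) := by
  let N : Matrix (Fin (k + 1)) (Fin (k + 1)) ℝ :=
    Matrix.of fun j l => (Fin.cons 1 (w j).1 : Fin (k + 1) → ℝ) l
  -- The unipotent matrix `C` performs the column operation which turns the column of ones in `N`
  -- into the barycentric coordinates `1 - ∑ xᵢ`. Subtracting row `0` then leaves the edge vectors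
  -- `w j - w 0`, which are the columns of the linear part.
  let C : Matrix (Fin (k + 1)) (Fin (k + 1)) ℝ := Matrix.of fun j l =>
    if l = j then 1 else if l = 0 then -1 else 0
  let N' : Matrix (Fin (k + 1)) (Fin (k + 1)) ℝ := Matrix.of fun j l =>
    if j = 0 then N 0 l else N j l - N 0 l
  have h1 : Matrix.of (fun j l => barycentric (w j).1 l) = N * C := by
    ext j l
    rw [Matrix.mul_apply, Fin.sum_univ_succ]
    refine Fin.cases ?_ (fun l => ?_) l
    · simp [N, C, barycentric, (Fin.succ_ne_zero _).symm, sub_eq_add_neg]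
    · simp [N, C, barycentric, Fin.succ_ne_zero, eq_comm]
  have h2 : C.det = 1 := by
    rw [Matrix.det_of_isLowerTriangular C]
    · simp [C]
    · intro i j hij
      have hij : i < j := hij
      simp [C, hij.ne', (Fin.pos_iff_ne_zero.1 ((Fin.zero_le i).trans_lt hij))]
  have h3 : N.det = N'.det := by
    refine Matrix.det_eq_of_forall_row_eq_smul_add_const (fun j => if j = 0 then 0 else 1) 0
      (by simp) fun j l => ?_
    by_cases hj : j = 0
    · simp [N', hj]
    · simp [N', hj]
  have h4 : N'.det = (LinearMap.toMatrix' (affineLinear w)).det := by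
    rw [Matrix.det_succ_column_zero, Fin.sum_univ_succ]
    have : ∀ i : Fin k, N' i.succ 0 = 0 := by intro i; simp [N', N, Fin.succ_ne_zero]
    simp only [this, mul_zero, zero_mul, Finset.sum_const_zero, add_zero]
    rw [← Matrix.det_transpose (LinearMap.toMatrix' _)]
    simp only [Fin.val_zero, pow_zero, one_mul]
    have h0 : N' 0 0 = 1 := by simp [N', N]
    rw [h0, one_mul]
    congr 1
    ext i j
    simp only [N', N, Matrix.submatrix_apply, Fin.succ_ne_zero, affineLinear_apply,
      LinearMap.toMatrix'_apply, Matrix.transpose_apply, Matrix.of_apply, if_false,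
      Fin.zero_succAbove, Fin.cons_succ, Finset.sum_apply, Pi.smul_apply, Pi.sub_apply, smul_eq_mul]
    rw [Finset.sum_eq_single i (fun c _ hc => by simp [hc]) (by simp)]
    simp
  rw [h1, Matrix.det_mul, h2, mul_one, h3, h4, LinearMap.det_toMatrix']

/-- After its columns are permuted by `π`, the matrix of barycentric coordinates is upper triangular
with diagonal entries `1 / (k + 1 - j)`. -/
theorem det_sdMap (π : Equiv.Perm (Fin (k + 1))) :
    LinearMap.det (affineLinear (sdVertex π)) = (π.sign : ℤ) * ((k + 1).factorial : ℝ)⁻¹ := by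
  let U : Matrix (Fin (k + 1)) (Fin (k + 1)) ℝ := Matrix.of fun j l =>
    if j ≤ l then ((k + 1 - j : ℕ) : ℝ)⁻¹ else 0
  have h1 : Matrix.of (fun j l => barycentric (sdVertex π j).1 l) = U.submatrix id π.symm := by
    ext j l
    simp [U, barycentric_sdVertex]
  rw [← det_barycentric, h1, Matrix.det_permute', Equiv.Perm.sign_symm]
  congr 1
  rw [Matrix.det_of_isUpperTriangular]
  · simp only [U, Matrix.of_apply, le_refl, if_true, Finset.prod_inv_distrib]
    congr 1
    rw [← Finset.prod_range_add_one_eq_factorial, Nat.cast_prod, ← Fin.prod_univ_eq_prod_range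
      (fun i => ((i + 1 : ℕ) : ℝ)), ← Equiv.prod_comp Fin.revPerm]
    refine Finset.prod_congr rfl fun i _ => ?_
    congr 1
    simp [Fin.rev]
    omega
  · intro i j hij
    have : j < i := hij
    simp [U, this]

end Simplex

open MeasureTheory in
-- The set is an affine subspace, and a proper one since it misses the `i`-th vertex.
theorem volume_setOf_barycentric_eq {k : ℕ} {i j : Fin (k + 1)} (hij : i ≠ j) :
    volume {x : Fin k → ℝ | barycentric x i = barycentric x j} = 0 := by
  have h : ∀ (c : ℝ) (p₁ p₂ p₃ : Fin k → ℝ) (i : Fin (k + 1)),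
      barycentric (c • (p₁ - p₂) + p₃) i =
        c * (barycentric p₁ i - barycentric p₂ i) + barycentric p₃ i := by
    intro c p₁ p₂ p₃ i
    refine Fin.cases ?_ (fun i => ?_) i
    · simp [barycentric, Finset.sum_add_distrib, ← Finset.mul_sum]
      ring
    · simp [barycentric]
  let S : AffineSubspace ℝ (Fin k → ℝ) :=
    { carrier := {x | barycentric x i = barycentric x j}
      smul_vsub_vadd_mem' := by
        intro c p₁ p₂ p₃ h₁ h₂ h₃
        simp only [Set.mem_ofPred_eq, vsub_eq_sub, vadd_eq_add] at *
        rw [h, h, h₁, h₂, h₃] }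
  refine Measure.addHaar_affineSubspace volume S fun hS => ?_
  have : (Simplex.vertex i).1 ∈ S := by rw [hS]; trivial
  have : barycentric (Simplex.vertex i).1 i = barycentric (Simplex.vertex i).1 j := this
  simp [hij.symm] at this

namespace Simplex

variable {k : ℕ}

open MeasureTheory

theorem volume_preimage_affineExt {w : Fin (k + 1) → Δ k} (h : LinearMap.det (affineLinear w) ≠ 0)
    {N : Set (Fin k → ℝ)} (hN : volume N = 0) : volume (affineExt w ⁻¹' N) = 0 := by
  have : affineExt w ⁻¹' N = affineLinear w ⁻¹' ((· + (w 0).1) ⁻¹' N) := rfl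
  rw [this, Measure.addHaar_preimage_linearMap volume h, measure_preimage_add_right, hN, mul_zero]

theorem injective_affineExt {w : Fin (k + 1) → Δ k} (h : LinearMap.det (affineLinear w) ≠ 0) :
    Function.Injective (affineExt w) := by
  intro x y hxy
  rw [affineExt_apply, affineExt_apply, add_left_inj] at hxy
  exact (LinearMap.equivOfDetNeZero _ h).injective hxy

theorem volume_image_affineExt (w : Fin (k + 1) → Δ k) (s : Set (Fin k → ℝ)) :
    volume (affineExt w '' s) =
      ENNReal.ofReal |LinearMap.det (affineLinear w)| * volume s := by
  have : affineExt w '' s = (· + (w 0).1) '' (affineLinear w '' s) := by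
    rw [Set.image_image]; rfl
  rw [this, Set.image_add_right, measure_preimage_add_right, Measure.addHaar_image_linearMap]

theorem det_sdMap_ne_zero (π : Equiv.Perm (Fin (k + 1))) :
    LinearMap.det (affineLinear (sdVertex π)) ≠ 0 := by
  rw [det_sdMap]
  have := Nat.factorial_ne_zero (k + 1)
  rcases Int.units_eq_one_or π.sign with h | h <;> simp [h, this]

theorem abs_det_sdMap (π : Equiv.Perm (Fin (k + 1))) :
    |LinearMap.det (affineLinear (sdVertex π))| = ((k + 1).factorial : ℝ)⁻¹ := by
  rw [det_sdMap]
  rcases Int.units_eq_one_or π.sign with h | h <;> simp [h]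

theorem monotone_barycentric_sdMap (π : Equiv.Perm (Fin (k + 1))) (x : Δ k) :
    Monotone (barycentric (sdMap π x).1 ∘ π) := by
  intro m m' hm
  simp only [Function.comp_apply, sdMap, barycentric_affine, barycentric_sdVertex,
    Equiv.symm_apply_apply]
  refine Finset.sum_le_sum fun j _ => mul_le_mul_of_nonneg_left ?_ (barycentric_nonneg x j)
  split_ifs with h1 h2
  · exact le_rfl
  · exact absurd (h1.trans hm) h2
  · positivity
  · exact le_rfl

/-- At a common point both `π` and `π'` sort the barycentric coordinates in increasing order. Sorted
tuples are unique, so the coordinates numbered `π m` and `π' m` coincide, which happens only on a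
null set. -/
theorem aedisjoint_sdMap {π π' : Equiv.Perm (Fin (k + 1))} (h : π ≠ π') :
    AEDisjoint volume (affineExt (sdVertex π) '' simplexSet k)
      (affineExt (sdVertex π') '' simplexSet k) := by
  obtain ⟨m, hm⟩ : ∃ m, π m ≠ π' m := by
    by_contra! hc
    exact h (Equiv.ext hc)
  refine measure_mono_null ?_ (volume_setOf_barycentric_eq hm)
  rintro _ ⟨⟨x, hx, rfl⟩, ⟨x', hx', he⟩⟩
  have e := affineExt_coe (sdVertex π) ⟨x, hx⟩
  have e' := affineExt_coe (sdVertex π') ⟨x', hx'⟩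
  have h1 := monotone_barycentric_sdMap π ⟨x, hx⟩
  have h2 := monotone_barycentric_sdMap π' ⟨x', hx'⟩
  rw [sdMap, ← e] at h1
  rw [sdMap, ← e', he] at h2
  exact congrFun (Tuple.unique_monotone h1 h2) m

/-- There are `(k + 1)!` almost disjoint pieces, each with `1 / (k + 1)!` of the volume of the
simplex. Counting volume replaces the argument that the pieces cover. -/
theorem iUnion_sdMap_ae_eq : (⋃ π : Equiv.Perm (Fin (k + 1)),
    affineExt (sdVertex π) '' simplexSet k) =ᵐ[volume] simplexSet k := by
  have hm : ∀ π : Equiv.Perm (Fin (k + 1)), MeasurableSet (affineExt (sdVertex π) '' simplexSet k) :=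
    fun π => ((isCompact_simplexSet k).image (contDiff_affineExt _).continuous).measurableSet
  refine ae_eq_of_subset_of_measure_ge
    (Set.iUnion_subset fun π => (mapsTo_affineExt _).image_subset) ?_
    (MeasurableSet.iUnion hm).nullMeasurableSet (isCompact_simplexSet k).measure_lt_top.ne
  rw [measure_iUnion₀ (fun π π' h => aedisjoint_sdMap h) fun π => (hm π).nullMeasurableSet]
  simp only [volume_image_affineExt, abs_det_sdMap, tsum_fintype, Finset.sum_const,
    Finset.card_univ, Fintype.card_perm, Fintype.card_fin, nsmul_eq_mul]
  rw [← mul_assoc, ← ENNReal.ofReal_natCast, ← ENNReal.ofReal_mul (by positivity),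
    mul_inv_cancel₀ (by positivity)]
  simp

end Simplex

namespace Chain

variable {M : SmoothMfd.{u}} {k : ℕ}

open MeasureTheory

/-- The degree of the form is the dimension of the simplex, so pulling back by a linear map
multiplies it by the determinant. -/
theorem density_comp_affine (α : Form k M) {σ : Δ k → M} (w : Fin (k + 1) → Δ k)
    {x : Fin k → ℝ} (hx : x ∈ simplexSet k)
    (hσ : MDifferentiableWithinAt 𝓘(ℝ, Fin k → ℝ) M.I (extendSimplex σ) (simplexSet k)
      (Simplex.affineExt w x)) :
    density α (σ ∘ Simplex.affine w) x =
      LinearMap.det (Simplex.affineLinear w) * density α σ (Simplex.affineExt w x) := by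
  have hu : UniqueMDiffWithinAt 𝓘(ℝ, Fin k → ℝ) (simplexSet k) x :=
    (uniqueDiffOn_simplexSet k x hx).uniqueMDiffWithinAt
  have hd : mfderivWithin 𝓘(ℝ, Fin k → ℝ) M.I (extendSimplex (σ ∘ Simplex.affine w))
      (simplexSet k) x = (mfderivWithin 𝓘(ℝ, Fin k → ℝ) M.I (extendSimplex σ) (simplexSet k)
        (Simplex.affineExt w x)).comp
          (LinearMap.toContinuousLinearMap (Simplex.affineLinear w)) := by
    have h1 := mfderivWithin_comp x hσ
      ((Simplex.hasFDerivAt_affineExt w x).hasFDerivWithinAt (s := simplexSet k)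
        |>.differentiableWithinAt.mdifferentiableWithinAt)
      (Simplex.mapsTo_affineExt w) hu
    rw [mfderivWithin_eq_fderivWithin, ((Simplex.hasFDerivAt_affineExt w x).hasFDerivWithinAt
      (s := simplexSet k)).fderivWithin (uniqueDiffOn_simplexSet k x hx)] at h1
    exact (mfderivWithin_congr (fun y hy => Simplex.extendSimplex_comp_affine w σ hy)
      (Simplex.extendSimplex_comp_affine w σ hx)).trans h1
  let β : (Fin k → ℝ) [⋀^Fin k]→ₗ[ℝ] ℝ :=
    AlternatingMap.compLinearMap (α (extendSimplex σ (Simplex.affineExt w x))).toAlternatingMap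
      (mfderivWithin 𝓘(ℝ, Fin k → ℝ) M.I (extendSimplex σ) (simplexSet k)
        (Simplex.affineExt w x) : (Fin k → ℝ) →L[ℝ] M.E).toLinearMap
  have hβ : density α (σ ∘ Simplex.affine w) x =
      β (Simplex.affineLinear w ∘ fun i => Pi.single i (1 : ℝ)) := by
    refine Form.apply_congr α (Simplex.extendSimplex_comp_affine w σ hx) (funext fun i => ?_)
    exact DFunLike.congr_fun hd (Pi.single i (1 : ℝ))
  rw [hβ]
  have hb := β.eq_smul_basis_det (Pi.basisFun ℝ (Fin k))
  have hb' := DFunLike.congr_fun hb (Simplex.affineLinear w ∘ Pi.basisFun ℝ (Fin k))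
  rw [AlternatingMap.smul_apply, Module.Basis.det_comp, Module.Basis.det_self, mul_one,
    smul_eq_mul, mul_comm] at hb'
  have he : (Pi.basisFun ℝ (Fin k) : Fin k → Fin k → ℝ) = fun i => Pi.single i (1 : ℝ) := by
    funext i; simp
  rw [he] at hb'
  exact hb'

/-- The sign of the piece in the subdivision equals the sign of its determinant. Their product is
the absolute value required by the change of variables. -/
theorem integralSimplex_comp_sdMap (α : Form k M) {σ : Δ k → M} (hσ : PiecewiseSmooth M σ)
    (π : Equiv.Perm (Fin (k + 1))) :
    (π.sign : ℤ) * integralSimplex α (σ ∘ Simplex.sdMap π) =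
      ∫ x in Simplex.affineExt (Simplex.sdVertex π) '' simplexSet k, density α σ x := by
  have hdet := Simplex.det_sdMap_ne_zero π
  have hm := (isClosed_simplexSet k).measurableSet
  rw [integral_image_eq_integral_abs_det_fderiv_smul volume hm
    (fun x _ => (Simplex.hasFDerivAt_affineExt _ x).hasFDerivWithinAt)
    (Simplex.injective_affineExt hdet).injOn, integralSimplex_eq, ← integral_const_mul]
  refine setIntegral_congr_ae hm ?_
  have h := hσ.ae_contMDiffAt
  rw [ae_restrict_iff' hm] at h
  -- Differentiability of `σ` is known almost everywhere in the target of the affine map. Preimages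
  -- of null sets under it are null because its determinant does not vanish.
  have h' : ∀ᵐ x : Fin k → ℝ, Simplex.affineExt (Simplex.sdVertex π) x ∈ simplexSet k →
      Simplex.affineExt (Simplex.sdVertex π) x ∈ interior (simplexSet k) ∧
      ContMDiffAt 𝓘(ℝ, Fin k → ℝ) M.I ∞ (extendSimplex σ)
        (Simplex.affineExt (Simplex.sdVertex π) x) :=
    Simplex.volume_preimage_affineExt hdet h
  filter_upwards [h'] with x hx hxs
  have hc := (hx (Simplex.mapsTo_affineExt _ hxs)).2
  rw [Simplex.sdMap, density_comp_affine α _ hxs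
    (hc.mdifferentiableAt (by simp)).mdifferentiableWithinAt, Simplex.det_sdMap]
  have hd : |(LinearMap.toContinuousLinearMap
      (Simplex.affineLinear (Simplex.sdVertex π))).det| = ((k + 1).factorial : ℝ)⁻¹ :=
    Simplex.abs_det_sdMap π
  rw [hd, smul_eq_mul]
  rcases Int.units_eq_one_or π.sign with h | h <;> simp [h]

theorem integral_sd {α : Form k M} (hα : α.IsSmooth) {c : Chain M k} (hc : c.IsSmoothChain) :
    integral α (sd c) = integral α c := by
  refine eq_of_isSmoothChain (f := (integralHom α).comp sd) (g := integralHom α)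
    (fun σ hσ => ?_) hc
  have hσ : PiecewiseSmooth M σ := hσ
  have hi : IntegrableOn (density α σ) (⋃ π : Equiv.Perm (Fin (k + 1)),
      Simplex.affineExt (Simplex.sdVertex π) '' simplexSet k) :=
    (integrableOn_density hα hσ).mono_set
      (Set.iUnion_subset fun π => (Simplex.mapsTo_affineExt _).image_subset)
  rw [AddMonoidHom.comp_apply, sd_single, map_sum, integralHom_single, Int.cast_one, one_mul,
    integralSimplex_eq, ← setIntegral_congr_set Simplex.iUnion_sdMap_ae_eq,
    integral_iUnion_ae (fun π => ((isCompact_simplexSet k).image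
      (Simplex.contDiff_affineExt _).continuous).measurableSet.nullMeasurableSet)
      (fun π π' h => Simplex.aedisjoint_sdMap h) hi, tsum_fintype]
  refine Finset.sum_congr rfl fun π _ => ?_
  rw [← integralSimplex_comp_sdMap α hσ, map_zsmul, integralHom_single]
  simp

end Chain

/-! ### Iterated subdivisions are small -/

namespace Simplex

variable {k : ℕ}

/-- The maps of the simplices of the `n`-fold barycentric subdivision. -/
def iterSdMaps (k : ℕ) : ℕ → Set (Δ k → Δ k)
  | 0 => {id}
  | n + 1 => {τ | ∃ τ' ∈ iterSdMaps k n, ∃ π, τ = τ' ∘ sdMap π}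

/-- All vertices of the piece of `π` are barycentres of sets containing the vertex `π k`, so this
vertex occurs everywhere on the piece with a definite weight. The piece is thus contained in a copy
of the simplex contracted towards that vertex. -/
theorem exists_sdMap_eq (π : Equiv.Perm (Fin (k + 1))) (x : Δ k) : ∃ x' : Δ k, ∀ i,
    barycentric (sdMap π x).1 i = ((k : ℝ) + 2)⁻¹ * (Pi.single (π (Fin.last k)) 1 : Fin (k + 1) → ℝ) i
      + (1 - ((k : ℝ) + 2)⁻¹) * barycentric x'.1 i := by
  -- The weight of `π k` is at least `1 / (k + 1)`. The smaller value `1 / (k + 2)` keeps `1 - ε`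
  -- positive also for `k = 0`.
  set ε : ℝ := ((k : ℝ) + 2)⁻¹
  have hk : (0 : ℝ) ≤ k := k.cast_nonneg
  have hε : 0 < 1 - ε := sub_pos.2 (inv_lt_one_of_one_lt₀ (by linarith))
  have h1 : ∀ i, ε * (Pi.single (π (Fin.last k)) 1 : Fin (k + 1) → ℝ) i ≤
      barycentric (sdMap π x).1 i := by
    intro i
    by_cases hi : i = π (Fin.last k)
    · subst hi
      rw [Pi.single_eq_same, mul_one, sdMap, barycentric_affine]
      simp only [barycentric_sdVertex, Equiv.symm_apply_apply, Fin.le_last, if_true]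
      calc ε = ∑ j, barycentric x.1 j * ε := by
            rw [← Finset.sum_mul, sum_barycentric, one_mul]
        _ ≤ _ := by
            refine Finset.sum_le_sum fun j _ =>
              mul_le_mul_of_nonneg_left ?_ (barycentric_nonneg x j)
            have : 0 < k + 1 - (j : ℕ) := by omega
            refine inv_anti₀ (by exact_mod_cast this) ?_
            have : k + 1 - (j : ℕ) ≤ k + 2 := by omega
            exact_mod_cast this
    · rw [Pi.single_eq_of_ne hi, mul_zero]
      exact barycentric_nonneg _ _
  refine ⟨ofBarycentric (fun i => (1 - ε)⁻¹ * (barycentric (sdMap π x).1 i -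
    ε * (Pi.single (π (Fin.last k)) 1 : Fin (k + 1) → ℝ) i))
    (fun i => mul_nonneg (inv_nonneg.2 hε.le) (sub_nonneg.2 (h1 i))) ?_, fun i => ?_⟩
  · rw [← Finset.mul_sum, Finset.sum_sub_distrib, ← Finset.mul_sum, sum_barycentric]
    simp [hε.ne']
  · rw [barycentric_ofBarycentric]
    field_simp
    ring

theorem barycentric_le_one (x : Δ k) (i : Fin (k + 1)) : barycentric x.1 i ≤ 1 := by
  rw [← sum_barycentric x.1]
  exact Finset.single_le_sum (f := barycentric x.1) (fun j _ => barycentric_nonneg x j)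
    (Finset.mem_univ i)

/-- An affine map preserves the convex combinations of `exists_sdMap_eq`. In a difference of two
values the fixed vertex cancels, which leaves the factor `1 - ε` at each subdivision. -/
theorem abs_sub_le_of_mem_iterSdMaps {n : ℕ} {τ : Δ k → Δ k} (hτ : τ ∈ iterSdMaps k n) :
    (∃ w, τ = affine w) ∧ ∀ x y i, |barycentric (τ x).1 i - barycentric (τ y).1 i| ≤
      (1 - ((k : ℝ) + 2)⁻¹) ^ n := by
  have hk : (0 : ℝ) ≤ k := k.cast_nonneg
  have hε : 0 < 1 - ((k : ℝ) + 2)⁻¹ := sub_pos.2 (inv_lt_one_of_one_lt₀ (by linarith))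
  induction n generalizing τ with
  | zero =>
    obtain rfl : τ = id := hτ
    refine ⟨⟨vertex, funext fun x => ext_barycentric fun i => ?_⟩, fun x y i => ?_⟩
    · simp [barycentric_affine, Pi.single_apply]
    · rw [pow_zero, abs_sub_le_iff]
      constructor <;> linarith [barycentric_le_one x i, barycentric_nonneg x i,
        barycentric_le_one y i, barycentric_nonneg y i, id_eq x, id_eq y,
        show barycentric (id x).1 i = barycentric x.1 i from rfl,
        show barycentric (id y).1 i = barycentric y.1 i from rfl]
  | succ n ih =>
    obtain ⟨τ', hτ', π, rfl⟩ := hτ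
    obtain ⟨⟨w, rfl⟩, h⟩ := ih hτ'
    refine ⟨⟨_, affine_comp _ _⟩, fun x y i => ?_⟩
    obtain ⟨x', hx'⟩ := exists_sdMap_eq π x
    obtain ⟨y', hy'⟩ := exists_sdMap_eq π y
    have : barycentric ((affine w ∘ sdMap π) x).1 i - barycentric ((affine w ∘ sdMap π) y).1 i =
        (1 - ((k : ℝ) + 2)⁻¹) * (barycentric (affine w x').1 i - barycentric (affine w y').1 i) := by
      simp only [Function.comp_apply, barycentric_affine, hx', hy', ← Finset.sum_sub_distrib,
        Finset.mul_sum]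
      exact Finset.sum_congr rfl fun j _ => by ring
    rw [this, abs_mul, abs_of_pos hε, pow_succ, mul_comm]
    exact mul_le_mul_of_nonneg_right (h x' y' i) hε.le

/-- The diameters of the pieces tend to zero, so they eventually fall below a Lebesgue number of the
pulled-back cover. -/
theorem eventually_iterSdMaps_small {O : Type u} [TopologicalSpace O] {m : Δ k → O}
    (hm : Continuous m) {𝒰 : Set (Set O)} (h𝒰 : ∀ o, ∃ U ∈ 𝒰, U ∈ nhds o) :
    ∀ᶠ n in Filter.atTop, ∀ τ ∈ iterSdMaps k n, ∃ U ∈ 𝒰, ∀ x, m (τ x) ∈ U := by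
  have := isCompact_iff_compactSpace.1 (isCompact_simplexSet k)
  choose U hU hUo using h𝒰
  obtain ⟨δ, hδ, hL⟩ := lebesgue_number_lemma_of_metric (s := (Set.univ : Set (Δ k)))
    (c := fun o => m ⁻¹' interior (U o)) isCompact_univ
    (fun o => isOpen_interior.preimage hm)
    (fun x _ => Set.mem_iUnion.2 ⟨m x, mem_interior_iff_mem_nhds.2 (hUo _)⟩)
  have hk : (0 : ℝ) ≤ k := k.cast_nonneg
  have hε : 0 ≤ 1 - ((k : ℝ) + 2)⁻¹ := (sub_pos.2 (inv_lt_one_of_one_lt₀ (by linarith))).le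
  have hlim := tendsto_pow_atTop_nhds_zero_of_lt_one hε
    (sub_lt_self 1 (by positivity : 0 < ((k : ℝ) + 2)⁻¹))
  filter_upwards [hlim.eventually (gt_mem_nhds hδ)] with n hn τ hτ
  obtain ⟨o, ho⟩ := hL (τ (vertex 0)) (Set.mem_univ _)
  refine ⟨U o, hU o, fun x => interior_subset (ho ?_)⟩
  rw [Metric.mem_ball, Subtype.dist_eq]
  refine lt_of_le_of_lt ((dist_pi_le_iff (pow_nonneg hε n)).2 fun i => ?_) hn
  simpa [barycentric, Real.dist_eq] using (abs_sub_le_of_mem_iterSdMaps hτ).2 x (vertex 0) i.succ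

end Simplex

namespace Chain

variable {A : Type u} {k : ℕ}

theorem exists_of_mem_support_iterate_sd (c : Chain A k) {n : ℕ} {σ : Δ k → A}
    (hσ : σ ∈ (sd^[n] c).support) :
    ∃ σ' ∈ c.support, ∃ τ ∈ Simplex.iterSdMaps k n, σ = σ' ∘ τ := by
  classical
  induction n generalizing σ with
  | zero => exact ⟨σ, hσ, id, rfl, rfl⟩
  | succ n ih =>
    rw [Function.iterate_succ_apply', sd, AddMonoidHom.finsetSum_apply] at hσ
    obtain ⟨π, -, hπ⟩ := Finset.mem_biUnion.1 (Finsupp.support_finsetSum hσ)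
    have h2 := Finsupp.mapDomain_support (Finsupp.support_smul hπ)
    obtain ⟨σ', h3, rfl⟩ := Finset.mem_image.1 h2
    obtain ⟨σ'', h4, τ, hτ, rfl⟩ := ih h3
    exact ⟨σ'', h4, τ ∘ Simplex.sdMap π, ⟨τ, hτ, π, rfl⟩, rfl⟩

theorem eventually_sd_small {O : Type u} [TopologicalSpace O] (c : Chain A k) {f : A → O}
    (hf : ∀ σ ∈ c.support, Continuous fun x => f (σ x)) {𝒰 : Set (Set O)}
    (h𝒰 : ∀ o, ∃ U ∈ 𝒰, U ∈ nhds o) :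
    ∀ᶠ n in Filter.atTop, ∀ σ ∈ (sd^[n] c).support, ∃ U ∈ 𝒰, ∀ x, f (σ x) ∈ U := by
  have := (Filter.eventually_all_finset c.support).2 fun σ hσ =>
    Simplex.eventually_iterSdMaps_small (hf σ hσ) h𝒰
  filter_upwards [this] with n hn σ hσ
  obtain ⟨σ', h1, τ, h2, rfl⟩ := exists_of_mem_support_iterate_sd c hσ
  exact hn σ' h1 τ h2

theorem IsSmoothChain.iterate_sd [HasSimplices A] [LawfulSimplices A] {c : Chain A k}
    (h : c.IsSmoothChain) (n : ℕ) : (Chain.sd^[n] c).IsSmoothChain := by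
  induction n with
  | zero => exact h
  | succ n ih => rw [Function.iterate_succ_apply']; exact ih.sd

theorem integral_iterate_sd {M : SmoothMfd.{u}} {α : Form k M} (hα : α.IsSmooth) {c : Chain M k}
    (hc : c.IsSmoothChain) (n : ℕ) : integral α (sd^[n] c) = integral α c := by
  induction n with
  | zero => rfl
  | succ n ih => rw [Function.iterate_succ_apply', integral_sd hα (hc.iterate_sd n), ih]

end Chain

namespace SetGroupoid

variable {A O : Type u} {𝒢 : SetGroupoid A O}

theorem iterate_sd_apply (D : 𝒢.DoubleChain) (n k p : ℕ) :
    (sd^[n] D) k p = Chain.sd^[n] (D k p) := by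
  induction n with
  | zero => rfl
  | succ n ih => rw [Function.iterate_succ_apply', Function.iterate_succ_apply', ← ih]; rfl

theorem iterate_sd_totalBd (D : 𝒢.DoubleChain) (n : ℕ) :
    sd^[n] (𝒢.totalBd D) = 𝒢.totalBd (sd^[n] D) := by
  induction n with
  | zero => rfl
  | succ n ih => rw [Function.iterate_succ_apply', Function.iterate_succ_apply', ih, sd_totalBd]

theorem Hom.push_iterate_sd {A' O' : Type u} {𝒢' : SetGroupoid A' O'} (φ : Hom 𝒢 𝒢')
    (D : 𝒢.DoubleChain) (n : ℕ) :
    φ.push (SetGroupoid.sd^[n] D) = SetGroupoid.sd^[n] (φ.push D) := by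
  induction n with
  | zero => rfl
  | succ n ih => rw [Function.iterate_succ_apply', Function.iterate_succ_apply', push_sd, ih]

variable [HasSimplices A] [HasSimplices O] [LawfulSimplices A] [𝒢.SmoothOps]

theorem IsChain.iterate_sd {m : ℕ} {D : 𝒢.DoubleChain} (h : 𝒢.IsChain m D) (n : ℕ) :
    𝒢.IsChain m (SetGroupoid.sd^[n] D) := by
  induction n with
  | zero => exact h
  | succ n ih => rw [Function.iterate_succ_apply']; exact ih.sd

theorem IsCycle.iterate_sd {m : ℕ} {D : 𝒢.DoubleChain} (h : 𝒢.IsCycle m D) (n : ℕ) :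
    𝒢.IsCycle m (SetGroupoid.sd^[n] D) := by
  induction n with
  | zero => exact h
  | succ n ih => rw [Function.iterate_succ_apply']; exact ih.sd

/-- If the map of objects has local sections, iterated subdivisions of chains can be lifted. -/
theorem IsChain.eventually_isLiftable [TopologicalSpace O] {A' O' : Type u} [HasSimplices O']
    {𝒦 : SetGroupoid A' O'} {φ : Hom 𝒦 𝒢}
    (hO : ∀ {k : ℕ} {m : Δ k → O}, HasSimplices.IsSimplex m → Continuous m)
    (hφ : ∀ o : O, ∃ U ∈ nhds o, ∀ (k : ℕ) (m : Δ k → O), HasSimplices.IsSimplex m →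
      (∀ x, m x ∈ U) → φ.Liftable m)
    {m : ℕ} {D : 𝒢.DoubleChain} (h : 𝒢.IsChain m D) :
    ∀ᶠ n in Filter.atTop, φ.IsLiftable (SetGroupoid.sd^[n] D) := by
  -- A chain of total degree `m` has components only in the finitely many bidegrees `(k, m - k)`,
  -- each with finitely many simplices and objects, so one number of subdivisions serves all of
  -- them.
  have key : ∀ k ∈ Finset.range (m + 1), ∀ᶠ n in Filter.atTop,
      ∀ i ∈ (Finset.univ : Finset (Fin (m - k + 1))),
      ∀ σ ∈ (Chain.sd^[n] (D k (m - k))).support, ∃ U ∈ {U : Set O | ∀ (k : ℕ) (m : Δ k → O),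
        HasSimplices.IsSimplex m → (∀ x, m x ∈ U) → φ.Liftable m}, ∀ x, obj (σ x) i ∈ U :=
    fun k _ => (Filter.eventually_all_finset _).2 fun i _ =>
      Chain.eventually_sd_small (D k (m - k)) (f := fun a => obj a i)
        (fun σ hσ => hO (mapsSimplices_obj i ((h k (m - k)).2 σ hσ)))
        fun o => by
          obtain ⟨U, hU, hU'⟩ := hφ o
          exact ⟨U, hU', hU⟩
  filter_upwards [(Filter.eventually_all_finset _).2 key] with n hn k p σ hσ i
  have hkp : k + p = m := by
    by_contra hne
    rw [((h.iterate_sd n) k p).1 hne] at hσ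
    simp at hσ
  obtain rfl : p = m - k := by omega
  rw [iterate_sd_apply] at hσ
  obtain ⟨U, hU, hU'⟩ := hn k (Finset.mem_range.2 (by omega)) i (Finset.mem_univ i) σ hσ
  exact hU k _ (mapsSimplices_obj i (((h k (m - k)).2.iterate_sd n) σ hσ)) hU'

end SetGroupoid

/-! ### Stokes' theorem for Lipschitz maps on a cube -/

section LipschitzStokes

open MeasureTheory Filter

open scoped Topology NNReal

variable {V : Type*} [NormedAddCommGroup V] [NormedSpace ℝ V] {n : ℕ}

/-- The sum of a `2`-form over the boundary of a square with two edges `u`, `v`. -/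
def squareSum (β : V [⋀^Fin 2]→L[ℝ] ℝ) (g : (Fin n → ℝ) → V) (x u v : Fin n → ℝ) : ℝ :=
  β ![g (x + u) - g x, g (x + u + v) - g (x + u)] - β ![g (x + v) - g x, g (x + u + v) - g (x + v)]

theorem alternating_add_left (β : V [⋀^Fin 2]→L[ℝ] ℝ) (a b c : V) :
    β ![a + b, c] = β ![a, c] + β ![b, c] := β.cons_add ![c] a b

theorem alternating_smul_left (β : V [⋀^Fin 2]→L[ℝ] ℝ) (r : ℝ) (a c : V) :
    β ![r • a, c] = r * β ![a, c] := β.cons_smul ![c] r a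

theorem alternating_swap (β : V [⋀^Fin 2]→L[ℝ] ℝ) (a b : V) : β ![a, b] = -β ![b, a] := by
  have h := β.toAlternatingMap.map_swap ![b, a] (show (0 : Fin 2) ≠ 1 by decide)
  have e : ![b, a] ∘ Equiv.swap (0 : Fin 2) 1 = ![a, b] := by
    funext i; fin_cases i <;> simp
  rw [e] at h
  exact h

theorem alternating_sub_left (β : V [⋀^Fin 2]→L[ℝ] ℝ) (a b c : V) :
    β ![a - b, c] = β ![a, c] - β ![b, c] := by
  have := alternating_add_left β (a - b) b c
  rw [sub_add_cancel] at this
  linarith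

theorem alternating_sub_right (β : V [⋀^Fin 2]→L[ℝ] ℝ) (a b c : V) :
    β ![c, a - b] = β ![c, a] - β ![c, b] := by
  rw [alternating_swap, alternating_sub_left, alternating_swap β c, alternating_swap β c]
  ring

theorem alternating_smul_right (β : V [⋀^Fin 2]→L[ℝ] ℝ) (r : ℝ) (a c : V) :
    β ![c, r • a] = r * β ![c, a] := by
  rw [alternating_swap, alternating_smul_left, alternating_swap β c]
  ring

theorem alternating_self (β : V [⋀^Fin 2]→L[ℝ] ℝ) (a : V) : β ![a, a] = 0 := by
  linarith [alternating_swap β a a]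

/-- The sum of `β (start, end)` over the four oriented edges of the square. Edges cancel between
adjacent faces of a cube, which is why only variations of the form survive in `squareSum_cube`. -/
theorem squareSum_eq (β : V [⋀^Fin 2]→L[ℝ] ℝ) (g : (Fin n → ℝ) → V) (x u v : Fin n → ℝ) :
    squareSum β g x u v = β ![g (x + u), g (x + u + v)] - β ![g (x + v), g (x + u + v)] +
      β ![g x, g (x + u)] - β ![g x, g (x + v)] := by
  simp only [squareSum, alternating_sub_left, alternating_sub_right, alternating_self]
  ring

theorem squareSum_sub (β η : V [⋀^Fin 2]→L[ℝ] ℝ) (g : (Fin n → ℝ) → V) (x u v : Fin n → ℝ) :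
    squareSum (β - η) g x u v = squareSum β g x u v - squareSum η g x u v := by
  simp only [squareSum, ContinuousAlternatingMap.sub_apply]
  ring

/-- The sum of a constant form over the boundary of a cube vanishes. -/
theorem squareSum_cube (A : (Fin n → ℝ) → V [⋀^Fin 2]→L[ℝ] ℝ) (g : (Fin n → ℝ) → V)
    (x u v w : Fin n → ℝ) :
    (squareSum (A (x + u)) g (x + u) v w - squareSum (A x) g x v w) -
      (squareSum (A (x + v)) g (x + v) u w - squareSum (A x) g x u w) +
      (squareSum (A (x + w)) g (x + w) u v - squareSum (A x) g x u v) =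
    squareSum (A (x + u) - A x) g (x + u) v w - squareSum (A (x + v) - A x) g (x + v) u w +
      squareSum (A (x + w) - A x) g (x + w) u v := by
  have e1 : x + v + u = x + u + v := add_right_comm _ _ _
  have e2 : x + w + u = x + u + w := add_right_comm _ _ _
  have e3 : x + w + v = x + v + w := add_right_comm _ _ _
  have e4 : x + u + w + v = x + u + v + w := add_right_comm _ _ _
  simp only [squareSum_sub]
  simp only [squareSum_eq, e1, e2, e3, e4]
  ring

/-- All vertices are compared with the value at `x`, so differentiability at the single point `x`
suffices even though the square is based at `x + h • w`. The factor `2` appears because the square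
sum measures twice the area. -/
theorem tendsto_squareSum {g : (Fin n → ℝ) → V} {g' : (Fin n → ℝ) →L[ℝ] V} {x : Fin n → ℝ}
    (hg : HasFDerivAt g g' x) {β : ℝ → V [⋀^Fin 2]→L[ℝ] ℝ} {η : V [⋀^Fin 2]→L[ℝ] ℝ}
    (hβ : Tendsto β (𝓝[>] 0) (𝓝 η)) (u v w : Fin n → ℝ) :
    Tendsto (fun h : ℝ => h⁻¹ ^ 2 * squareSum (β h) g (x + h • w) (h • u) (h • v)) (𝓝[>] 0)
      (𝓝 (2 * η ![g' u, g' v])) := by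
  have h0 : ∀ p : Fin n → ℝ, Tendsto (fun h : ℝ => h⁻¹ • (g (x + h • p) - g x)) (𝓝[>] 0)
      (𝓝 (g' p)) := by
    intro p
    have h1 := (hg.hasLineDerivAt p).tendsto_slope_zero_right
    exact h1
  have h1 : ∀ p q : Fin n → ℝ, Tendsto (fun h : ℝ => h⁻¹ • (g (x + h • p) - g (x + h • q))) (𝓝[>] 0)
      (𝓝 (g' (p - q))) := by
    intro p q
    rw [map_sub]
    refine ((h0 p).sub (h0 q)).congr fun h => ?_
    rw [← smul_sub, sub_sub_sub_cancel_right]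
  have h2 : ∀ p q r s : Fin n → ℝ, Tendsto (fun h : ℝ => h⁻¹ ^ 2 *
      β h ![g (x + h • p) - g (x + h • q), g (x + h • r) - g (x + h • s)]) (𝓝[>] 0)
      (𝓝 (η ![g' (p - q), g' (r - s)])) := by
    intro p q r s
    have hv : Tendsto (fun h : ℝ => ![h⁻¹ • (g (x + h • p) - g (x + h • q)),
        h⁻¹ • (g (x + h • r) - g (x + h • s))]) (𝓝[>] 0) (𝓝 ![g' (p - q), g' (r - s)]) := by
      rw [tendsto_pi_nhds]
      intro i
      fin_cases i
      · exact h1 p q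
      · exact h1 r s
    refine (hβ.eval hv).congr fun h => ?_
    rw [alternating_smul_left, alternating_smul_right]
    ring
  have h3 := (h2 (w + u) w (w + u + v) (w + u)).sub (h2 (w + v) w (w + u + v) (w + v))
  have e1 : w + u - w = u := by abel
  have e2 : w + u + v - (w + u) = v := by abel
  have e3 : w + v - w = v := by abel
  have e4 : w + u + v - (w + v) = u := by abel
  rw [e1, e2, e3, e4, alternating_swap η (g' v), sub_neg_eq_add, ← two_mul] at h3
  refine h3.congr fun h => ?_
  simp only [squareSum, smul_add, ← add_assoc]
  ring

theorem abs_squareSum_le {K : ℝ≥0} {g : (Fin n → ℝ) → V} (hg : LipschitzWith K g)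
    (β : V [⋀^Fin 2]→L[ℝ] ℝ) (x : Fin n → ℝ) {u v : Fin n → ℝ} {h : ℝ} (hu : ‖u‖ ≤ h)
    (hv : ‖v‖ ≤ h) : |squareSum β g x u v| ≤ 2 * (‖β‖ * (K * h) ^ 2) := by
  have h0 : 0 ≤ h := (norm_nonneg u).trans hu
  have hd : ∀ p q : Fin n → ℝ, ‖q‖ ≤ h → ‖g (p + q) - g p‖ ≤ K * h := by
    intro p q hq
    have := hg.dist_le_mul (p + q) p
    rw [dist_eq_norm, dist_eq_norm, add_sub_cancel_left] at this
    exact this.trans (mul_le_mul_of_nonneg_left hq K.2)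
  have hb : ∀ a b : V, ‖a‖ ≤ K * h → ‖b‖ ≤ K * h → |β ![a, b]| ≤ ‖β‖ * (K * h) ^ 2 := by
    intro a b ha hb
    refine (β.le_opNorm _).trans (mul_le_mul_of_nonneg_left ?_ (norm_nonneg _))
    rw [Fin.prod_univ_two, pow_two]
    exact mul_le_mul ha hb (norm_nonneg _) (mul_nonneg K.2 h0)
  have h1 := hb _ _ (hd x u hu) (hd (x + u) v hv)
  have h2 := hb _ _ (hd x v hv) (hd (x + v) u hu)
  rw [add_right_comm x v u] at h2
  rw [squareSum]
  exact (abs_sub _ _).trans (by linarith)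

theorem continuous_squareSum {g : (Fin n → ℝ) → V} (hg : Continuous g)
    {A : (Fin n → ℝ) → V [⋀^Fin 2]→L[ℝ] ℝ} (hA : Continuous A) (u v : Fin n → ℝ) :
    Continuous fun x => squareSum (A x) g x u v := by
  have key : ∀ p q r s : Fin n → ℝ,
      Continuous fun x => A x ![g (x + p) - g (x + q), g (x + r) - g (x + s)] := by
    intro p q r s
    have h₁ : Continuous fun x => g (x + p) - g (x + q) := by fun_prop
    have h₂ : Continuous fun x => g (x + r) - g (x + s) := by fun_prop
    refine hA.eval (continuous_pi fun i => ?_)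
    fin_cases i
    · exact h₁
    · exact h₂
  refine ((key u 0 (u + v) u).sub (key v 0 (u + v) v)).congr fun x => ?_
  simp only [squareSum, Pi.sub_apply, add_zero, add_assoc]

/-- After integrating out the other coordinates, the left side is `∫ (Φ (t + h) - Φ t)` over `[-1,
1]`, which telescopes to integrals over `[1, 1 + h]` and `[-1, -1 + h]`. On both intervals `Φ` is
constant, the second one lying in `t ≤ 0` because `h ≤ 1`. This margin is the reason for integrating
over `[-1, 1]` instead of `[0, 1]`. -/
theorem integral_shift_sub {φ : (Fin (n + 1) → ℝ) → ℝ} (hφ : Continuous φ) (i : Fin (n + 1))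
    (h1 : ∀ (t : ℝ) y, 1 ≤ t → φ (i.insertNth t y) = φ (i.insertNth 1 y))
    (h0 : ∀ (t : ℝ) y, t ≤ 0 → φ (i.insertNth t y) = φ (i.insertNth 0 y))
    {h : ℝ} (hh : 0 < h) (hh1 : h ≤ 1) :
    ∫ x in Set.Icc (-1) 1, (φ (x + h • Pi.single i 1) - φ x) =
      h * ((∫ y in Set.Icc (-1) 1, φ (i.insertNth 1 y)) -
        ∫ y in Set.Icc (-1) 1, φ (i.insertNth 0 y)) := by
  have hins : Continuous fun p : ℝ × (Fin n → ℝ) =>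
      (i.insertNth p.1 p.2 : Fin (n + 1) → ℝ) := by fun_prop
  have hφ' : Continuous fun p : ℝ × (Fin n → ℝ) => φ (i.insertNth p.1 p.2) := hφ.comp hins
  set Φ : ℝ → ℝ := fun t => ∫ y in Set.Icc (-1) 1, φ (i.insertNth t y)
  have hΦ : Continuous Φ := continuous_parametric_integral_of_continuous
    (f := fun t (y : Fin n → ℝ) => φ (i.insertNth t y)) hφ' isCompact_Icc
  have hmp := volume_preserving_piFinSuccAbove (fun _ : Fin (n + 1) => ℝ) i
  have hset : (Set.Icc (-1) 1 : Set (Fin (n + 1) → ℝ)) =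
      MeasurableEquiv.piFinSuccAbove (fun _ : Fin (n + 1) => ℝ) i ⁻¹'
        (Set.Icc (-1) 1 ×ˢ Set.Icc (-1) 1) := by
    ext x
    simp only [Set.mem_preimage, Set.mem_prod, Set.mem_Icc, Pi.le_def,
      MeasurableEquiv.piFinSuccAbove_apply, Fin.insertNthEquiv_symm_apply, Fin.removeNth,
      Pi.neg_apply, Pi.one_apply]
    constructor
    · rintro ⟨h1, h2⟩
      exact ⟨⟨h1 _, h2 _⟩, fun j => h1 _, fun j => h2 _⟩
    · rintro ⟨⟨h1, h2⟩, h3, h4⟩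
      exact ⟨fun j => Fin.succAboveCases i h1 h3 j, fun j => Fin.succAboveCases i h2 h4 j⟩
  have hstep : ∫ x in Set.Icc (-1) 1, (φ (x + h • Pi.single i 1) - φ x) =
      ∫ p in (Set.Icc (-1) 1 : Set ℝ) ×ˢ (Set.Icc (-1) 1 : Set (Fin n → ℝ)),
        (φ (i.insertNth (p.1 + h) p.2) - φ (i.insertNth p.1 p.2)) := by
    rw [hset, ← hmp.setIntegral_preimage_emb (MeasurableEquiv.measurableEmbedding _)]
    refine integral_congr_ae (Eventually.of_forall fun x => ?_)
    simp only [MeasurableEquiv.piFinSuccAbove_apply, Fin.insertNthEquiv_symm_apply,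
      Fin.insertNth_self_removeNth]
    congr 2
    funext j
    refine Fin.succAboveCases i ?_ (fun j => ?_) j
    · simp
    · simp [Fin.removeNth]
  rw [hstep, Measure.volume_eq_prod, setIntegral_prod]
  · have hinner : ∀ t : ℝ, ∫ y in Set.Icc (-1) 1, (φ (i.insertNth (t + h) y) -
        φ (i.insertNth t y)) = Φ (t + h) - Φ t := by
      intro t
      refine integral_sub ?_ ?_
      · exact Continuous.integrableOn_Icc (hφ'.comp (by fun_prop : Continuous fun y => (t + h, y)))
      · exact Continuous.integrableOn_Icc (hφ'.comp (by fun_prop : Continuous fun y => (t, y)))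
    simp only [hinner]
    have hc1 : ∀ t, 1 ≤ t → Φ t = Φ 1 := fun t ht => by simp only [Φ, h1 t _ ht]
    have hc0 : ∀ t, t ≤ 0 → Φ t = Φ 0 := fun t ht => by simp only [Φ, h0 t _ ht]
    rw [integral_Icc_eq_integral_Ioc, ← intervalIntegral.integral_of_le (by norm_num),
      intervalIntegral.integral_sub (f := fun t => Φ (t + h))
        ((hΦ.comp (continuous_add_const h)).intervalIntegrable _ _) (hΦ.intervalIntegrable _ _),
      intervalIntegral.integral_comp_add_right,
      intervalIntegral.integral_interval_sub_interval_comm' (hΦ.intervalIntegrable _ _)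
        (hΦ.intervalIntegrable _ _) (hΦ.intervalIntegrable _ _)]
    have i1 : ∫ t in (1 : ℝ)..1 + h, Φ t = ∫ t in (1 : ℝ)..1 + h, Φ 1 := by
      refine intervalIntegral.integral_congr fun t ht => hc1 t ?_
      rw [Set.uIcc_of_le (by linarith)] at ht
      exact ht.1
    have i0 : ∫ t in (-1 : ℝ)..-1 + h, Φ t = ∫ t in (-1 : ℝ)..-1 + h, Φ 0 := by
      refine intervalIntegral.integral_congr fun t ht => hc0 t ?_
      rw [Set.uIcc_of_le (by linarith)] at ht
      linarith [ht.2]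
    rw [i1, i0]
    simp [Φ, mul_sub]
  · have : Continuous fun p : ℝ × (Fin n → ℝ) =>
        φ (i.insertNth (p.1 + h) p.2) - φ (i.insertNth p.1 p.2) :=
      (hφ'.comp (by fun_prop : Continuous fun p : ℝ × (Fin n → ℝ) => (p.1 + h, p.2))).sub hφ'
    rw [← Measure.volume_eq_prod]
    exact this.continuousOn.integrableOn_compact (isCompact_Icc.prod isCompact_Icc)

/-- The integral of the pull-back of a `2`-form to the square, where `A` is the `2`-form along the
map `g`. -/
def squareIntegral (A : (Fin 2 → ℝ) → V [⋀^Fin 2]→L[ℝ] ℝ) (g : (Fin 2 → ℝ) → V) : ℝ :=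
  ∫ y in Set.Icc (-1) 1, A y ![fderiv ℝ g y (Pi.single 0 1), fderiv ℝ g y (Pi.single 1 1)]

theorem norm_smul_single_le (i : Fin n) {h : ℝ} (hh : 0 < h) :
    ‖h • (Pi.single i 1 : Fin n → ℝ)‖ ≤ h := by
  rw [norm_smul, Real.norm_eq_abs, abs_of_pos hh]
  refine mul_le_of_le_one_right hh.le ((pi_norm_le_iff_of_nonneg zero_le_one).2 fun j => ?_)
  by_cases hj : j = i
  · subst hj; simp
  · simp [hj]

theorem lipschitzWith_insertNth {K : ℝ≥0} {W : Type*} [PseudoEMetricSpace W]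
    {g : (Fin (n + 1) → ℝ) → W} (hg : LipschitzWith K g) (i : Fin (n + 1)) (t : ℝ) :
    LipschitzWith K fun y => g (i.insertNth t y) := by
  have : LipschitzWith 1 fun y : Fin n → ℝ => (i.insertNth t y : Fin (n + 1) → ℝ) := by
    refine LipschitzWith.of_dist_le_mul fun y y' => ?_
    rw [NNReal.coe_one, one_mul]
    refine (dist_pi_le_iff dist_nonneg).2 fun j => ?_
    refine Fin.succAboveCases i ?_ (fun j => ?_) j
    · simp
    · simpa using dist_le_pi_dist y y' j
  have h := hg.comp this
  rw [mul_one] at h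
  exact h

variable [FiniteDimensional ℝ V]

/-- Rademacher's theorem gives pointwise convergence almost everywhere, and the Lipschitz constant
provides the dominating constant. -/
theorem tendsto_integral_squareSum {K C : ℝ≥0} {g : (Fin 2 → ℝ) → V} (hg : LipschitzWith K g)
    {A : (Fin 2 → ℝ) → V [⋀^Fin 2]→L[ℝ] ℝ} (hA : Continuous A) (hC : ∀ x, ‖A x‖ ≤ C) :
    Tendsto (fun h : ℝ => h⁻¹ ^ 2 * ∫ y in Set.Icc (-1) 1,
      squareSum (A y) g y (h • Pi.single 0 1) (h • Pi.single 1 1)) (𝓝[>] 0)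
      (𝓝 (2 * squareIntegral A g)) := by
  simp only [squareIntegral, ← integral_const_mul]
  have hpos : ∀ᶠ h : ℝ in 𝓝[>] 0, 0 < h := self_mem_nhdsWithin
  refine tendsto_integral_filter_of_dominated_convergence (fun _ => 2 * (C * K ^ 2)) ?_ ?_ ?_ ?_
  · exact Eventually.of_forall fun h =>
      ((continuous_squareSum hg.continuous hA _ _).const_mul _).aestronglyMeasurable
  · filter_upwards [hpos] with h hh
    refine Eventually.of_forall fun y => ?_
    have h1 := abs_squareSum_le hg (A y) y (u := h • Pi.single 0 1) (v := h • Pi.single 1 1) (h := h)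
      (norm_smul_single_le _ hh) (norm_smul_single_le _ hh)
    rw [Real.norm_eq_abs, abs_mul, abs_of_pos (by positivity : 0 < h⁻¹ ^ 2)]
    calc h⁻¹ ^ 2 * _ ≤ h⁻¹ ^ 2 * (2 * (‖A y‖ * (K * h) ^ 2)) := by gcongr
      _ = 2 * (‖A y‖ * K ^ 2) := by field_simp
      _ ≤ _ := by gcongr; exact hC y
  · exact continuous_const.integrableOn_Icc
  · refine ae_restrict_of_ae ?_
    filter_upwards [hg.ae_differentiableAt] with y hy
    have := tendsto_squareSum hy.hasFDerivAt (tendsto_const_nhds (x := A y)) (Pi.single 0 1)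
      (Pi.single 1 1) 0
    simpa using this

/-- Stokes' theorem for a Lipschitz map `g` of the cube and a Lipschitz `2`-form `A` along `g`. -/
theorem integral_cube_eq {K K' C : ℝ≥0} {g : (Fin 3 → ℝ) → V} (hg : LipschitzWith K g)
    {A : (Fin 3 → ℝ) → V [⋀^Fin 2]→L[ℝ] ℝ} (hA : LipschitzWith K' A) (hC : ∀ x, ‖A x‖ ≤ C)
    (hAd : ∀ x, DifferentiableAt ℝ g x → DifferentiableAt ℝ A x)
    (hg1 : ∀ (i : Fin 3) (t : ℝ) y, 1 ≤ t → g (i.insertNth t y) = g (i.insertNth 1 y))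
    (hg0 : ∀ (i : Fin 3) (t : ℝ) y, t ≤ 0 → g (i.insertNth t y) = g (i.insertNth 0 y))
    (hA1 : ∀ (i : Fin 3) (t : ℝ) y, 1 ≤ t → A (i.insertNth t y) = A (i.insertNth 1 y))
    (hA0 : ∀ (i : Fin 3) (t : ℝ) y, t ≤ 0 → A (i.insertNth t y) = A (i.insertNth 0 y)) :
    ∫ x in Set.Icc (-1) 1, ∑ i : Fin 3, (-1 : ℝ) ^ (i : ℕ) * fderiv ℝ A x (Pi.single i 1)
      ![fderiv ℝ g x (Pi.single (i.succAbove 0) 1), fderiv ℝ g x (Pi.single (i.succAbove 1) 1)] =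
    ∑ i : Fin 3, (-1 : ℝ) ^ (i : ℕ) *
      (squareIntegral (fun y => A (i.insertNth 1 y)) (fun y => g (i.insertNth 1 y)) -
        squareIntegral (fun y => A (i.insertNth 0 y)) (fun y => g (i.insertNth 0 y))) := by
  let e : Fin 3 → Fin 3 → ℝ := fun i => Pi.single i 1
  let S : ℝ → Fin 3 → (Fin 3 → ℝ) → ℝ := fun h i x =>
    squareSum (A x) g x (h • e (i.succAbove 0)) (h • e (i.succAbove 1))
  have hScont : ∀ h i, Continuous (S h i) := fun h i =>
    continuous_squareSum hg.continuous hA.continuous _ _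
  have hSins : ∀ h i t y, S h i (i.insertNth t y) = squareSum (A (i.insertNth t y))
      (fun y => g (i.insertNth t y)) y (h • Pi.single 0 1) (h • Pi.single 1 1) := by
    intro h i t y
    have key : ∀ (y u : Fin 2 → ℝ) (j : Fin 2) (c : ℝ),
        (i.insertNth t y : Fin 3 → ℝ) + c • e (i.succAbove j) =
          i.insertNth t (y + c • Pi.single j 1) := by
      intro y u j c
      funext l
      refine Fin.succAboveCases i ?_ (fun l => ?_) l
      · simp [e]
      · by_cases hl : l = j
        · subst hl; simp [e]
        · have : i.succAbove l ≠ i.succAbove j := fun hh => hl (Fin.succAbove_right_injective hh)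
          simp [e, hl]
    simp only [S, squareSum, key _ 0]
  have hpos : ∀ᶠ h : ℝ in 𝓝[>] 0, 0 < h := self_mem_nhdsWithin
  have hle : ∀ᶠ h : ℝ in 𝓝[>] 0, h ≤ 1 :=
    mem_nhdsWithin_of_mem_nhds (Iic_mem_nhds one_pos)
  have hnorm : ∀ (h : ℝ) (i : Fin 3), 0 < h → ‖h • e i‖ ≤ h := fun h i hh =>
    norm_smul_single_le i hh
  -- `Θ h x` is the sum over the boundary of the cube of side `h` at `x`. In the equal expression
  -- `Ψ` each term contains an increment of `A`, so it is of order `h ^ 3` and `h⁻¹ ^ 3 * Ψ` tends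
  -- to the exterior derivative of the pull-back, up to the factor `2`.
  let Θ : ℝ → (Fin 3 → ℝ) → ℝ := fun h x => ∑ i : Fin 3, (-1 : ℝ) ^ (i : ℕ) *
    (S h i (x + h • e i) - S h i x)
  let Ψ : ℝ → (Fin 3 → ℝ) → ℝ := fun h x => ∑ i : Fin 3, (-1 : ℝ) ^ (i : ℕ) *
    squareSum (A (x + h • e i) - A x) g (x + h • e i) (h • e (i.succAbove 0))
      (h • e (i.succAbove 1))
  have hΘΨ : ∀ h x, Θ h x = Ψ h x := by
    intro h x
    have := squareSum_cube A g x (h • e 0) (h • e 1) (h • e 2)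
    simp only [Θ, Ψ, S, Fin.sum_univ_three]
    simp only [show (0 : Fin 3).succAbove (0 : Fin 2) = 1 by decide,
      show (0 : Fin 3).succAbove (1 : Fin 2) = 2 by decide,
      show (1 : Fin 3).succAbove (0 : Fin 2) = 0 by decide,
      show (1 : Fin 3).succAbove (1 : Fin 2) = 2 by decide,
      show (2 : Fin 3).succAbove (0 : Fin 2) = 0 by decide,
      show (2 : Fin 3).succAbove (1 : Fin 2) = 1 by decide]
    simp only [Fin.val_zero, Fin.val_one, Fin.val_two, pow_zero, pow_one, one_mul, neg_mul]
    linarith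
  -- the integral over the cube
  have hlim1 : Tendsto (fun h : ℝ => ∫ x in Set.Icc (-1) 1, h⁻¹ ^ 3 * Θ h x) (𝓝[>] 0)
      (𝓝 (∫ x in Set.Icc (-1) 1, ∑ i : Fin 3, (-1 : ℝ) ^ (i : ℕ) *
        (2 * fderiv ℝ A x (e i) ![fderiv ℝ g x (e (i.succAbove 0)),
          fderiv ℝ g x (e (i.succAbove 1))]))) := by
    refine tendsto_integral_filter_of_dominated_convergence
      (fun _ => ∑ i : Fin 3, 2 * (K' * K ^ 2 : ℝ)) ?_ ?_
      (Continuous.integrableOn_Icc continuous_const) ?_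
    · refine Eventually.of_forall fun h => ?_
      refine Continuous.aestronglyMeasurable (continuous_const.mul
        (continuous_finsetSum _ fun i _ => continuous_const.mul (((hScont h i).comp
          (continuous_add_const _)).sub (hScont h i))))
    · filter_upwards [hpos] with h hh
      refine Eventually.of_forall fun x => ?_
      rw [hΘΨ, Finset.mul_sum]
      refine (norm_sum_le _ _).trans (Finset.sum_le_sum fun i _ => ?_)
      have h1 := abs_squareSum_le hg (A (x + h • e i) - A x) (x + h • e i)
        (hnorm h (i.succAbove 0) hh) (hnorm h (i.succAbove 1) hh)
      have h2 : ‖A (x + h • e i) - A x‖ ≤ K' * h := by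
        have := hA.dist_le_mul (x + h • e i) x
        rw [dist_eq_norm, dist_eq_norm, add_sub_cancel_left] at this
        exact this.trans (mul_le_mul_of_nonneg_left (hnorm h i hh) K'.2)
      have h3 : ‖(-1 : ℝ) ^ (i : ℕ)‖ = 1 := by simp
      rw [norm_mul, norm_mul, h3, one_mul, Real.norm_eq_abs, Real.norm_eq_abs,
        abs_of_pos (by positivity : 0 < h⁻¹ ^ 3)]
      calc h⁻¹ ^ 3 * _ ≤ h⁻¹ ^ 3 * (2 * (‖A (x + h • e i) - A x‖ * (K * h) ^ 2)) := by gcongr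
        _ ≤ h⁻¹ ^ 3 * (2 * (K' * h * (K * h) ^ 2)) := by gcongr
        _ = 2 * (K' * K ^ 2) := by field_simp
    · refine ae_restrict_of_ae ?_
      filter_upwards [hg.ae_differentiableAt] with x hx
      have hx' := hAd x hx
      simp only [hΘΨ, Ψ, Finset.mul_sum]
      refine tendsto_finsetSum _ fun i _ => ?_
      have h1 : Tendsto (fun h : ℝ => h⁻¹ • (A (x + h • e i) - A x)) (𝓝[>] 0)
          (𝓝 (fderiv ℝ A x (e i))) := (hx'.hasFDerivAt.hasLineDerivAt (e i)).tendsto_slope_zero_right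
      refine ((tendsto_squareSum hx.hasFDerivAt h1 (e (i.succAbove 0)) (e (i.succAbove 1))
        (e i)).const_mul ((-1) ^ (i : ℕ))).congr fun h => ?_
      simp only [squareSum, ContinuousAlternatingMap.smul_apply, smul_eq_mul]
      ring
  -- the integral over the boundary
  have hlim2 : Tendsto (fun h : ℝ => ∑ i : Fin 3, (-1 : ℝ) ^ (i : ℕ) *
      (h⁻¹ ^ 2 * (∫ y in Set.Icc (-1) 1, S h i (i.insertNth 1 y)) -
        h⁻¹ ^ 2 * ∫ y in Set.Icc (-1) 1, S h i (i.insertNth 0 y))) (𝓝[>] 0)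
      (𝓝 (∑ i : Fin 3, (-1 : ℝ) ^ (i : ℕ) *
        (2 * squareIntegral (fun y => A (i.insertNth 1 y)) (fun y => g (i.insertNth 1 y)) -
        2 * squareIntegral (fun y => A (i.insertNth 0 y)) (fun y => g (i.insertNth 0 y))))) := by
    simp only [hSins]
    refine tendsto_finsetSum _ fun i _ => Tendsto.const_mul _ (Tendsto.sub ?_ ?_)
    · exact tendsto_integral_squareSum (lipschitzWith_insertNth hg i 1)
        (lipschitzWith_insertNth hA i 1).continuous fun y => hC _
    · exact tendsto_integral_squareSum (lipschitzWith_insertNth hg i 0)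
        (lipschitzWith_insertNth hA i 0).continuous fun y => hC _
  -- Integrated over all positions `x`, opposite faces of the small cubes telescope, and only the
  -- walls `1` and `0` in each direction remain, with one factor `h`.
  have heq : ∀ᶠ h : ℝ in 𝓝[>] 0, ∫ x in Set.Icc (-1) 1, h⁻¹ ^ 3 * Θ h x =
      ∑ i : Fin 3, (-1 : ℝ) ^ (i : ℕ) *
      (h⁻¹ ^ 2 * (∫ y in Set.Icc (-1) 1, S h i (i.insertNth 1 y)) -
        h⁻¹ ^ 2 * ∫ y in Set.Icc (-1) 1, S h i (i.insertNth 0 y)) := by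
    filter_upwards [hpos, hle] with h hh hh1
    have hint : ∀ i : Fin 3, IntegrableOn (fun x => (-1 : ℝ) ^ (i : ℕ) * (S h i (x + h • e i) - S h i x))
        (Set.Icc (-1) 1) := fun i => (continuous_const.mul (((hScont h i).comp
          (continuous_add_const _)).sub (hScont h i))).integrableOn_Icc
    rw [integral_const_mul]
    simp only [Θ]
    rw [integral_finsetSum _ fun i _ => hint i, Finset.mul_sum]
    refine Finset.sum_congr rfl fun i _ => ?_
    rw [integral_const_mul, integral_shift_sub (hScont h i) i ?_ ?_ hh hh1]
    · field_simp
    · intro t y ht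
      rw [hSins, hSins]
      simp only [squareSum, hA1 i t _ ht, hg1 i t _ ht]
    · intro t y ht
      rw [hSins, hSins]
      simp only [squareSum, hA0 i t _ ht, hg0 i t _ ht]
  have hfin := tendsto_nhds_unique (hlim1.congr' heq) hlim2
  have h2 : ∀ a b c : ℝ, a * (2 * b - 2 * c) = 2 * (a * (b - c)) := fun a b c => by ring
  have h3 : ∀ a b : ℝ, a * (2 * b) = 2 * (a * b) := fun a b => by ring
  simp only [h2, h3, ← Finset.mul_sum, integral_const_mul] at hfin
  linarith

end LipschitzStokes

/-! ### Lipschitz estimates for piecewise smooth maps, and a Lipschitz retraction onto the simplex.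
-/

section Retraction

open MeasureTheory Filter

open scoped Topology NNReal

variable {V : Type*} [NormedAddCommGroup V] [NormedSpace ℝ V] {n : ℕ}

/-- A function which is Lipschitz on each of finitely many closed sets covering a convex set is
Lipschitz there. -/
theorem lipschitzOnWith_of_cover {E W : Type*} [NormedAddCommGroup E] [NormedSpace ℝ E]
    [PseudoMetricSpace W] {S : Set E}
    (hS : Convex ℝ S) {𝒬 : Set (Set E)} (hfin : 𝒬.Finite) (hcov : S ⊆ ⋃₀ 𝒬)
    (hclosed : ∀ Q ∈ 𝒬, IsClosed Q) {f : E → W} (hf : ContinuousOn f S) {K : ℝ≥0}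
    (hK : ∀ Q ∈ 𝒬, LipschitzOnWith K f (S ∩ Q)) : LipschitzOnWith K f S := by
  refine LipschitzOnWith.of_dist_le_mul fun y hy x hx => ?_
  -- The estimate is propagated along the segment from `x` to `y`: the parameters where it holds
  -- form a closed set, and it is shown that from each of them one can move further to the right.
  let γ : ℝ → E := fun t => AffineMap.lineMap x y t
  have hγ : Continuous γ := AffineMap.lineMap_continuous
  have hγS : ∀ t ∈ Set.Icc (0 : ℝ) 1, γ t ∈ S := fun t ht => hS.lineMap_mem hx hy ht
  have hγd : ∀ s t, dist (γ s) (γ t) = dist s t * dist y x := fun s t => by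
    rw [dist_lineMap_lineMap, dist_comm y x]
  have hF : ContinuousOn (fun t => f (γ t)) (Set.Icc 0 1) := hf.comp hγ.continuousOn hγS
  have hcl : IsClosed ({t | dist (f (γ t)) (f x) ≤ K * (t * dist y x)} ∩ Set.Icc 0 1) := by
    have h0 : ContinuousOn (fun t => dist (f (γ t)) (f x)) (Set.Icc 0 1) := fun t ht =>
      Filter.Tendsto.dist (hF t ht) tendsto_const_nhds
    have h1 : ContinuousOn (fun t => (dist (f (γ t)) (f x), (K : ℝ) * (t * dist y x)))
        (Set.Icc 0 1) := h0.prodMk (by fun_prop)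
    rw [Set.inter_comm]
    exact h1.preimage_isClosed_of_isClosed isClosed_Icc OrderClosedTopology.isClosed_le'
  have hsub : Set.Icc (0 : ℝ) 1 ⊆ {t | dist (f (γ t)) (f x) ≤ K * (t * dist y x)} := by
    refine hcl.Icc_subset_of_forall_exists_gt (by simp [γ]) ?_
    rintro t ⟨ht, ht01⟩ z hz
    have h1 : ∀ᶠ s in 𝓝[>] t, ∃ Q ∈ 𝒬, γ s ∈ Q := by
      filter_upwards [Ioc_mem_nhdsGT ht01.2] with s hs
      exact hcov (hγS s ⟨ht01.1.trans hs.1.le, hs.2⟩)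
    -- Since the cover is finite, a single `Q` meets the segment arbitrarily close to the right of
    -- `t`. As `Q` is closed it contains `γ t` too, and the estimate on `Q` applies between `t` and
    -- such an `s`.
    have h2 : ∃ Q ∈ 𝒬, ∃ᶠ s in 𝓝[>] t, γ s ∈ Q := by
      by_contra! hc
      have h3 : ∀ᶠ s in 𝓝[>] t, ∀ Q ∈ 𝒬, γ s ∉ Q :=
        (Filter.eventually_all_finite hfin).2 hc
      obtain ⟨s, ⟨Q, hQ, hs⟩, hs'⟩ := (h1.and h3).exists
      exact hs' Q hQ hs
    obtain ⟨Q, hQ, hfr⟩ := h2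
    have htQ : γ t ∈ Q := by
      have : IsClosed (γ ⁻¹' Q) := (hclosed Q hQ).preimage hγ
      exact this.mem_of_frequently_of_tendsto hfr (tendsto_id.mono_left nhdsWithin_le_nhds)
    obtain ⟨s, hs, hsz, hs1⟩ := (hfr.and_eventually (Filter.inter_mem
      (Ioc_mem_nhdsGT (Set.mem_Ioi.1 hz)) (Ioc_mem_nhdsGT ht01.2))).exists
    have hs01 : s ∈ Set.Icc (0 : ℝ) 1 := ⟨ht01.1.trans hs1.1.le, hs1.2⟩
    have h4 := (hK Q hQ).dist_le_mul _ ⟨hγS s hs01, hs⟩ _ ⟨hγS t ⟨ht01.1, ht01.2.le⟩, htQ⟩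
    rw [hγd, Real.dist_eq, abs_of_pos (sub_pos.2 hsz.1)] at h4
    have h5 := dist_triangle (f (γ s)) (f (γ t)) (f x)
    have h6 : dist (f (γ t)) (f x) ≤ K * (t * dist y x) := ht
    have h7 : dist (f (γ s)) (f x) ≤ K * (s * dist y x) := by
      calc dist (f (γ s)) (f x) ≤ K * ((s - t) * dist y x) + K * (t * dist y x) := by linarith
        _ = _ := by ring
    exact ⟨s, h7, hsz⟩
  simpa [γ] using hsub (Set.right_mem_Icc.2 zero_le_one)

/-- A piecewise smooth map from the simplex to a vector space is Lipschitz. -/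
theorem exists_lipschitzOnWith_simplexSet {Ps : Set (Set (Fin n → ℝ))} (hfin : Ps.Finite)
    (hcov : simplexSet n ⊆ ⋃₀ Ps) (hP : ∀ P ∈ Ps, IsPolyhedron P) {f : (Fin n → ℝ) → V}
    (hf : ∀ P ∈ Ps, ContDiffOn ℝ ∞ f (simplexSet n ∩ P)) :
    ∃ K, LipschitzOnWith K f (simplexSet n) := by
  have h1 : ∀ P ∈ Ps, ∃ K, LipschitzOnWith K f (simplexSet n ∩ P) := fun P h =>
    (hf P h).exists_lipschitzOnWith (by simp) ((convex_simplexSet n).inter (hP P h).convex)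
      ((isCompact_simplexSet n).inter_right (hP P h).isClosed)
  choose! K hK using h1
  have hc : ContinuousOn f (simplexSet n) := by
    have : simplexSet n = ⋃ P : Ps, simplexSet n ∩ P.1 := by
      rw [← Set.inter_iUnion, ← Set.sUnion_eq_iUnion, Set.inter_eq_left.2 hcov]
    rw [this]
    have := hfin.to_subtype
    exact (locallyFinite_of_finite _).continuousOn_iUnion
      (fun P => (isClosed_simplexSet n).inter (hP P.1 P.2).isClosed)
      fun P => (hf P.1 P.2).continuousOn
  refine ⟨∑ P ∈ hfin.toFinset, K P, lipschitzOnWith_of_cover (convex_simplexSet n) hfin hcov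
    (fun P h => (hP P h).isClosed) hc fun P h => (hK P h).weaken ?_⟩
  exact Finset.single_le_sum (f := K) (fun _ _ => zero_le) (hfin.mem_toFinset.2 h)

/-- Truncation of real numbers to `[0, b]`. -/
def truncate (b t : ℝ) : ℝ := max 0 (min t b)

theorem truncate_nonneg (b t : ℝ) : 0 ≤ truncate b t := le_max_left _ _

theorem truncate_le {b : ℝ} (hb : 0 ≤ b) (t : ℝ) : truncate b t ≤ b :=
  max_le hb (min_le_right _ _)

theorem truncate_of_mem {b t : ℝ} (h0 : 0 ≤ t) (h1 : t ≤ b) : truncate b t = t := by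
  rw [truncate, min_eq_left h1, max_eq_right h0]

theorem truncate_of_nonpos {b t : ℝ} (h : t ≤ 0) : truncate b t = 0 :=
  max_eq_left ((min_le_left _ _).trans h)

theorem truncate_of_le {b t : ℝ} (hb : 0 ≤ b) (h : b ≤ t) : truncate b t = b := by
  rw [truncate, min_eq_right h, max_eq_right hb]

/-- A Lipschitz retraction of `ℝ^n` onto the standard simplex. -/
def retraction : (n : ℕ) → (Fin n → ℝ) → Fin n → ℝ
  | 0, x => x
  | n + 1, x => Fin.cons (truncate (1 - ∑ i, retraction n (Fin.tail x) i) (x 0))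
      (retraction n (Fin.tail x))

theorem retraction_succ (x : Fin (n + 1) → ℝ) : retraction (n + 1) x =
    Fin.cons (truncate (1 - ∑ i, retraction n (Fin.tail x) i) (x 0))
      (retraction n (Fin.tail x)) := rfl

theorem retraction_mem (x : Fin n → ℝ) : retraction n x ∈ simplexSet n := by
  induction n with
  | zero => exact ⟨fun i => i.elim0, by simp⟩
  | succ n ih =>
    have h := ih (Fin.tail x)
    refine ⟨fun i => ?_, ?_⟩
    · refine Fin.cases ?_ (fun i => ?_) i
      · exact truncate_nonneg _ _
      · exact h.1 i
    · rw [Fin.sum_univ_succ, retraction_succ]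
      simp only [Fin.cons_zero, Fin.cons_succ]
      linarith [truncate_le (sub_nonneg.2 h.2) (x 0)]

theorem tail_mem_simplexSet {x : Fin (n + 1) → ℝ} (hx : x ∈ simplexSet (n + 1)) :
    Fin.tail x ∈ simplexSet n := by
  refine ⟨fun i => hx.1 i.succ, ?_⟩
  have := hx.2
  rw [Fin.sum_univ_succ] at this
  have h0 := hx.1 0
  simp only [Fin.tail]
  linarith

theorem retraction_of_mem {x : Fin n → ℝ} (hx : x ∈ simplexSet n) : retraction n x = x := by
  induction n with
  | zero => rfl
  | succ n ih =>
    have h1 := hx.2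
    rw [Fin.sum_univ_succ] at h1
    rw [retraction_succ, ih (tail_mem_simplexSet hx), truncate_of_mem (hx.1 0)
      (by simp only [Fin.tail]; linarith)]
    exact Fin.cons_self_tail x

/-- Each coordinate is truncated to `[0, b]` with `b ≤ 1`, so truncating it to `[0, 1]` beforehand
changes nothing. This makes the retraction constant outside of the unit cube in each coordinate
direction, as `integral_cube_eq` demands. -/
theorem retraction_congr {x y : Fin n → ℝ} (h : ∀ i, truncate 1 (x i) = truncate 1 (y i)) :
    retraction n x = retraction n y := by
  induction n with
  | zero => exact funext fun i => i.elim0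
  | succ n ih =>
    have ht : retraction n (Fin.tail x) = retraction n (Fin.tail y) := ih fun i => h i.succ
    rw [retraction_succ, retraction_succ, ht]
    congr 1
    have hm := retraction_mem (Fin.tail y)
    set b := 1 - ∑ i, retraction n (Fin.tail y) i
    have hb0 : 0 ≤ b := sub_nonneg.2 hm.2
    have hb1 : b ≤ 1 := sub_le_self _ (Finset.sum_nonneg fun i _ => hm.1 i)
    have key : ∀ t, truncate b (truncate 1 t) = truncate b t := by
      intro t
      rcases le_total t 0 with h0 | h0
      · rw [truncate_of_nonpos h0, truncate_of_nonpos le_rfl, truncate_of_nonpos h0]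
      rcases le_total t 1 with h1 | h1
      · rw [truncate_of_mem h0 h1]
      · rw [truncate_of_le zero_le_one h1, truncate_of_le hb0 hb1, truncate_of_le hb0 (hb1.trans h1)]
    rw [← key, h 0, key]

theorem retraction_insertNth_of_one_le (i : Fin (n + 1)) {t : ℝ} (ht : 1 ≤ t) (y : Fin n → ℝ) :
    retraction (n + 1) (i.insertNth t y) = retraction (n + 1) (i.insertNth 1 y) := by
  refine retraction_congr fun j => ?_
  refine Fin.succAboveCases i ?_ (fun j => ?_) j
  · simp [truncate_of_le zero_le_one ht, truncate_of_le zero_le_one le_rfl]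
  · simp

theorem retraction_insertNth_of_nonpos (i : Fin (n + 1)) {t : ℝ} (ht : t ≤ 0) (y : Fin n → ℝ) :
    retraction (n + 1) (i.insertNth t y) = retraction (n + 1) (i.insertNth 0 y) := by
  refine retraction_congr fun j => ?_
  refine Fin.succAboveCases i ?_ (fun j => ?_) j
  · simp [truncate_of_nonpos ht, truncate_of_nonpos le_rfl]
  · simp

theorem retraction_insertNth_zero (i : Fin (n + 1)) (y : Fin n → ℝ) :
    retraction (n + 1) (i.insertNth 0 y) = i.insertNth 0 (retraction n y) := by
  induction n with
  | zero =>
    obtain rfl : i = 0 := Subsingleton.elim (α := Fin 1) _ _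
    rw [retraction_succ]
    funext j
    obtain rfl : j = 0 := Subsingleton.elim (α := Fin 1) _ _
    simp [truncate_of_nonpos]
  | succ n ih =>
    refine Fin.cases ?_ (fun i => ?_) i
    · simp [retraction_succ (n := n + 1), truncate_of_nonpos]
    · have h1 : (i.succ.insertNth 0 y : Fin (n + 2) → ℝ) =
          Fin.cons (y 0) (i.insertNth 0 (Fin.tail y)) := by
        rw [← Fin.cons_self_tail y, Fin.insertNth_succ_cons]
        simp
      rw [h1, retraction_succ (Fin.cons (y 0) _), retraction_succ y, Fin.tail_cons, Fin.cons_zero,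
        ih, Fin.insertNth_succ_cons, Fin.sum_univ_succAbove _ i]
      simp

theorem retraction_cons_one (y : Fin n → ℝ) : retraction (n + 1) (Fin.cons 1 y) =
    Fin.cons (1 - ∑ i, retraction n y i) (retraction n y) := by
  rw [retraction_succ, Fin.tail_cons, Fin.cons_zero, truncate_of_le]
  · exact sub_nonneg.2 (retraction_mem y).2
  · exact sub_le_self _ (Finset.sum_nonneg fun i _ => (retraction_mem y).1 i)

theorem exists_lipschitzWith_retraction (n : ℕ) : ∃ K, LipschitzWith K (retraction n) := by
  induction n with
  | zero => exact ⟨1, LipschitzWith.id⟩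
  | succ n ih =>
    obtain ⟨K, hK⟩ := ih
    have htail : LipschitzWith 1 fun x : Fin (n + 1) → ℝ => Fin.tail x := by
      refine LipschitzWith.of_dist_le_mul fun x y => ?_
      rw [NNReal.coe_one, one_mul]
      exact (dist_pi_le_iff dist_nonneg).2 fun i => dist_le_pi_dist x y i.succ
    have hr : LipschitzWith (K * 1) fun x : Fin (n + 1) → ℝ => retraction n (Fin.tail x) :=
      hK.comp htail
    have hsum : ∃ L, LipschitzWith L fun x : Fin (n + 1) → ℝ =>
        1 - ∑ i, retraction n (Fin.tail x) i := by
      refine ⟨∑ i : Fin n, K * 1, LipschitzWith.of_dist_le_mul fun x y => ?_⟩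
      rw [dist_sub_left, NNReal.coe_sum, Finset.sum_mul]
      refine (dist_sum_sum_le _ _ _).trans (Finset.sum_le_sum fun i _ => ?_)
      exact (dist_le_pi_dist _ _ i).trans (hr.dist_le_mul x y)
    obtain ⟨L, hL⟩ := hsum
    have h0 : LipschitzWith 1 fun x : Fin (n + 1) → ℝ => x 0 := LipschitzWith.eval 0
    have hhead := (h0.min hL).const_max 0
    refine ⟨max (max 1 L) (K * 1), LipschitzWith.of_dist_le_mul fun x y => ?_⟩
    refine (dist_pi_le_iff (by positivity)).2 fun i => ?_
    refine Fin.cases ?_ (fun i => ?_) i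
    · refine (hhead.dist_le_mul x y).trans (mul_le_mul_of_nonneg_right ?_ dist_nonneg)
      exact_mod_cast le_max_left _ _
    · refine ((dist_le_pi_dist _ _ i).trans (hr.dist_le_mul x y)).trans
        (mul_le_mul_of_nonneg_right ?_ dist_nonneg)
      exact_mod_cast le_max_right _ _

/-- Outside of the simplex, the retraction is locally independent of one of the coordinates. -/
theorem exists_retraction_add_eq {x : Fin n → ℝ} (hx : x ∉ simplexSet n) :
    ∃ i, ∀ᶠ t : ℝ in 𝓝 0, retraction n (x + t • Pi.single i 1) = retraction n x := by
  induction n with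
  | zero => exact absurd ⟨fun i => i.elim0, by simp⟩ hx
  | succ n ih =>
    by_cases ht : Fin.tail x ∈ simplexSet n
    · refine ⟨0, ?_⟩
      have htail : ∀ t : ℝ, Fin.tail (x + t • Pi.single 0 1) = Fin.tail x := fun t => by
        funext j; simp [Fin.tail]
      have h0 : ∀ t : ℝ, (x + t • (Pi.single 0 1 : Fin (n + 1) → ℝ)) 0 = x 0 + t := by simp
      simp only [retraction_succ, htail, h0, retraction_of_mem ht]
      have hc : Tendsto (fun t : ℝ => x 0 + t) (𝓝 0) (𝓝 (x 0)) := by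
        have : Continuous fun t : ℝ => x 0 + t := by fun_prop
        simpa using this.tendsto 0
      by_cases hneg : x 0 < 0
      · filter_upwards [hc.eventually (gt_mem_nhds hneg)] with t h
        rw [truncate_of_nonpos h.le, truncate_of_nonpos hneg.le]
      · have hb : 0 ≤ 1 - ∑ i, Fin.tail x i := sub_nonneg.2 ht.2
        have hgt : 1 - ∑ i, Fin.tail x i < x 0 := by
          by_contra! hle
          refine hx ⟨fun i => Fin.cases (not_lt.1 hneg) (fun i => ht.1 i) i, ?_⟩
          rw [Fin.sum_univ_succ]
          simp only [Fin.tail] at hle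
          linarith
        filter_upwards [hc.eventually (lt_mem_nhds hgt)] with t h
        rw [truncate_of_le hb h.le, truncate_of_le hb hgt.le]
    · obtain ⟨i, hi⟩ := ih ht
      refine ⟨i.succ, ?_⟩
      filter_upwards [hi] with t h
      have htail : Fin.tail (x + t • Pi.single i.succ 1) = Fin.tail x + t • Pi.single i 1 := by
        funext j
        by_cases hj : j = i
        · subst hj; simp [Fin.tail]
        · simp [Fin.tail, hj]
      simp only [retraction_succ, htail, h]
      congr 2
      simp

end Retraction

/-! ### Stokes' theorem for Lipschitz maps of the 3-simplex. -/

section SimplexStokes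

open MeasureTheory Filter

open scoped Topology NNReal

variable {V W : Type*} [NormedAddCommGroup V] [NormedSpace ℝ V] [NormedAddCommGroup W]
  [NormedSpace ℝ W] {n : ℕ}

theorem fderiv_apply_eq_zero_of_eventually {f : V → W} {x v : V}
    (h : ∀ᶠ t : ℝ in 𝓝 0, f (x + t • v) = f x) : fderiv ℝ f x v = 0 := by
  by_cases hf : DifferentiableAt ℝ f x
  · have h1 := hf.hasFDerivAt.hasLineDerivAt v
    have h2 : HasLineDerivAt ℝ f 0 x v := by
      have : (fun t : ℝ => f (x + t • v)) =ᶠ[𝓝 0] fun _ => f x := h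
      exact (hasDerivAt_const (0 : ℝ) (f x)).congr_of_eventuallyEq this
    exact h1.unique h2
  -- At points of non-differentiability `fderiv` has the default value zero, so no differentiability
  -- needs to be assumed.
  · rw [fderiv_zero_of_not_differentiableAt hf]; rfl

theorem fderiv_retraction_apply_eq_zero {x : Fin n → ℝ} (hx : x ∉ simplexSet n) :
    ∃ i, ∀ f : (Fin n → ℝ) → W,
      fderiv ℝ (fun y => f (retraction n y)) x (Pi.single i 1) = 0 := by
  obtain ⟨i, hi⟩ := exists_retraction_add_eq hx
  exact ⟨i, fun f => fderiv_apply_eq_zero_of_eventually (hi.mono fun t ht => by rw [ht])⟩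

theorem fderiv_retraction_of_mem_interior {x : Fin n → ℝ} (hx : x ∈ interior (simplexSet n))
    (f : (Fin n → ℝ) → W) : fderiv ℝ (fun y => f (retraction n y)) x = fderiv ℝ f x := by
  refine EventuallyEq.fderiv_eq ?_
  filter_upwards [mem_interior_iff_mem_nhds.1 hx] with y hy
  rw [retraction_of_mem hy]

theorem setIntegral_Icc_eq_simplexSet {P Q : (Fin n → ℝ) → ℝ} (h0 : ∀ x ∉ simplexSet n, P x = 0)
    (h1 : ∀ᵐ x, x ∈ interior (simplexSet n) → P x = Q x) :
    ∫ x in Set.Icc (-1) 1, P x = ∫ x in simplexSet n, Q x := by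
  have hsub : simplexSet n ⊆ Set.Icc (-1) 1 := (simplexSet_subset_Icc n).trans
    (Set.Icc_subset_Icc_left fun i => by simp)
  rw [setIntegral_eq_of_subset_of_forall_sdiff_eq_zero measurableSet_Icc hsub
    fun x hx => h0 x hx.2]
  have hae : (interior (simplexSet n) : Set (Fin n → ℝ)) =ᵐ[volume] simplexSet n :=
    interior_ae_eq_of_null_frontier ((convex_simplexSet n).addHaar_frontier volume)
  rw [← setIntegral_congr_set hae, ← setIntegral_congr_set hae]
  exact setIntegral_congr_ae isOpen_interior.measurableSet h1

/-- The integral of the pull-back of a `2`-form under a map of the triangle. -/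
def triangleIntegral (β : V → V [⋀^Fin 2]→L[ℝ] ℝ) (f : (Fin 2 → ℝ) → V) : ℝ :=
  ∫ y in simplexSet 2, β (f y) ![fderiv ℝ f y (Pi.single 0 1), fderiv ℝ f y (Pi.single 1 1)]

theorem alternating_zero_left (β : V [⋀^Fin 2]→L[ℝ] ℝ) (a : V) : β ![0, a] = 0 := by
  simpa using alternating_smul_left β 0 0 a

theorem alternating_zero_right (β : V [⋀^Fin 2]→L[ℝ] ℝ) (a : V) : β ![a, 0] = 0 := by
  rw [alternating_swap, alternating_zero_left, neg_zero]

/-- Outside of the triangle the retraction is locally constant in one coordinate direction, so one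
argument of the alternating form is zero there. -/
theorem squareIntegral_retraction (β : V → V [⋀^Fin 2]→L[ℝ] ℝ) (f : (Fin 2 → ℝ) → V) :
    squareIntegral (fun y => β (f (retraction 2 y))) (fun y => f (retraction 2 y)) =
      triangleIntegral β f := by
  refine setIntegral_Icc_eq_simplexSet (fun x hx => ?_) (Eventually.of_forall fun x hx => ?_)
  · obtain ⟨i, hi⟩ := fderiv_retraction_apply_eq_zero (W := V) hx
    fin_cases i
    · have h0 : fderiv ℝ (fun y => f (retraction 2 y)) x (Pi.single 0 1) = 0 := hi f
      rw [h0, alternating_zero_left]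
    · have h0 : fderiv ℝ (fun y => f (retraction 2 y)) x (Pi.single 1 1) = 0 := hi f
      rw [h0, alternating_zero_right]
  · simp only [fderiv_retraction_of_mem_interior hx, retraction_of_mem (interior_subset hx)]

theorem squareIntegral_eq_zero (A : (Fin 2 → ℝ) → V [⋀^Fin 2]→L[ℝ] ℝ) {g : (Fin 2 → ℝ) → V}
    (h : ∀ (y : Fin 2 → ℝ) (t : ℝ), g (y + t • Pi.single 0 1) = g y) : squareIntegral A g = 0 := by
  have : ∀ y, fderiv ℝ g y (Pi.single 0 1) = 0 := fun y =>
    fderiv_apply_eq_zero_of_eventually (Eventually.of_forall (h y))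
  simp [squareIntegral, this, alternating_zero_left]

/-- The extension of the face maps of the simplex to the ambient space. -/
def faceExt (j : Fin (n + 2)) (x : Fin n → ℝ) (i : Fin (n + 1)) : ℝ :=
  (j.insertNth (0 : ℝ) (barycentric x) : Fin (n + 2) → ℝ) i.succ

theorem faceExt_coe (j : Fin (n + 2)) (x : Δ n) : faceExt j x.1 = (simplexFace j x).1 := rfl

theorem faceExt_succ (i : Fin (n + 1)) (x : Fin n → ℝ) :
    faceExt i.succ x = i.insertNth 0 x := by
  funext l
  simp only [faceExt, barycentric, Fin.insertNth_succ_cons, Fin.cons_succ]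

theorem faceExt_zero (x : Fin n → ℝ) : faceExt (n := n) 0 x = barycentric x := by
  funext l
  simp [faceExt]

theorem retraction_faceExt_succ (i : Fin (n + 1)) (y : Fin n → ℝ) :
    retraction (n + 1) (i.insertNth 0 y) = faceExt i.succ (retraction n y) := by
  rw [faceExt_succ, retraction_insertNth_zero]

theorem retraction_faceExt_zero (y : Fin n → ℝ) :
    retraction (n + 1) (Fin.cons 1 y) = faceExt 0 (retraction n y) := by
  rw [faceExt_zero, retraction_cons_one]; rfl

/-- Coordinates are filled from the last to the first, each bounded by the room left by the later
ones. A coordinate equal to `1` in a position `i ≠ 0` uses up the remaining room, so the first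
coordinate becomes `0` whatever its value: these two walls of the cube are degenerate. -/
theorem retraction_insertNth_one_add (i : Fin 3) (hi : i ≠ 0) (y : Fin 2 → ℝ) (t : ℝ) :
    retraction 3 (i.insertNth 1 (y + t • Pi.single 0 1)) = retraction 3 (i.insertNth 1 y) := by
  have ht1 : truncate 1 1 = 1 := truncate_of_le zero_le_one le_rfl
  have h0 : ∀ s, truncate 0 s = 0 := fun s =>
    le_antisymm (truncate_le le_rfl s) (truncate_nonneg _ _)
  have ht : ∀ s, truncate (1 - truncate 1 s) 1 = 1 - truncate 1 s := fun s =>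
    truncate_of_le (sub_nonneg.2 (truncate_le zero_le_one s)) (sub_le_self _ (truncate_nonneg _ _))
  have e1 : (1 : Fin 3).insertNth (1 : ℝ) (y + t • Pi.single 0 1) = ![y 0 + t, 1, y 1] := by
    funext j; fin_cases j <;> simp [Fin.insertNth, Fin.succAboveCases]
  have e1' : (1 : Fin 3).insertNth (1 : ℝ) y = ![y 0, 1, y 1] := by
    funext j; fin_cases j <;> simp [Fin.insertNth, Fin.succAboveCases]
  have e2 : (2 : Fin 3).insertNth (1 : ℝ) (y + t • Pi.single 0 1) = ![y 0 + t, y 1, 1] := by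
    funext j; fin_cases j <;> simp [Fin.insertNth, Fin.succAboveCases]
  have e2' : (2 : Fin 3).insertNth (1 : ℝ) y = ![y 0, y 1, 1] := by
    funext j; fin_cases j <;> simp [Fin.insertNth, Fin.succAboveCases]
  fin_cases i
  · exact absurd rfl hi
  · show retraction 3 ((1 : Fin 3).insertNth 1 _) = retraction 3 ((1 : Fin 3).insertNth 1 _)
    rw [e1, e1']
    simp [retraction_succ, Fin.sum_univ_succ, ht, h0]
  · show retraction 3 ((2 : Fin 3).insertNth 1 _) = retraction 3 ((2 : Fin 3).insertNth 1 _)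
    rw [e2, e2']
    simp [retraction_succ, Fin.sum_univ_succ, ht1, h0]

variable [FiniteDimensional ℝ V]

/-- Stokes' theorem for a Lipschitz map of the `3`-simplex to a vector space. -/
theorem integral_extDeriv_simplexSet {β : V → V [⋀^Fin 2]→L[ℝ] ℝ} {f : (Fin 3 → ℝ) → V}
    {K K' : ℝ≥0} (hf : LipschitzOnWith K f (simplexSet 3))
    (hA : LipschitzOnWith K' (fun x => β (f x)) (simplexSet 3))
    (hβ : ∀ x ∈ simplexSet 3, DifferentiableAt ℝ β (f x)) :
    ∫ x in simplexSet 3, extDeriv β (f x) (fun i => fderiv ℝ f x (Pi.single i 1)) =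
      ∑ j : Fin 4, (-1 : ℝ) ^ (j : ℕ) * triangleIntegral β fun y => f (faceExt j y) := by
  obtain ⟨L, hL⟩ := exists_lipschitzWith_retraction 3
  have hg : LipschitzWith (K * L) fun x => f (retraction 3 x) :=
    lipschitzOnWith_univ.1 (hf.comp (lipschitzOnWith_univ.2 hL) fun x _ => retraction_mem x)
  have hA' : LipschitzWith (K' * L) fun x => β (f (retraction 3 x)) :=
    lipschitzOnWith_univ.1 (hA.comp (lipschitzOnWith_univ.2 hL) fun x _ => retraction_mem x)
  obtain ⟨C, hC⟩ : ∃ C : ℝ≥0, ∀ x, ‖β (f (retraction 3 x))‖ ≤ C := by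
    obtain ⟨C, hC⟩ := (isCompact_simplexSet 3).exists_bound_of_continuousOn hA.continuousOn
    refine ⟨C.toNNReal, fun x => (hC _ (retraction_mem x)).trans (Real.le_coe_toNNReal C)⟩
  have hd : ∀ x, DifferentiableAt ℝ (fun x => f (retraction 3 x)) x →
      DifferentiableAt ℝ (fun x => β (f (retraction 3 x))) x := fun x hx =>
    DifferentiableAt.comp (g := β) x (hβ _ (retraction_mem x)) hx
  have key := integral_cube_eq hg hA' hC hd
    (fun i t y ht => by rw [retraction_insertNth_of_one_le i ht])
    (fun i t y ht => by rw [retraction_insertNth_of_nonpos i ht])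
    (fun i t y ht => by rw [retraction_insertNth_of_one_le i ht])
    (fun i t y ht => by rw [retraction_insertNth_of_nonpos i ht])
  -- Outside of the simplex, some direction `j` is lost by the retraction. Each term of the
  -- alternating sum either differentiates the form in direction `j` or has the `j`-th partial
  -- derivative as an argument, so all of them vanish.
  have hlhs : ∫ x in simplexSet 3, extDeriv β (f x) (fun i => fderiv ℝ f x (Pi.single i 1)) =
      ∫ x in Set.Icc (-1) 1, ∑ i : Fin 3, (-1 : ℝ) ^ (i : ℕ) *
        fderiv ℝ (fun x => β (f (retraction 3 x))) x (Pi.single i 1)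
        ![fderiv ℝ (fun x => f (retraction 3 x)) x (Pi.single (i.succAbove 0) 1),
          fderiv ℝ (fun x => f (retraction 3 x)) x (Pi.single (i.succAbove 1) 1)] := by
    refine (setIntegral_Icc_eq_simplexSet (fun x hx => ?_) ?_).symm
    · obtain ⟨j, hj⟩ := exists_retraction_add_eq hx
      have h1 : fderiv ℝ (fun x => β (f (retraction 3 x))) x (Pi.single j 1) = 0 :=
        fderiv_apply_eq_zero_of_eventually (hj.mono fun t ht => by rw [ht])
      have h2 : fderiv ℝ (fun x => f (retraction 3 x)) x (Pi.single j 1) = 0 :=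
        fderiv_apply_eq_zero_of_eventually (hj.mono fun t ht => by rw [ht])
      refine Finset.sum_eq_zero fun i _ => ?_
      rcases Fin.eq_self_or_eq_succAbove i j with rfl | ⟨l, rfl⟩
      · rw [h1]; simp
      · fin_cases l
        · have h2' : fderiv ℝ (fun x => f (retraction 3 x)) x (Pi.single (i.succAbove 0) 1) = 0 := h2
          rw [h2', alternating_zero_left, mul_zero]
        · have h2' : fderiv ℝ (fun x => f (retraction 3 x)) x (Pi.single (i.succAbove 1) 1) = 0 := h2
          rw [h2', alternating_zero_right, mul_zero]
    · filter_upwards [hg.ae_differentiableAt] with x hx hxi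
      have hfx : DifferentiableAt ℝ f x := hx.congr_of_eventuallyEq (by
        filter_upwards [mem_interior_iff_mem_nhds.1 hxi] with y hy
        rw [retraction_of_mem hy])
      have hβx := hβ x (interior_subset hxi)
      have hcomp : fderiv ℝ (fun x => β (f x)) x = (fderiv ℝ β (f x)).comp (fderiv ℝ f x) :=
        fderiv_comp x hβx hfx
      rw [extDeriv_apply hβx, fderiv_retraction_of_mem_interior hxi,
        fderiv_retraction_of_mem_interior hxi (f := fun x => β (f x)), hcomp]
      refine Finset.sum_congr rfl fun i _ => ?_
      rw [fderiv_continuousAlternatingMap_apply_const_apply hβx, zsmul_eq_mul]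
      push_cast
      congr 2
      funext l
      fin_cases l <;> rfl
  rw [hlhs, key]
  -- The six walls of the cube: the wall where coordinate `i` is `0` retracts to face `i + 1` of the
  -- simplex, the wall where coordinate `0` is `1` to face `0`, and the other two contribute
  -- nothing. The minus sign of the walls at `0` turns `(-1) ^ i` into the sign of face `i + 1`.
  have hz : ∀ i : Fin 3, squareIntegral (fun y => β (f (retraction 3 (i.insertNth 0 y))))
      (fun y => f (retraction 3 (i.insertNth 0 y))) =
        triangleIntegral β fun y => f (faceExt i.succ y) := by
    intro i
    simp only [retraction_faceExt_succ]
    exact squareIntegral_retraction β fun y => f (faceExt i.succ y)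
  have ho : squareIntegral (fun y => β (f (retraction 3 ((0 : Fin 3).insertNth 1 y))))
      (fun y => f (retraction 3 ((0 : Fin 3).insertNth 1 y))) =
        triangleIntegral β fun y => f (faceExt 0 y) := by
    simp only [Fin.insertNth_zero', retraction_faceExt_zero]
    exact squareIntegral_retraction β fun y => f (faceExt 0 y)
  have h1 : ∀ i : Fin 3, i ≠ 0 → squareIntegral
      (fun y => β (f (retraction 3 (i.insertNth 1 y))))
      (fun y => f (retraction 3 (i.insertNth 1 y))) = 0 := fun i hi =>
    squareIntegral_eq_zero _ fun y t => by rw [retraction_insertNth_one_add i hi]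
  rw [Fin.sum_univ_three, hz, hz, hz, ho, h1 1 (by decide), h1 2 (by decide), Fin.sum_univ_four]
  simp only [Fin.val_zero, Fin.val_one, Fin.val_two, Fin.succ_zero_eq_one, Fin.succ_one_eq_two,
    show (2 : Fin 3).succ = 3 from rfl, show ((3 : Fin 4) : ℕ) = 3 from rfl]
  ring

end SimplexStokes

/-! ### The exterior derivative in charts, Stokes' theorem -/

namespace Form

variable {M : SmoothMfd.{u}} {k : ℕ}

theorem isOpen_target (z : M) : IsOpen (extChartAt M.I z).target := isOpen_extChartAt_target z

theorem IsSmooth.differentiableAt_inChart {α : Form k M} (hα : α.IsSmooth) {z : M} {w : M.E}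
    (hw : w ∈ (extChartAt M.I z).target) : DifferentiableAt ℝ (α.inChart z) w :=
  ((hα z).contDiffAt ((isOpen_target z).mem_nhds hw)).differentiableAt (by simp)

/-- The exterior derivative can be computed in any chart. -/
theorem d_apply_eq {α : Form k M} (hα : α.IsSmooth) {z y : M} (hy : y ∈ (extChartAt M.I z).source)
    (v : Fin (k + 1) → M.E) : (α.d y v : ℝ) = extDeriv (α.inChart z) (extChartAt M.I z y)
      fun i => (mfderiv M.I 𝓘(ℝ, M.E) (extChartAt M.I z) y (v i) : M.E) := by
  set φ := extChartAt M.I y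
  set ψ := extChartAt M.I z
  -- The transition map. Near `φ y` the two chart expressions of `α` are related by pull-back along
  -- `τ`, with which the exterior derivative commutes.
  let τ : M.E → M.E := fun w => ψ (φ.symm w)
  have hy' : y ∈ φ.source := mem_extChartAt_source y
  have hsymm : ContMDiffOn 𝓘(ℝ, M.E) M.I ∞ φ.symm φ.target := contMDiffOn_extChartAt_symm y
  have hψ : ContMDiffOn M.I 𝓘(ℝ, M.E) ∞ ψ ψ.source := by
    have := contMDiffOn_extChartAt (I := M.I) (n := ∞) (x := z)
    rwa [← extChartAt_source M.I] at this
  have hopen : ∀ᶠ w in nhds (φ y), w ∈ φ.target ∧ φ.symm w ∈ ψ.source := by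
    refine Filter.Eventually.and ((isOpen_target y).mem_nhds (φ.map_source hy')) ?_
    have hc := (continuousAt_extChartAt_symm (I := M.I) y)
    refine hc.preimage_mem_nhds ?_
    rw [φ.left_inv hy']
    exact (isOpen_extChartAt_source z).mem_nhds hy
  have hev : α.inChart y =ᶠ[nhds (φ y)] fun w =>
      (α.inChart z (τ w)).compContinuousLinearMap (fderiv ℝ τ w) := by
    filter_upwards [hopen] with w hw
    ext v
    have hs : MDifferentiableWithinAt 𝓘(ℝ, M.E) M.I φ.symm Set.univ w :=
      ((hsymm.contMDiffAt ((isOpen_target y).mem_nhds hw.1)).mdifferentiableAt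
        (by simp)).mdifferentiableWithinAt
    have := α.apply_mfderivWithin_eq_inChart (z := z) hw.2 hs uniqueDiffWithinAt_univ v
    rw [mfderivWithin_univ, fderivWithin_univ] at this
    exact this
  have hτ : ContDiffAt ℝ ∞ τ (φ y) := by
    rw [← contMDiffAt_iff_contDiffAt]
    refine ContMDiffAt.comp (I' := M.I) (φ y) (hψ.contMDiffAt ?_)
      (hsymm.contMDiffAt ((isOpen_target y).mem_nhds (φ.map_source hy')))
    rw [φ.left_inv hy']
    exact (isOpen_extChartAt_source z).mem_nhds hy
  have hτy : τ (φ y) = ψ y := by simp only [τ, φ.left_inv hy']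
  have hd0 : DifferentiableAt ℝ (α.inChart z) (τ (φ y)) := by
    rw [hτy]; exact hα.differentiableAt_inChart (ψ.map_source hy)
  have h0 : minSmoothness ℝ 2 ≤ (∞ : WithTop ℕ∞) := by
    rw [minSmoothness_of_isRCLikeNormedField]
    exact WithTop.coe_le_coe.2 le_top
  have h1 := extDeriv_pullback (r := ∞) hd0 hτ h0
  rw [hτy] at h1
  have hd : α.d y v = extDeriv (α.inChart y) (φ y) fun i =>
      (mfderiv M.I 𝓘(ℝ, M.E) φ y (v i) : M.E) := rfl
  rw [hd, hev.extDeriv_eq, h1]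
  refine congrArg (extDeriv (α.inChart z) (ψ y)) (funext fun i => ?_)
  have h2 : MDifferentiableAt M.I 𝓘(ℝ, M.E) φ y := mdifferentiableAt_extChartAt (by
    rwa [extChartAt_source] at hy')
  have h3 : mfderiv M.I 𝓘(ℝ, M.E) (fun x => τ (φ x)) y =
      (mfderiv 𝓘(ℝ, M.E) 𝓘(ℝ, M.E) τ (φ y)).comp (mfderiv M.I 𝓘(ℝ, M.E) φ y) :=
    mfderiv_comp y (hτ.differentiableAt (by simp)).mdifferentiableAt h2
  have h4 : (fun x => τ (φ x)) =ᶠ[nhds y] ψ := by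
    filter_upwards [(isOpen_extChartAt_source (I := M.I) y).mem_nhds hy'] with x hx
    simp only [τ]
    rw [φ.left_inv hx]
  rw [mfderiv_eq_fderiv] at h3
  exact ((DFunLike.congr_fun h3 (v i)).symm.trans (DFunLike.congr_fun h4.mfderiv_eq (v i)))

theorem IsSmooth.d {α : Form k M} (hα : α.IsSmooth) : α.d.IsSmooth := by
  intro z
  have h1 : ContDiffOn ℝ ∞ (extDeriv (α.inChart z)) (extChartAt M.I z).target :=
    (ContinuousAlternatingMap.alternatizeUncurryFinCLM ℝ M.E ℝ).contDiff.comp_contDiffOn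
      ((hα z).fderiv_of_isOpen (isOpen_target z) (by simp))
  refine h1.congr fun w hw => ?_
  ext v
  have hs := (extChartAt M.I z).map_target hw
  have := d_apply_eq hα hs fun i =>
    (mfderiv 𝓘(ℝ, M.E) M.I (extChartAt M.I z).symm w (v i) : M.E)
  refine (show α.d.inChart z w v = _ from this).trans ?_
  rw [(extChartAt M.I z).right_inv hw]
  refine congrArg _ (funext fun i => ?_)
  have h := mfderiv_extChartAt_comp_mfderivWithin_extChartAt_symm (I := M.I) (x := z) hw
  rw [M.I.range_eq_univ, mfderivWithin_univ] at h
  exact DFunLike.congr_fun h (v i)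

end Form

namespace Chain

variable {M : SmoothMfd.{u}} {k : ℕ}

open MeasureTheory

/-- The integral of a form, computed in a chart. -/
theorem integralSimplex_eq_inChart {α : Form k M} {σ : Δ k → M} (hσ : PiecewiseSmooth M σ) {z : M}
    (hz : ∀ x, σ x ∈ (extChartAt M.I z).source) :
    integralSimplex α σ = ∫ x in simplexSet k, α.inChart z (extChartAt M.I z (extendSimplex σ x))
      fun i => fderiv ℝ (fun y => extChartAt M.I z (extendSimplex σ y)) x (Pi.single i 1) := by
  rw [integralSimplex_eq]
  refine integral_congr_ae ?_
  filter_upwards [hσ.ae_contMDiffAt] with x hx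
  have hm := mem_interior_iff_mem_nhds.1 hx.1
  have hs : extendSimplex σ x ∈ (extChartAt M.I z).source := by
    obtain ⟨y, hy⟩ := exists_extendSimplex_eq σ x
    rw [hy]; exact hz y
  refine (α.apply_mfderivWithin_eq_inChart hs (hx.2.mdifferentiableAt
    (by simp)).mdifferentiableWithinAt (uniqueDiffOn_simplexSet k x (interior_subset hx.1))
      fun i => Pi.single i 1).trans ?_
  rw [fderivWithin_of_mem_nhds hm]

theorem integralSimplex_d_of_chart {α : Form 2 M} (hα : α.IsSmooth) {σ : Δ 3 → M}
    (hσ : PiecewiseSmooth M σ) {z : M} (hz : ∀ x, σ x ∈ (extChartAt M.I z).source) :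
    integralSimplex α.d σ =
      ∑ j : Fin 4, (-1 : ℝ) ^ (j : ℕ) * integralSimplex α (σ ∘ simplexFace j) := by
  have hs : ∀ x, extendSimplex σ x ∈ (extChartAt M.I z).source := by
    intro x
    obtain ⟨y, hy⟩ := exists_extendSimplex_eq σ x
    rw [hy]; exact hz y
  have ht : ∀ x, extChartAt M.I z (extendSimplex σ x) ∈ (extChartAt M.I z).target := fun x =>
    (extChartAt M.I z).map_source (hs x)
  let f : (Fin 3 → ℝ) → M.E := fun x => extChartAt M.I z (extendSimplex σ x)
  obtain ⟨Ps, hfin, hcov, hP⟩ := id hσ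
  have hfP : ∀ P ∈ Ps, ContDiffOn ℝ ∞ f (simplexSet 3 ∩ P) := fun P h => by
    rw [← contMDiffOn_iff_contDiffOn]
    refine (contMDiffOn_extChartAt (x := z)).comp (hP P h).2 fun y _ => ?_
    rw [← extChartAt_source M.I]
    exact hs y
  -- In the chart, both the simplex and the form along it are smooth on finitely many convex pieces,
  -- hence Lipschitz, as Stokes' theorem in the model space requires.
  obtain ⟨K, hK⟩ := exists_lipschitzOnWith_simplexSet hfin hcov (fun P h => (hP P h).1) hfP
  obtain ⟨K', hK'⟩ := exists_lipschitzOnWith_simplexSet (f := fun x => α.inChart z (f x)) hfin hcov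
    (fun P h => (hP P h).1) fun P h => (hα z).comp (hfP P h) fun x _ => ht x
  have key := integral_extDeriv_simplexSet hK hK'
    fun x _ => hα.differentiableAt_inChart (ht x)
  have h1 : integralSimplex α.d σ =
      ∫ x in simplexSet 3, extDeriv (α.inChart z) (f x) fun i => fderiv ℝ f x (Pi.single i 1) := by
    rw [integralSimplex_eq_inChart hσ hz]
    refine setIntegral_congr_fun (isClosed_simplexSet 3).measurableSet fun x _ => ?_
    have h2 := α.d.apply_eq_inChart (hs x) fun i =>
      (mfderiv 𝓘(ℝ, M.E) M.I (extChartAt M.I z).symm (f x) (fderiv ℝ f x (Pi.single i 1)) : M.E)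
    have h3 := Form.d_apply_eq hα (hs x) fun i =>
      (mfderiv 𝓘(ℝ, M.E) M.I (extChartAt M.I z).symm (f x) (fderiv ℝ f x (Pi.single i 1)) : M.E)
    have h4 : ∀ v : M.E, (mfderiv M.I 𝓘(ℝ, M.E) (extChartAt M.I z) (extendSimplex σ x)
        (mfderiv 𝓘(ℝ, M.E) M.I (extChartAt M.I z).symm (f x) v : M.E) : M.E) = v := by
      intro v
      have h := mfderiv_extChartAt_comp_mfderivWithin_extChartAt_symm (I := M.I) (x := z) (ht x)
      rw [M.I.range_eq_univ, mfderivWithin_univ, (extChartAt M.I z).left_inv (hs x)] at h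
      exact DFunLike.congr_fun h v
    simp only [h4] at h2 h3
    exact h2.symm.trans h3
  rw [h1, key]
  refine Finset.sum_congr rfl fun j _ => ?_
  congr 1
  have hσj : PiecewiseSmooth M (σ ∘ simplexFace j) := by
    rw [Simplex.simplexFace_eq_affine]
    exact hσ.comp_affine _
  rw [integralSimplex_eq_inChart hσj fun x => hz _, triangleIntegral]
  have hfj : ∀ y ∈ simplexSet 2, f (faceExt j y) =
      extChartAt M.I z (extendSimplex (σ ∘ simplexFace j) y) := by
    intro y hy
    rw [extendSimplex_of_mem _ hy]
    have h5 := faceExt_coe j ⟨y, hy⟩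
    simp only [f]
    rw [h5, extendSimplex_coe]
    rfl
  -- The two extensions of the face to the plane agree on the triangle, so their derivatives are
  -- compared at interior points.
  have hae : (interior (simplexSet 2) : Set (Fin 2 → ℝ)) =ᵐ[volume] simplexSet 2 :=
    interior_ae_eq_of_null_frontier ((convex_simplexSet 2).addHaar_frontier volume)
  rw [← setIntegral_congr_set hae, ← setIntegral_congr_set hae]
  refine setIntegral_congr_fun isOpen_interior.measurableSet fun y hy => ?_
  have hev : (fun y => f (faceExt j y)) =ᶠ[nhds y]
      fun y => extChartAt M.I z (extendSimplex (σ ∘ simplexFace j) y) := by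
    filter_upwards [mem_interior_iff_mem_nhds.1 hy] with x hx using hfj x hx
  rw [hev.fderiv_eq, hfj y (interior_subset hy)]
  congr 1
  funext i
  fin_cases i <;> rfl

theorem eq_of_forall_mem_support {A : Type u} {B : Type*} [AddCommGroup B]
    {f g : Chain A k →+ B} {c : Chain A k} (h : ∀ σ ∈ c.support,
      f (Finsupp.single σ 1) = g (Finsupp.single σ 1)) : f c = g c := by
  rw [← Finsupp.sum_single c, Finsupp.sum, map_sum, map_sum]
  refine Finset.sum_congr rfl fun σ hσ => ?_
  have : (Finsupp.single σ (c σ) : Chain A k) = c σ • Finsupp.single σ 1 := by simp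
  rw [this, map_zsmul, map_zsmul, h σ hσ]

theorem d_iterate_sd {A : Type u} (c : Chain A (k + 1)) (n : ℕ) : d (sd^[n] c) = sd^[n] (d c) := by
  induction n with
  | zero => rfl
  | succ n ih => rw [Function.iterate_succ_apply', Function.iterate_succ_apply', d_sd, ih]

/-- Stokes' theorem for `2`-forms and piecewise smooth `3`-chains. -/
theorem integral_d {α : Form 2 M} (hα : α.IsSmooth) {c : Chain M 3} (hc : c.IsSmoothChain) :
    integral α.d c = integral α (d c) := by
  -- Both sides are unchanged by subdivision, after which each simplex lies in a single chart.
  obtain ⟨n, hn⟩ := (eventually_sd_small c (f := fun x => x) (𝒰 := {U | ∃ z : M,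
      U = (extChartAt M.I z).source}) (fun σ hσ => (hc σ hσ : PiecewiseSmooth M σ).continuous)
    fun z => ⟨_, ⟨z, rfl⟩, extChartAt_source_mem_nhds z⟩).exists
  rw [← integral_iterate_sd hα.d hc n, ← integral_iterate_sd hα hc.d n, ← d_iterate_sd]
  refine eq_of_forall_mem_support (f := integralHom α.d) (g := (integralHom α).comp d)
    fun σ hσ => ?_
  obtain ⟨_, ⟨z, rfl⟩, hz⟩ := hn σ hσ
  rw [AddMonoidHom.comp_apply, d_single, map_sum, integralHom_single,
    integralSimplex_d_of_chart hα (hc.iterate_sd n σ hσ) hz]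
  simp only [map_zsmul, integralHom_single, zsmul_eq_mul]
  push_cast
  simp

end Chain

/-! ### Local sections -/

namespace SmoothMfd

variable {M N P : SmoothMfd.{u}}

open Manifold in
/-- Around a point, the fibres of a submersion are the images of smoothly varying retractions. -/
theorem exists_retraction_of_isSubmersion {f : N → M} (hf : IsSubmersion N.I M.I ∞ f) (x₀ : N) :
    ∃ (R : N × M → N) (W : Set (N × M)), IsOpen W ∧ (x₀, f x₀) ∈ W ∧
      ContMDiffOn (N.I.prod M.I) N.I ∞ R W ∧ (∀ p ∈ W, f (R p) = p.2) ∧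
      ∀ x, (x, f x) ∈ W → R (x, f x) = x := by
  have h := hf.isSubmersionAt x₀
  set φ := h.domChart.extend N.I with hφ
  set ψ := h.codChart.extend M.I with hψ
  set e := h.equiv with he
  have hφs : φ.source = h.domChart.source := h.domChart.extend_source
  have hψs : ψ.source = h.codChart.source := h.codChart.extend_source
  have hφo : IsOpen φ.target := h.domChart.isOpen_extend_target
  have hw : ∀ w ∈ φ.target, ψ (f (φ.symm w)) = (e w).1 := fun w hw => h.writtenInCharts hw
  have hfs : ∀ x ∈ φ.source, f x ∈ ψ.source := fun x hx => by
    rw [hφs] at hx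
    rw [hψs]
    exact h.source_subset_preimage_source hx
  have hx₀ : x₀ ∈ φ.source := by rw [hφs]; exact h.mem_domChart_source
  have key : ∀ x ∈ φ.source, e.symm (ψ (f x), (e (φ x)).2) = φ x := by
    intro x hx
    have := hw _ (φ.map_source hx)
    rw [φ.left_inv hx] at this
    rw [this]
    exact e.symm_apply_apply _
  have hsφ : ContMDiffOn N.I 𝓘(ℝ, N.E) ∞ φ φ.source := by
    rw [hφs]
    exact OpenPartialHomeomorph.contMDiffOn_extend h.domChart_mem_maximalAtlas
  have hsψ : ContMDiffOn M.I 𝓘(ℝ, M.E) ∞ ψ ψ.source := by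
    rw [hψs]
    exact OpenPartialHomeomorph.contMDiffOn_extend h.codChart_mem_maximalAtlas
  have hsφ' : ContMDiffOn 𝓘(ℝ, N.E) N.I ∞ φ.symm φ.target := by
    have := contMDiffOn_extend_symm h.domChart_mem_maximalAtlas
    rwa [← OpenPartialHomeomorph.extend_target'] at this
  -- In adapted charts `f` is the projection to the first factor. `T` takes the base coordinate from
  -- the point of `M` and the fibre coordinate from the point of `N`.
  let T : N × M → N.E := fun p => e.symm (ψ p.2, (e (φ p.1)).2)
  have hS : IsOpen (φ.source ×ˢ ψ.source : Set (N × M)) := by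
    rw [hφs, hψs]
    exact h.domChart.open_source.prod h.codChart.open_source
  have hT : ContMDiffOn (N.I.prod M.I) 𝓘(ℝ, N.E) ∞ T (φ.source ×ˢ ψ.source) := by
    have h1 : ContMDiffOn (N.I.prod M.I) 𝓘(ℝ, N.E) ∞ (fun p : N × M => φ p.1)
        (φ.source ×ˢ ψ.source) := hsφ.comp contMDiffOn_fst fun p hp => hp.1
    have h2 : ContMDiffOn (N.I.prod M.I) 𝓘(ℝ, M.E) ∞ (fun p : N × M => ψ p.2)
        (φ.source ×ˢ ψ.source) := hsψ.comp contMDiffOn_snd fun p hp => hp.2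
    have h3 : ContMDiff 𝓘(ℝ, N.E) 𝓘(ℝ, h.complement) ∞ fun w => (e w).2 :=
      (contDiff_snd.comp e.contDiff).contMDiff
    exact e.symm.contDiff.contMDiff.comp_contMDiffOn (h2.prodMk_space (h3.comp_contMDiffOn h1))
  refine ⟨fun p => φ.symm (T p), (φ.source ×ˢ ψ.source) ∩ T ⁻¹' φ.target,
    hT.continuousOn.isOpen_inter_preimage hS hφo, ?_, ?_, ?_, ?_⟩
  · refine ⟨⟨hx₀, hfs _ hx₀⟩, ?_⟩
    show e.symm (ψ (f x₀), (e (φ x₀)).2) ∈ φ.target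
    rw [key _ hx₀]
    exact φ.map_source hx₀
  · exact hsφ'.comp (hT.mono Set.inter_subset_left) fun p hp => hp.2
  · rintro p ⟨hp, hp'⟩
    have h1 := hw _ hp'
    rw [show e (T p) = (ψ p.2, (e (φ p.1)).2) from e.apply_symm_apply _] at h1
    exact ψ.injOn (hfs _ (φ.map_target hp')) hp.2 h1
  · rintro x ⟨hx, -⟩
    show φ.symm (e.symm (ψ (f x), (e (φ x)).2)) = x
    rw [key x hx.1, φ.left_inv hx.1]

open Manifold in
/-- Submersions have local sections. -/
theorem exists_section_of_isSubmersion {f : N → M} (hf : IsSubmersion N.I M.I ∞ f) (x₀ : N) :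
    ∃ (r : M → N) (U : Set M), IsOpen U ∧ f x₀ ∈ U ∧ ContMDiffOn M.I N.I ∞ r U ∧
      ∀ m ∈ U, f (r m) = m := by
  obtain ⟨R, W, hW, hx, hR, h1, -⟩ := exists_retraction_of_isSubmersion hf x₀
  have hι : ContMDiff M.I (N.I.prod M.I) ∞ fun m : M => (x₀, m) :=
    contMDiff_const.prodMk contMDiff_id
  exact ⟨fun m => R (x₀, m), (fun m : M => (x₀, m)) ⁻¹' W, hW.preimage hι.continuous, hx,
    hR.comp hι.contMDiffOn fun m hm => hm, fun m hm => h1 _ hm⟩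

/-- A smooth map between vector spaces with surjective derivative has a local section. -/
theorem exists_section_of_fderiv_surjective {V V' : Type*} [NormedAddCommGroup V]
    [NormedSpace ℝ V] [NormedAddCommGroup V'] [NormedSpace ℝ V']
    [FiniteDimensional ℝ V'] {g : V → V'} {S : Set V} (hS : IsOpen S) (hg : ContDiffOn ℝ ∞ g S)
    {x₀ : V} (hx₀ : x₀ ∈ S) (hsurj : Function.Surjective (fderiv ℝ g x₀)) :
    ∃ (r : V' → V) (U : Set V'), IsOpen U ∧ g x₀ ∈ U ∧ ContDiffOn ℝ ∞ r U ∧ (∀ y ∈ U, r y ∈ S) ∧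
      ∀ y ∈ U, g (r y) = y := by
  -- The inverse function theorem is applied to `g` on the slice `x₀ + L w` through a linear right
  -- inverse `L` of the derivative; there the derivative at `0` is the identity.
  obtain ⟨L₀, hL₀⟩ := (fderiv ℝ g x₀).toLinearMap.exists_rightInverse_of_surjective
    (LinearMap.range_eq_top.2 hsurj)
  let L : V' →L[ℝ] V := L₀.toContinuousLinearMap
  let a : V' → V := fun w => x₀ + L w
  have ha : ContDiff ℝ ∞ a := contDiff_const.add L.contDiff
  let k : V' → V' := fun w => g (a w)
  have ha0 : a 0 = x₀ := by simp [a]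
  let S' : Set V' := a ⁻¹' S
  have hS' : IsOpen S' := hS.preimage ha.continuous
  have h0 : (0 : V') ∈ S' := by rw [Set.mem_preimage, ha0]; exact hx₀
  have hk : ContDiffOn ℝ ∞ k S' := hg.comp ha.contDiffOn fun w hw => hw
  have hkat : ∀ w ∈ S', ContDiffAt ℝ ∞ k w := fun w hw => hk.contDiffAt (hS'.mem_nhds hw)
  have hda : ∀ w, HasFDerivAt a L w := fun w => (L.hasFDerivAt).const_add x₀
  have hk0 : fderiv ℝ k 0 = (ContinuousLinearEquiv.refl ℝ V' : V' →L[ℝ] V') := by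
    have h1 : HasFDerivAt g (fderiv ℝ g x₀) (a 0) := by
      rw [ha0]
      exact ((hg.contDiffAt (hS.mem_nhds hx₀)).differentiableAt (by simp)).hasFDerivAt
    have h2 : HasFDerivAt k ((fderiv ℝ g x₀).comp L) 0 := h1.comp 0 (hda 0)
    rw [h2.fderiv]
    ext w
    exact LinearMap.congr_fun hL₀ w
  have hst : HasStrictFDerivAt k ((ContinuousLinearEquiv.refl ℝ V' : V' →L[ℝ] V')) 0 := by
    rw [← hk0]
    exact (hkat 0 h0).hasStrictFDerivAt (by simp)
  let Θ := hst.toOpenPartialHomeomorph k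
  have hΘ : ⇑Θ = k := hst.toOpenPartialHomeomorph_coe
  have hΘ0 : (0 : V') ∈ Θ.source := hst.mem_toOpenPartialHomeomorph_source
  -- The local inverse is smooth at each point where the derivative of `k` is invertible.
  -- Restricting to this open set gives smoothness on a whole neighbourhood.
  have hinv : IsOpen (S' ∩ fderiv ℝ k ⁻¹'
      Set.range ((↑) : (V' ≃L[ℝ] V') → V' →L[ℝ] V')) :=
    (hk.continuousOn_fderiv_of_isOpen hS' (by simp)).isOpen_inter_preimage hS'
      ContinuousLinearEquiv.isOpen
  set S'' := S' ∩ fderiv ℝ k ⁻¹' Set.range ((↑) : (V' ≃L[ℝ] V') → V' →L[ℝ] V') with hS''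
  refine ⟨fun y => a (Θ.symm y), Θ.target ∩ Θ.symm ⁻¹' S'', Θ.isOpen_inter_preimage_symm hinv,
    ?_, ?_, fun y hy => hy.2.1, fun y hy => ?_⟩
  · have : g x₀ = Θ 0 := by rw [hΘ]; simp only [k, ha0]
    rw [this]
    refine ⟨Θ.map_source hΘ0, ?_⟩
    rw [Set.mem_preimage, Θ.left_inv hΘ0]
    exact ⟨h0, ⟨_, hk0.symm⟩⟩
  · refine ha.comp_contDiffOn fun y hy => ContDiffAt.contDiffWithinAt ?_
    obtain ⟨e, he⟩ := hy.2.2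
    refine Θ.contDiffAt_symm hy.1 (f₀' := e) ?_ ?_
    · rw [hΘ, he]
      exact ((hkat _ hy.2.1).differentiableAt (by simp)).hasFDerivAt
    · rw [hΘ]
      exact hkat _ hy.2.1
  · have := Θ.right_inv hy.1
    rwa [hΘ] at this

/-- A smooth map with surjective differential has a local section. -/
theorem exists_section_of_mfderiv_surjective {f : N → M} {S : Set N} (hS : IsOpen S)
    (hf : ContMDiffOn N.I M.I ∞ f S) {x₀ : N} (hx₀ : x₀ ∈ S)
    (hsurj : Function.Surjective (mfderiv N.I M.I f x₀)) :
    ∃ (r : M → N) (U : Set M), IsOpen U ∧ f x₀ ∈ U ∧ ContMDiffOn M.I N.I ∞ r U ∧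
      (∀ y ∈ U, r y ∈ S) ∧ ∀ y ∈ U, f (r y) = y := by
  let φ := extChartAt N.I x₀
  let ψ := extChartAt M.I (f x₀)
  let g : N.E → M.E := fun w => ψ (f (φ.symm w))
  have hφo : IsOpen φ.target := Form.isOpen_target x₀
  have hψo : IsOpen ψ.source := isOpen_extChartAt_source _
  have hφ' : ContMDiffOn 𝓘(ℝ, N.E) N.I ∞ φ.symm φ.target := contMDiffOn_extChartAt_symm x₀
  have hψ : ContMDiffOn M.I 𝓘(ℝ, M.E) ∞ ψ ψ.source := by
    rw [extChartAt_source]; exact contMDiffOn_extChartAt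
  have hψ' : ContMDiffOn 𝓘(ℝ, M.E) M.I ∞ ψ.symm ψ.target := contMDiffOn_extChartAt_symm _
  let S₁ : Set N := S ∩ f ⁻¹' ψ.source
  have hS₁ : IsOpen S₁ := hf.continuousOn.isOpen_inter_preimage hS hψo
  have hx₁ : x₀ ∈ S₁ := ⟨hx₀, mem_extChartAt_source _⟩
  have hfψ : ContMDiffOn N.I 𝓘(ℝ, M.E) ∞ (fun x => ψ (f x)) S₁ :=
    hψ.comp (hf.mono Set.inter_subset_left) fun x hx => hx.2
  let T : Set N.E := φ.target ∩ φ.symm ⁻¹' S₁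
  have hT : IsOpen T := hφ'.continuousOn.isOpen_inter_preimage hφo hS₁
  have hxφ : x₀ ∈ φ.source := mem_extChartAt_source x₀
  have hxT : φ x₀ ∈ T := ⟨φ.map_source hxφ, by
    rw [Set.mem_preimage, φ.left_inv hxφ]; exact hx₁⟩
  have hg : ContMDiffOn 𝓘(ℝ, N.E) 𝓘(ℝ, M.E) ∞ g T :=
    hfψ.comp (hφ'.mono Set.inter_subset_left) fun w hw => hw.2
  have hd : Function.Surjective (fderiv ℝ g (φ x₀)) := by
    have e1 : mfderiv 𝓘(ℝ, N.E) 𝓘(ℝ, M.E) g (φ x₀) =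
        (mfderiv M.I 𝓘(ℝ, M.E) ψ (f x₀)).comp ((mfderiv N.I M.I f x₀).comp
          (mfderiv 𝓘(ℝ, N.E) N.I φ.symm (φ x₀))) := by
      have d1 : HasMFDerivAt 𝓘(ℝ, N.E) N.I φ.symm (φ x₀)
          (mfderiv 𝓘(ℝ, N.E) N.I φ.symm (φ x₀)) :=
        ((hφ'.contMDiffAt (hφo.mem_nhds hxT.1)).mdifferentiableAt (by simp)).hasMFDerivAt
      have d2 : HasMFDerivAt N.I M.I f (φ.symm (φ x₀)) (mfderiv N.I M.I f x₀) := by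
        rw [φ.left_inv hxφ]
        exact ((hf.contMDiffAt (hS.mem_nhds hx₀)).mdifferentiableAt (by simp)).hasMFDerivAt
      have d3 : HasMFDerivAt M.I 𝓘(ℝ, M.E) ψ (f (φ.symm (φ x₀)))
          (mfderiv M.I 𝓘(ℝ, M.E) ψ (f x₀)) := by
        rw [φ.left_inv hxφ]
        exact ((hψ.contMDiffAt (hψo.mem_nhds hx₁.2)).mdifferentiableAt (by simp)).hasMFDerivAt
      exact (HasMFDerivAt.comp (φ x₀) (g := fun x => ψ (f x)) (HasMFDerivAt.comp (φ.symm (φ x₀)) d3 d2)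
        d1).mfderiv
    rw [← mfderiv_eq_fderiv, e1]
    have s1 := (isInvertible_mfderiv_extChartAt (I := M.I) hx₁.2).bijective.2
    have s2 := (isInvertible_mfderivWithin_extChartAt_symm (I := N.I) hxT.1).bijective.2
    rw [N.I.range_eq_univ, mfderivWithin_univ] at s2
    exact s1.comp (hsurj.comp s2)
  obtain ⟨r, U, hU, hxU, hr, hrS, hrg⟩ := exists_section_of_fderiv_surjective hT hg.contDiffOn hxT hd
  have hxU' : ψ (f x₀) ∈ U := by
    have : g (φ x₀) = ψ (f x₀) := by simp only [g, φ.left_inv hxφ]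
    rwa [← this]
  refine ⟨fun y => φ.symm (r (ψ y)), ψ.source ∩ ψ ⁻¹' U,
    hψ.continuousOn.isOpen_inter_preimage hψo hU, ⟨hx₁.2, hxU'⟩, ?_, fun y hy => (hrS _ hy.2).2.1,
    fun y hy => ?_⟩
  · have h1 : ContMDiffOn M.I 𝓘(ℝ, N.E) ∞ (fun y => r (ψ y)) (ψ.source ∩ ψ ⁻¹' U) :=
      hr.contMDiffOn.comp (hψ.mono Set.inter_subset_left) fun y hy => hy.2
    exact hφ'.comp h1 fun y hy => (hrS _ hy.2).1
  · exact ψ.injOn (hrS _ hy.2).2.2 hy.1 (hrg _ hy.2)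

open Manifold in
/-- A smooth map on a fibre product whose differential is surjective has local sections. -/
theorem exists_section_fiberProduct {Q : SmoothMfd.{u}} {f : N → M}
    (hf : IsSubmersion N.I M.I ∞ f) {j : P → M} (hj : ContMDiff P.I M.I ∞ j) {q : N × P → Q}
    (hq : ContMDiffOn (N.I.prod P.I) Q.I ∞ q {p | f p.1 = j p.2}) {x₀ : N} {y₀ : P}
    (h₀ : f x₀ = j y₀)
    (hsurj : ∀ c : TangentSpace Q.I (q (x₀, y₀)),
      ∃ (a : TangentSpace N.I x₀) (b : TangentSpace P.I y₀),
        (mfderiv N.I M.I f x₀ a : M.E) = (mfderiv P.I M.I j y₀ b : M.E) ∧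
        mfderivWithin (N.I.prod P.I) Q.I q {p | f p.1 = j p.2} (x₀, y₀) (a, b) = c) :
    ∃ (r₁ : Q → N) (r₂ : Q → P) (U : Set Q), IsOpen U ∧ q (x₀, y₀) ∈ U ∧
      ContMDiffOn Q.I N.I ∞ r₁ U ∧ ContMDiffOn Q.I P.I ∞ r₂ U ∧
      ∀ z ∈ U, f (r₁ z) = j (r₂ z) ∧ q (r₁ z, r₂ z) = z := by
  obtain ⟨R, W, hW, hxW, hR, hRf, hRx⟩ := exists_retraction_of_isSubmersion hf x₀
  have hfs : ContMDiff N.I M.I ∞ f := hf.contMDiff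
  have hι : ContMDiff (N.I.prod P.I) (N.I.prod M.I) ∞ fun p : N × P => (p.1, j p.2) :=
    contMDiff_fst.prodMk (hj.comp contMDiff_snd)
  let S : Set (N × P) := (fun p : N × P => (p.1, j p.2)) ⁻¹' W
  have hS : IsOpen S := hW.preimage hι.continuous
  have h₀S : (x₀, y₀) ∈ S := by show (x₀, j y₀) ∈ W; rw [← h₀]; exact hxW
  have hRι : ContMDiffOn (N.I.prod P.I) N.I ∞ (fun p : N × P => R (p.1, j p.2)) S :=
    hR.comp hι.contMDiffOn fun p hp => hp
  -- `Φ` retracts an open subset of `N × P` into the fibre product and fixes the fibre product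
  -- there. The composite `q ∘ Φ` lives on an open set, so the fibre product needs no manifold
  -- structure of its own.
  let Φ : N × P → N × P := fun p => (R (p.1, j p.2), p.2)
  have hΦ : ContMDiffOn (N.I.prod P.I) (N.I.prod P.I) ∞ Φ S := hRι.prodMk contMDiffOn_snd
  have hmaps : Set.MapsTo Φ S {p | f p.1 = j p.2} := fun p hp => hRf _ hp
  have hqΦ : ContMDiffOn (N.I.prod P.I) Q.I ∞ (fun p => q (Φ p)) S := hq.comp hΦ hmaps
  have hΦ₀ : Φ (x₀, y₀) = (x₀, y₀) := by
    simp only [Φ]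
    rw [← h₀, hRx _ hxW]
  have hnS : S ∈ nhds (x₀, y₀) := hS.mem_nhds h₀S
  have dR : HasMFDerivAt (N.I.prod M.I) N.I R (x₀, f x₀)
      (mfderiv (N.I.prod M.I) N.I R (x₀, f x₀)) :=
    ((hR.contMDiffAt (hW.mem_nhds hxW)).mdifferentiableAt (by simp)).hasMFDerivAt
  have df : HasMFDerivAt N.I M.I f x₀ (mfderiv N.I M.I f x₀) :=
    (hfs.mdifferentiable (by simp) x₀).hasMFDerivAt
  have dj : HasMFDerivAt P.I M.I j y₀ (mfderiv P.I M.I j y₀) :=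
    (hj.mdifferentiable (by simp) y₀).hasMFDerivAt
  -- Differentiating `R (x, f x) = x` shows that the derivative of `Φ` fixes the pairs `(a, b)` with
  -- `df a = dj b`. The surjectivity of the derivative of `q` on such pairs thus passes to `q ∘ Φ`.
  have dRx : ∀ a : N.E, (mfderiv (N.I.prod M.I) N.I R (x₀, f x₀)
      ((a, (mfderiv N.I M.I f x₀ a : M.E)) : N.E × M.E) : N.E) = a := by
    intro a
    have h1 : HasMFDerivAt N.I N.I (fun x => R (x, f x)) x₀
        ((mfderiv (N.I.prod M.I) N.I R (x₀, f x₀)).comp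
          ((ContinuousLinearMap.id ℝ (TangentSpace N.I x₀)).prod (mfderiv N.I M.I f x₀))) :=
      HasMFDerivAt.comp x₀ (g := R) (f := fun x => (x, f x)) dR ((hasMFDerivAt_id x₀).prodMk df)
    have h2 : (fun x => R (x, f x)) =ᶠ[nhds x₀] id := by
      have : (fun x => (x, f x)) ⁻¹' W ∈ nhds x₀ :=
        (contMDiff_id.prodMk hfs).continuous.continuousAt.preimage_mem_nhds (hW.mem_nhds hxW)
      filter_upwards [this] with x hx using hRx x hx
    have h3 := hasMFDerivAt_unique h1 ((hasMFDerivAt_id x₀).congr_of_eventuallyEq h2)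
    exact DFunLike.congr_fun h3 a
  have hs : Function.Surjective (mfderiv (N.I.prod P.I) Q.I (fun p => q (Φ p)) (x₀, y₀)) := by
    intro c
    have hqe : q (Φ (x₀, y₀)) = q (x₀, y₀) := by rw [hΦ₀]
    obtain ⟨a, b, hab, hc⟩ := hsurj (c : Q.E)
    refine ⟨((a, b) : N.E × P.E), ?_⟩
    have dq : HasMFDerivWithinAt (N.I.prod P.I) Q.I q {p | f p.1 = j p.2} (Φ (x₀, y₀))
        (mfderivWithin (N.I.prod P.I) Q.I q {p | f p.1 = j p.2} (x₀, y₀)) := by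
      rw [hΦ₀]
      exact ((hq (x₀, y₀) h₀).mdifferentiableWithinAt (by simp)).hasMFDerivWithinAt
    have dι : HasMFDerivAt (N.I.prod P.I) (N.I.prod M.I) (fun p : N × P => (p.1, j p.2)) (x₀, y₀)
        ((ContinuousLinearMap.fst ℝ N.E P.E).prod
          ((mfderiv P.I M.I j y₀).comp (ContinuousLinearMap.snd ℝ N.E P.E))) :=
      (hasMFDerivAt_fst (x₀, y₀)).prodMk
        (HasMFDerivAt.comp (x₀, y₀) (g := j) (f := Prod.snd) dj (hasMFDerivAt_snd (x₀, y₀)))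
    have dR' : HasMFDerivAt (N.I.prod M.I) N.I R (x₀, j y₀)
        (mfderiv (N.I.prod M.I) N.I R (x₀, f x₀)) := by rw [← h₀]; exact dR
    have dΦ : HasMFDerivAt (N.I.prod P.I) (N.I.prod P.I) Φ (x₀, y₀)
        (((mfderiv (N.I.prod M.I) N.I R (x₀, f x₀)).comp
          ((ContinuousLinearMap.fst ℝ N.E P.E).prod
            ((mfderiv P.I M.I j y₀).comp (ContinuousLinearMap.snd ℝ N.E P.E)))).prod
          (ContinuousLinearMap.snd ℝ N.E P.E)) :=
      (HasMFDerivAt.comp (x₀, y₀) (g := R) (f := fun p : N × P => (p.1, j p.2)) dR' dι).prodMk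
        (hasMFDerivAt_snd (x₀, y₀))
    have dqΦ := (HasMFDerivWithinAt.comp (x₀, y₀) dq dΦ.hasMFDerivWithinAt hmaps).hasMFDerivAt hnS
    have e1 := dqΦ.mfderiv
    have e2 : (mfderiv (N.I.prod M.I) N.I R (x₀, f x₀)
        ((a, (mfderiv P.I M.I j y₀ b : M.E)) : N.E × M.E) : N.E) = a := by
      rw [← hab]
      exact dRx a
    refine (DFunLike.congr_fun e1 ((a, b) : N.E × P.E)).trans (Eq.trans ?_ hc)
    show mfderivWithin (N.I.prod P.I) Q.I q {p | f p.1 = j p.2} (x₀, y₀)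
      (((mfderiv (N.I.prod M.I) N.I R (x₀, f x₀)
        ((a, (mfderiv P.I M.I j y₀ b : M.E)) : N.E × M.E) : N.E), b) : N.E × P.E) = _
    rw [e2]
  obtain ⟨r, U, hU, hxU, hr, hrS, hrq⟩ := exists_section_of_mfderiv_surjective
    (N := N.prod P) (M := Q) (f := fun p => q (Φ p)) hS hqΦ h₀S hs
  have hr₂ : ContMDiffOn Q.I P.I ∞ (fun z => (r z).2) U := contMDiff_snd.comp_contMDiffOn hr
  refine ⟨fun z => R ((r z).1, j (r z).2), fun z => (r z).2, U, hU, ?_, hRι.comp hr hrS, hr₂,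
    fun z hz => ⟨hRf _ (hrS z hz), hrq z hz⟩⟩
  have : q (Φ (x₀, y₀)) = q (x₀, y₀) := by rw [hΦ₀]
  rwa [← this]

end SmoothMfd

/-! ### Pull-back groupoids -/

namespace SetGroupoid

variable {A O A' O' Y Y' : Type u} (𝒢 : SetGroupoid A O) (π : Y → O)

/-- The arrows `(y', γ, y)` of the pull-back of `𝒢` along `π`. -/
abbrev PullbackArrows : Type u := {p : Y × A × Y // 𝒢.s p.2.1 = π p.1 ∧ 𝒢.t p.2.1 = π p.2.2}

open Classical in
/-- The product `(y'', γ', y') (y', γ, y) = (y'', γ' γ, y)`; other pairs are irrelevant. -/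
def pullbackMul (p q : 𝒢.PullbackArrows π) : 𝒢.PullbackArrows π :=
  if h : p.1.2.2 = q.1.1 then ⟨(p.1.1, 𝒢.mul p.1.2.1 q.1.2.1, q.1.2.2), by
    have e : 𝒢.t p.1.2.1 = 𝒢.s q.1.2.1 := by rw [p.2.2, h, q.2.1]
    exact ⟨(𝒢.s_mul _ _ e).trans p.2.1, (𝒢.t_mul _ _ e).trans q.2.2⟩⟩
  else p

variable {𝒢 π}

theorem pullbackMul_val {p q : 𝒢.PullbackArrows π} (h : p.1.2.2 = q.1.1) :
    (𝒢.pullbackMul π p q).1 = (p.1.1, 𝒢.mul p.1.2.1 q.1.2.1, q.1.2.2) := by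
  simp [pullbackMul, h]

theorem t_eq_s_of_pullback {p q : 𝒢.PullbackArrows π} (h : p.1.2.2 = q.1.1) :
    𝒢.t p.1.2.1 = 𝒢.s q.1.2.1 := by rw [p.2.2, h, q.2.1]

variable (𝒢 π)

/-- The pull-back of `𝒢` along a map to the objects. -/
def pullback : SetGroupoid (𝒢.PullbackArrows π) Y where
  s p := p.1.1
  t p := p.1.2.2
  one y := ⟨(y, 𝒢.one (π y), y), 𝒢.s_one _, 𝒢.t_one _⟩
  inv p := ⟨(p.1.2.2, 𝒢.inv p.1.2.1, p.1.1), (𝒢.s_inv _).trans p.2.2, (𝒢.t_inv _).trans p.2.1⟩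
  mul := 𝒢.pullbackMul π
  s_one _ := rfl
  t_one _ := rfl
  s_inv _ := rfl
  t_inv _ := rfl
  s_mul p q h := by rw [pullbackMul_val h]
  t_mul p q h := by rw [pullbackMul_val h]
  mul_assoc p q r h h' := by
    have e : p.1.2.2 = q.1.1 := h
    have e' : q.1.2.2 = r.1.1 := h'
    have k : (𝒢.pullbackMul π p q).1.2.2 = r.1.1 := by rw [pullbackMul_val e]; exact e'
    have k' : p.1.2.2 = (𝒢.pullbackMul π q r).1.1 := by rw [pullbackMul_val e']; exact e
    refine Subtype.ext ?_
    rw [pullbackMul_val k, pullbackMul_val k', pullbackMul_val e, pullbackMul_val e']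
    exact Prod.ext rfl (Prod.ext
      (𝒢.mul_assoc _ _ _ (t_eq_s_of_pullback e) (t_eq_s_of_pullback e')) rfl)
  one_mul p := by
    refine Subtype.ext ((pullbackMul_val rfl).trans (Prod.ext rfl (Prod.ext ?_ rfl)))
    show 𝒢.mul (𝒢.one (π p.1.1)) p.1.2.1 = p.1.2.1
    rw [← p.2.1, 𝒢.one_mul]
  mul_one p := by
    refine Subtype.ext ((pullbackMul_val rfl).trans (Prod.ext rfl (Prod.ext ?_ rfl)))
    show 𝒢.mul p.1.2.1 (𝒢.one (π p.1.2.2)) = p.1.2.1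
    rw [← p.2.2, 𝒢.mul_one]
  mul_inv p := by
    refine Subtype.ext ((pullbackMul_val rfl).trans (Prod.ext rfl (Prod.ext ?_ rfl)))
    show 𝒢.mul p.1.2.1 (𝒢.inv p.1.2.1) = 𝒢.one (π p.1.1)
    rw [← p.2.1, 𝒢.mul_inv]
  inv_mul p := by
    refine Subtype.ext ((pullbackMul_val rfl).trans (Prod.ext rfl (Prod.ext ?_ rfl)))
    show 𝒢.mul (𝒢.inv p.1.2.1) p.1.2.1 = 𝒢.one (π p.1.2.2)
    rw [← p.2.2, 𝒢.inv_mul]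

/-- The projection of the pull-back. -/
def pullbackHom : Hom (𝒢.pullback π) 𝒢 where
  onArr p := p.1.2.1
  onObj := π
  map_s p := p.2.1
  map_t p := p.2.2
  map_mul p q h := by
    show (𝒢.pullbackMul π p q).1.2.1 = _
    rw [pullbackMul_val h]

variable {𝒢 π}

/-- The homomorphism of pull-backs induced by a homomorphism and a compatible map of objects. -/
def Hom.pullbackMap {𝒢' : SetGroupoid A' O'} (φ : Hom 𝒢 𝒢') {π' : Y' → O'} (f : Y → Y')
    (hf : ∀ y, φ.onObj (π y) = π' (f y)) : Hom (𝒢.pullback π) (𝒢'.pullback π') where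
  onArr p := ⟨(f p.1.1, φ.onArr p.1.2.1, f p.1.2.2), by
    show 𝒢'.s (φ.onArr p.1.2.1) = π' (f p.1.1) ∧ 𝒢'.t (φ.onArr p.1.2.1) = π' (f p.1.2.2)
    rw [φ.map_s, φ.map_t, p.2.1, p.2.2, hf, hf]
    exact ⟨rfl, rfl⟩⟩
  onObj := f
  map_s _ := rfl
  map_t _ := rfl
  map_mul p q h := by
    have e : p.1.2.2 = q.1.1 := h
    refine Subtype.ext ?_
    refine Eq.trans ?_ (pullbackMul_val (𝒢 := 𝒢') (π := π') (congrArg f e)).symm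
    show (f (𝒢.pullbackMul π p q).1.1, φ.onArr (𝒢.pullbackMul π p q).1.2.1,
      f (𝒢.pullbackMul π p q).1.2.2) = _
    rw [pullbackMul_val e]
    exact Prod.ext rfl (Prod.ext (φ.map_mul _ _ (t_eq_s_of_pullback e)) rfl)

section

variable [HasSimplices A] [HasSimplices O] [HasSimplices Y]

theorem smoothOps_pullback [𝒢.SmoothOps] (hπ : MapsSimplices π) : (𝒢.pullback π).SmoothOps where
  s h := h.1
  t h := h.2.2
  one h := ⟨h, SmoothOps.one (𝒢 := 𝒢) (hπ h), h⟩
  inv h := ⟨h.2.2, SmoothOps.inv (𝒢 := 𝒢) h.2.1, h.1⟩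
  mul {k σ τ} hσ hτ h := by
    have e : (fun x => ((𝒢.pullback π).mul (σ x) (τ x)).1) = fun x =>
        ((σ x).1.1, 𝒢.mul (σ x).1.2.1 (τ x).1.2.1, (τ x).1.2.2) :=
      funext fun x => pullbackMul_val (h x)
    show HasSimplices.IsSimplex fun x => ((𝒢.pullback π).mul (σ x) (τ x)).1
    rw [e]
    exact ⟨hσ.1, SmoothOps.mul (𝒢 := 𝒢) hσ.2.1 hτ.2.1 fun x => t_eq_s_of_pullback (h x), hτ.2.2⟩

open Classical in
/-- The projection of the pull-back is Cartesian. -/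
def cartesianPullbackHom : (𝒢.pullbackHom π).Cartesian where
  -- The value `one y` only makes `lift` total; every condition on `lift` assumes that `γ` fits the
  -- given objects.
  lift γ y' y := if h : 𝒢.s γ = π y' ∧ 𝒢.t γ = π y then ⟨(y', γ, y), h⟩ else (𝒢.pullback π).one y
  s_lift γ y' y h h' := by rw [dif_pos ⟨h, h'⟩]; rfl
  t_lift γ y' y h h' := by rw [dif_pos ⟨h, h'⟩]; rfl
  map_lift γ y' y h h' := by rw [dif_pos ⟨h, h'⟩]; rfl
  unique a b h h' e := Subtype.ext (Prod.ext h (Prod.ext e h'))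
  mapsSimplices h := h.2.1
  isSimplex_lift {k σ τ' τ} hσ hτ' hτ h h' := by
    have e : (fun x => (if h : 𝒢.s (σ x) = π (τ' x) ∧ 𝒢.t (σ x) = π (τ x) then
        (⟨(τ' x, σ x, τ x), h⟩ : 𝒢.PullbackArrows π) else (𝒢.pullback π).one (τ x)).1) =
        fun x => (τ' x, σ x, τ x) := funext fun x => by rw [dif_pos ⟨h x, h' x⟩]
    show HasSimplices.IsSimplex fun x => (if h : 𝒢.s (σ x) = π (τ' x) ∧ 𝒢.t (σ x) = π (τ x) then
        (⟨(τ' x, σ x, τ x), h⟩ : 𝒢.PullbackArrows π) else (𝒢.pullback π).one (τ x)).1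
    rw [e]
    exact ⟨hτ', hσ, hτ⟩

end

theorem Hom.push_push_eq {B P B' P' : Type u} {ℋ : SetGroupoid B P} {ℋ' : SetGroupoid B' P'}
    {𝒢' : SetGroupoid A' O'} {φ : Hom 𝒢 ℋ} {ψ : Hom ℋ 𝒢'} {φ' : Hom 𝒢 ℋ'} {ψ' : Hom ℋ' 𝒢'}
    (h : ∀ a, ψ.onArr (φ.onArr a) = ψ'.onArr (φ'.onArr a))
    (h' : ∀ y, ψ.onObj (φ.onObj y) = ψ'.onObj (φ'.onObj y)) (D : 𝒢.DoubleChain) :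
    ψ.push (φ.push D) = ψ'.push (φ'.push D) := by
  funext k p
  simp only [push, Chain.push_push]
  congr 2
  funext a
  cases p with
  | zero => exact h' a
  | succ p => exact Subtype.ext (funext fun i => h (a.1 i))

end SetGroupoid

/-! ### Lie groupoids and their actions -/

namespace LieGroupoid

variable {Γ M : SmoothMfd.{u}} (𝒢 : LieGroupoid Γ M)

instance smoothOps : 𝒢.toSetGroupoid.SmoothOps where
  s h := PiecewiseSmooth.comp_contMDiff h 𝒢.submersion_s.contMDiff
  t h := PiecewiseSmooth.comp_contMDiff h 𝒢.submersion_t.contMDiff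
  one h := PiecewiseSmooth.comp_contMDiff h 𝒢.smooth_one
  inv h := PiecewiseSmooth.comp_contMDiff h 𝒢.smooth_inv
  mul hσ hτ h := (PiecewiseSmooth.prodMk hσ hτ).comp_contMDiffOn (M := Γ.prod Γ) 𝒢.smooth_mul h

end LieGroupoid

namespace LeftAction

variable {Γ M X : SmoothMfd.{u}} {𝒢 : LieGroupoid Γ M} (𝒜 : LeftAction 𝒢 X)

theorem isSimplex_act {k : ℕ} {σ : Δ k → Γ} {τ : Δ k → X} (hσ : PiecewiseSmooth Γ σ)
    (hτ : PiecewiseSmooth X τ) (h : ∀ x, 𝒢.t (σ x) = 𝒜.J (τ x)) :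
    PiecewiseSmooth X fun x => 𝒜.act (σ x) (τ x) :=
  (PiecewiseSmooth.prodMk hσ hτ).comp_contMDiffOn (M := Γ.prod X) 𝒜.smooth_act h

instance smoothOps_transformation : 𝒜.transformation.SmoothOps where
  s {k σ} h := 𝒜.isSimplex_act h.1 h.2 fun x => (σ x).2
  t h := h.2
  one h := ⟨PiecewiseSmooth.comp_contMDiff (PiecewiseSmooth.comp_contMDiff h 𝒜.smooth_J)
    𝒢.smooth_one, h⟩
  inv {k σ} h := ⟨PiecewiseSmooth.comp_contMDiff h.1 𝒢.smooth_inv,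
    𝒜.isSimplex_act h.1 h.2 fun x => (σ x).2⟩
  mul {k σ τ} hσ hτ h := by
    have h' : ∀ x, (σ x).1.2 = 𝒜.act (τ x).1.1 (τ x).1.2 := h
    have e : (fun x => (𝒜.transformation.mul (σ x) (τ x)).1) = fun x =>
        (𝒢.mul (σ x).1.1 (τ x).1.1, (τ x).1.2) := funext fun x => 𝒜.mulArrow_val (h' x)
    show HasSimplices.IsSimplex fun x => (𝒜.transformation.mul (σ x) (τ x)).1
    rw [e]
    refine ⟨SetGroupoid.SmoothOps.mul (𝒢 := 𝒢.toSetGroupoid) hσ.1 hτ.1 fun x => ?_, hτ.2⟩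
    rw [(σ x).2, h' x, 𝒜.J_act _ _ (τ x).2]

theorem act_inv_act {g : Γ} {x : X} (h : 𝒢.t g = 𝒜.J x) : 𝒜.act (𝒢.inv g) (𝒜.act g x) = x := by
  rw [← 𝒜.mul_act _ _ _ (𝒢.t_inv _) h, 𝒢.inv_mul, h, 𝒜.one_act]

end LeftAction

theorem RightAction.act_act_inv {Γ M X : SmoothMfd.{u}} {𝒢 : LieGroupoid Γ M}
    (𝒜 : RightAction 𝒢 X) {x : X} {h : Γ} (e : 𝒜.J x = 𝒢.s h) :
    𝒜.act (𝒜.act x h) (𝒢.inv h) = x := by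
  rw [← 𝒜.act_mul _ _ _ e (𝒢.s_inv _).symm, 𝒢.mul_inv, ← e, 𝒜.act_one]

theorem SetGroupoid.eq_of_mul_inv_eq_one {A O : Type u} (𝒢 : SetGroupoid A O) {g g' : A}
    (ht : 𝒢.t g = 𝒢.t g') (h : 𝒢.mul g (𝒢.inv g') = 𝒢.one (𝒢.s g)) : g = g' := by
  have h1 : 𝒢.t g = 𝒢.s (𝒢.inv g') := by rw [𝒢.s_inv, ht]
  have hs : 𝒢.s g' = 𝒢.s g := by
    rw [← 𝒢.t_inv g', ← 𝒢.t_mul _ _ h1, h, 𝒢.t_one]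
  have h2 := 𝒢.mul_assoc g (𝒢.inv g') g' h1 (𝒢.t_inv _)
  rw [h, 𝒢.inv_mul, ← ht, 𝒢.mul_one, ← hs, 𝒢.one_mul] at h2
  exact h2.symm

theorem SetGroupoid.eq_of_inv_mul_eq_one {A O : Type u} (𝒢 : SetGroupoid A O) {g g' : A}
    (hs : 𝒢.s g = 𝒢.s g') (h : 𝒢.mul (𝒢.inv g') g = 𝒢.one (𝒢.t g')) : g = g' := by
  have h1 : 𝒢.t (𝒢.inv g') = 𝒢.s g := by rw [𝒢.t_inv, hs]
  have h2 := 𝒢.mul_assoc g' (𝒢.inv g') g (𝒢.s_inv _).symm h1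
  rw [h, 𝒢.mul_inv, ← hs, 𝒢.one_mul, 𝒢.mul_one] at h2
  exact h2

/-! ### The linking groupoid: the pull-back of `G` to `X` is also the pull-back of `H`. -/

namespace MoritaBimodule

variable {G G₀ H H₀ X : SmoothMfd.{u}} {𝒢 : LieGroupoid G G₀} {ℋ : LieGroupoid H H₀}
  (B : MoritaBimodule 𝒢 ℋ X)

theorem left_cancel {g g' : G} {x : X} (h : 𝒢.t g = B.left.J x) (h' : 𝒢.t g' = B.left.J x)
    (e : B.left.act g x = B.left.act g' x) : g = g' := by
  have hs : 𝒢.s g = 𝒢.s g' := by rw [← B.left.J_act _ _ h, e, B.left.J_act _ _ h']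
  have h1 : 𝒢.t (𝒢.inv g') = 𝒢.s g := by rw [𝒢.t_inv, hs]
  have h2 : 𝒢.t (𝒢.mul (𝒢.inv g') g) = B.left.J x := by rw [𝒢.t_mul _ _ h1, h]
  refine 𝒢.eq_of_inv_mul_eq_one hs ?_
  rw [h']
  refine B.left_free _ _ h2 ?_
  rw [B.left.mul_act _ _ _ h1 h, e, B.left.act_inv_act h']

theorem right_cancel {h h' : H} {x : X} (e₁ : B.right.J x = ℋ.s h) (e₂ : B.right.J x = ℋ.s h')
    (e : B.right.act x h = B.right.act x h') : h = h' := by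
  have ht : ℋ.t h = ℋ.t h' := by rw [← B.right.J_act _ _ e₁, e, B.right.J_act _ _ e₂]
  have h1 : ℋ.t h = ℋ.s (ℋ.inv h') := by rw [ℋ.s_inv, ht]
  have h2 : B.right.J x = ℋ.s (ℋ.mul h (ℋ.inv h')) := by rw [ℋ.s_mul _ _ h1, e₁]
  refine ℋ.eq_of_mul_inv_eq_one ht ?_
  rw [← e₁]
  refine B.right_free _ _ h2 ?_
  rw [B.right.act_mul _ _ _ e₁ h1, e, B.right.act_act_inv e₂]

/-- The arrow `g` with `x = g y`. -/
def leftDiv : X → X → G := B.left_principal.choose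

/-- The arrow `h` with `x h = y`. -/
def rightDiv : X → X → H := B.right_principal.choose

variable {B}

theorem t_leftDiv {x y : X} (h : B.right.J x = B.right.J y) : 𝒢.t (B.leftDiv x y) = B.left.J y :=
  (B.left_principal.choose_spec.2 x y h).1

theorem leftDiv_act {x y : X} (h : B.right.J x = B.right.J y) :
    B.left.act (B.leftDiv x y) y = x :=
  (B.left_principal.choose_spec.2 x y h).2

theorem s_leftDiv {x y : X} (h : B.right.J x = B.right.J y) : 𝒢.s (B.leftDiv x y) = B.left.J x := by
  rw [← B.left.J_act _ _ (t_leftDiv h), leftDiv_act h]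

theorem s_rightDiv {x y : X} (h : B.left.J x = B.left.J y) : ℋ.s (B.rightDiv x y) = B.right.J x :=
  (B.right_principal.choose_spec.2 x y h).1.symm

theorem act_rightDiv {x y : X} (h : B.left.J x = B.left.J y) :
    B.right.act x (B.rightDiv x y) = y :=
  (B.right_principal.choose_spec.2 x y h).2

theorem t_rightDiv {x y : X} (h : B.left.J x = B.left.J y) :
    ℋ.t (B.rightDiv x y) = B.right.J y := by
  rw [← B.right.J_act _ _ (s_rightDiv h).symm, act_rightDiv h]

theorem isSimplex_leftDiv {k : ℕ} {σ τ : Δ k → X} (hσ : PiecewiseSmooth X σ)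
    (hτ : PiecewiseSmooth X τ) (h : ∀ x, B.right.J (σ x) = B.right.J (τ x)) :
    PiecewiseSmooth G fun x => B.leftDiv (σ x) (τ x) :=
  (hσ.prodMk hτ).comp_contMDiffOn (M := X.prod X) B.left_principal.choose_spec.1 h

theorem isSimplex_rightDiv {k : ℕ} {σ τ : Δ k → X} (hσ : PiecewiseSmooth X σ)
    (hτ : PiecewiseSmooth X τ) (h : ∀ x, B.left.J (σ x) = B.left.J (τ x)) :
    PiecewiseSmooth H fun x => B.rightDiv (σ x) (τ x) :=
  (hσ.prodMk hτ).comp_contMDiffOn (M := X.prod X) B.right_principal.choose_spec.1 h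

theorem isSimplex_right_act {k : ℕ} {σ : Δ k → X} {τ : Δ k → H} (hσ : PiecewiseSmooth X σ)
    (hτ : PiecewiseSmooth H τ) (h : ∀ x, B.right.J (σ x) = ℋ.s (τ x)) :
    PiecewiseSmooth X fun x => B.right.act (σ x) (τ x) :=
  (PiecewiseSmooth.prodMk hσ hτ).comp_contMDiffOn (M := X.prod H) B.right.smooth_act h

variable (B)

/-- The pull-back of `G` to `X`. -/
abbrev linking : SetGroupoid (𝒢.PullbackArrows B.left.J) X := 𝒢.pullback B.left.J

/-- The arrow `h` of `H` with `x' h = g x`. -/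
def rightArrow (x' : X) (g : G) (x : X) : H := B.rightDiv x' (B.left.act g x)

/-- The arrow `g` of `G` with `x' h = g x`. -/
def leftArrow (x' : X) (h : H) (x : X) : G := B.leftDiv (B.right.act x' h) x

variable {B}

section

variable {x' x : X} {g : G} {h : H}

theorem J_act_eq (hs : 𝒢.s g = B.left.J x') (ht : 𝒢.t g = B.left.J x) :
    B.left.J x' = B.left.J (B.left.act g x) := by rw [B.left.J_act _ _ ht, hs]

theorem s_rightArrow (hs : 𝒢.s g = B.left.J x') (ht : 𝒢.t g = B.left.J x) :
    ℋ.s (B.rightArrow x' g x) = B.right.J x' := s_rightDiv (J_act_eq hs ht)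

theorem t_rightArrow (hs : 𝒢.s g = B.left.J x') (ht : 𝒢.t g = B.left.J x) :
    ℋ.t (B.rightArrow x' g x) = B.right.J x := by
  rw [rightArrow, t_rightDiv (J_act_eq hs ht), B.right_left _ _ ht]

theorem act_rightArrow (hs : 𝒢.s g = B.left.J x') (ht : 𝒢.t g = B.left.J x) :
    B.right.act x' (B.rightArrow x' g x) = B.left.act g x := act_rightDiv (J_act_eq hs ht)

/-- Freeness of the right action makes the equation `x' h = g x` characterize `h`. Identities
between arrows of `H` are proved by checking this equation. -/
theorem rightArrow_eq (hs : 𝒢.s g = B.left.J x') (ht : 𝒢.t g = B.left.J x)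
    (hs' : ℋ.s h = B.right.J x') (e : B.right.act x' h = B.left.act g x) :
    B.rightArrow x' g x = h :=
  B.right_cancel (s_rightArrow hs ht).symm hs'.symm ((act_rightArrow hs ht).trans e.symm)

theorem J_right_act_eq (hs : ℋ.s h = B.right.J x') (ht : ℋ.t h = B.right.J x) :
    B.right.J (B.right.act x' h) = B.right.J x := by rw [B.right.J_act _ _ hs.symm, ht]

theorem s_leftArrow (hs : ℋ.s h = B.right.J x') (ht : ℋ.t h = B.right.J x) :
    𝒢.s (B.leftArrow x' h x) = B.left.J x' := by
  rw [leftArrow, s_leftDiv (J_right_act_eq hs ht), B.left_right _ _ hs.symm]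

theorem t_leftArrow (hs : ℋ.s h = B.right.J x') (ht : ℋ.t h = B.right.J x) :
    𝒢.t (B.leftArrow x' h x) = B.left.J x := t_leftDiv (J_right_act_eq hs ht)

theorem leftArrow_act (hs : ℋ.s h = B.right.J x') (ht : ℋ.t h = B.right.J x) :
    B.left.act (B.leftArrow x' h x) x = B.right.act x' h := leftDiv_act (J_right_act_eq hs ht)

theorem rightArrow_leftArrow (hs : ℋ.s h = B.right.J x') (ht : ℋ.t h = B.right.J x) :
    B.rightArrow x' (B.leftArrow x' h x) x = h :=
  rightArrow_eq (s_leftArrow hs ht) (t_leftArrow hs ht) hs (leftArrow_act hs ht).symm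

theorem eq_of_rightArrow_eq {g' : G} (hs : 𝒢.s g = B.left.J x') (ht : 𝒢.t g = B.left.J x)
    (hs' : 𝒢.s g' = B.left.J x') (ht' : 𝒢.t g' = B.left.J x)
    (e : B.rightArrow x' g x = B.rightArrow x' g' x) : g = g' :=
  B.left_cancel ht ht' (by rw [← act_rightArrow hs ht, e, act_rightArrow hs' ht'])

/-- Since the actions commute, `x'' h' h = (g' x') h = g' (x' h) = (g' g) x`. -/
theorem rightArrow_mul {x'' : X} {g' : G} (hs' : 𝒢.s g' = B.left.J x'')
    (ht' : 𝒢.t g' = B.left.J x') (hs : 𝒢.s g = B.left.J x') (ht : 𝒢.t g = B.left.J x) :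
    B.rightArrow x'' (𝒢.mul g' g) x = ℋ.mul (B.rightArrow x'' g' x') (B.rightArrow x' g x) := by
  have e : 𝒢.t g' = 𝒢.s g := ht'.trans hs.symm
  have e' : ℋ.t (B.rightArrow x'' g' x') = ℋ.s (B.rightArrow x' g x) :=
    (t_rightArrow hs' ht').trans (s_rightArrow hs ht).symm
  refine rightArrow_eq ((𝒢.s_mul _ _ e).trans hs') ((𝒢.t_mul _ _ e).trans ht)
    ((ℋ.s_mul _ _ e').trans (s_rightArrow hs' ht')) ?_
  rw [B.right.act_mul _ _ _ (s_rightArrow hs' ht').symm e', act_rightArrow hs' ht',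
    ← B.comm _ _ _ ht' (s_rightArrow hs ht).symm, act_rightArrow hs ht,
    B.left.mul_act _ _ _ e ht]

end

theorem isSimplex_rightArrow {k : ℕ} {τ' τ : Δ k → X} {σ : Δ k → G} (hτ' : PiecewiseSmooth X τ')
    (hσ : PiecewiseSmooth G σ) (hτ : PiecewiseSmooth X τ) (hs : ∀ x, 𝒢.s (σ x) = B.left.J (τ' x))
    (ht : ∀ x, 𝒢.t (σ x) = B.left.J (τ x)) :
    PiecewiseSmooth H fun x => B.rightArrow (τ' x) (σ x) (τ x) :=
  isSimplex_rightDiv hτ' (B.left.isSimplex_act hσ hτ ht) fun x => J_act_eq (hs x) (ht x)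

theorem isSimplex_leftArrow {k : ℕ} {τ' τ : Δ k → X} {σ : Δ k → H} (hτ' : PiecewiseSmooth X τ')
    (hσ : PiecewiseSmooth H σ) (hτ : PiecewiseSmooth X τ) (hs : ∀ x, ℋ.s (σ x) = B.right.J (τ' x))
    (ht : ∀ x, ℋ.t (σ x) = B.right.J (τ x)) :
    PiecewiseSmooth G fun x => B.leftArrow (τ' x) (σ x) (τ x) :=
  isSimplex_leftDiv (isSimplex_right_act hτ' hσ fun x => (hs x).symm) hτ
    fun x => J_right_act_eq (hs x) (ht x)

variable (B)

/-- The homomorphism from the pull-back of `G` to `H`. -/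
def linkingHom : SetGroupoid.Hom B.linking ℋ.toSetGroupoid where
  onArr p := B.rightArrow p.1.1 p.1.2.1 p.1.2.2
  onObj := B.right.J
  map_s p := s_rightArrow p.2.1 p.2.2
  map_t p := t_rightArrow p.2.1 p.2.2
  map_mul p q h := by
    have e : p.1.2.2 = q.1.1 := h
    show B.rightArrow (𝒢.pullbackMul _ p q).1.1 (𝒢.pullbackMul _ p q).1.2.1
      (𝒢.pullbackMul _ p q).1.2.2 = _
    rw [SetGroupoid.pullbackMul_val e]
    refine (rightArrow_mul (x' := q.1.1) p.2.1 (by rw [p.2.2, e]) q.2.1 q.2.2).trans ?_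
    rw [e]

open Classical in
/-- The pull-back of `G` to `X` is also the pull-back of `H`. -/
def cartesianLinkingHom : B.linkingHom.Cartesian where
  lift h x' x := if e : ℋ.s h = B.right.J x' ∧ ℋ.t h = B.right.J x then
    ⟨(x', B.leftArrow x' h x, x), s_leftArrow e.1 e.2, t_leftArrow e.1 e.2⟩ else B.linking.one x
  s_lift h x' x e e' := by rw [dif_pos ⟨e, e'⟩]; rfl
  t_lift h x' x e e' := by rw [dif_pos ⟨e, e'⟩]; rfl
  map_lift h x' x e e' := by rw [dif_pos ⟨e, e'⟩]; exact rightArrow_leftArrow e e'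
  unique := by
    rintro ⟨⟨x', g, x⟩, hs, ht⟩ ⟨⟨y', g', y⟩, hs', ht'⟩ h h' e
    obtain rfl : x' = y' := h
    obtain rfl : x = y := h'
    exact Subtype.ext (Prod.ext rfl (Prod.ext (eq_of_rightArrow_eq hs ht hs' ht' e) rfl))
  mapsSimplices {k σ} h := isSimplex_rightArrow h.1 h.2.1 h.2.2 (fun x => (σ x).2.1)
    fun x => (σ x).2.2
  isSimplex_lift {k σ τ' τ} hσ hτ' hτ h h' := by
    have e : (fun x => (if e : ℋ.s (σ x) = B.right.J (τ' x) ∧ ℋ.t (σ x) = B.right.J (τ x) then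
        (⟨(τ' x, B.leftArrow (τ' x) (σ x) (τ x), τ x), s_leftArrow e.1 e.2, t_leftArrow e.1 e.2⟩ :
          𝒢.PullbackArrows B.left.J) else B.linking.one (τ x)).1) =
        fun x => (τ' x, B.leftArrow (τ' x) (σ x) (τ x), τ x) :=
      funext fun x => by rw [dif_pos ⟨h x, h' x⟩]
    show HasSimplices.IsSimplex fun x => (if e : ℋ.s (σ x) = B.right.J (τ' x) ∧
      ℋ.t (σ x) = B.right.J (τ x) then
        (⟨(τ' x, B.leftArrow (τ' x) (σ x) (τ x), τ x), s_leftArrow e.1 e.2, t_leftArrow e.1 e.2⟩ :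
          𝒢.PullbackArrows B.left.J) else B.linking.one (τ x)).1
    rw [e]
    exact ⟨hτ', isSimplex_leftArrow hτ' hσ hτ h h', hτ⟩

instance smoothOps_linking : B.linking.SmoothOps :=
  SetGroupoid.smoothOps_pullback fun h => PiecewiseSmooth.comp_contMDiff h B.left.smooth_J

end MoritaBimodule

/-! ### Spaces which correspond under a Morita equivalence -/

namespace SmoothMfd

variable {M N P Q : SmoothMfd.{u}}

open Manifold in
/-- Small simplices lift along surjective submersions. -/
theorem exists_nhds_lift_of_isSubmersion {f : N → M} (hf : IsSubmersion N.I M.I ∞ f)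
    (hs : Function.Surjective f) (o : M) : ∃ U ∈ nhds o, ∀ (k : ℕ) (m : Δ k → M),
      PiecewiseSmooth M m → (∀ x, m x ∈ U) →
      ∃ y : Δ k → N, PiecewiseSmooth N y ∧ ∀ x, f (y x) = m x := by
  obtain ⟨x₀, rfl⟩ := hs o
  obtain ⟨r, U, hU, hxU, hr, hfr⟩ := exists_section_of_isSubmersion hf x₀
  exact ⟨U, hU.mem_nhds hxU, fun k m hm hmU =>
    ⟨fun x => r (m x), hm.comp_contMDiffOn hr hmU, fun x => hfr _ (hmU x)⟩⟩

open Manifold in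
/-- Small simplices lift to fibre products with surjective submersions. -/
theorem exists_nhds_lift_fiberProduct {f : N → M} (hf : IsSubmersion N.I M.I ∞ f)
    (hs : Function.Surjective f) {j : P → M} (hj : ContMDiff P.I M.I ∞ j) (o : P) :
    ∃ U ∈ nhds o, ∀ (k : ℕ) (m : Δ k → P), PiecewiseSmooth P m → (∀ x, m x ∈ U) →
      ∃ y : Δ k → {p : N × P // f p.1 = j p.2}, HasSimplices.IsSimplex y ∧
        ∀ x, (y x).1.2 = m x := by
  obtain ⟨U, hU, h⟩ := exists_nhds_lift_of_isSubmersion hf hs (j o)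
  refine ⟨j ⁻¹' U, hj.continuous.continuousAt.preimage_mem_nhds hU, fun k m hm hmU => ?_⟩
  obtain ⟨y, hy, hfy⟩ := h k (fun x => j (m x)) (hm.comp_contMDiff hj) hmU
  exact ⟨fun x => ⟨(y x, m x), hfy x⟩, ⟨hy, hm⟩, fun x => rfl⟩

end SmoothMfd

namespace RightAction

variable {Γ M X : SmoothMfd.{u}} {𝒢 : LieGroupoid Γ M}

theorem act_inv_act (𝒜 : RightAction 𝒢 X) {x : X} {h : Γ} (e : 𝒜.J x = 𝒢.t h) :
    𝒜.act (𝒜.act x (𝒢.inv h)) h = x := by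
  rw [← 𝒜.act_mul _ _ _ (e.trans (𝒢.s_inv _).symm) (𝒢.t_inv _), 𝒢.inv_mul, ← e, 𝒜.act_one]

end RightAction

/-! ### The linking groupoid over `X ×_{G₀} F` and its projection to the transformation groupoid of
`E`. -/

namespace MoritaBimodule

variable {G G₀ H H₀ X F₀ E₀ : SmoothMfd.{u}} {𝒢 : LieGroupoid G G₀} {ℋ : LieGroupoid H H₀}
  (B : MoritaBimodule 𝒢 ℋ X) (F : LeftAction 𝒢 F₀) (E : LeftAction ℋ E₀)

/-- The fibre product `X ×_{G₀} F`. -/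
abbrev FiberProduct : Type u := {p : X × F₀ // B.left.J p.1 = F.J p.2}

/-- The pull-back of the transformation groupoid of `F` to `X ×_{G₀} F`. -/
abbrev linkingOver : SetGroupoid (F.transformation.PullbackArrows fun p : B.FiberProduct F => p.1.2)
    (B.FiberProduct F) :=
  F.transformation.pullback fun p : B.FiberProduct F => p.1.2

instance smoothOps_linkingOver : (B.linkingOver F).SmoothOps :=
  SetGroupoid.smoothOps_pullback fun h => h.2

/-- The homomorphism of pull-backs which covers the moment map. -/
def linkingMomentHom : SetGroupoid.Hom (B.linkingOver F) B.linking :=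
  F.momentHom.pullbackMap (fun p => p.1.1) fun p => p.2.symm

/-- `E` is the quotient of `X ×_{G₀} F` by `G`, by means of the map `q`. -/
structure IsQuotientMap (q : X × F₀ → E₀) : Prop where
  smooth : ContMDiffOn (X.I.prod F₀.I) E₀.I ∞ q {p | B.left.J p.1 = F.J p.2}
  eq_iff : ∀ x f x' f', B.left.J x = F.J f → B.left.J x' = F.J f' →
      (q (x, f) = q (x', f') ↔
        ∃ g, 𝒢.t g = B.left.J x ∧ x' = B.left.act g x ∧ f' = F.act g f)
  J_apply : ∀ x f, B.left.J x = F.J f → E.J (q (x, f)) = B.right.J x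
  act_apply : ∀ h x f, B.left.J x = F.J f → ℋ.t h = B.right.J x →
      E.act h (q (x, f)) = q (B.right.act x (ℋ.inv h), f)

namespace IsQuotientMap

variable {B F E} {q : X × F₀ → E₀} (hq : B.IsQuotientMap F E q)

include hq

theorem mapsSimplices : MapsSimplices fun p : B.FiberProduct F => q p.1 := by
  intro k σ h
  exact (PiecewiseSmooth.prodMk h.1 h.2).comp_contMDiffOn (M := X.prod F₀) hq.smooth
    fun x => (σ x).2

/-- If `x' h = g x`, then `h · [x, f] = [x h⁻¹, f]`, and moving this representative by `g` gives `[g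
x h⁻¹, g f] = [x', g f]`. -/
theorem act_eq_of_rightArrow {x' x : X} {g : G} {f : F₀} (hs : 𝒢.s g = B.left.J x')
    (ht : 𝒢.t g = B.left.J x) (hf : B.left.J x = F.J f) :
    E.act (B.rightArrow x' g x) (q (x, f)) = q (x', F.act g f) := by
  have h1 := s_rightArrow hs ht
  have h2 := t_rightArrow hs ht
  have h3 : B.right.J x = ℋ.s (ℋ.inv (B.rightArrow x' g x)) := by rw [ℋ.s_inv, h2]
  have h4 := B.left_right x _ h3
  rw [hq.act_apply _ _ _ hf h2, hq.eq_iff _ _ _ _ (h4.trans hf)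
    (by rw [F.J_act _ _ (ht.trans hf), hs])]
  refine ⟨g, ht.trans h4.symm, ?_, rfl⟩
  rw [B.comm _ _ _ ht h3, ← act_rightArrow hs ht, B.right.act_act_inv h1.symm]

/-- The equality of classes provides some `g` with `x' = g x h⁻¹` and `f' = g f`. By freeness of the
left action on `X`, this `g` is the arrow determined by `x' h = g x`. -/
theorem leftArrow_act_eq {x' x : X} {h : H} {f' f : F₀} (hf' : B.left.J x' = F.J f')
    (hf : B.left.J x = F.J f) (hs : ℋ.s h = B.right.J x') (ht : ℋ.t h = B.right.J x)
    (e : E.act h (q (x, f)) = q (x', f')) : F.act (B.leftArrow x' h x) f = f' := by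
  have h3 : B.right.J x = ℋ.s (ℋ.inv h) := by rw [ℋ.s_inv, ht]
  have h4 := B.left_right x _ h3
  rw [hq.act_apply _ _ _ hf ht, hq.eq_iff _ _ _ _ (h4.trans hf) hf'] at e
  obtain ⟨g, h5, h6, h7⟩ := e
  have h8 : B.leftArrow x' h x = g := by
    refine B.left_cancel (t_leftArrow hs ht) (h5.trans h4) ?_
    rw [leftArrow_act hs ht, h6, ← B.comm _ _ _ h5 (by rw [B.right.J_act _ _ h3, ℋ.t_inv]),
      B.right.act_inv_act ht.symm]
  rw [h8, h7]

/-- The homomorphism to the transformation groupoid of `E`. -/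
def hom : SetGroupoid.Hom (B.linkingOver F) E.transformation where
  onArr p := ⟨(B.rightArrow p.1.1.1.1 p.1.2.1.1.1 p.1.2.2.1.1, q p.1.2.2.1), by
    have h := ((B.linkingMomentHom F).onArr p).2
    show ℋ.t (B.rightArrow p.1.1.1.1 p.1.2.1.1.1 p.1.2.2.1.1) = E.J (q p.1.2.2.1)
    exact (t_rightArrow h.1 h.2).trans (hq.J_apply _ _ p.1.2.2.2).symm⟩
  onObj p := q p.1
  map_s p := by
    have h := ((B.linkingMomentHom F).onArr p).2
    refine (hq.act_eq_of_rightArrow h.1 h.2 p.1.2.2.2).trans (congrArg q (Prod.ext rfl ?_))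
    have h1 : p.1.2.1.1.2 = p.1.2.2.1.2 := p.2.2
    show F.act p.1.2.1.1.1 p.1.2.2.1.2 = p.1.1.1.2
    rw [← h1]
    exact p.2.1
  map_t p := rfl
  map_mul a b h := by
    have e : a.1.2.2 = b.1.1 := h
    have e' : (B.linking).t ((B.linkingMomentHom F).onArr a) =
        B.linking.s ((B.linkingMomentHom F).onArr b) := by
      rw [(B.linkingMomentHom F).map_t, (B.linkingMomentHom F).map_s, h]
    have e'' := B.linkingHom.map_mul _ _ e'
    rw [← (B.linkingMomentHom F).map_mul _ _ h] at e''
    have h1 := ((B.linkingMomentHom F).onArr b).2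
    refine Subtype.ext (Eq.trans ?_ (E.mulArrow_val ?_).symm)
    · refine Prod.ext e'' ?_
      show q (F.transformation.pullbackMul _ a b).1.2.2.1 = q b.1.2.2.1
      rw [SetGroupoid.pullbackMul_val e]
    · refine Eq.trans ?_ (hq.act_eq_of_rightArrow h1.1 h1.2 b.1.2.2.2).symm
      show q a.1.2.2.1 = _
      rw [e]
      refine congrArg q (Prod.ext rfl ?_)
      have h2 : b.1.2.1.1.2 = b.1.2.2.1.2 := b.2.2
      show b.1.1.1.2 = F.act b.1.2.1.1.1 b.1.2.2.1.2
      rw [← h2]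
      exact b.2.1.symm

theorem s_eq_of_arrow {a : E.Arrows} {y' : B.FiberProduct F}
    (h' : E.transformation.s a = q y'.1) : ℋ.s a.1.1 = B.right.J y'.1.1 := by
  rw [← E.J_act _ _ a.2, ← hq.J_apply _ _ y'.2]
  exact congrArg E.J h'

theorem t_eq_of_arrow {a : E.Arrows} {y : B.FiberProduct F}
    (h : E.transformation.t a = q y.1) : ℋ.t a.1.1 = B.right.J y.1.1 := by
  rw [a.2, ← hq.J_apply _ _ y.2]
  exact congrArg E.J h

/-- The arrow of the pull-back over an arrow of the transformation groupoid of `E`. -/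
def liftArrow (a : E.Arrows) (y' y : B.FiberProduct F) (h' : E.transformation.s a = q y'.1)
    (h : E.transformation.t a = q y.1) :
    F.transformation.PullbackArrows fun p : B.FiberProduct F => p.1.2 :=
  have hs := hq.s_eq_of_arrow h'
  have ht := hq.t_eq_of_arrow h
  ⟨(y', ⟨(B.leftArrow y'.1.1 a.1.1 y.1.1, y.1.2), (t_leftArrow hs ht).trans y.2⟩, y),
    hq.leftArrow_act_eq y'.2 y.2 hs ht (by
      have h2 : a.1.2 = q (y.1.1, y.1.2) := h
      rw [← h2]
      exact h'), rfl⟩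

open Classical in
/-- The homomorphism to the transformation groupoid of `E` is Cartesian. -/
def cartesianHom : hq.hom.Cartesian where
  lift a y' y := if h : E.transformation.s a = q y'.1 ∧ E.transformation.t a = q y.1 then
    hq.liftArrow a y' y h.1 h.2 else (B.linkingOver F).one y
  s_lift a y' y h h' := by rw [dif_pos ⟨h, h'⟩]; rfl
  t_lift a y' y h h' := by rw [dif_pos ⟨h, h'⟩]; rfl
  map_lift a y' y h h' := by
    rw [dif_pos ⟨h, h'⟩]
    exact Subtype.ext (Prod.ext (rightArrow_leftArrow (hq.s_eq_of_arrow h) (hq.t_eq_of_arrow h'))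
      h'.symm)
  unique := by
    intro a b h h' e
    have ha := ((B.linkingMomentHom F).onArr a).2
    have hb := ((B.linkingMomentHom F).onArr b).2
    have e1 : B.rightArrow a.1.1.1.1 a.1.2.1.1.1 a.1.2.2.1.1 =
        B.rightArrow b.1.1.1.1 b.1.2.1.1.1 b.1.2.2.1.1 := congrArg (fun c => c.1.1) e
    have h0 : a.1.1 = b.1.1 := h
    have h0' : a.1.2.2 = b.1.2.2 := h'
    have h1 : a.1.2.1.1.2 = a.1.2.2.1.2 := a.2.2
    have h2 : b.1.2.1.1.2 = b.1.2.2.1.2 := b.2.2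
    have hbs : 𝒢.s b.1.2.1.1.1 = B.left.J a.1.1.1.1 := by rw [h0]; exact hb.1
    have hbt : 𝒢.t b.1.2.1.1.1 = B.left.J a.1.2.2.1.1 := by rw [h0']; exact hb.2
    rw [← h0, ← h0'] at e1
    refine Subtype.ext (Prod.ext h (Prod.ext (Subtype.ext (Prod.ext ?_ ?_)) h'))
    · exact eq_of_rightArrow_eq ha.1 ha.2 hbs hbt e1
    · rw [h1, h2, h0']
  mapsSimplices {k σ} h := by
    have h' := fun x => ((B.linkingMomentHom F).onArr (σ x)).2
    exact ⟨isSimplex_rightArrow h.1.1 h.2.1.1 h.2.2.1 (fun x => (h' x).1) fun x => (h' x).2,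
      hq.mapsSimplices h.2.2⟩
  isSimplex_lift {k σ τ' τ} hσ hτ' hτ h h' := by
    have e : (fun x => (if e : E.transformation.s (σ x) = q (τ' x).1 ∧
        E.transformation.t (σ x) = q (τ x).1 then
        hq.liftArrow (σ x) (τ' x) (τ x) e.1 e.2 else (B.linkingOver F).one (τ x))) =
        fun x => hq.liftArrow (σ x) (τ' x) (τ x) (h x) (h' x) :=
      funext fun x => by rw [dif_pos ⟨h x, h' x⟩]
    show HasSimplices.IsSimplex fun x => (if e : E.transformation.s (σ x) = q (τ' x).1 ∧
        E.transformation.t (σ x) = q (τ x).1 then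
        hq.liftArrow (σ x) (τ' x) (τ x) e.1 e.2 else (B.linkingOver F).one (τ x))
    rw [e]
    exact ⟨hτ', ⟨isSimplex_leftArrow hτ'.1 hσ.1 hτ.1 (fun x => hq.s_eq_of_arrow (h x))
      fun x => hq.t_eq_of_arrow (h' x), hτ.2⟩, hτ⟩

end IsQuotientMap

end MoritaBimodule

/-! ### Relations between integrals -/

namespace Form

variable {M N : SmoothMfd.{u}} {k : ℕ}

theorem prodBar_apply (α : Form k M) (η : Form k N) (p : M × N) (v : Fin k → M.E × N.E) :
    (prodBar α η p v : ℝ) = α p.1 (fun i => (v i).1) - η p.2 fun i => (v i).2 := by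
  have h1 : mfderiv (M.I.prod N.I) M.I (Prod.fst : M × N → M) p =
      ContinuousLinearMap.fst ℝ M.E N.E := mfderiv_fst
  have h2 : mfderiv (M.I.prod N.I) N.I (Prod.snd : M × N → N) p =
      ContinuousLinearMap.snd ℝ M.E N.E := mfderiv_snd
  show (α p.1 fun i => (mfderiv (M.I.prod N.I) M.I (Prod.fst : M × N → M) p (v i) : M.E)) -
    (η p.2 fun i => (mfderiv (M.I.prod N.I) N.I (Prod.snd : M × N → N) p (v i) : N.E)) = _
  rw [h1, h2]
  rfl

end Form

namespace Chain

variable {M N : SmoothMfd.{u}} {k : ℕ}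

open MeasureTheory

/-- The partial derivatives of a simplex. -/
def tangent (σ : Δ k → M) (y : Δ k) : Fin k → M.E := fun i =>
  mfderivWithin 𝓘(ℝ, Fin k → ℝ) M.I (extendSimplex σ) (simplexSet k) y.1 (Pi.single i (1 : ℝ))

theorem density_coe (α : Form k M) (σ : Δ k → M) (y : Δ k) :
    density α σ y.1 = α (σ y) (tangent σ y) :=
  α.apply_congr (extendSimplex_coe σ y) rfl

/-- The actions and the quotient map are smooth only on fibre products, so the derivative within `S`
occurs. It need not be unique on `S`: the chain rule uses uniqueness of derivatives only on the
simplex, which is mapped into `S`. -/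
theorem tangent_comp {σ : Δ k → N} {y : Δ k} {f : N → M} {S : Set N}
    (hf : ContMDiffOn N.I M.I ∞ f S) (hS : ∀ z, σ z ∈ S)
    (hσ : MDifferentiableAt 𝓘(ℝ, Fin k → ℝ) N.I (extendSimplex σ) y.1) (i : Fin k) :
    tangent (fun z => f (σ z)) y i = (mfderivWithin N.I M.I f S (σ y) (tangent σ y i) : M.E) := by
  have h1 : HasMFDerivWithinAt N.I M.I f S (extendSimplex σ y.1)
      (mfderivWithin N.I M.I f S (σ y)) := by
    rw [extendSimplex_coe]
    exact ((hf _ (hS y)).mdifferentiableWithinAt (by simp)).hasMFDerivWithinAt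
  have hu : UniqueMDiffWithinAt 𝓘(ℝ, Fin k → ℝ) (simplexSet k) y.1 :=
    (uniqueDiffOn_simplexSet k y.1 y.2).uniqueMDiffWithinAt
  have h2 : HasMFDerivWithinAt 𝓘(ℝ, Fin k → ℝ) N.I (extendSimplex σ) (simplexSet k) y.1
      (mfderivWithin 𝓘(ℝ, Fin k → ℝ) N.I (extendSimplex σ) (simplexSet k) y.1) :=
    hσ.mdifferentiableWithinAt.hasMFDerivWithinAt
  have hm : simplexSet k ⊆ extendSimplex σ ⁻¹' S := fun x _ => by
    obtain ⟨z, hz⟩ := exists_extendSimplex_eq σ x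
    rw [Set.mem_preimage, hz]
    exact hS z
  have h3 := (HasMFDerivWithinAt.comp y.1 h1 h2 hm).mfderivWithin hu
  have h4 : extendSimplex (fun z => f (σ z)) = f ∘ extendSimplex σ := extendSimplex_comp f σ
  rw [tangent, h4]
  exact DFunLike.congr_fun h3 (Pi.single i 1)

theorem tangent_comp_contMDiff {σ : Δ k → N} {y : Δ k} {f : N → M} (hf : ContMDiff N.I M.I ∞ f)
    (hσ : MDifferentiableAt 𝓘(ℝ, Fin k → ℝ) N.I (extendSimplex σ) y.1) (i : Fin k) :
    tangent (fun z => f (σ z)) y i = (mfderiv N.I M.I f (σ y) (tangent σ y i) : M.E) := by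
  rw [tangent_comp (contMDiffOn_univ.2 hf) (fun _ => Set.mem_univ _) hσ, mfderivWithin_univ]

theorem extendSimplex_prodMk {A B : Type u} (σ : Δ k → A) (τ : Δ k → B) :
    extendSimplex (fun z => (σ z, τ z)) = fun x => (extendSimplex σ x, extendSimplex τ x) := by
  funext x
  simp only [extendSimplex]
  split_ifs <;> rfl

theorem mdifferentiableAt_prodMk {σ : Δ k → M} {τ : Δ k → N} {x : Fin k → ℝ}
    (hσ : MDifferentiableAt 𝓘(ℝ, Fin k → ℝ) M.I (extendSimplex σ) x)
    (hτ : MDifferentiableAt 𝓘(ℝ, Fin k → ℝ) N.I (extendSimplex τ) x) :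
    MDifferentiableAt 𝓘(ℝ, Fin k → ℝ) (M.prod N).I
      (extendSimplex (A := M.prod N) fun z => (σ z, τ z)) x := by
  have h : extendSimplex (A := M.prod N) (fun z => (σ z, τ z)) =
      fun x => (extendSimplex σ x, extendSimplex τ x) := extendSimplex_prodMk σ τ
  rw [h]
  exact MDifferentiableAt.prodMk hσ hτ

theorem tangent_prodMk {σ : Δ k → M} {τ : Δ k → N} {y : Δ k}
    (hσ : MDifferentiableAt 𝓘(ℝ, Fin k → ℝ) M.I (extendSimplex σ) y.1)
    (hτ : MDifferentiableAt 𝓘(ℝ, Fin k → ℝ) N.I (extendSimplex τ) y.1) (i : Fin k) :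
    tangent (M := M.prod N) (fun z => (σ z, τ z)) y i = (tangent σ y i, tangent τ y i) := by
  have hu : UniqueMDiffWithinAt 𝓘(ℝ, Fin k → ℝ) (simplexSet k) y.1 :=
    (uniqueDiffOn_simplexSet k y.1 y.2).uniqueMDiffWithinAt
  have h : extendSimplex (A := M.prod N) (fun z => (σ z, τ z)) =
      fun x => (extendSimplex σ x, extendSimplex τ x) := extendSimplex_prodMk σ τ
  have h1 := (hσ.mdifferentiableWithinAt.hasMFDerivWithinAt.prodMk
    hτ.mdifferentiableWithinAt.hasMFDerivWithinAt (s := simplexSet k)).mfderivWithin hu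
  exact (congrArg (fun f : (Fin k → ℝ) → M × N => (mfderivWithin 𝓘(ℝ, Fin k → ℝ) (M.I.prod N.I) f
    (simplexSet k) y.1 (Pi.single i (1 : ℝ)) : M.E × N.E)) h).trans
    (DFunLike.congr_fun h1 (Pi.single i 1))

theorem ae_exists_mdifferentiableAt {σ : Δ k → M} (h : PiecewiseSmooth M σ) :
    ∀ᵐ x ∂(volume.restrict (simplexSet k)),
      MDifferentiableAt 𝓘(ℝ, Fin k → ℝ) M.I (extendSimplex σ) x :=
  h.ae_contMDiffAt.mono fun _ hx => hx.2.mdifferentiableAt (by simp)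

theorem integralSimplex_sub {α : Form k M} {β : Form k N} (hα : α.IsSmooth) (hβ : β.IsSmooth)
    {σ : Δ k → M} {τ : Δ k → N} (hσ : PiecewiseSmooth M σ) (hτ : PiecewiseSmooth N τ) :
    integralSimplex α σ - integralSimplex β τ =
      ∫ x in simplexSet k, (density α σ x - density β τ x) :=
  (integral_sub (integrableOn_density hα hσ) (integrableOn_density hβ hτ)).symm

theorem integral_push_single {A : Type u} (α : Form k M) (f : A → M) (σ : Δ k → A) :
    integral α (push f (Finsupp.single σ 1)) = integralSimplex α fun x => f (σ x) := by
  rw [push_single, ← integralHom_apply, integralHom_single, Int.cast_one, _root_.one_mul]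
  rfl

end Chain

namespace MoritaEquivalence

variable {G G₀ H H₀ X F₀ E₀ : SmoothMfd.{u}} {𝒢 : PreQuasiSymplecticGroupoid G G₀}
  {ℋ : PreQuasiSymplecticGroupoid H H₀} (B : MoritaEquivalence 𝒢 ℋ X)

open MeasureTheory Chain

theorem isSmooth_form : B.form.IsSmooth := B.isPreHamiltonian.1

/-- Along `X`, the difference of the `3`-forms is the exterior derivative of the `2`-form. -/
theorem integralSimplex_form₃ {σ : Δ 3 → X} (hσ : PiecewiseSmooth X σ) :
    integralSimplex 𝒢.form₃ (fun x => B.left.J (σ x)) -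
      integralSimplex ℋ.form₃ (fun x => B.right.J (σ x)) = integralSimplex B.form.d σ := by
  rw [integralSimplex_sub 𝒢.smooth_form₃ ℋ.smooth_form₃ (hσ.comp_contMDiff B.left.smooth_J)
    (hσ.comp_contMDiff B.right.smooth_J), integralSimplex_eq]
  refine integral_congr_ae ?_
  filter_upwards [ae_exists_mdifferentiableAt hσ,
    ae_exists_mdifferentiableAt (hσ.comp_contMDiff B.left.smooth_J),
    ae_exists_mdifferentiableAt (hσ.comp_contMDiff B.right.smooth_J),
    ae_restrict_mem (isClosed_simplexSet 3).measurableSet] with x h1 h2 h3 hx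
  obtain ⟨y, rfl⟩ : ∃ y : Δ 3, y.1 = x := ⟨⟨x, hx⟩, rfl⟩
  rw [density_coe, density_coe, density_coe, B.isPreHamiltonian.2.1]
  have hJ : ∀ i, (mfderiv X.I (G₀.prod H₀).I B.prodAction.J (σ y) (tangent σ y i) : G₀.E × H₀.E) =
      (tangent (fun x => B.left.J (σ x)) y i, tangent (fun x => B.right.J (σ x)) y i) := fun i =>
    (tangent_comp_contMDiff (M := G₀.prod H₀) B.prodAction.smooth_J h1 i).symm.trans
      (tangent_prodMk h2 h3 i)
  refine Eq.symm ((Form.prodBar_apply 𝒢.form₃ ℋ.form₃ (B.left.J (σ y), B.right.J (σ y))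
    fun i => (mfderiv X.I (G₀.prod H₀).I B.prodAction.J (σ y) (tangent σ y i) : G₀.E × H₀.E)).trans
      ?_)
  simp only [hJ]

/-- Along the pull-back of `G` to `X`, the difference of the `2`-forms is exact. -/
theorem integralSimplex_form₂ {σ : Δ 2 → 𝒢.PullbackArrows B.left.J}
    (hσ : HasSimplices.IsSimplex σ) :
    integralSimplex 𝒢.form₂ (fun x => (σ x).1.2.1) -
      integralSimplex ℋ.form₂ (fun x => B.linkingHom.onArr (σ x)) =
    integralSimplex B.form (fun x => (σ x).1.1) - integralSimplex B.form fun x => (σ x).1.2.2 := by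
  have hx' : PiecewiseSmooth X fun x => (σ x).1.1 := hσ.1
  have hg : PiecewiseSmooth G fun x => (σ x).1.2.1 := hσ.2.1
  have hx : PiecewiseSmooth X fun x => (σ x).1.2.2 := hσ.2.2
  have hh : PiecewiseSmooth H fun x => B.linkingHom.onArr (σ x) :=
    B.cartesianLinkingHom.mapsSimplices hσ
  rw [integralSimplex_sub 𝒢.smooth_form₂ ℋ.smooth_form₂ hg hh,
    integralSimplex_sub B.isSmooth_form B.isSmooth_form hx' hx]
  have hgh : PiecewiseSmooth (G.prod H) fun x => ((σ x).1.2.1, B.linkingHom.onArr (σ x)) :=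
    hg.prodMk hh
  have ht : ∀ z, (𝒢.prod ℋ.toLieGroupoid).t ((σ z).1.2.1, B.linkingHom.onArr (σ z)) =
      B.prodAction.J (σ z).1.2.2 := fun z => Prod.ext (σ z).2.2 (B.linkingHom.map_t (σ z))
  -- The arrow `(x', g, x)` with its `h` satisfies `g x h⁻¹ = x'`, so it is a point of the graph of
  -- the `G × H`-action. Isotropy of the graph gives `ω_G - ω_H + ω_X(x) - ω_X(x') = 0` on tangent
  -- vectors.
  have hact : ∀ z, B.prodAction.act ((σ z).1.2.1, B.linkingHom.onArr (σ z)) (σ z).1.2.2 =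
      (σ z).1.1 := by
    intro z
    show B.right.act (B.left.act (σ z).1.2.1 (σ z).1.2.2) (ℋ.inv (B.linkingHom.onArr (σ z))) = _
    have h1 : B.right.act (σ z).1.1 (B.linkingHom.onArr (σ z)) =
      B.left.act (σ z).1.2.1 (σ z).1.2.2 := MoritaBimodule.act_rightArrow (σ z).2.1 (σ z).2.2
    rw [← h1]
    exact B.right.act_act_inv (B.linkingHom.map_s (σ z)).symm
  refine integral_congr_ae ?_
  filter_upwards [ae_exists_mdifferentiableAt hg, ae_exists_mdifferentiableAt hh,
    ae_exists_mdifferentiableAt hgh, ae_exists_mdifferentiableAt hx,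
    ae_restrict_mem (isClosed_simplexSet 2).measurableSet] with x h1 h2 h3 h4 hx
  obtain ⟨y, rfl⟩ : ∃ y : Δ 2, y.1 = x := ⟨⟨x, hx⟩, rfl⟩
  simp only [density_coe]
  have hpair : ∀ i, tangent (M := G.prod H)
      (fun x => ((σ x).1.2.1, B.linkingHom.onArr (σ x))) y i = _ := tangent_prodMk h1 h2
  -- The partial derivatives of the simplex are tangent to the graph: differentiate the identity `t
  -- (g, h) = J x` along the simplex.
  have hcond : ∀ i, (mfderiv (G.prod H).I (G₀.prod H₀).I (𝒢.prod ℋ.toLieGroupoid).t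
      ((σ y).1.2.1, B.linkingHom.onArr (σ y)) (tangent (M := G.prod H)
        (fun x => ((σ x).1.2.1, B.linkingHom.onArr (σ x))) y i) : (G₀.prod H₀).E) =
      (mfderiv X.I (G₀.prod H₀).I B.prodAction.J (σ y).1.2.2
        (tangent (fun x => (σ x).1.2.2) y i) : (G₀.prod H₀).E) := by
    intro i
    refine (tangent_comp_contMDiff (M := G₀.prod H₀) (N := G.prod H)
      (𝒢.prod ℋ.toLieGroupoid).submersion_t.contMDiff h3 i).symm.trans (Eq.trans ?_
      (tangent_comp_contMDiff (M := G₀.prod H₀) B.prodAction.smooth_J h4 i))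
    rw [show (fun z => (𝒢.prod ℋ.toLieGroupoid).t ((σ z).1.2.1, B.linkingHom.onArr (σ z))) =
      fun z => B.prodAction.J (σ z).1.2.2 from funext ht]
  have key := B.isPreHamiltonian.2.2 _ _ (ht y) (fun i => tangent (M := G.prod H)
    (fun x => ((σ x).1.2.1, B.linkingHom.onArr (σ x))) y i)
    (fun i => tangent (fun x => (σ x).1.2.2) y i) hcond
  have e1 : (Form.prodBar 𝒢.form₂ ℋ.form₂ ((σ y).1.2.1, B.linkingHom.onArr (σ y))
      (fun i => tangent (M := G.prod H)
        (fun x => ((σ x).1.2.1, B.linkingHom.onArr (σ x))) y i) : ℝ) =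
      𝒢.form₂ (σ y).1.2.1 (tangent (fun x => (σ x).1.2.1) y) -
      ℋ.form₂ (B.linkingHom.onArr (σ y)) (tangent (fun x => B.linkingHom.onArr (σ x)) y) := by
    refine (Form.prodBar_apply 𝒢.form₂ ℋ.form₂ ((σ y).1.2.1, B.linkingHom.onArr (σ y)) fun i =>
      tangent (M := G.prod H) (fun x => ((σ x).1.2.1, B.linkingHom.onArr (σ x))) y i).trans ?_
    simp only [hpair]
  have e2 : ∀ i, tangent (fun x => (σ x).1.1) y i =
      (mfderivWithin ((G.prod H).I.prod X.I) X.I (fun p : (G.prod H) × X => B.prodAction.act p.1 p.2)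
        {p | (𝒢.prod ℋ.toLieGroupoid).t p.1 = B.prodAction.J p.2}
        (((σ y).1.2.1, B.linkingHom.onArr (σ y)), (σ y).1.2.2)
        ((tangent (M := G.prod H) (fun x => ((σ x).1.2.1, B.linkingHom.onArr (σ x))) y i,
          tangent (fun x => (σ x).1.2.2) y i) : (G.prod H).E × X.E) : X.E) := by
    intro i
    have h5 := tangent_comp (N := (G.prod H).prod X) (M := X)
      (σ := fun x => (((σ x).1.2.1, B.linkingHom.onArr (σ x)), (σ x).1.2.2)) (y := y)
      (f := fun p : (G.prod H) × X => B.prodAction.act p.1 p.2)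
      B.prodAction.smooth_act ht (mdifferentiableAt_prodMk (M := G.prod H) h3 h4) i
    have h6 := tangent_prodMk (M := G.prod H) h3 h4 i
    rw [show (fun x => (σ x).1.1) = fun z => B.prodAction.act
      ((σ z).1.2.1, B.linkingHom.onArr (σ z)) (σ z).1.2.2 from funext fun z => (hact z).symm]
    exact h5.trans (by rw [h6]; rfl)
  have e3 := B.form.apply_congr (hact y).symm (funext e2)
  have key' : (Form.prodBar 𝒢.form₂ ℋ.form₂ ((σ y).1.2.1, B.linkingHom.onArr (σ y))
      (fun i => tangent (M := G.prod H)
        (fun x => ((σ x).1.2.1, B.linkingHom.onArr (σ x))) y i) : ℝ) +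
      B.form (σ y).1.2.2 (tangent (fun x => (σ x).1.2.2) y) -
      B.form (σ y).1.1 (tangent (fun x => (σ x).1.1) y) = 0 := by
    rw [e3]
    exact key
  rw [e1] at key'
  linarith

/-- The form of the quotient `E` of `X ×_{G₀} F`. -/
theorem integralSimplex_quotient {F : LeftAction 𝒢.toLieGroupoid F₀}
    {α : Form 2 F₀} {η : Form 2 E₀} (hα : α.IsSmooth) (hη : η.IsSmooth) {q : X × F₀ → E₀}
    (hq : ContMDiffOn (X.I.prod F₀.I) E₀.I ∞ q {p | B.left.J p.1 = F.J p.2})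
    (h : ∀ x f, B.left.J x = F.J f →
      ∀ (a : Fin 2 → TangentSpace X.I x) (b : Fin 2 → TangentSpace F₀.I f),
        (∀ i, (mfderiv X.I G₀.I B.left.J x (a i) : G₀.E) =
          (mfderiv F₀.I G₀.I F.J f (b i) : G₀.E)) →
        η (q (x, f)) (fun i =>
          mfderivWithin (X.I.prod F₀.I) E₀.I q {p | B.left.J p.1 = F.J p.2} (x, f) (a i, b i)) =
          α f b - B.form x a)
    {σ : Δ 2 → B.FiberProduct F} (hσ : HasSimplices.IsSimplex σ) :
    integralSimplex α (fun x => (σ x).1.2) - integralSimplex η (fun x => q (σ x).1) =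
      integralSimplex B.form fun x => (σ x).1.1 := by
  have hx : PiecewiseSmooth X fun x => (σ x).1.1 := hσ.1
  have hf : PiecewiseSmooth F₀ fun x => (σ x).1.2 := hσ.2
  have hqσ : PiecewiseSmooth E₀ fun x => q (σ x).1 :=
    (hx.prodMk hf).comp_contMDiffOn (M := X.prod F₀) hq fun x => (σ x).2
  rw [integralSimplex_sub hα hη hf hqσ, integralSimplex_eq]
  refine integral_congr_ae ?_
  filter_upwards [ae_exists_mdifferentiableAt hx, ae_exists_mdifferentiableAt hf,
    ae_restrict_mem (isClosed_simplexSet 2).measurableSet] with x h1 h2 hx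
  obtain ⟨y, rfl⟩ : ∃ y : Δ 2, y.1 = x := ⟨⟨x, hx⟩, rfl⟩
  simp only [density_coe]
  have key := h (σ y).1.1 (σ y).1.2 (σ y).2 (tangent (fun x => (σ x).1.1) y)
    (tangent (fun x => (σ x).1.2) y) fun i => by
      refine (tangent_comp_contMDiff B.left.smooth_J h1 i).symm.trans (Eq.trans ?_
        (tangent_comp_contMDiff F.smooth_J h2 i))
      rw [show (fun z => B.left.J (σ z).1.1) = fun z => F.J (σ z).1.2 from
        funext fun z => (σ z).2]
  have e : ∀ i, tangent (fun x => q (σ x).1) y i =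
      (mfderivWithin (X.I.prod F₀.I) E₀.I q {p | B.left.J p.1 = F.J p.2} (σ y).1
        ((tangent (fun x => (σ x).1.1) y i, tangent (fun x => (σ x).1.2) y i) : X.E × F₀.E) :
        E₀.E) := by
    intro i
    have h5 := tangent_comp (N := X.prod F₀) (M := E₀)
      (σ := fun x => ((σ x).1.1, (σ x).1.2)) (y := y) (f := q) hq (fun z => (σ z).2)
      (mdifferentiableAt_prodMk h1 h2) i
    exact h5.trans (by rw [tangent_prodMk h1 h2 i]; rfl)
  have e' := η.apply_congr (x := q (σ y).1) rfl (funext e)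
  have key' : (η (q (σ y).1) (tangent (fun x => q (σ x).1) y) : ℝ) =
      α (σ y).1.2 (tangent (fun x => (σ x).1.2) y) -
        B.form (σ y).1.1 (tangent (fun x => (σ x).1.1) y) := e'.trans key
  linarith

end MoritaEquivalence

/-! ### Transfer of the integrality condition -/

namespace SetGroupoid

variable {A O A' O' : Type u} {𝒢 : SetGroupoid A O} {𝒢' : SetGroupoid A' O'}

/-- The arrow which constitutes an element of `Γ_1`. -/
def firstArrow (a : 𝒢.Nerve 1) : A := a.1 0

theorem mapsSimplices_firstArrow [HasSimplices A] [HasSimplices O] :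
    MapsSimplices (firstArrow (𝒢 := 𝒢)) := fun h => h 0

theorem push_firstArrow {k : ℕ} (φ : Hom 𝒢 𝒢') (D : 𝒢.DoubleChain) :
    Chain.push firstArrow (φ.push D k 1) = Chain.push φ.onArr (Chain.push firstArrow (D k 1)) := by
  rw [Hom.push, Chain.push_push, Chain.push_push]
  rfl

theorem bd_zero {k : ℕ} (c : Chain (𝒢.Nerve 1) k) :
    𝒢.bd k 0 c = Chain.push 𝒢.s (Chain.push firstArrow c) -
      Chain.push 𝒢.t (Chain.push firstArrow c) := by
  have h0 : 𝒢.face 0 0 = 𝒢.s ∘ firstArrow := rfl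
  have h1 : 𝒢.face 0 1 = 𝒢.t ∘ firstArrow := rfl
  rw [Chain.push_push, Chain.push_push, bd, Fin.sum_univ_two, h0, h1]
  simp only [Fin.val_zero, pow_zero, one_smul, Fin.val_one, pow_one, neg_smul, sub_eq_add_neg]
  rfl

end SetGroupoid

namespace PreHamiltonianSpace

open SetGroupoid

variable {Γ M X : SmoothMfd.{u}} {𝒢 : PreQuasiSymplecticGroupoid Γ M}

/-- The number `∫_C ω_X - ∫_D (ω + Ω)`. -/
def pairing (F : PreHamiltonianSpace 𝒢 X) (C : F.transformation.DoubleChain)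
    (D : 𝒢.DoubleChain) : ℝ :=
  Chain.integral F.form (C 2 0) -
    (Chain.integral 𝒢.form₂ (Chain.push firstArrow (D 2 1)) + Chain.integral 𝒢.form₃ (D 3 0))

theorem pairing_iterate_sd (F : PreHamiltonianSpace 𝒢 X) {C : F.transformation.DoubleChain}
    {D : 𝒢.DoubleChain} (hC : F.transformation.IsCycle 2 C) (hD : 𝒢.IsChain 3 D) (n : ℕ) :
    F.pairing (SetGroupoid.sd^[n] C) (SetGroupoid.sd^[n] D) = F.pairing C D := by
  have h1 : Chain.push firstArrow (Chain.sd^[n] (D 2 1)) =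
      Chain.sd^[n] (Chain.push firstArrow (D 2 1)) := by
    induction n with
    | zero => rfl
    | succ n ih =>
      rw [Function.iterate_succ_apply', Function.iterate_succ_apply', ← Chain.sd_push, ih]
  have hC' : Chain.IsSmoothChain (A := X) (C 2 0) := (hC.1 2 0).2
  have hD' : Chain.IsSmoothChain (A := M) (D 3 0) := (hD 3 0).2
  have hD'' : Chain.IsSmoothChain (A := Γ) (Chain.push firstArrow (D 2 1)) :=
    (hD 2 1).2.push mapsSimplices_firstArrow
  have e1 := Chain.integral_iterate_sd F.isPreHamiltonian.1 hC' n
  have e2 := Chain.integral_iterate_sd 𝒢.smooth_form₃ hD' n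
  have e3 := Chain.integral_iterate_sd 𝒢.smooth_form₂ hD'' n
  rw [pairing, pairing, iterate_sd_apply, iterate_sd_apply, iterate_sd_apply, h1, e3]
  exact congrArg₂ (· - ·) e1 (congrArg (_ + ·) e2)

/-- The integrality condition is transferred by a groupoid which is a pull-back of the second
groupoid. -/
theorem IntegralityCondition.transfer {Γ' M' X' : SmoothMfd.{u}}
    {𝒢' : PreQuasiSymplecticGroupoid Γ' M'} {F : PreHamiltonianSpace 𝒢 X}
    {E : PreHamiltonianSpace 𝒢' X'} (hF : F.IntegralityCondition) {A O B P : Type u}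
    [HasSimplices A] [HasSimplices O] [HasSimplices B] [HasSimplices P] [LawfulSimplices A]
    [LawfulSimplices B] {𝒦 : SetGroupoid A O} {ℒ : SetGroupoid B P} [𝒦.SmoothOps] [ℒ.SmoothOps]
    (κ : Hom ℒ 𝒦) (φ : Hom 𝒦 𝒢.toSetGroupoid) (ψ : Hom ℒ F.transformation)
    (φ' : Hom 𝒦 𝒢'.toSetGroupoid) (ψ' : Hom ℒ E.transformation)
    (hκs : MapsSimplices κ.onArr) (hφ : MapsSimplices φ.onArr) (hψ : MapsSimplices ψ.onArr)
    (L : φ'.Cartesian) (L' : ψ'.Cartesian)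
    (hκ : ∀ C, φ.push (κ.push C) = F.momentHom.push (ψ.push C))
    (hκ' : ∀ C, φ'.push (κ.push C) = E.momentHom.push (ψ'.push C))
    (hL : ∀ o : M', ∃ U ∈ nhds o, ∀ (k : ℕ) (m : Δ k → M'), HasSimplices.IsSimplex m →
      (∀ x, m x ∈ U) → φ'.Liftable m)
    (hL' : ∀ o : X', ∃ U ∈ nhds o, ∀ (k : ℕ) (m : Δ k → X'), HasSimplices.IsSimplex m →
      (∀ x, m x ∈ U) → ψ'.Liftable m)
    (hp : ∀ C D, ℒ.IsCycle 2 C → 𝒦.IsChain 3 D → 𝒦.totalBd D = κ.push C →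
      F.pairing (ψ.push C) (φ.push D) = E.pairing (ψ'.push C) (φ'.push D)) :
    E.IntegralityCondition := by
  intro C D hC hD hCD
  -- Both properties hold eventually, so a common number `n` of subdivisions can be chosen; `C` and
  -- `D` must be subdivided equally often to keep `δD = J_* C`.
  obtain ⟨n, h1, h2⟩ := ((IsChain.eventually_isLiftable
    (fun h => PiecewiseSmooth.continuous h) hL hD).and (IsChain.eventually_isLiftable
    (fun h => PiecewiseSmooth.continuous h) hL' hC.1)).exists
  -- The cycle is lifted first. The lift of `D` is then required to have the boundary `κ_* C'`,
  -- which is possible because both have the same image under `φ'_*`.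
  obtain ⟨C', hC', eC⟩ := L'.exists_lift_cycle (hC.iterate_sd n) h2
  obtain ⟨D', hD', eD, hCD'⟩ := L.exists_lift_totalBd (hD.iterate_sd n) h1 (hC'.push κ hκs) (by
    rw [hκ', eC, Hom.push_iterate_sd, ← hCD, iterate_sd_totalBd])
  obtain ⟨z, hz⟩ := hF (ψ.push C') (φ.push D') (hC'.push ψ hψ) (hD'.push φ hφ)
    (by rw [← Hom.push_totalBd, hCD', hκ])
  refine ⟨z, ?_⟩
  rw [← hz]
  refine Eq.trans ?_ (hp C' D' hC' hD' hCD').symm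
  rw [eC, eD]
  exact (E.pairing_iterate_sd hC hD n).symm

end PreHamiltonianSpace

namespace MoritaEquivalence

open SetGroupoid Chain

variable {G G₀ H H₀ X F₀ E₀ : SmoothMfd.{u}} {𝒢 : PreQuasiSymplecticGroupoid G G₀}
  {ℋ : PreQuasiSymplecticGroupoid H H₀} (B : MoritaEquivalence 𝒢 ℋ X)

/-- The chain version of `ω_G - ω_H = ∂ω_X`, where `∂ = s^* - t^*` is moved onto the chain. -/
theorem integral_form₂ {D : B.linking.DoubleChain} (h : (D 2 1).IsSmoothChain) :
    integral 𝒢.form₂ (push firstArrow ((𝒢.pullbackHom B.left.J).push D 2 1)) -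
      integral ℋ.form₂ (push firstArrow (B.linkingHom.push D 2 1)) =
    integral B.form (B.linking.bd 2 0 (D 2 1)) := by
  rw [push_firstArrow, push_firstArrow]
  refine Eq.trans ?_ (congrArg (integral B.form) (bd_zero (D 2 1)).symm)
  have hc : (push firstArrow (D 2 1)).IsSmoothChain := h.push mapsSimplices_firstArrow
  generalize push firstArrow (D 2 1) = c at hc
  have key := eq_of_isSmoothChain
    (f := (integralHom 𝒢.form₂).comp (push (𝒢.pullbackHom B.left.J).onArr) -
      (integralHom ℋ.form₂).comp (push B.linkingHom.onArr))
    (g := (integralHom B.form).comp (push B.linking.s) -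
      (integralHom B.form).comp (push B.linking.t)) (fun σ hσ => ?_) hc
  · exact key.trans (map_sub (integralHom B.form) _ _).symm
  · simp only [AddMonoidHom.sub_apply, AddMonoidHom.comp_apply, integralHom_apply,
      integral_push_single]
    exact B.integralSimplex_form₂ hσ

/-- The chain version of `Ω_G - Ω_H = dω_X`, combined with Stokes' theorem. -/
theorem integral_form₃ {D : B.linking.DoubleChain} (h : (D 3 0).IsSmoothChain) :
    integral 𝒢.form₃ ((𝒢.pullbackHom B.left.J).push D 3 0) -
      integral ℋ.form₃ (B.linkingHom.push D 3 0) = integral B.form (d (A := X) (D 3 0)) := by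
  have hc : IsSmoothChain (A := X) (D 3 0) := h
  rw [← integral_d B.isSmooth_form hc]
  have key := eq_of_isSmoothChain
    (f := (integralHom 𝒢.form₃).comp (push B.left.J) -
      (integralHom ℋ.form₃).comp (push B.right.J))
    (g := integralHom B.form.d) (fun σ hσ => ?_) hc
  · exact key
  · simp only [AddMonoidHom.sub_apply, AddMonoidHom.comp_apply, integralHom_apply,
      integral_push_single]
    exact (B.integralSimplex_form₃ hσ).trans (by
      rw [← integralHom_apply, integralHom_single, Int.cast_one, _root_.one_mul])

/-- The value of the pairing on chains of the linking groupoids can be computed on both sides. -/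
theorem pairing_eq {F : PreHamiltonianSpace 𝒢 F₀} {E : PreHamiltonianSpace ℋ E₀} {q : X × F₀ → E₀}
    (hq : B.IsQuotientMap F.toLeftAction E.toLeftAction q)
    (h : ∀ x f, B.left.J x = F.J f →
      ∀ (a : Fin 2 → TangentSpace X.I x) (b : Fin 2 → TangentSpace F₀.I f),
        (∀ i, (mfderiv X.I G₀.I B.left.J x (a i) : G₀.E) =
          (mfderiv F₀.I G₀.I F.J f (b i) : G₀.E)) →
        E.form (q (x, f)) (fun i =>
          mfderivWithin (X.I.prod F₀.I) E₀.I q {p | B.left.J p.1 = F.J p.2} (x, f) (a i, b i)) =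
          F.form f b - B.form x a)
    {C : (B.linkingOver F.toLeftAction).DoubleChain} {D : B.linking.DoubleChain}
    (hC : (B.linkingOver F.toLeftAction).IsCycle 2 C) (hD : B.linking.IsChain 3 D)
    (hCD : B.linking.totalBd D = (B.linkingMomentHom F.toLeftAction).push C) :
    F.pairing ((F.transformation.pullbackHom _).push C) ((𝒢.pullbackHom B.left.J).push D) =
      E.pairing (hq.hom.push C) (B.linkingHom.push D) := by
  have e1 : integral F.form ((F.transformation.pullbackHom
      fun p : B.FiberProduct F.toLeftAction => p.1.2).push C 2 0) -
      integral E.form (hq.hom.push C 2 0) =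
      integral B.form ((B.linkingMomentHom F.toLeftAction).push C 2 0) := by
    have hc : IsSmoothChain (A := B.FiberProduct F.toLeftAction) (C 2 0) := (hC.1 2 0).2
    have key := eq_of_isSmoothChain
      (f := (integralHom F.form).comp (push fun p : B.FiberProduct F.toLeftAction => p.1.2) -
        (integralHom E.form).comp (push fun p => q p.1))
      (g := (integralHom B.form).comp (push fun p => p.1.1)) (fun σ hσ => ?_) hc
    · exact key
    · simp only [AddMonoidHom.sub_apply, AddMonoidHom.comp_apply, integralHom_apply,
        integral_push_single]
      exact B.integralSimplex_quotient F.isPreHamiltonian.1 E.isPreHamiltonian.1 hq.smooth h hσ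
  have e2 := B.integral_form₂ (hD 2 1).2
  have e3 := B.integral_form₃ (hD 3 0).2
  -- The component of `δD = κ_* C` in `C_2(X)`. It says that the corrections by `ω_X` from the two
  -- components of `D` add up to the one from `C`, so they cancel in the difference of the pairings.
  have e4 : integral B.form (d (A := X) (D 3 0)) + integral B.form (B.linking.bd 2 0 (D 2 1)) =
      integral B.form ((B.linkingMomentHom F.toLeftAction).push C 2 0) := by
    rw [← hCD]
    have : B.linking.totalBd D 2 0 = d (D 3 0) + B.linking.bd 2 0 (D 2 1) := by
      show (-1 : ℤ) ^ 0 • d (D 3 0) + B.linking.bd 2 0 (D 2 1) = _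
      rw [pow_zero, one_smul]
    refine Eq.trans ?_ (congrArg (integral B.form) this.symm)
    exact (map_add (integralHom B.form) _ _).symm
  rw [PreHamiltonianSpace.pairing, PreHamiltonianSpace.pairing]
  linarith

theorem integralityCondition_iff (F : PreHamiltonianSpace 𝒢 F₀) (E : PreHamiltonianSpace ℋ E₀)
    (hFE : B.Corresponding F E) : F.IntegralityCondition ↔ E.IntegralityCondition := by
  obtain ⟨q, h1, h2, h3, h4, h5, h6, h7⟩ := hFE
  have hq : B.IsQuotientMap F.toLeftAction E.toLeftAction q := ⟨h1, h4, h5, h6⟩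
  have hκ : ∀ C, (𝒢.pullbackHom B.left.J).push ((B.linkingMomentHom F.toLeftAction).push C) =
      F.momentHom.push ((F.transformation.pullbackHom _).push C) := fun C =>
    Hom.push_push_eq (φ := B.linkingMomentHom F.toLeftAction) (ψ := 𝒢.pullbackHom B.left.J)
      (φ' := F.transformation.pullbackHom _) (ψ' := F.momentHom) (fun a => rfl) (fun y => y.2) C
  have hκ' : ∀ C, B.linkingHom.push ((B.linkingMomentHom F.toLeftAction).push C) =
      E.momentHom.push (hq.hom.push C) := fun C =>
    Hom.push_push_eq (φ := B.linkingMomentHom F.toLeftAction) (ψ := B.linkingHom)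
      (φ' := hq.hom) (ψ' := E.momentHom) (fun a => rfl) (fun y => (h5 _ _ y.2).symm) C
  have hκs : MapsSimplices (B.linkingMomentHom F.toLeftAction).onArr := fun h =>
    ⟨h.1.1, h.2.1.1, h.2.2.1⟩
  have L₁ := (cartesianPullbackHom (𝒢 := 𝒢.toSetGroupoid) (π := B.left.J))
  have L₂ := (cartesianPullbackHom (𝒢 := F.transformation)
    (π := fun p : B.FiberProduct F.toLeftAction => p.1.2))
  constructor
  -- Chains are lifted along the projections to `H` and to the transformation groupoid of `E`. Local
  -- sections exist because `σ` and `q` are surjective with surjective derivatives.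
  · intro hF
    refine hF.transfer (B.linkingMomentHom F.toLeftAction) (𝒢.pullbackHom B.left.J)
      (F.transformation.pullbackHom _) B.linkingHom hq.hom hκs L₁.mapsSimplices L₂.mapsSimplices
      B.cartesianLinkingHom hq.cartesianHom hκ hκ' ?_ ?_ fun C D hC hD => B.pairing_eq hq h7 hC hD
    · exact SmoothMfd.exists_nhds_lift_of_isSubmersion B.right_submersion B.right_surjective
    · intro o
      obtain ⟨⟨x₀, f₀⟩, h₀, rfl⟩ := h2 o
      obtain ⟨r₁, r₂, U, hU, hxU, hr₁, hr₂, hr⟩ := SmoothMfd.exists_section_fiberProduct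
        B.left_submersion F.smooth_J h1 h₀ (h3 x₀ f₀ h₀)
      exact ⟨U, hU.mem_nhds hxU, fun k m hm hmU => ⟨fun x => ⟨(r₁ (m x), r₂ (m x)), (hr _ (hmU x)).1⟩,
        ⟨PiecewiseSmooth.comp_contMDiffOn hm hr₁ hmU, PiecewiseSmooth.comp_contMDiffOn hm hr₂ hmU⟩,
        fun x => (hr _ (hmU x)).2⟩⟩
  -- The roles are exchanged: `ρ` has local sections, and they induce local sections of `X ×_{G₀} F
  -- → F`.
  · intro hE
    refine hE.transfer (B.linkingMomentHom F.toLeftAction) B.linkingHom hq.hom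
      (𝒢.pullbackHom B.left.J) (F.transformation.pullbackHom _) hκs
      B.cartesianLinkingHom.mapsSimplices hq.cartesianHom.mapsSimplices L₁ L₂ hκ' hκ ?_ ?_
      fun C D hC hD hCD => (B.pairing_eq hq h7 hC hD hCD).symm
    · exact SmoothMfd.exists_nhds_lift_of_isSubmersion B.left_submersion B.left_surjective
    · exact SmoothMfd.exists_nhds_lift_fiberProduct B.left_submersion B.left_surjective F.smooth_J

end MoritaEquivalence

end PreQuasi

theorem mainTheorem8 {G G₀ H H₀ X F₀ E₀ : PreQuasi.SmoothMfd}
    (𝒢 : PreQuasi.PreQuasiSymplecticGroupoid G G₀)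
    (ℋ : PreQuasi.PreQuasiSymplecticGroupoid H H₀)
    (B : PreQuasi.MoritaEquivalence 𝒢 ℋ X)
    (F : PreQuasi.PreHamiltonianSpace 𝒢 F₀) (E : PreQuasi.PreHamiltonianSpace ℋ E₀)
    (hFE : B.Corresponding F E) :
    F.IntegralityCondition ↔ E.IntegralityCondition := by
  exact B.integralityCondition_iff F E hFE
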